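/- Let $N=\{x\in\mathbb Z^6:\sum x_i=0\}$, $N_{\mathbb R}=\{x\in\mathbb R^6:\sum x_i=0\}$, let $M$ be the dual lattice of $N$, and put $u_i=3e_i-e_1-e_2-e_3$, $v_i=3e_i-e_4-e_5-e_6$ $(1\le i\le 6)$, $w=e_1+e_2+e_3-e_4-e_5-e_6$, $$\Delta_1=\operatorname{conv}(u_1,\dots,u_6),\quad \Delta_2=\operatorname{conv}(v_1,\dots,v_6),\quad P=\operatorname{conv}(\Delta_1,\Delta_2)\subset N_{\mathbb R}.$$ Let $\nabla=\nabla_1+\nabla_2\subset M_{\mathbb R}$, where $\nabla_1=\{m:(\Delta_1,m)+1\ge 0,\ (\Delta_2,m)\ge 0\}$ and $\nabla_2=\{m:(\Delta_1,m)\ge 0,\ (\Delta_2,m)+1\ge 0\}$, and let $\Sigma_\nabla$ be the (inner) normal fan of $\nabla$ in $N_{\mathbb R}$. For $1\le i\le 3$ and $4\le j\le 6$ put $$U_i=\operatorname{cone}(u_k:k\ne i),\quad V_j=\operatorname{cone}(v_k:k\neq j),\quad C_{i,j}=\operatorname{cone}(u_k,v_k:k\ne i,j),$$ and write $P(\sigma)=\partial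 P\cap\sigma$ for a cone $\sigma$. For a simplex with ordered vertices $p_0,\dots,p_d$ and $k\ge1$, the maximal simplices of the $k$-edgewise subdivision $\operatorname{Esd}_k$ are indexed by the maps $r:\{0,\dots,d-1\}\to\{1,\dots,k\}$. In a $k\times(d+1)$ matrix with columns $0,\dots,d$ draw, for each $c<d$, a dividing line in row $r(c)$ between the columns $c$ and $c+1$; let $m_{a,b}$ be the number of dividing lines passed before the entry $(a,b)$ when the matrix is read row by row. The simplex has the ordered vertices $\frac1k\sum_{a=1}^k p_{m_{a,b}}$, $b=0,\dots,d$. For ordered simplices $\delta=(p_0,\dots,p_d)$ and $\delta'=(q_0,\dots,q_d)$ that are translates of each other, the maximal simplices of $\operatorname{prism}(\delta,\delta')$ are those with vertices $p_0,\dots,p_i,q_i,\dots,q_d$, $0\le i\le d$. The other simplices of both subdivisions are the faces of the maximal ones, with the induced order. Define $$\tau(P(U_i))=\operatorname{Esd}_3(u_1,\dots,\widehat{u_i},\dots,u_6),\qquad \tau(P(V_j))=\operatorname{Esd}_3(v_1,\dots,\widehat{v_j},\dots,v_6),$$ $$\tau(P(C_{i,j}))=\bigcup_{\delta\in\tau(P(U_i)),\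 \delta\subset C_{i,j}}\operatorname{prism}(\delta,\delta+w),$$ let $\tau(\partial P)$ be the union of all these collections, and let $\tau(P)$ consist of all faces of the simplices obtained by appending the vertex $0$ to the maximal simplices of $\tau(\partial P)$. Let $\Pi$ be the set of the cones over the simplices of $\tau(P)$ that have $0$ as a vertex. **Theorem.** 1. The facets of $P$ are precisely the $P(U_i)$, $P(V_j)$ and $P(C_{i,j})$, $1\le i\le 3$, $4\le j\le 6$. The collections $\tau(P(U_i))$, $\tau(P(V_j))$, $\tau(P(C_{i,j}))$ are triangulations of them into lattice simplices, and these glue: $\tau(\partial P)$ is a triangulation of $\partial P$. 2. $\tau(P)$ is a triangulation of $P$ into lattice simplices. It is maximal (every point of $P\cap N$ is a vertex of one of its simplices) and star ($0$ is an interior point of $P$ and a vertex of every maximal simplex). 3. $\tau(P)$ is projective: there is a convex function on $P$ whose domains of linearity are precisely the maximal simplices of $\tau(P)$. 4. $\Pi$ and $\Sigma_\nabla$ are fans, and $\Pi$ subdivides $\Sigma_\nabla$. The toric morphism $\pi:\mathbb P_\Pi\to\mathbb P_{\Sigma_\nabla}$ of complex toric varieties induced by the identity of $N$ is an MPCP desingularization,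 and indeed a crepant desingularization: $\pi$ is projective and birational, $\mathbb P_\Pi$ is smooth of dimension $5$, the canonical divisor of $\mathbb P_{\Sigma_\nabla}$ is Cartier, and $\pi^*K_{\mathbb P_{\Sigma_\nabla}}=K_{\mathbb P_\Pi}$. -/

import Mathlib

open CategoryTheory AlgebraicGeometry
open scoped Pointwise KaehlerDifferential

noncomputable section

namespace CubicsMPCP

/-! ### Ordered simplices: edgewise and prism subdivisions

An ordered simplex is the list of its vertices. Its faces are its nonempty sublists. -/

section Subdivisions

variable {E : Type} [AddCommGroup E] [Module ℝ E]

/-- The `k × (d+1)` color scheme attached to the choice, for every `c < d`, of the row `r c`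
that carries the dividing line between the columns `c` and `c + 1`. Reading the matrix row by row,
the entry at `(i, j)` is the number of dividing lines that have been passed, i.e. the index of the
block that contains the position `(i, j)`. -/
def colorScheme {k d : ℕ} (r : Fin d → Fin k) (i : Fin k) (j : Fin (d + 1)) : Fin (d + 1) :=
  ⟨(Finset.univ.filter fun c : Fin d => r c < i ∨ (r c = i ∧ c.castSucc < j)).card,
    Nat.lt_succ_of_le ((Finset.card_le_univ _).trans (Fintype.card_fin d).le)⟩

/-- The ordered maximal simplices of the `k`-edgewise subdivision of the simplex with the ordered
vertices `p 0, …, p d`; the `j`-th vertex is the average of the `p`'s named in column `j`. -/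
def edgewiseMax (k : ℕ) {d : ℕ} (p : Fin (d + 1) → E) : Set (List E) :=
  {l | ∃ r : Fin d → Fin k,
    l = List.ofFn fun j => (k : ℝ)⁻¹ • ∑ i : Fin k, p (colorScheme r i j)}

/-- All ordered simplices of the `k`-edgewise subdivision. -/
def edgewise (k : ℕ) {d : ℕ} (p : Fin (d + 1) → E) : Set (List E) :=
  {l | l ≠ [] ∧ ∃ t ∈ edgewiseMax k p, l.Sublist t}

/-- All ordered simplices of the prism subdivision with the ordered bottom `p 0, …, p d` and the
ordered top `q 0, …, q d`: the maximal ones are `p 0, …, p i, q i, …, q d`. -/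
def prism (p q : List E) : Set (List E) :=
  {l | l ≠ [] ∧ ∃ i < p.length, l.Sublist (p.take (i + 1) ++ q.drop i)}

open Classical in
/-- The underlying vertex sets of a set of ordered simplices. -/
def vertexSets (T : Set (List E)) : Set (Finset E) := List.toFinset '' T

end Subdivisions

/-! ### Triangulations -/

section Triangulations

variable {E : Type} [NormedAddCommGroup E] [NormedSpace ℝ E]

/-- `τ` (a set of vertex sets of simplices) is a triangulation of `Q` into lattice simplices. -/
def IsTriangulation (N : AddSubgroup E) (τ : Set (Finset E)) (Q : Set E) : Prop :=
  (∃ K : Geometry.SimplicialComplex ℝ E, K.faces = τ ∧ K.space = Q) ∧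
    ∀ s ∈ τ, ∀ x ∈ s, x ∈ N

/-- Every lattice point of `Q` is a vertex of a simplex of `τ`. -/
def IsMaximalTriangulation (N : AddSubgroup E) (τ : Set (Finset E)) (Q : Set E) : Prop :=
  ∀ x ∈ Q, x ∈ N → ∃ s ∈ τ, x ∈ s

/-- `0` is an interior point of `P` and a vertex of every maximal simplex of `τ`. -/
def IsStar (τ : Set (Finset E)) (P : Set E) : Prop :=
  (0 : E) ∈ interior P ∧ ∀ s, Maximal (· ∈ τ) s → (0 : E) ∈ s

/-- The domains of linearity of `f` on `P`: the maximal convex subsets of `P` on which `f` agrees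
with an affine function. -/
def linearityDomains (P : Set E) (f : E → ℝ) : Set (Set E) :=
  {D | Maximal (fun D' : Set E => D' ⊆ P ∧ Convex ℝ D' ∧ ∃ g : E →ᵃ[ℝ] ℝ, Set.EqOn f g D') D}

/-- There is a convex function on `P` whose domains of linearity are precisely the maximal
simplices of `τ`. -/
def IsProjectiveTriangulation (τ : Set (Finset E)) (P : Set E) : Prop :=
  ∃ f : E → ℝ, ConvexOn ℝ P f ∧
    linearityDomains P f = {D | ∃ s, Maximal (· ∈ τ) s ∧ D = convexHull ℝ (s : Set E)}

/-- A facet of the polytope `P`: a maximal proper face. -/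
def IsFacet (P F : Set E) : Prop :=
  Maximal (fun G : Set E => IsExposed ℝ P G ∧ G ≠ P) F

end Triangulations

/-! ### Fans and their toric varieties over `ℂ`

The ambient real vector space `E` is `N_ℝ`, for a lattice `N ⊆ E`. The character lattice `M` is the
dual lattice, inside the real dual `M_ℝ` of `E`. -/

section Toric

variable {E : Type} [AddCommGroup E] [Module ℝ E]

/-- A fan: a finite nonempty collection of strongly convex rational polyhedral cones, closed under
faces, any two of which meet in a common face. -/
structure IsFan (N : AddSubgroup E) (F : Set (PointedCone ℝ E)) : Prop where
  finite : F.Finite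
  nonempty : F.Nonempty
  rational : ∀ σ ∈ F, ∃ s : Finset E, (∀ x ∈ s, x ∈ N) ∧ PointedCone.hull ℝ (s : Set E) = σ
  salient : ∀ σ ∈ F, ∀ x ∈ σ, -x ∈ σ → x = 0
  face_mem : ∀ σ ∈ F, ∀ ρ : PointedCone ℝ E, ρ.IsFaceOf σ → ρ ∈ F
  inf_isFaceOf : ∀ σ ∈ F, ∀ ρ ∈ F, (σ ⊓ ρ).IsFaceOf σ

/-- The fan `F` is a subdivision of the fan `G`. -/
def Subdivides (F G : Set (PointedCone ℝ E)) : Prop :=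
  (∀ σ ∈ F, ∃ ρ ∈ G, σ ≤ ρ) ∧ (⋃ σ ∈ F, (σ : Set E)) = ⋃ ρ ∈ G, (ρ : Set E)

/-- The face fan of a star triangulation: the cones over the simplices that have `0` as a vertex. -/
def faceFan (τ : Set (Finset E)) : Set (PointedCone ℝ E) :=
  {σ | ∃ s ∈ τ, (0 : E) ∈ s ∧ σ = PointedCone.hull ℝ (s : Set E)}

/-- The cone of all `n` whose minimum over `Q ⊆ M_ℝ` is attained at `m₀`. -/
def normalCone (Q : Set (Module.Dual ℝ E)) (m₀ : Module.Dual ℝ E) : PointedCone ℝ E where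
  carrier := {n | ∀ m ∈ Q, m₀ n ≤ m n}
  add_mem' := by
    intro a b ha hb m hm
    simpa using add_le_add (ha m hm) (hb m hm)
  zero_mem' := by
    intro m _
    simp
  smul_mem' := by
    rintro ⟨c, hc⟩ a ha m hm
    simpa [Nonneg.mk_smul] using mul_le_mul_of_nonneg_left (ha m hm) hc

/-- The (inner) normal fan of a polytope `Q ⊆ M_ℝ`. The cone of a nonempty face of `Q` is the
normal cone at any point of its relative interior. -/
def normalFan (Q : Set (Module.Dual ℝ E)) : Set (PointedCone ℝ E) :=
  {σ | ∃ m₀ ∈ Q, σ = normalCone Q m₀}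

/-- The monoid `σ^∨ ∩ M`. -/
def dualMonoid (N : AddSubgroup E) (σ : PointedCone ℝ E) : AddSubmonoid (Module.Dual ℝ E) where
  carrier := {m | (∀ x ∈ N, ∃ z : ℤ, m x = z) ∧ ∀ x ∈ σ, 0 ≤ m x}
  add_mem' := by
    rintro a b ⟨ha, ha'⟩ ⟨hb, hb'⟩
    refine ⟨fun x hx => ?_, fun x hx => ?_⟩
    · obtain ⟨y, hy⟩ := ha x hx
      obtain ⟨z, hz⟩ := hb x hx
      exact ⟨y + z, by simp [hy, hz]⟩
    · simpa using add_nonneg (ha' x hx) (hb' x hx)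
  zero_mem' := ⟨fun _ _ => ⟨0, by simp⟩, fun _ _ => by simp⟩

theorem dualMonoid_anti (N : AddSubgroup E) {ρ σ : PointedCone ℝ E} (h : ρ ≤ σ) :
    dualMonoid N σ ≤ dualMonoid N ρ :=
  fun _ hm => ⟨hm.1, fun x hx => hm.2 x (h hx)⟩

/-- The affine toric variety `U_σ = Spec ℂ[σ^∨ ∩ M]`. -/
def affineToric (N : AddSubgroup E) (σ : PointedCone ℝ E) : Scheme.{0} :=
  Spec (CommRingCat.of (AddMonoidAlgebra ℂ (dualMonoid N σ)))

/-- The structure morphism of `U_σ`. -/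
def affineToricStr (N : AddSubgroup E) (σ : PointedCone ℝ E) :
    affineToric N σ ⟶ Spec (CommRingCat.of ℂ) :=
  Spec.map (CommRingCat.ofHom (algebraMap ℂ (AddMonoidAlgebra ℂ (dualMonoid N σ))))

/-- The toric morphism `U_ρ ⟶ U_σ`, for `ρ ⊆ σ`, given by the inclusion `σ^∨ ∩ M ⊆ ρ^∨ ∩ M`. -/
def affineToricMap (N : AddSubgroup E) {ρ σ : PointedCone ℝ E} (h : ρ ≤ σ) :
    affineToric N ρ ⟶ affineToric N σ :=
  Spec.map (CommRingCat.ofHom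
    (AddMonoidAlgebra.mapDomainRingHom ℂ (AddSubmonoid.inclusion (dualMonoid_anti N h))))

/-- The toric variety of the fan `F`: the scheme over `ℂ` glued from the affine toric varieties
`U_σ`, `σ ∈ F`, where `U_σ` and `U_ρ` are glued along `U_{σ ∩ ρ}`. These data determine the scheme
and its charts up to a unique isomorphism. -/
structure ToricVariety (N : AddSubgroup E) (F : Set (PointedCone ℝ E)) where
  X : Scheme.{0}
  str : X ⟶ Spec (CommRingCat.of ℂ)
  chart : ∀ σ : F, affineToric N σ.1 ⟶ X
  chart_isOpenImmersion : ∀ σ, IsOpenImmersion (chart σ)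
  chart_str : ∀ σ, chart σ ≫ str = affineToricStr N σ.1
  chart_comp : ∀ (ρ σ : F) (h : ρ.1 ≤ σ.1), affineToricMap N h ≫ chart σ = chart ρ
  cover : ∀ x : X, ∃ σ, x ∈ Set.range (chart σ)
  inter : ∀ σ σ' ρ : F, ρ.1 = σ.1 ⊓ σ'.1 →
    Set.range (chart σ) ∩ Set.range (chart σ') = Set.range (chart ρ)

/-- `π` is the toric morphism induced by the identity of `N`, for `F` a subdivision of `G`. -/
def IsToricMorphism {N : AddSubgroup E} {F G : Set (PointedCone ℝ E)}
    (A : ToricVariety N F) (B : ToricVariety N G) (π : A.X ⟶ B.X) : Prop :=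
  ∀ (σ : F) (ρ : G) (h : σ.1 ≤ ρ.1), A.chart σ ≫ π = affineToricMap N h ≫ B.chart ρ

end Toric

/-! ### Projective birational morphisms and crepancy -/

section Crepant

attribute [local instance] MvPolynomial.gradedAlgebra

/-- Projective `n`-space over `ℤ`. -/
def projectiveSpaceInt (n : ℕ) : Scheme.{0} :=
  Proj (MvPolynomial.homogeneousSubmodule (Fin (n + 1)) ℤ)

/-- A morphism is projective if it factors as a closed immersion into some `ℙⁿ × Y`, followed by
the projection to `Y`. -/
def IsProjectiveMorphism {X Y : Scheme.{0}} (π : X ⟶ Y) : Prop :=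
  ∃ (n : ℕ) (i : X ⟶ Limits.pullback
      (Limits.terminal.from (projectiveSpaceInt n)) (Limits.terminal.from Y)),
    IsClosedImmersion i ∧ i ≫ Limits.pullback.snd _ _ = π

/-- A morphism is birational if it is an isomorphism over a dense open subset with dense
preimage. -/
def IsBirationalMorphism {X Y : Scheme.{0}} (π : X ⟶ Y) : Prop :=
  ∃ V : Y.Opens, Dense (V : Set Y) ∧ Dense ((π ⁻¹ᵁ V : X.Opens) : Set X) ∧ IsIso (π ∣_ V)

/-- For a subring `A` of a field `K ⊇ ℂ`, the `A`-submodule of the rational `n`-forms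
`⋀ⁿ Ω_{K/ℂ}` that is generated by the forms `da₁ ∧ … ∧ daₙ`, `aᵢ ∈ A`. For the local ring `A` of a
normal `n`-dimensional variety at a point of codimension one, this is the stalk of the canonical
sheaf. -/
def formLattice {K : Type} [Field K] [Algebra ℂ K] (n : ℕ) (A : Subring K) :
    Submodule A (⋀[K]^n (Ω[K⁄ℂ])) :=
  Submodule.span A {η | ∃ a : Fin n → A,
    η = exteriorPower.ιMulti K n fun i => KaehlerDifferential.D ℂ K (a i : K)}

/-- The inclusion of the scalars into the function field of a scheme over `ℂ`. -/
def scalars {X : Scheme.{0}} [IrreducibleSpace X] (s : X ⟶ Spec (CommRingCat.of ℂ)) :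
    ℂ →+* X.functionField :=
  ((Scheme.ΓSpecIso (CommRingCat.of ℂ)).inv ≫ s.appTop ≫ X.presheaf.germ ⊤ (genericPoint X) trivial).hom

theorem specializes_of_isDominant {X Y : Scheme.{0}} [IrreducibleSpace X] (π : X ⟶ Y)
    [IsDominant π] (y : Y) : π (genericPoint X) ⤳ y := by
  rw [specializes_iff_mem_closure]
  have h : Set.range π ⊆ closure {π (genericPoint X)} := by
    rintro _ ⟨x, rfl⟩
    exact (((genericPoint_spec X).specializes trivial).map π.continuous).mem_closure
  exact closure_minimal h isClosed_closure (π.denseRange y)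

/-- For a dominant morphism `π : X ⟶ Y`, the image in the function field of `X` of the local ring of
`Y` at `y`. -/
def localRingIn {X Y : Scheme.{0}} [IrreducibleSpace X] (π : X ⟶ Y) [IsDominant π] (y : Y) :
    Subring X.functionField :=
  (Y.presheaf.stalkSpecializes (specializes_of_isDominant π y) ≫
    π.stalkMap (genericPoint X)).hom.range

/-- A birational morphism `π : X ⟶ Y` of normal `n`-dimensional varieties over `ℂ` (with structure
morphism `s` of `X`) is crepant, `K_X = π^* K_Y`: the canonical divisor `K_Y` is Cartier, i.e. `Y` is
covered by open sets `U` on which a rational `n`-form `ω` generates the canonical sheaf at all points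
of codimension one, and the same `ω`, pulled back to `X`, generates the canonical sheaf of `X` at all
points of codimension one of `π⁻¹ U`. Rational forms on `Y` are identified with rational forms on
`X`. -/
def IsCrepant (n : ℕ) {X Y : Scheme.{0}} [IsIntegral X] (s : X ⟶ Spec (CommRingCat.of ℂ))
    (π : X ⟶ Y) [IsDominant π] : Prop :=
  letI : Algebra ℂ X.functionField := (scalars s).toAlgebra
  ∀ y : Y, ∃ U : Y.Opens, y ∈ U ∧ ∃ ω : ⋀[X.functionField]^n (Ω[X.functionField⁄ℂ]),
    (∀ z ∈ U, ringKrullDim (Y.presheaf.stalk z) = 1 →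
      formLattice n (localRingIn π z) = Submodule.span (localRingIn π z) {ω}) ∧
    (∀ x : X, π x ∈ U → ringKrullDim (X.presheaf.stalk x) = 1 →
      formLattice n (localRingIn (𝟙 X) x) = Submodule.span (localRingIn (𝟙 X) x) {ω})

/-- `π : X ⟶ Y` is a projective crepant desingularization of `n`-dimensional varieties over `ℂ`. -/
structure IsCrepantDesingularization (n : ℕ) {X Y : Scheme.{0}}
    (sX : X ⟶ Spec (CommRingCat.of ℂ)) (sY : Y ⟶ Spec (CommRingCat.of ℂ)) (π : X ⟶ Y) : Prop where
  comp_str : π ≫ sY = sX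
  smooth : SmoothOfRelativeDimension n sX
  isProjective : IsProjectiveMorphism π
  isBirational : IsBirationalMorphism π
  isIntegral_target : IsIntegral Y
  isIntegral_source : IsIntegral X
  isDominant : IsDominant π
  isCrepant : IsCrepant n sX π

end Crepant

/-! ### The nef-partition, its dual, and the explicit triangulation

The indices `1, …, 6` are written `0, …, 5` in the code, so that `i ∈ {1, 2, 3}` becomes `i < 3` and
`j ∈ {4, 5, 6}` becomes `j ≥ 3`. -/

/-- `N_ℝ`, the hyperplane of vectors with coordinate sum `0` in `ℝ⁶`. -/
abbrev NR : Type :=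
  LinearMap.ker (∑ i : Fin 6, LinearMap.proj i : (Fin 6 → ℝ) →ₗ[ℝ] ℝ)

/-- The lattice `N` of integral vectors in `N_ℝ`. -/
def latticeN : AddSubgroup NR where
  carrier := {x | ∀ i, ∃ z : ℤ, x.1 i = z}
  add_mem' := by
    intro a b ha hb i
    obtain ⟨y, hy⟩ := ha i
    obtain ⟨z, hz⟩ := hb i
    exact ⟨y + z, by simp [hy, hz]⟩
  zero_mem' := fun _ => ⟨0, by simp⟩
  neg_mem' := by
    intro a ha i
    obtain ⟨y, hy⟩ := ha i
    exact ⟨-y, by simp [hy]⟩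

/-- The standard basis vectors of `ℝ⁶`. -/
def e (i : Fin 6) : Fin 6 → ℝ := Pi.single i 1

/-- `u_i = 3 e_i - e_1 - e_2 - e_3`. -/
def u (i : Fin 6) : NR :=
  ⟨(3 : ℝ) • e i - e 0 - e 1 - e 2, by
    simp [e, Finset.sum_sub_distrib, ← Finset.mul_sum]
    norm_num⟩

/-- `v_i = 3 e_i - e_4 - e_5 - e_6`. -/
def v (i : Fin 6) : NR :=
  ⟨(3 : ℝ) • e i - e 3 - e 4 - e 5, by
    simp [e, Finset.sum_sub_distrib, ← Finset.mul_sum]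
    norm_num⟩

/-- `w = e_1 + e_2 + e_3 - e_4 - e_5 - e_6`. -/
def w : NR :=
  ⟨e 0 + e 1 + e 2 - e 3 - e 4 - e 5, by
    simp [e, Finset.sum_sub_distrib, Finset.sum_add_distrib]⟩

/-- `Δ₁`. -/
def Delta₁ : Set NR := convexHull ℝ (Set.range u)

/-- `Δ₂`. -/
def Delta₂ : Set NR := convexHull ℝ (Set.range v)

/-- `P = conv(Δ₁, Δ₂)`. -/
def P : Set NR := convexHull ℝ (Delta₁ ∪ Delta₂)

/-- `∇₁`, from the dual nef-partition. -/
def nabla₁ : Set (Module.Dual ℝ NR) :=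
  {m | (∀ x ∈ Delta₁, 0 ≤ m x + 1) ∧ ∀ x ∈ Delta₂, 0 ≤ m x}

/-- `∇₂`, from the dual nef-partition. -/
def nabla₂ : Set (Module.Dual ℝ NR) :=
  {m | (∀ x ∈ Delta₁, 0 ≤ m x) ∧ ∀ x ∈ Delta₂, 0 ≤ m x + 1}

/-- `Σ_∇`, the normal fan of `∇ = ∇₁ + ∇₂`. -/
def SigmaNabla : Set (PointedCone ℝ NR) := normalFan (nabla₁ + nabla₂)

/-- The cone `U_i`, for `i ∈ {1, 2, 3}`. -/
def coneU (i : Fin 6) : PointedCone ℝ NR := PointedCone.hull ℝ (u '' {k | k ≠ i})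

/-- The cone `V_j`, for `j ∈ {4, 5, 6}`. -/
def coneV (j : Fin 6) : PointedCone ℝ NR := PointedCone.hull ℝ (v '' {k | k ≠ j})

/-- The cone `C_{i,j}`, for `i ∈ {1, 2, 3}` and `j ∈ {4, 5, 6}`. -/
def coneC (i j : Fin 6) : PointedCone ℝ NR :=
  PointedCone.hull ℝ (u '' {k | k ≠ i ∧ k ≠ j} ∪ v '' {k | k ≠ i ∧ k ≠ j})

/-- `P(σ) = ∂P ∩ σ`. -/
def face (σ : PointedCone ℝ NR) : Set NR := frontier P ∩ σ

/-- `τ(P(U_i)) = Esd₃`, with the vertices `u_1, …, u_6` other than `u_i` in this order. -/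
def tauU (i : Fin 6) : Set (List NR) := edgewise 3 fun k : Fin 5 => u (i.succAbove k)

/-- `τ(P(V_j)) = Esd₃`, with the vertices `v_1, …, v_6` other than `v_j` in this order. -/
def tauV (j : Fin 6) : Set (List NR) := edgewise 3 fun k : Fin 5 => v (j.succAbove k)

/-- `τ(P(C_{i,j}))`, the union of the prism subdivisions over `δ` and `δ + w`, for the simplices `δ`
of `τ(P(U_i))` that lie in `C_{i,j}`. -/
def tauC (i j : Fin 6) : Set (List NR) :=
  {l | ∃ δ ∈ tauU i, (∀ x ∈ δ, x ∈ coneC i j) ∧ l ∈ prism δ (δ.map (· + w))}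

/-- `τ(∂P)`, the union of the triangulations of the facets. -/
def tauBoundary : Set (Finset NR) :=
  {s | (∃ i < 3, s ∈ vertexSets (tauU i)) ∨ (∃ j ≥ 3, s ∈ vertexSets (tauV j)) ∨
    ∃ i < 3, ∃ j ≥ 3, s ∈ vertexSets (tauC i j)}

open Classical in
/-- `τ(P)`, whose maximal simplices arise from those of `τ(∂P)` by appending the vertex `0`. -/
def tauP : Set (Finset NR) :=
  {s | s.Nonempty ∧ ∃ t, Maximal (· ∈ tauBoundary) t ∧ s ⊆ insert 0 t}

end CubicsMPCP

end

/-! Let A_0 = 0 and let A_1, A_2, A_3 be the negatives of the first three coordinates; define B_0,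
…, B_3 likewise from the last three. Then ∇₁ and ∇₂ are the negatives of the convex hulls of the A_i
and of the B_j, and P is the set where max A_i + max B_j, its gauge, is at most 1. Hence the cones
of Σ_∇ are the cells on which prescribed A_i and B_j are maximal, and the facets of P are the slices
A_i + B_j = 1 of the cells of the pairs (i, j) ≠ (0, 0).

Fix such a pair and put T = A_i + B_j. Adding A_i to the first three coordinates and B_j to the last
three gives forms z_k (`formZ`) that are nonnegative on the cell and sum to 3T. Let Y_m be their
partial sums, and Y_7 = A_i. The walls Y_m - Y_l = kT with |k| ≤ 2 (`formH`) cut the cell into the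
cones over the simplices of τ. The integral parts of the Y_m, in units of T, are the rows of the
dividing lines of a color scheme. Sorting the fractional parts gives the columns, and the place of
A_i among the fractional parts is where a prism simplex passes from the bottom to the top.

This is made algebraic. A submonoid S of the dual space is read as a set of forms declared
nonnegative. If in this sense A_i and B_j are maximal and every wall form has a sign (`Selects`),
then S contains the dual basis of a simplex of τ with integral vertices and integral dual basis
(`IsFrame`, `Selects.exists_frame`). Conversely, along the ordered vertices of a simplex of τ every
Y_m drops by at most one at a time (`chain_of_mem_tauAt`), so that no wall separates them
(`selects_nonnegOn`).

Different choices of S give the combinatorial claims. The forms nonnegative at one point give the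
covering. The forms nonnegative on the vertices of a simplex show that it is a face of a frame. The
forms nonnegative on one simplex and on the support, in another simplex, of a common point show that
simplices meet in common faces (`IsFrame.exists_eq_of_pos`). Maximality follows from unimodularity,
because the gauge is integral on N.

For projectivity the positive parts of the wall forms are added up, each corrected by multiples of
max A_i and max B_j so that it becomes a maximum of linear forms on all of N_ℝ (`totalForm`). With S
generated by the differences of one of these forms and all the others, the domains of linearity turn
out to be the frames. Moreover these differences generate the characters of the corresponding chart
(`diffMonoid_eq`), so the same forms embed the toric variety of Π into a projective space.

On the toric side, charts are glued along faces, and a very ample family of characters gives a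
closed immersion into projective space; this makes π projective. Over the torus π is an isomorphism,
and the chart of a frame is an affine space. There the canonical sheaf is generated by the
logarithmic volume form times the character of the sum of the dual basis, which is T. Since T agrees
with the gauge, which is linear on each cell of Σ_∇, one rational form serves on a whole chart of
the target and on its preimage. Points of codimension one of the target lie in the torus or in the
chart of a ray through some u_k or v_k, and these rays belong to both fans (`hasRays`). This gives
crepancy. -/

open CategoryTheory AlgebraicGeometry
open scoped Pointwise KaehlerDifferential

noncomputable section

namespace CubicsMPCP

/-! ### Affine toric charts -/

section ToricCharts

variable {E : Type} [AddCommGroup E] [Module ℝ E] {N : AddSubgroup E}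

/-- `m` is an integral linear form that cuts out `κ` as a face of `σ`. -/
structure IsFaceForm (N : AddSubgroup E) (σ κ : PointedCone ℝ E) (m : Module.Dual ℝ E) : Prop where
  mem : m ∈ dualMonoid N σ
  eq_zero : ∀ x ∈ κ, m x = 0
  mem_of_eq_zero : ∀ x ∈ σ, m x = 0 → x ∈ κ

/-- The properties of a fan that are needed to glue its toric variety. -/
structure IsGluable (N : AddSubgroup E) (F : Set (PointedCone ℝ E)) : Prop where
  fg : ∀ σ ∈ F, ∃ s : Finset E, PointedCone.hull ℝ (s : Set E) = σ
  inf_mem : ∀ σ ∈ F, ∀ ρ ∈ F, σ ⊓ ρ ∈ F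
  exists_faceForm : ∀ σ ∈ F, ∀ κ ∈ F, κ ≤ σ → ∃ m, IsFaceForm N σ κ m
  bot_mem : ⊥ ∈ F

/-- The coordinate ring `ℂ[σ^∨ ∩ M]`. -/
abbrev toricRing (N : AddSubgroup E) (σ : PointedCone ℝ E) : Type :=
  AddMonoidAlgebra ℂ (dualMonoid N σ)

/-- The inclusion of coordinate rings for `ρ ≤ σ`. -/
def restr (N : AddSubgroup E) {ρ σ : PointedCone ℝ E} (h : ρ ≤ σ) :
    toricRing N σ →+* toricRing N ρ :=
  AddMonoidAlgebra.mapDomainRingHom ℂ (AddSubmonoid.inclusion (dualMonoid_anti N h))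

/-- The character `χ^m`, for `m ∈ σ^∨ ∩ M`. -/
def chr {σ : PointedCone ℝ E} (m : dualMonoid N σ) : toricRing N σ :=
  AddMonoidAlgebra.single m 1

theorem affineToricMap_eq {ρ σ : PointedCone ℝ E} (h : ρ ≤ σ) :
    affineToricMap N h = Spec.map (CommRingCat.ofHom (restr N h)) := rfl

theorem chr_add {σ : PointedCone ℝ E} (m n : dualMonoid N σ) : chr (m + n) = chr m * chr n := by
  simp [chr, AddMonoidAlgebra.single_mul_single]

theorem chr_zero {σ : PointedCone ℝ E} : chr (0 : dualMonoid N σ) = 1 := rfl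

theorem chr_nsmul {σ : PointedCone ℝ E} (n : ℕ) (m : dualMonoid N σ) :
    chr (n • m) = chr m ^ n := by
  induction n with
  | zero => simp [chr_zero]
  | succ n ih => rw [succ_nsmul, chr_add, ih, pow_succ]

theorem chr_ne_zero {σ : PointedCone ℝ E} (m : dualMonoid N σ) : chr m ≠ 0 := by
  simp [chr]

theorem restr_chr {ρ σ : PointedCone ℝ E} (h : ρ ≤ σ) (m : dualMonoid N σ) :
    restr N h (chr m) = chr (AddSubmonoid.inclusion (dualMonoid_anti N h) m) := by
  simp [restr, chr]

theorem restr_injective {ρ σ : PointedCone ℝ E} (h : ρ ≤ σ) :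
    Function.Injective (restr N h) :=
  AddMonoidAlgebra.mapDomain_injective (AddSubmonoid.inclusion_injective _)

theorem restr_comp {κ ρ σ : PointedCone ℝ E} (h : κ ≤ ρ) (h' : ρ ≤ σ) :
    (restr N h).comp (restr N h') = restr N (h.trans h') := by
  rw [restr, restr, restr, ← AddMonoidAlgebra.mapDomainRingHom_comp]
  rfl

theorem restr_algebraMap {ρ σ : PointedCone ℝ E} (h : ρ ≤ σ) :
    (restr N h).comp (algebraMap ℂ (toricRing N σ)) = algebraMap ℂ (toricRing N ρ) :=
  AddMonoidAlgebra.mapDomainRingHom_comp_algebraMap _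

theorem affineToricMap_comp {κ ρ σ : PointedCone ℝ E} (h : κ ≤ ρ) (h' : ρ ≤ σ) :
    affineToricMap N h ≫ affineToricMap N h' = affineToricMap N (h.trans h') := by
  refine (Spec.map_comp (CommRingCat.ofHom (restr N h')) (CommRingCat.ofHom (restr N h))).symm.trans ?_
  rw [← CommRingCat.ofHom_comp, restr_comp]
  rfl

theorem affineToricMap_refl (σ : PointedCone ℝ E) :
    affineToricMap N (le_refl σ) = 𝟙 _ := by
  have : restr N (le_refl σ) = RingHom.id _ := by
    rw [restr, ← AddMonoidAlgebra.mapDomainRingHom_id]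
    rfl
  rw [affineToricMap_eq, this]
  exact Spec.map_id _

theorem affineToricMap_str {ρ σ : PointedCone ℝ E} (h : ρ ≤ σ) :
    affineToricMap N h ≫ affineToricStr N σ = affineToricStr N ρ := by
  refine (Spec.map_comp (CommRingCat.ofHom (algebraMap ℂ (toricRing N σ)))
    (CommRingCat.ofHom (restr N h))).symm.trans ?_
  rw [← CommRingCat.ofHom_comp, restr_algebraMap]
  rfl

/-- The monoid embeds into a rational vector space, so it has unique sums, and its monoid algebra
has no zero divisors. -/
instance (σ : PointedCone ℝ E) : IsDomain (toricRing N σ) := by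
  let _ : Module ℚ (Module.Dual ℝ E) := Module.compHom _ (algebraMap ℚ ℝ)
  have : UniqueSums (dualMonoid N σ) :=
    UniqueSums.of_injective_addHom (dualMonoid N σ).subtype.toAddHom Subtype.val_injective
      inferInstance
  infer_instance

/-- Only the finitely many generators of `σ` matter. Where `m` vanishes the generator lies in `κ`
and `m'` is nonnegative already; elsewhere `m` is positive and a large multiple of it compensates
for `m'`. -/
theorem exists_nsmul_add_mem {σ κ : PointedCone ℝ E} {m : Module.Dual ℝ E}
    (hm : IsFaceForm N σ κ m) {s : Finset E} (hs : PointedCone.hull ℝ (s : Set E) = σ)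
    {m' : Module.Dual ℝ E} (hm' : m' ∈ dualMonoid N κ) :
    ∃ n : ℕ, m' + n • m ∈ dualMonoid N σ := by
  have hsub : ∀ g ∈ s, g ∈ σ := fun g hg => hs ▸ Submodule.subset_span hg
  have h1 : ∀ g ∈ s, ∃ n : ℕ, ∀ k : ℕ, n ≤ k → 0 ≤ m' g + k * m g := by
    intro g hg
    have h0 := hm.mem.2 g (hsub g hg)
    rcases h0.eq_or_lt with h | h
    · refine ⟨0, fun k _ => ?_⟩
      rw [← h]
      simpa using hm'.2 g (hm.mem_of_eq_zero g (hsub g hg) h.symm)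
    · obtain ⟨n, hn⟩ := exists_nat_gt (-(m' g) / m g)
      refine ⟨n, fun k hk => ?_⟩
      rw [div_lt_iff₀ h] at hn
      have : (n : ℝ) * m g ≤ k * m g := by gcongr
      linarith
  choose! n hn using h1
  refine ⟨s.sup n, ?_, ?_⟩
  · intro x hx
    obtain ⟨a, ha⟩ := hm'.1 x hx
    obtain ⟨b, hb⟩ := hm.mem.1 x hx
    exact ⟨a + (s.sup n : ℕ) * b, by simp [ha, hb]⟩
  · intro x hx
    rw [← hs] at hx
    induction hx using Submodule.span_induction with
    | mem x hx => simpa using hn x hx (s.sup n) (Finset.le_sup hx)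
    | zero => simp
    | add x y _ _ hx hy => simpa [mul_add, add_add_add_comm] using add_nonneg hx hy
    | smul c x _ hx =>
      obtain ⟨c, hc⟩ := c
      have : (m' + (s.sup n) • m) ((⟨c, hc⟩ : {c : ℝ // 0 ≤ c}) • x) =
        c * ((m' + (s.sup n) • m) x) := by
        rw [Nonneg.mk_smul, map_smul, smul_eq_mul]
      rw [this]
      exact mul_nonneg hc hx

/-- The form as an element of the dual monoid. -/
def IsFaceForm.elt {σ κ : PointedCone ℝ E} {m : Module.Dual ℝ E} (hm : IsFaceForm N σ κ m) :
    dualMonoid N σ := ⟨m, hm.mem⟩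

theorem IsFaceForm.neg_mem {σ κ : PointedCone ℝ E} {m : Module.Dual ℝ E}
    (hm : IsFaceForm N σ κ m) : -m ∈ dualMonoid N κ := by
  refine ⟨fun x hx => ?_, fun x hx => by simp [hm.eq_zero x hx]⟩
  obtain ⟨a, ha⟩ := hm.mem.1 x hx
  exact ⟨-a, by simp [ha]⟩

theorem isUnit_chr {σ : PointedCone ℝ E} (m : dualMonoid N σ) (h : -m.1 ∈ dualMonoid N σ) :
    IsUnit (chr m) := by
  refine IsUnit.of_mul_eq_one (chr ⟨_, h⟩) ?_
  rw [← chr_add, ← chr_zero]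
  congr 1
  ext1
  simp

/-- The chart of a face is a principal open subset: a character of `κ` becomes one of `σ` after
multiplication by a power of χ^m, which is invertible over `κ`. -/
theorem isLocalization_restr {σ κ : PointedCone ℝ E} {m : Module.Dual ℝ E} (h : κ ≤ σ)
    (hm : IsFaceForm N σ κ m) {s : Finset E} (hs : PointedCone.hull ℝ (s : Set E) = σ) :
    let _ := (restr N h).toAlgebra
    IsLocalization.Away (chr hm.elt) (toricRing N κ) := by
  let _ := (restr N h).toAlgebra
  refine IsLocalization.Away.mk _ ?_ ?_ ?_
  · rw [RingHom.algebraMap_toAlgebra, restr_chr]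
    exact isUnit_chr _ hm.neg_mem
  · intro f
    rw [RingHom.algebraMap_toAlgebra]
    induction f using AddMonoidAlgebra.induction_linear with
    | zero => exact ⟨0, 0, by simp⟩
    | add f g hf hg =>
      obtain ⟨n, a, ha⟩ := hf
      obtain ⟨k, b, hb⟩ := hg
      refine ⟨n + k, a * chr hm.elt ^ k + b * chr hm.elt ^ n, ?_⟩
      rw [map_add, map_mul, map_mul, ← ha, ← hb, map_pow, map_pow]
      ring
    | single m' c =>
      obtain ⟨n, hn⟩ := exists_nsmul_add_mem hm hs m'.2
      refine ⟨n, AddMonoidAlgebra.single ⟨_, hn⟩ c, ?_⟩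
      rw [← map_pow, ← chr_nsmul, restr_chr]
      simp only [chr, restr, AddMonoidAlgebra.mapDomainRingHom_apply,
        AddMonoidAlgebra.mapDomain_single, AddMonoidAlgebra.single_mul_single, mul_one]
      rfl
  · intro a b hab
    exact ⟨0, by rw [restr_injective h hab]⟩

/-- The points of the affine toric variety at which `χ^m` does not vanish. -/
def nonvanishing {σ : PointedCone ℝ E} (m : dualMonoid N σ) : Set (affineToric N σ) :=
  ((PrimeSpectrum.basicOpen (chr m) : TopologicalSpace.Opens (PrimeSpectrum (toricRing N σ))) :
    Set (PrimeSpectrum (toricRing N σ)))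

theorem nonvanishing_add {σ : PointedCone ℝ E} (m n : dualMonoid N σ) :
    nonvanishing (m + n) = nonvanishing m ∩ nonvanishing n := by
  rw [nonvanishing, chr_add, PrimeSpectrum.basicOpen_mul]
  rfl

theorem range_affineToricMap {σ κ : PointedCone ℝ E} {m : Module.Dual ℝ E} (h : κ ≤ σ)
    (hm : IsFaceForm N σ κ m) {s : Finset E} (hs : PointedCone.hull ℝ (s : Set E) = σ) :
    Set.range (affineToricMap N h) = nonvanishing hm.elt := by
  let _ := (restr N h).toAlgebra
  have := isLocalization_restr h hm hs
  exact PrimeSpectrum.localization_away_comap_range (toricRing N κ) (chr hm.elt)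

theorem isOpenImmersion_affineToricMap {σ κ : PointedCone ℝ E} {m : Module.Dual ℝ E} (h : κ ≤ σ)
    (hm : IsFaceForm N σ κ m) {s : Finset E} (hs : PointedCone.hull ℝ (s : Set E) = σ) :
    IsOpenImmersion (affineToricMap N h) := by
  let _ := (restr N h).toAlgebra
  have := isLocalization_restr h hm hs
  exact IsOpenImmersion.of_isLocalization (chr hm.elt)

theorem IsFaceForm.add {σ κ κ' : PointedCone ℝ E} {m m' : Module.Dual ℝ E}
    (hm : IsFaceForm N σ κ m) (hm' : IsFaceForm N σ κ' m') :
    IsFaceForm N σ (κ ⊓ κ') (m + m') where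
  mem := add_mem hm.mem hm'.mem
  eq_zero x hx := by simp [hm.eq_zero x hx.1, hm'.eq_zero x hx.2]
  mem_of_eq_zero x hx h := by
    have h1 := hm.mem.2 x hx
    have h2 := hm'.mem.2 x hx
    rw [LinearMap.add_apply] at h
    exact ⟨hm.mem_of_eq_zero x hx (by linarith), hm'.mem_of_eq_zero x hx (by linarith)⟩

/-! ### Gluing -/

variable {F : Set (PointedCone ℝ E)}

/-- The diagram of the affine toric varieties of the cones of a fan. -/
@[simps]
def toricDiagram (N : AddSubgroup E) (F : Set (PointedCone ℝ E)) : F ⥤ Scheme.{0} where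
  obj σ := affineToric N σ.1
  map f := affineToricMap N (leOfHom f)
  map_id σ := affineToricMap_refl σ.1
  map_comp f g := (affineToricMap_comp (leOfHom f) (leOfHom g)).symm

theorem IsGluable.isOpenImmersion (hF : IsGluable N F) {σ κ : PointedCone ℝ E} (hσ : σ ∈ F)
    (hκ : κ ∈ F) (h : κ ≤ σ) : IsOpenImmersion (affineToricMap N h) := by
  obtain ⟨s, hs⟩ := hF.fg σ hσ
  obtain ⟨m, hm⟩ := hF.exists_faceForm σ hσ κ hκ h
  exact isOpenImmersion_affineToricMap h hm hs

/-- The nonvanishing loci of χ^m and χ^m' meet in that of χ^(m + m'), and the sum of two face forms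
cuts out the intersection of the faces. -/
theorem IsGluable.range_inter (hF : IsGluable N F) {σ κ κ' : PointedCone ℝ E} (hσ : σ ∈ F)
    (hκ : κ ∈ F) (hκ' : κ' ∈ F) (h : κ ≤ σ) (h' : κ' ≤ σ) :
    Set.range (affineToricMap N h) ∩ Set.range (affineToricMap N h') =
      Set.range (affineToricMap N (inf_le_left.trans h : κ ⊓ κ' ≤ σ)) := by
  obtain ⟨s, hs⟩ := hF.fg σ hσ
  obtain ⟨m, hm⟩ := hF.exists_faceForm σ hσ κ hκ h
  obtain ⟨m', hm'⟩ := hF.exists_faceForm σ hσ κ' hκ' h'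
  rw [range_affineToricMap h hm hs, range_affineToricMap h' hm' hs,
    range_affineToricMap _ (hm.add hm') hs]
  exact (nonvanishing_add hm.elt hm'.elt).symm

/-- This is the condition under which the colimit of the charts is an honest gluing: points of two
charts that agree in a larger chart come from the chart of the intersection. -/
theorem IsGluable.isLocallyDirected (hF : IsGluable N F) :
    (toricDiagram N F ⋙ Scheme.forget).IsLocallyDirected where
  cond := by
    intro κ κ' σ f f' x x' h
    have hmem : affineToricMap N (leOfHom f) x ∈
        Set.range (affineToricMap N (inf_le_left.trans (leOfHom f) : κ.1 ⊓ κ'.1 ≤ σ.1)) := by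
      rw [← hF.range_inter σ.2 κ.2 κ'.2 (leOfHom f) (leOfHom f')]
      exact ⟨⟨x, rfl⟩, ⟨x', h.symm⟩⟩
    obtain ⟨y, hy⟩ := hmem
    have hi := hF.isOpenImmersion σ.2 κ.2 (leOfHom f)
    have hi' := hF.isOpenImmersion σ.2 κ'.2 (leOfHom f')
    refine ⟨⟨_, hF.inf_mem _ κ.2 _ κ'.2⟩,
      homOfLE (show κ.1 ⊓ κ'.1 ≤ κ.1 from inf_le_left),
      homOfLE (show κ.1 ⊓ κ'.1 ≤ κ'.1 from inf_le_right), y, ?_, ?_⟩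
    · exact hi.base_open.injective
        (congr($(affineToricMap_comp (N := N) (inf_le_left : κ.1 ⊓ κ'.1 ≤ κ.1) (leOfHom f)) y).trans hy)
    · exact hi'.base_open.injective
        (congr($(affineToricMap_comp (N := N) (inf_le_right : κ.1 ⊓ κ'.1 ≤ κ'.1)
          (leOfHom f')) y).trans (hy.trans h))

/-- The toric variety of a fan exists, and morphisms out of it are compatible families of morphisms
out of its affine charts. -/
theorem IsGluable.exists_toricVariety (hF : IsGluable N F) :
    ∃ A : ToricVariety N F, ∀ (Z : Scheme.{0}) (f : ∀ σ : F, affineToric N σ.1 ⟶ Z),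
      (∀ (ρ σ : F) (h : ρ.1 ≤ σ.1), affineToricMap N h ≫ f σ = f ρ) →
      ∃ π : A.X ⟶ Z, ∀ σ, A.chart σ ≫ π = f σ := by
  have : ∀ {i j : F} (f : i ⟶ j), IsOpenImmersion ((toricDiagram N F).map f) :=
    fun {i j} f => hF.isOpenImmersion j.2 i.2 (leOfHom f)
  have := hF.isLocallyDirected
  let c : Limits.Cocone (toricDiagram N F) :=
    { pt := Spec (CommRingCat.of ℂ)
      ι := { app := fun σ => affineToricStr N σ.1
             naturality := fun σ ρ f => by
              exact (affineToricMap_str (N := N) (leOfHom f)).trans (Category.comp_id _).symm } }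
  have hι : ∀ σ : F, IsOpenImmersion (Limits.colimit.ι (toricDiagram N F) σ) := fun σ =>
    Scheme.IsLocallyDirected.instIsOpenImmersionι _ σ
  refine ⟨{
    X := Limits.colimit (toricDiagram N F)
    str := Limits.colimit.desc _ c
    chart := Limits.colimit.ι (toricDiagram N F)
    chart_isOpenImmersion := hι
    chart_str := fun σ => Limits.colimit.ι_desc _ _
    chart_comp := fun ρ σ h => Limits.colimit.w (toricDiagram N F) (homOfLE h)
    cover := fun x => ?_
    inter := fun σ σ' ρ h => ?_ }, ?_⟩
  · obtain ⟨i, y, hy⟩ := Scheme.IsLocallyDirected.ι_jointly_surjective (toricDiagram N F) x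
    exact ⟨i, y, hy⟩
  · apply Set.Subset.antisymm
    · rintro _ ⟨⟨y, rfl⟩, ⟨z, hz⟩⟩
      -- Points of two charts are identified in the colimit only through the chart of some cone
      -- contained in both, hence in the intersection.
      obtain ⟨k, f, g, x, hx, -⟩ :=
        (Scheme.IsLocallyDirected.ι_eq_ι_iff (toricDiagram N F)).mp hz.symm
      have hk : k.1 ≤ ρ.1 := h ▸ le_inf (leOfHom f) (leOfHom g)
      refine ⟨affineToricMap N hk x, ?_⟩
      rw [← hx]
      have h1 := Limits.colimit.w (toricDiagram N F) (homOfLE hk : k ⟶ ρ)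
      have h2 := Limits.colimit.w (toricDiagram N F) f
      exact congr($(h1.trans h2.symm) x)
    · rintro _ ⟨y, rfl⟩
      have h1 := Limits.colimit.w (toricDiagram N F) (homOfLE (h.trans_le inf_le_left) : ρ ⟶ σ)
      have h2 := Limits.colimit.w (toricDiagram N F) (homOfLE (h.trans_le inf_le_right) : ρ ⟶ σ')
      exact ⟨⟨_, congr($h1 y)⟩, ⟨_, congr($h2 y)⟩⟩
  · intro Z f hf
    let d : Limits.Cocone (toricDiagram N F) :=
      { pt := Z
        ι := { app := f
               naturality := fun σ ρ g => (hf σ ρ (leOfHom g)).trans (Category.comp_id _).symm } }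
    exact ⟨Limits.colimit.desc _ d, fun σ => Limits.colimit.ι_desc _ _⟩

end ToricCharts


/-! ### Morphisms to `Proj` -/

section ProjMaps

open HomogeneousLocalization

variable {S A R R' : Type} [CommRing A] [SetLike S A] [AddSubgroupClass S A] (𝒜 : ℕ → S)
  [GradedRing 𝒜] [CommRing R] [CommRing R']

/-- The homomorphism from a homogeneous localization induced by a ring homomorphism that inverts
the denominator. -/
def awayEval (g : A →+* R) {f : A} (hu : IsUnit (g f)) : Away 𝒜 f →+* R :=
  (IsLocalization.Away.lift (S := Localization.Away f) f hu).comp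
    (algebraMap (Away 𝒜 f) (Localization.Away f))

theorem awayEval_mk (g : A →+* R) {f : A} (hu : IsUnit (g f)) {d : ℕ} (hd : f ∈ 𝒜 d) (n : ℕ) (a : A)
    (ha : a ∈ 𝒜 (n • d)) : awayEval 𝒜 g hu (Away.mk 𝒜 hd n a ha) * g f ^ n = g a := by
  have h : (algebraMap (Away 𝒜 f) (Localization.Away f) (Away.mk 𝒜 hd n a ha)) *
      algebraMap A (Localization.Away f) f ^ n = algebraMap A (Localization.Away f) a := by
    rw [HomogeneousLocalization.algebraMap_apply, Away.val_mk, ← map_pow,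
      ← Localization.mk_one_eq_algebraMap, ← Localization.mk_one_eq_algebraMap, Localization.mk_mul,
      Localization.mk_eq_mk_iff, Localization.r_iff_exists]
    exact ⟨1, by simp; ring⟩
  have h2 := congrArg (IsLocalization.Away.lift (S := Localization.Away f) f hu) h
  rw [map_mul, map_pow, IsLocalization.Away.lift_eq, IsLocalization.Away.lift_eq] at h2
  exact h2

/-- The morphism to `Proj` induced by a ring homomorphism that inverts a form of degree one. -/
def toProj (g : A →+* R) {f : A} (hf : f ∈ 𝒜 1) (hu : IsUnit (g f)) :
    Spec (CommRingCat.of R) ⟶ Proj 𝒜 :=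
  Spec.map (CommRingCat.ofHom (awayEval 𝒜 g hu)) ≫ Proj.awayι 𝒜 f hf one_pos

theorem SpecMap_toProj (φ : R →+* R') (g : A →+* R) {f : A} (hf : f ∈ 𝒜 1) (hu : IsUnit (g f)) :
    Spec.map (CommRingCat.ofHom φ) ≫ toProj 𝒜 g hf hu =
      toProj 𝒜 (φ.comp g) hf (hu.map φ) := by
  rw [toProj, toProj, ← Category.assoc, ← Spec.map_comp, ← CommRingCat.ofHom_comp]
  congr 3
  ext z
  obtain ⟨n, a, ha, rfl⟩ := Away.mk_surjective 𝒜 hf z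
  have h1 := congrArg φ (awayEval_mk 𝒜 g hu hf n a ha)
  rw [map_mul, map_pow] at h1
  have h2 := awayEval_mk 𝒜 (φ.comp g) (hu.map φ) hf n a ha
  exact ((hu.map φ).pow n).mul_left_injective (h1.trans h2.symm)

/-- Morphisms defined through D₊(f) and through D₊(f') are compared over the common piece D₊(f f').
-/
theorem toProj_eq_mul (g : A →+* R) {f f' : A} (hf : f ∈ 𝒜 1) (hu : IsUnit (g f)) (hf' : f' ∈ 𝒜 1)
    (hu' : IsUnit (g (f * f'))) :
    toProj 𝒜 g hf hu = Spec.map (CommRingCat.ofHom (awayEval 𝒜 g hu')) ≫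
      Proj.awayι 𝒜 (f * f') (SetLike.mul_mem_graded hf hf') two_pos := by
  have h := Proj.SpecMap_awayMap_awayι 𝒜 (f := f) hf one_pos hf' (x := f * f') rfl
  rw [toProj]
  refine Eq.trans ?_ congr(Spec.map (CommRingCat.ofHom (awayEval 𝒜 g hu')) ≫ $h)
  rw [← Category.assoc, ← Spec.map_comp, ← CommRingCat.ofHom_comp]
  congr 3
  ext z
  obtain ⟨n, a, ha, rfl⟩ := Away.mk_surjective 𝒜 hf z
  rw [RingHom.comp_apply, awayMap_mk]
  have h1 := awayEval_mk 𝒜 g hu hf n a ha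
  have h2 := awayEval_mk 𝒜 g hu' (SetLike.mul_mem_graded hf hf') n (a * f' ^ n)
    (by rw [smul_add]; exact SetLike.mul_mem_graded ha (SetLike.pow_mem_graded n hf'))
  apply (hu'.pow n).mul_left_injective
  refine Eq.trans ?_ h2.symm
  dsimp only
  rw [map_mul g, map_mul g, map_pow g, mul_pow, ← h1]
  ring

/-- Rescaling homogeneous coordinates by a unit does not change the morphism: a form of degree d is
multiplied by the d-th power, and this cancels in fractions of degree zero. -/
theorem toProj_congr (g g' : A →+* R) {f f' : A} (hf : f ∈ 𝒜 1) (hu : IsUnit (g f)) (hf' : f' ∈ 𝒜 1)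
    (hu' : IsUnit (g' f')) (c : Rˣ) (hc : ∀ (d : ℕ) (a : A), a ∈ 𝒜 d → g' a = (c : R) ^ d * g a) :
    toProj 𝒜 g hf hu = toProj 𝒜 g' hf' hu' := by
  have hff' : f * f' ∈ 𝒜 (1 + 1) := SetLike.mul_mem_graded hf hf'
  have hgf' : IsUnit (g f') := by
    have := hc 1 f' hf'
    rw [this] at hu'
    exact isUnit_of_mul_isUnit_right hu'
  have hg'f : IsUnit (g' f) := by
    rw [hc 1 f hf]
    exact (c.isUnit.pow 1).mul hu
  have hv : IsUnit (g (f * f')) := by rw [map_mul]; exact hu.mul hgf'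
  have hv' : IsUnit (g' (f * f')) := by rw [map_mul]; exact hg'f.mul hu'
  have hw' : IsUnit (g' (f' * f)) := by rwa [mul_comm]
  rw [toProj_eq_mul 𝒜 g hf hu hf' hv, toProj_eq_mul 𝒜 g' hf' hu' hf hw']
  have key : ∀ (x y : A) (hx : x ∈ 𝒜 2) (hy : y ∈ 𝒜 2) (h : x = y) (hux : IsUnit (g x))
      (huy : IsUnit (g' y)),
      Spec.map (CommRingCat.ofHom (awayEval 𝒜 g hux)) ≫ Proj.awayι 𝒜 x hx two_pos =
        Spec.map (CommRingCat.ofHom (awayEval 𝒜 g' huy)) ≫ Proj.awayι 𝒜 y hy two_pos := by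
    rintro x _ hx hy rfl hux huy
    congr 3
    ext z
    obtain ⟨n, a, ha, rfl⟩ := Away.mk_surjective 𝒜 hx z
    have h1 := awayEval_mk 𝒜 g hux hx n a ha
    have h2 := awayEval_mk 𝒜 g' huy hx n a ha
    -- The denominator is the n-th power of a form of degree two, so numerator and denominator both
    -- have degree 2n.
    rw [hc _ a ha, hc _ x hx, mul_pow, ← pow_mul, mul_comm 2 n, ← h1] at h2
    apply ((c.isUnit.pow (n * 2)).mul (hux.pow n)).mul_left_injective
    dsimp only
    rw [smul_eq_mul] at h2
    rw [h2]
    ring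
  exact key _ _ _ _ (mul_comm _ _) _ _

theorem toProj_range_subset (g : A →+* R) {f : A} (hf : f ∈ 𝒜 1) (hu : IsUnit (g f))
    (x : Spec (CommRingCat.of R)) : toProj 𝒜 g hf hu x ∈ Proj.basicOpen 𝒜 f := by
  rw [← Proj.opensRange_awayι 𝒜 f hf one_pos]
  exact ⟨_, rfl⟩

/-- Inside D₊(f) the set D₊(f') is the nonvanishing locus of f'/f, and the pullback of this fraction
differs from `g f'` by a unit. -/
theorem toProj_preimage_basicOpen (g : A →+* R) {f f' : A} (hf : f ∈ 𝒜 1) (hu : IsUnit (g f))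
    (hf' : f' ∈ 𝒜 1) (x : PrimeSpectrum R)
    (hx : toProj 𝒜 g hf hu (show Spec (CommRingCat.of R) from x) ∈ Proj.basicOpen 𝒜 f') :
    x ∈ PrimeSpectrum.basicOpen (g f') := by
  have h := Proj.awayι_preimage_basicOpen 𝒜 (f := f) hf one_pos hf' one_pos
  have h2 : Spec.map (CommRingCat.ofHom (awayEval 𝒜 g hu)) (show Spec (CommRingCat.of R) from x) ∈
      PrimeSpectrum.basicOpen (Away.isLocalizationElem hf hf') := by
    rw [← h]
    exact hx
  have h3 : awayEval 𝒜 g hu (Away.isLocalizationElem hf hf') ∉ x.asIdeal := h2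
  have h4 := awayEval_mk 𝒜 g hu hf 1 (f' ^ 1) (by simpa using hf')
  change g f' ∉ x.asIdeal
  intro hmem
  apply h3
  have h5 : awayEval 𝒜 g hu (Away.isLocalizationElem hf hf') * g f ∈ x.asIdeal := by
    have h6 : awayEval 𝒜 g hu (Away.isLocalizationElem hf hf') * g f ^ 1 = g (f' ^ 1) := h4
    rw [pow_one, pow_one] at h6
    rwa [h6]
  exact (x.isPrime.mem_or_mem h5).resolve_right
    fun h => x.isPrime.ne_top (Ideal.eq_top_of_isUnit_mem _ h hu)

end ProjMaps

/-! ### Restrictions of morphisms -/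

section Restrict

/-- Open immersions are determined by their image up to isomorphism, so the restriction over an open
set may be replaced by any model of it. -/
theorem morphismRestrict_of_comm (Q : MorphismProperty Scheme.{0}) [Q.RespectsIso]
    {X T U W : Scheme.{0}} (f : X ⟶ T) (V : T.Opens) (c : U ⟶ X) [IsOpenImmersion c] (j : W ⟶ T)
    [IsOpenImmersion j] (g : U ⟶ W) (hg : Q g) (hj : Set.range j = V)
    (hc : Set.range c = f ⁻¹ᵁ V) (comm : g ≫ j = c ≫ f) : Q (f ∣_ V) := by
  let e₁ : U ≅ f ⁻¹ᵁ V := IsOpenImmersion.isoOfRangeEq c (f ⁻¹ᵁ V).ι (by simpa using hc)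
  let e₂ : W ≅ V := IsOpenImmersion.isoOfRangeEq j V.ι (by simpa using hj)
  have : f ∣_ V = e₁.inv ≫ g ≫ e₂.hom := by
    rw [← cancel_mono V.ι, ← cancel_epi e₁.hom]
    simp [e₁, e₂, comm, IsOpenImmersion.isoOfRangeEq_hom_fac_assoc]
  rw [this]
  exact (Q.cancel_left_of_respectsIso _ _).mpr ((Q.cancel_right_of_respectsIso _ _).mpr hg)

end Restrict


/-! ### Projective embeddings of toric varieties -/

section ProjectiveEmbedding

attribute [local instance] MvPolynomial.gradedAlgebra

variable {E : Type} [AddCommGroup E] [Module ℝ E] {N : AddSubgroup E} {F : Set (PointedCone ℝ E)}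

/-- A finite set of characters whose maxima have linearity domains in the fan `F`, and which
generate the coordinate rings of the corresponding charts. -/
structure IsVeryAmple (N : AddSubgroup E) (F : Set (PointedCone ℝ E)) {n : ℕ}
    (m : Fin (n + 1) → Module.Dual ℝ E) (τ : Fin (n + 1) → F) : Prop where
  mem_of_forall_le : ∀ k x, (∀ l, m l x ≤ m k x) → x ∈ (τ k).1
  closure_eq : ∀ k, dualMonoid N (τ k).1 = AddSubmonoid.closure (Set.range fun l => m k - m l)
  exists_le : ∀ σ : F, ∃ k, σ.1 ≤ (τ k).1

variable {n : ℕ} {m : Fin (n + 1) → Module.Dual ℝ E} {τ : Fin (n + 1) → F}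

theorem IsVeryAmple.sub_mem (h : IsVeryAmple N F m τ) {k : Fin (n + 1)} {σ : PointedCone ℝ E}
    (hσ : σ ≤ (τ k).1) (l : Fin (n + 1)) : m k - m l ∈ dualMonoid N σ := by
  apply dualMonoid_anti N hσ
  rw [h.closure_eq k]
  exact AddSubmonoid.subset_closure ⟨l, rfl⟩

/-- The homomorphism that sends the coordinate `x_l` to `χ^(m_k - m_l)`. -/
def IsVeryAmple.ev (h : IsVeryAmple N F m τ) {k : Fin (n + 1)} {σ : PointedCone ℝ E}
    (hσ : σ ≤ (τ k).1) : MvPolynomial (Fin (n + 1)) ℤ →+* toricRing N σ :=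
  MvPolynomial.eval₂Hom (Int.castRingHom _) fun l => chr ⟨_, h.sub_mem hσ l⟩

theorem IsVeryAmple.ev_X (h : IsVeryAmple N F m τ) {k : Fin (n + 1)} {σ : PointedCone ℝ E}
    (hσ : σ ≤ (τ k).1) (l : Fin (n + 1)) :
    h.ev hσ (MvPolynomial.X l) = chr ⟨_, h.sub_mem hσ l⟩ := by
  simp [ev]

theorem IsVeryAmple.ev_X_self (h : IsVeryAmple N F m τ) {k : Fin (n + 1)} {σ : PointedCone ℝ E}
    (hσ : σ ≤ (τ k).1) : IsUnit (h.ev hσ (MvPolynomial.X k)) := by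
  rw [h.ev_X]
  exact isUnit_chr _ (by simp)

theorem X_mem_homogeneous (k : Fin (n + 1)) :
    (MvPolynomial.X k : MvPolynomial (Fin (n + 1)) ℤ) ∈
      MvPolynomial.homogeneousSubmodule (Fin (n + 1)) ℤ 1 :=
  MvPolynomial.isHomogeneous_X ℤ k

/-- The morphism from an affine chart to projective space. -/
def IsVeryAmple.chartMap (h : IsVeryAmple N F m τ) {k : Fin (n + 1)} {σ : PointedCone ℝ E}
    (hσ : σ ≤ (τ k).1) : affineToric N σ ⟶ projectiveSpaceInt n :=
  toProj (MvPolynomial.homogeneousSubmodule (Fin (n + 1)) ℤ) (h.ev hσ) (X_mem_homogeneous k)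
    (h.ev_X_self hσ)

/-- The two systems of homogeneous coordinates differ by the factor χ^(m_k' - m_k). It is a unit on
the chart of `ρ`, because `ρ` lies in both `τ k` and `τ k'`. -/
theorem IsVeryAmple.chartMap_comp (h : IsVeryAmple N F m τ) {k k' : Fin (n + 1)}
    {ρ σ : PointedCone ℝ E} (hρσ : ρ ≤ σ) (hσ : σ ≤ (τ k).1) (hρ : ρ ≤ (τ k').1) :
    affineToricMap N hρσ ≫ h.chartMap hσ = h.chartMap hρ := by
  refine (SpecMap_toProj (MvPolynomial.homogeneousSubmodule (Fin (n + 1)) ℤ) (restr N hρσ)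
    (h.ev hσ) (X_mem_homogeneous k) (h.ev_X_self hσ)).trans ?_
  have hu : IsUnit (chr (⟨_, h.sub_mem hρ k⟩ : dualMonoid N ρ)) := by
    apply isUnit_chr
    simpa using h.sub_mem (hρσ.trans hσ) k'
  refine toProj_congr _ _ _ _ _ _ _ hu.unit fun d a ha => ?_
  have hX : ∀ l, h.ev hρ (MvPolynomial.X l) =
      hu.unit * restr N hρσ (h.ev hσ (MvPolynomial.X l)) := by
    intro l
    rw [h.ev_X, h.ev_X, restr_chr, IsUnit.unit_spec, ← chr_add]
    congr 1
    ext1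
    simp
  have hC : (h.ev hρ).comp MvPolynomial.C = ((restr N hρσ).comp (h.ev hσ)).comp MvPolynomial.C :=
    RingHom.ext_int _ _
  have hs : ∀ s ∈ a.support, s.degree = d := by
    intro s hs
    have := ha (MvPolynomial.mem_support_iff.mp hs)
    rw [Finsupp.degree_eq_weight_one (R := ℕ)]
    exact this
  rw [MvPolynomial.as_sum a, map_sum, map_sum, Finset.mul_sum]
  refine Finset.sum_congr rfl fun s hs' => ?_
  have hdeg : s.degree = ∑ i ∈ s.support, s i := rfl
  rw [← hs s hs', hdeg, MvPolynomial.monomial_eq, map_mul, map_mul, Finsupp.prod, map_prod, map_prod]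
  have h1 := congr($hC (MvPolynomial.coeff s a))
  simp only [RingHom.comp_apply] at h1
  rw [h1]
  simp only [RingHom.comp_apply, map_pow, hX, mul_pow, Finset.prod_mul_distrib,
    Finset.prod_pow_eq_pow_sum]
  ring

variable (A : ToricVariety N F)

theorem range_subset_of_nonvanishing (hF : IsGluable N F) {σ κ : F} (h : κ.1 ≤ σ.1)
    {m : Module.Dual ℝ E} (hm : IsFaceForm N σ.1 κ.1 m) {x : affineToric N σ.1}
    (hx : x ∈ nonvanishing hm.elt) : A.chart σ x ∈ Set.range (A.chart κ) := by
  obtain ⟨s, hs⟩ := hF.fg σ.1 σ.2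
  rw [← range_affineToricMap h hm hs] at hx
  obtain ⟨y, rfl⟩ := hx
  exact ⟨y, congr($((A.chart_comp κ σ h).symm) y)⟩

variable {A} {q : A.X ⟶ projectiveSpaceInt n}

/-- On the chart of a cone `σ ≤ τ k'` the coordinate x_k is the character of m_k' - m_k. On `σ` this
form vanishes exactly where m_k attains the maximum as well, that is on `σ ⊓ τ k`, so the locus
where x_k is invertible is the chart of this face. -/
theorem IsVeryAmple.range_chart (hF : IsGluable N F) (h : IsVeryAmple N F m τ)
    (hq : ∀ (σ : F) (k : Fin (n + 1)) (hσ : σ.1 ≤ (τ k).1), A.chart σ ≫ q = h.chartMap hσ)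
    (k : Fin (n + 1)) :
    Set.range (A.chart (τ k)) =
      q ⁻¹ᵁ Proj.basicOpen (MvPolynomial.homogeneousSubmodule (Fin (n + 1)) ℤ) (MvPolynomial.X k) := by
  apply Set.Subset.antisymm
  · rintro _ ⟨x, rfl⟩
    have h1 := hq (τ k) k le_rfl
    change (A.chart (τ k) ≫ q) x ∈ Proj.basicOpen _ _
    rw [h1]
    exact toProj_range_subset _ _ _ _ _
  · intro x hx
    obtain ⟨σ, y, rfl⟩ := A.cover x
    obtain ⟨k', hk'⟩ := h.exists_le σ
    have h1 := hq σ k' hk'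
    replace hx : (A.chart σ ≫ q) y ∈
      Proj.basicOpen (MvPolynomial.homogeneousSubmodule (Fin (n + 1)) ℤ) (MvPolynomial.X k) := hx
    rw [h1] at hx
    have h2 := toProj_preimage_basicOpen _ _ _ _ (X_mem_homogeneous k) y hx
    rw [h.ev_X] at h2
    have hface : IsFaceForm N σ.1 (σ.1 ⊓ (τ k).1) (m k' - m k) := by
      refine ⟨h.sub_mem hk' k, fun z hz => ?_, fun z hz hz0 => ⟨hz, ?_⟩⟩
      · have a1 := (h.sub_mem hk' k).2 z hz.1
        have a2 := (h.sub_mem (le_refl (τ k).1) k').2 z hz.2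
        simp only [LinearMap.sub_apply] at a1 a2 ⊢
        linarith
      · apply h.mem_of_forall_le
        intro l
        have a1 := (h.sub_mem hk' l).2 z hz
        simp only [LinearMap.sub_apply] at a1 hz0 ⊢
        linarith
    obtain ⟨z, hz⟩ := range_subset_of_nonvanishing A hF
      (κ := ⟨_, hF.inf_mem _ σ.2 _ (τ k).2⟩) inf_le_left hface h2
    rw [← hz]
    exact ⟨_, congr($(A.chart_comp ⟨_, hF.inf_mem _ σ.2 _ (τ k).2⟩ (τ k) inf_le_right) z)⟩

/-- Used to exhibit functions in the image of the restriction to the chart: whatever is pulled back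
along `g ≫ p` comes from `W`. -/
theorem mem_range_of_comp_eq {R R' : Type} [CommRing R] [CommRing R'] {W : Scheme.{0}}
    (g : Spec (CommRingCat.of R) ⟶ W) (p : W ⟶ Spec (CommRingCat.of R')) (φ : R' →+* R)
    (h : g ≫ p = Spec.map (CommRingCat.ofHom φ)) (r : R') :
    φ r ∈ (g.appTop ≫ (Scheme.ΓSpecIso (CommRingCat.of R)).hom).hom.range := by
  refine ⟨(p.appTop).hom ((Scheme.ΓSpecIso (CommRingCat.of R')).inv.hom r), ?_⟩
  have h1 : (Scheme.ΓSpecIso (CommRingCat.of R')).inv ≫ p.appTop ≫ g.appTop ≫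
      (Scheme.ΓSpecIso (CommRingCat.of R)).hom = CommRingCat.ofHom φ := by
    rw [← Category.assoc p.appTop, ← Scheme.Hom.comp_appTop, h, Scheme.ΓSpecIso_naturality,
      Iso.inv_hom_id_assoc]
  exact congr(($h1).hom r)

theorem toricRing_subring_eq_top {σ : PointedCone ℝ E} {s : Set (Module.Dual ℝ E)}
    (hs : dualMonoid N σ = AddSubmonoid.closure s) (B : Subring (toricRing N σ))
    (hC : ∀ c : ℂ, algebraMap ℂ _ c ∈ B) (hB : ∀ a ∈ s, ∀ ha : a ∈ dualMonoid N σ, chr ⟨a, ha⟩ ∈ B) :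
    B = ⊤ := by
  have h1 : ∀ a, ∀ h : a ∈ AddSubmonoid.closure s, chr (⟨a, hs ▸ h⟩ : dualMonoid N σ) ∈ B := by
    intro a h
    induction h using AddSubmonoid.closure_induction with
    | mem x hx => exact hB x hx _
    | zero => exact B.one_mem
    | add x y hx hy hx' hy' =>
      have := B.mul_mem hx' hy'
      rwa [← chr_add] at this
  rw [eq_top_iff]
  intro f _
  induction f using AddMonoidAlgebra.induction_linear with
  | zero => exact B.zero_mem
  | add f g hf hg => exact B.add_mem (hf trivial) (hg trivial)
  | single a c =>
    have : (AddMonoidAlgebra.single a c : toricRing N σ) = algebraMap ℂ _ c * chr a := by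
      simp [chr, AddMonoidAlgebra.single_mul_single]
    rw [this]
    exact B.mul_mem (hC c) (h1 a.1 (hs ▸ a.2))

theorem iSup_basicOpen_X :
    ⨆ k : Fin (n + 1), Proj.basicOpen (MvPolynomial.homogeneousSubmodule (Fin (n + 1)) ℤ)
      (MvPolynomial.X k) = ⊤ := by
  refine Proj.iSup_basicOpen_eq_top' _ _ (fun k => ⟨1, X_mem_homogeneous k⟩) ?_
  rw [eq_top_iff]
  intro p _
  induction p using MvPolynomial.induction_on with
  | C a =>
    have : (MvPolynomial.C a : MvPolynomial (Fin (n + 1)) ℤ) = ((a : ℤ) : MvPolynomial (Fin (n + 1)) ℤ) :=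
      by simp
    rw [this]
    exact intCast_mem _ _
  | add p q hp hq => exact add_mem (hp trivial) (hq trivial)
  | mul_X p k hp => exact mul_mem (hp trivial) (Algebra.subset_adjoin ⟨k, rfl⟩)

-- A closed immersion can be recognized locally on the target. Over the affine piece D₊(x_k) × Spec
-- ℂ the preimage is the affine chart of `τ k`, and functions restrict surjectively: the scalars
-- come from Spec ℂ, and the generating characters m_k - m_l come from the fractions x_l / x_k.
open Limits in
theorem IsVeryAmple.isClosedImmersion (hF : IsGluable N F) (h : IsVeryAmple N F m τ)
    (hq : ∀ (σ : F) (k : Fin (n + 1)) (hσ : σ.1 ≤ (τ k).1), A.chart σ ≫ q = h.chartMap hσ) :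
    IsClosedImmersion (pullback.lift q A.str (terminal.hom_ext _ _) :
      A.X ⟶ pullback (terminal.from (projectiveSpaceInt n))
        (terminal.from (Spec (CommRingCat.of ℂ)))) := by
  set f := (pullback.lift q A.str (terminal.hom_ext _ _) :
      A.X ⟶ pullback (terminal.from (projectiveSpaceInt n))
        (terminal.from (Spec (CommRingCat.of ℂ)))) with hf
  set fst := pullback.fst (terminal.from (projectiveSpaceInt n))
        (terminal.from (Spec (CommRingCat.of ℂ))) with hfst
  let D : Fin (n + 1) → (projectiveSpaceInt n).Opens := fun k =>
    Proj.basicOpen (MvPolynomial.homogeneousSubmodule (Fin (n + 1)) ℤ) (MvPolynomial.X k)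
  have hD : ⨆ k, fst ⁻¹ᵁ D k = ⊤ := by
    rw [← Scheme.Hom.preimage_iSup]
    exact congr(fst ⁻¹ᵁ $(iSup_basicOpen_X (n := n)))
  refine IsZariskiLocalAtTarget.of_iSup_eq_top _ hD fun k => ?_
  have hrange : Set.range (A.chart (τ k)) = f ⁻¹ᵁ (fst ⁻¹ᵁ D k) := by
    rw [h.range_chart hF hq k, ← Scheme.Hom.comp_preimage, hf, pullback.lift_fst]
  have hopen := A.chart_isOpenImmersion (τ k)
  have haff : IsAffineOpen (D k) :=
    Proj.isAffineOpen_basicOpen _ _ (X_mem_homogeneous k) one_pos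
  have hfstaff : IsAffineHom fst := by
    exact MorphismProperty.IsStableUnderBaseChange.of_isPullback
      (IsPullback.of_hasPullback _ _).flip inferInstance
  have haffW : IsAffine (fst ⁻¹ᵁ D k : Scheme.Opens _) := haff.preimage fst
  let W := fst ⁻¹ᵁ D k
  let g : affineToric N (τ k).1 ⟶ W := IsOpenImmersion.lift W.ι (A.chart (τ k) ≫ f) (by
    rw [Scheme.Opens.range_ι]
    rintro _ ⟨x, rfl⟩
    have : A.chart (τ k) x ∈ (f ⁻¹ᵁ W : Set _) := by
      rw [← hrange]
      exact ⟨x, rfl⟩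
    exact this)
  have hg : g ≫ W.ι = A.chart (τ k) ≫ f := IsOpenImmersion.lift_fac _ _ _
  refine morphismRestrict_of_comm @IsClosedImmersion f W (A.chart (τ k)) W.ι g ?_ (by simp) hrange hg
  have haffU : IsAffine (affineToric N (τ k).1) := by unfold affineToric; infer_instance
  refine IsClosedImmersion.of_surjective_of_isAffine g ?_
  let awayi : Spec _ ⟶ projectiveSpaceInt n := Proj.awayι (MvPolynomial.homogeneousSubmodule (Fin (n + 1)) ℤ) (MvPolynomial.X k)
    (X_mem_homogeneous k) one_pos
  have hawayi : IsOpenImmersion awayi := by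
    exact IsOpenImmersion.comp (Proj.basicOpenIsoSpec _ _ _ _).inv (Scheme.Opens.ι _)
  let p : (W : Scheme) ⟶ Spec (CommRingCat.of (HomogeneousLocalization.Away
      (MvPolynomial.homogeneousSubmodule (Fin (n + 1)) ℤ) (MvPolynomial.X k))) :=
    IsOpenImmersion.lift awayi (W.ι ≫ fst) (by
      have := Proj.opensRange_awayι (MvPolynomial.homogeneousSubmodule (Fin (n + 1)) ℤ)
        (MvPolynomial.X k) (X_mem_homogeneous k) one_pos
      have h2 : Set.range awayi = (D k : Set (projectiveSpaceInt n)) :=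
        congrArg (fun U : (projectiveSpaceInt n).Opens => (U : Set (projectiveSpaceInt n))) this
      rw [h2]
      rintro _ ⟨x, rfl⟩
      exact x.2)
  have hp : p ≫ awayi = W.ι ≫ fst := IsOpenImmersion.lift_fac _ _ _
  have hgp : g ≫ p = Spec.map (CommRingCat.ofHom (awayEval _ (h.ev (le_refl (τ k).1))
      (h.ev_X_self le_rfl))) := by
    refine (cancel_mono awayi).mp ?_
    have e1 : (g ≫ p) ≫ awayi = A.chart (τ k) ≫ q := by
      rw [Category.assoc, hp, reassoc_of% hg, hf, pullback.lift_fst]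
    exact e1.trans (hq (τ k) k le_rfl)
  have hgs : g ≫ (W.ι ≫ pullback.snd _ _) =
      Spec.map (CommRingCat.ofHom (algebraMap ℂ (toricRing N (τ k).1))) := by
    rw [reassoc_of% hg, hf, pullback.lift_snd, A.chart_str]
    rfl
  have htop : (g.appTop ≫ (Scheme.ΓSpecIso (CommRingCat.of (toricRing N (τ k).1))).hom).hom.range =
      ⊤ := by
    refine toricRing_subring_eq_top (h.closure_eq k) _
      (fun c => mem_range_of_comp_eq g _ _ hgs c) ?_
    rintro _ ⟨l, rfl⟩ ha
    have h1 := mem_range_of_comp_eq g _ _ hgp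
      (HomogeneousLocalization.Away.mk _ (X_mem_homogeneous k) 1 (MvPolynomial.X l)
        (by simpa using X_mem_homogeneous l))
    have h2 := awayEval_mk _ (h.ev (le_refl (τ k).1)) (h.ev_X_self le_rfl) (X_mem_homogeneous k) 1
      (MvPolynomial.X l) (by simpa using X_mem_homogeneous l)
    -- On its own chart x_k becomes χ^0, so x_l / x_k becomes χ^(m_k - m_l) without a denominator.
    have h3 : h.ev (le_refl (τ k).1) (MvPolynomial.X k) = 1 := by
      rw [h.ev_X, ← chr_zero]
      congr 1
      ext1
      simp
    rw [h3, one_pow, mul_one, h.ev_X] at h2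
    rwa [h2] at h1
  have hsurj := RingHom.range_eq_top.mp htop
  have hinj := (Scheme.ΓSpecIso (CommRingCat.of (toricRing N (τ k).1))).commRingCatIsoToRingEquiv.injective
  intro y
  obtain ⟨x, hx⟩ := hsurj ((Scheme.ΓSpecIso (CommRingCat.of (toricRing N (τ k).1))).hom.hom y)
  exact ⟨x, hinj hx⟩

end ProjectiveEmbedding


/-! ### Morphisms of toric varieties -/

section ToricMorphisms

variable {E : Type} [AddCommGroup E] [Module ℝ E] {N : AddSubgroup E} {F G : Set (PointedCone ℝ E)}

/-- The cover of a toric variety by its affine charts. -/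
def ToricVariety.openCover (A : ToricVariety N F) : A.X.OpenCover :=
  Scheme.Cover.mkOfCovers F (fun σ => affineToric N σ.1) A.chart (fun x => by
    obtain ⟨σ, y, hy⟩ := A.cover x
    exact ⟨σ, y, hy⟩) A.chart_isOpenImmersion

theorem ToricVariety.hom_ext (A : ToricVariety N F) {Z : Scheme.{0}} {f g : A.X ⟶ Z}
    (h : ∀ σ, A.chart σ ≫ f = A.chart σ ≫ g) : f = g :=
  Scheme.Cover.hom_ext A.openCover _ _ h

/-- Morphisms out of a toric variety can be glued from the affine charts. -/
def ToricVariety.HasDesc (A : ToricVariety N F) : Prop :=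
  ∀ (Z : Scheme.{0}) (f : ∀ σ : F, affineToric N σ.1 ⟶ Z),
      (∀ (ρ σ : F) (h : ρ.1 ≤ σ.1), affineToricMap N h ≫ f σ = f ρ) →
      ∃ π : A.X ⟶ Z, ∀ σ, A.chart σ ≫ π = f σ

/-- Both composites factor through the chart of `ρ ⊓ ρ'`. -/
theorem ToricVariety.affineToricMap_chart_eq (B : ToricVariety N G)
    (hG : ∀ σ ∈ G, ∀ ρ ∈ G, σ ⊓ ρ ∈ G) {κ : PointedCone ℝ E} {ρ ρ' : G} (h : κ ≤ ρ.1)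
    (h' : κ ≤ ρ'.1) : affineToricMap N h ≫ B.chart ρ = affineToricMap N h' ≫ B.chart ρ' := by
  have hi : κ ≤ ρ.1 ⊓ ρ'.1 := le_inf h h'
  rw [← affineToricMap_comp hi inf_le_left, ← affineToricMap_comp hi inf_le_right, Category.assoc,
    Category.assoc, B.chart_comp ⟨_, hG _ ρ.2 _ ρ'.2⟩ ρ inf_le_left,
    B.chart_comp ⟨_, hG _ ρ.2 _ ρ'.2⟩ ρ' inf_le_right]

theorem exists_isToricMorphism {A : ToricVariety N F} (hA : A.HasDesc) (B : ToricVariety N G)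
    (hG : ∀ σ ∈ G, ∀ ρ ∈ G, σ ⊓ ρ ∈ G) (hFG : ∀ σ ∈ F, ∃ ρ ∈ G, σ ≤ ρ) :
    ∃ π : A.X ⟶ B.X, IsToricMorphism A B π := by
  have : ∀ σ : F, ∃ ρ : G, σ.1 ≤ ρ.1 := fun σ => by
    obtain ⟨ρ, hρ, h⟩ := hFG σ.1 σ.2
    exact ⟨⟨ρ, hρ⟩, h⟩
  choose c hc using this
  obtain ⟨π, hπ⟩ := hA B.X (fun σ => affineToricMap N (hc σ) ≫ B.chart (c σ)) fun ρ σ h => by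
    rw [← Category.assoc, affineToricMap_comp]
    exact B.affineToricMap_chart_eq hG _ _
  exact ⟨π, fun σ ρ h => (hπ σ).trans (B.affineToricMap_chart_eq hG _ _)⟩

variable {A : ToricVariety N F} {B : ToricVariety N G} {π : A.X ⟶ B.X}

theorem IsToricMorphism.comp_str (h : IsToricMorphism A B π) (hFG : ∀ σ ∈ F, ∃ ρ ∈ G, σ ≤ ρ) :
    π ≫ B.str = A.str := by
  refine A.hom_ext fun σ => ?_
  obtain ⟨ρ, hρ, hσρ⟩ := hFG σ.1 σ.2
  rw [← Category.assoc, h σ ⟨ρ, hρ⟩ hσρ, Category.assoc, B.chart_str, A.chart_str,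
    affineToricMap_str]

theorem IsFaceForm.restrict {σ ρ κ : PointedCone ℝ E} {m : Module.Dual ℝ E}
    (hm : IsFaceForm N ρ κ m) (h : σ ≤ ρ) : IsFaceForm N σ (σ ⊓ κ) m :=
  ⟨dualMonoid_anti N h hm.mem, fun x hx => hm.eq_zero x hx.2,
    fun x hx h0 => ⟨hx, hm.mem_of_eq_zero x (h hx) h0⟩⟩

theorem mem_nonvanishing_iff {σ : PointedCone ℝ E} (m : dualMonoid N σ) (x : affineToric N σ) :
    x ∈ nonvanishing m ↔ chr m ∉ (x : PrimeSpectrum (toricRing N σ)).asIdeal := Iff.rfl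

theorem affineToricMap_mem_nonvanishing {σ ρ : PointedCone ℝ E} (h : σ ≤ ρ) (m : dualMonoid N ρ)
    (x : affineToric N σ) : affineToricMap N h x ∈ nonvanishing m ↔
      x ∈ nonvanishing (AddSubmonoid.inclusion (dualMonoid_anti N h) m) := by
  rw [mem_nonvanishing_iff, mem_nonvanishing_iff, ← restr_chr h]
  rfl

/-- This describes the preimage of a chart of the target. Let `ρ'` contain `σ`. The image point lies
in the chart of `ρ' ⊓ ρ`, where the form that cuts out this face of `ρ'` is invertible; restricted
to `σ`, the same form cuts out `σ ⊓ ρ`. -/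
theorem IsToricMorphism.exists_mem_range (h : IsToricMorphism A B π) (hF : IsGluable N F)
    (hG : IsGluable N G) (hFG : ∀ σ ∈ F, ∃ ρ ∈ G, σ ≤ ρ) (hinf : ∀ σ ∈ F, ∀ ρ ∈ G, σ ⊓ ρ ∈ F)
    {σ : F} {ρ : G} {x : A.X} (hx : x ∈ Set.range (A.chart σ)) (hπ : π x ∈ Set.range (B.chart ρ)) :
    x ∈ Set.range (A.chart ⟨σ.1 ⊓ ρ.1, hinf _ σ.2 _ ρ.2⟩) := by
  obtain ⟨y, rfl⟩ := hx
  obtain ⟨ρ', hρ', hσ⟩ := hFG σ.1 σ.2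
  have hinj := (B.chart_isOpenImmersion ⟨ρ', hρ'⟩).base_open.injective
  have e1 : π (A.chart σ y) = B.chart ⟨ρ', hρ'⟩ (affineToricMap N hσ y) :=
    congr($(h σ ⟨ρ', hρ'⟩ hσ) y)
  have e2 : π (A.chart σ y) ∈ Set.range (B.chart ⟨_, hG.inf_mem _ hρ' _ ρ.2⟩) := by
    rw [← B.inter ⟨ρ', hρ'⟩ ρ ⟨_, hG.inf_mem _ hρ' _ ρ.2⟩ rfl]
    exact ⟨⟨_, e1.symm⟩, hπ⟩
  obtain ⟨z, hz⟩ := e2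
  obtain ⟨m, hm⟩ := hG.exists_faceForm ρ' hρ' _ (hG.inf_mem _ hρ' _ ρ.2) inf_le_left
  obtain ⟨s, hs⟩ := hG.fg ρ' hρ'
  have e3 : affineToricMap N hσ y ∈ nonvanishing hm.elt := by
    rw [← range_affineToricMap inf_le_left hm hs]
    refine ⟨z, hinj ?_⟩
    exact (congr($(B.chart_comp ⟨_, hG.inf_mem _ hρ' _ ρ.2⟩ ⟨ρ', hρ'⟩ inf_le_left) z)).trans
      (hz.trans e1)
  rw [affineToricMap_mem_nonvanishing] at e3
  have e4 : σ.1 ⊓ (ρ' ⊓ ρ.1) = σ.1 ⊓ ρ.1 := by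
    rw [← inf_assoc, inf_eq_left.mpr hσ]
  have hm' : IsFaceForm N σ.1 (σ.1 ⊓ ρ.1) m := e4 ▸ hm.restrict hσ
  exact range_subset_of_nonvanishing A hF (κ := ⟨_, hinf _ σ.2 _ ρ.2⟩) inf_le_left hm' e3

/-! ### Integrality and birationality -/

instance (σ : PointedCone ℝ E) : IsIntegral (affineToric N σ) := by
  unfold affineToric
  infer_instance

/-- The torus is a nonempty open subset of every chart, and the charts are irreducible. -/
theorem ToricVariety.dense_range_chart_bot (A : ToricVariety N F) (hF : IsGluable N F) :
    Dense (Set.range (A.chart ⟨⊥, hF.bot_mem⟩)) := by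
  intro x
  obtain ⟨σ, y, rfl⟩ := A.cover x
  have := hF.isOpenImmersion σ.2 hF.bot_mem bot_le
  have h1 : DenseRange (affineToricMap N (bot_le : ⊥ ≤ σ.1)) := by
    refine (IsOpenImmersion.isOpen_range (affineToricMap N (bot_le : ⊥ ≤ σ.1))).dense ?_
    exact Set.range_nonempty _
  refine closure_mono ?_ (((A.chart σ).continuous.range_subset_closure_image_dense h1) ⟨y, rfl⟩)
  rintro _ ⟨_, ⟨z, rfl⟩, rfl⟩
  exact ⟨z, congr($((A.chart_comp ⟨⊥, hF.bot_mem⟩ σ bot_le).symm) z)⟩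

theorem ToricVariety.irreducibleSpace (A : ToricVariety N F) (hF : IsGluable N F) :
    IrreducibleSpace A.X := by
  have h1 := (IrreducibleSpace.isIrreducible_univ (affineToric N (⊥ : PointedCone ℝ E))).image
    (A.chart ⟨⊥, hF.bot_mem⟩) (A.chart ⟨⊥, hF.bot_mem⟩).continuous.continuousOn
  have h2 := h1.closure
  rw [Set.image_univ, (A.dense_range_chart_bot hF).closure_eq] at h2
  exact (irreducibleSpace_def _).mpr h2

theorem ToricVariety.isIntegral (A : ToricVariety N F) (hF : IsGluable N F) :
    IsIntegral A.X := by
  have := A.irreducibleSpace hF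
  have : ∀ i, IsReduced (A.openCover.X i) := fun i =>
    inferInstanceAs (IsReduced (affineToric N i.1))
  have := IsReduced.of_openCover _ A.openCover
  exact isIntegral_of_irreducibleSpace_of_isReduced _

theorem IsToricMorphism.comp_chart_self (h : IsToricMorphism A B π) {η : PointedCone ℝ E}
    (hF : η ∈ F) (hG : η ∈ G) : A.chart ⟨η, hF⟩ ≫ π = B.chart ⟨η, hG⟩ := by
  rw [h ⟨η, hF⟩ ⟨η, hG⟩ le_rfl, affineToricMap_refl]
  exact Category.id_comp _

theorem IsToricMorphism.isDominant (h : IsToricMorphism A B π) (hF : IsGluable N F)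
    (hG : IsGluable N G) : IsDominant π := by
  refine ⟨(B.dense_range_chart_bot hG).mono ?_⟩
  rintro _ ⟨y, rfl⟩
  exact ⟨_, congr($(h.comp_chart_self hF.bot_mem hG.bot_mem) y)⟩

/-- The preimage of the torus is covered by the charts of the cones `σ ⊓ ⊥ = ⊥`, so it is the torus
of the source, on which the morphism is the identity of the common chart. -/
theorem IsToricMorphism.isBirational (h : IsToricMorphism A B π) (hF : IsGluable N F)
    (hG : IsGluable N G) (hFG : ∀ σ ∈ F, ∃ ρ ∈ G, σ ≤ ρ) (hinf : ∀ σ ∈ F, ∀ ρ ∈ G, σ ⊓ ρ ∈ F) :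
    IsBirationalMorphism π := by
  have hc := A.chart_isOpenImmersion ⟨⊥, hF.bot_mem⟩
  have hj := B.chart_isOpenImmersion ⟨⊥, hG.bot_mem⟩
  have hrange : Set.range (A.chart ⟨⊥, hF.bot_mem⟩) =
      (π ⁻¹ᵁ (B.chart ⟨⊥, hG.bot_mem⟩).opensRange : A.X.Opens) := by
    apply Set.Subset.antisymm
    · rintro _ ⟨y, rfl⟩
      exact ⟨y, congr($((h.comp_chart_self hF.bot_mem hG.bot_mem).symm) y)⟩
    · intro x hx
      obtain ⟨σ, hσ⟩ := A.cover x
      have key : ∀ (κ : F), κ.1 = ⊥ → x ∈ Set.range (A.chart κ) →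
          x ∈ Set.range (A.chart ⟨⊥, hF.bot_mem⟩) := by
        rintro ⟨κ, hκ⟩ rfl h
        exact h
      exact key _ (inf_bot_eq _) (h.exists_mem_range hF hG hFG hinf hσ hx)
  refine ⟨(B.chart ⟨⊥, hG.bot_mem⟩).opensRange, B.dense_range_chart_bot hG, ?_, ?_⟩
  · rw [← hrange]
    exact A.dense_range_chart_bot hF
  · refine morphismRestrict_of_comm (MorphismProperty.isomorphisms _) π _
      (A.chart ⟨⊥, hF.bot_mem⟩) (B.chart ⟨⊥, hG.bot_mem⟩) (𝟙 _) ?_ rfl hrange ?_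
    · exact (inferInstance : IsIso (𝟙 (affineToric N (⊥ : PointedCone ℝ E))))
    · rw [h.comp_chart_self hF.bot_mem hG.bot_mem]
      exact Category.id_comp _

/-! ### Projectivity -/

theorem IsVeryAmple.exists_map {n : ℕ} {m : Fin (n + 1) → Module.Dual ℝ E} {τ : Fin (n + 1) → F}
    (h : IsVeryAmple N F m τ) (hA : A.HasDesc) :
    ∃ q : A.X ⟶ projectiveSpaceInt n,
      ∀ (σ : F) (k : Fin (n + 1)) (hσ : σ.1 ≤ (τ k).1), A.chart σ ≫ q = h.chartMap hσ := by
  choose c hc using h.exists_le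
  obtain ⟨q, hq⟩ := hA (projectiveSpaceInt n) (fun σ => h.chartMap (hc σ)) fun ρ σ hρσ =>
    h.chartMap_comp hρσ _ _
  refine ⟨q, fun σ k hσ => (hq σ).trans ?_⟩
  rw [← h.chartMap_comp le_rfl hσ (hc σ), affineToricMap_refl]
  exact Category.id_comp _

-- The variety is closed in a projective space over ℂ, and this is separated as a base change of a
-- `Proj`. It is needed for the target of π.
attribute [local instance] MvPolynomial.gradedAlgebra in
open Limits in
theorem IsVeryAmple.isSeparated_str {n : ℕ} {m : Fin (n + 1) → Module.Dual ℝ E}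
    {τ : Fin (n + 1) → F} (h : IsVeryAmple N F m τ) (hF : IsGluable N F) (hA : A.HasDesc) :
    IsSeparated A.str := by
  obtain ⟨q, hq⟩ := h.exists_map hA
  have h1 := h.isClosedImmersion hF hq
  have h0 : Scheme.IsSeparated (projectiveSpaceInt n) :=
    inferInstanceAs (Scheme.IsSeparated (Proj (MvPolynomial.homogeneousSubmodule (Fin (n + 1)) ℤ)))
  have h2 : IsSeparated (pullback.snd (terminal.from (projectiveSpaceInt n))
        (terminal.from (Spec (CommRingCat.of ℂ)))) :=
    MorphismProperty.IsStableUnderBaseChange.of_isPullback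
      (IsPullback.of_hasPullback _ _) h0.isSeparated_terminal_from
  rw [← pullback.lift_snd (f := terminal.from (projectiveSpaceInt n))
    (g := terminal.from (Spec (CommRingCat.of ℂ))) q A.str (terminal.hom_ext _ _)]
  infer_instance

-- The embedding of the source into ℙⁿ × Spec ℂ is the pair (q, π) into ℙⁿ × B.X followed by a
-- separated morphism; hence the pair is a closed immersion too.
open Limits in
theorem IsToricMorphism.isProjective (h : IsToricMorphism A B π) (hF : IsGluable N F)
    (hG : IsGluable N G) (hFG : ∀ σ ∈ F, ∃ ρ ∈ G, σ ≤ ρ) (hA : A.HasDesc) (hB : B.HasDesc)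
    {n n' : ℕ} {m : Fin (n + 1) → Module.Dual ℝ E} {τ : Fin (n + 1) → F}
    {m' : Fin (n' + 1) → Module.Dual ℝ E} {τ' : Fin (n' + 1) → G}
    (hm : IsVeryAmple N F m τ) (hm' : IsVeryAmple N G m' τ') : IsProjectiveMorphism π := by
  obtain ⟨q, hq⟩ := hm.exists_map hA
  have h1 := hm.isClosedImmersion hF hq
  have h2 := hm'.isSeparated_str hG hB
  let i := pullback.lift (f := terminal.from (projectiveSpaceInt n)) (g := terminal.from B.X) q π
    (terminal.hom_ext _ _)
  refine ⟨n, i, ?_, pullback.lift_snd _ _ _⟩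
  let b : pullback (terminal.from (projectiveSpaceInt n)) (terminal.from B.X) ⟶
      pullback (terminal.from (projectiveSpaceInt n)) (terminal.from (Spec (CommRingCat.of ℂ))) :=
    pullback.lift (pullback.fst _ _) (pullback.snd _ _ ≫ B.str) (terminal.hom_ext _ _)
  have hb : i ≫ b = pullback.lift q A.str (terminal.hom_ext _ _) := by
    apply pullback.hom_ext
    · rw [Category.assoc, pullback.lift_fst, pullback.lift_fst, pullback.lift_fst]
    · rw [Category.assoc, pullback.lift_snd, pullback.lift_snd_assoc, pullback.lift_snd,
        h.comp_str hFG]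
  -- Followed by the projection to ℙⁿ, the morphism `b` becomes a base change of the structure
  -- morphism of `B.X`, which is separated.
  have hsep : IsSeparated b := by
    have h3 : IsSeparated (terminal.from B.X) := by
      rw [← terminal.comp_from B.str]
      infer_instance
    have h4 : IsSeparated (b ≫ pullback.fst _ _) := by
      rw [pullback.lift_fst]
      exact MorphismProperty.IsStableUnderBaseChange.of_isPullback
        (IsPullback.of_hasPullback _ _).flip h3
    exact IsSeparated.of_comp b (pullback.fst _ _)
  rw [← hb] at h1
  exact IsClosedImmersion.of_comp i b

end ToricMorphisms


/-! ### Smooth cones -/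

section Smooth

variable {E : Type} [AddCommGroup E] [Module ℝ E] {N : AddSubgroup E} {F : Set (PointedCone ℝ E)}

/-- The dual monoid of the cone `σ` is freely generated by the linearly independent forms `l`. -/
structure IsSmoothCone (N : AddSubgroup E) (σ : PointedCone ℝ E) {n : ℕ}
    (l : Fin n → Module.Dual ℝ E) : Prop where
  closure_eq : dualMonoid N σ = AddSubmonoid.closure (Set.range l)
  linearIndependent : LinearIndependent ℝ l

variable {σ : PointedCone ℝ E} {n : ℕ} {l : Fin n → Module.Dual ℝ E}

theorem IsSmoothCone.mem (h : IsSmoothCone N σ l) (i : Fin n) : l i ∈ dualMonoid N σ := by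
  rw [h.closure_eq]
  exact AddSubmonoid.subset_closure ⟨i, rfl⟩

/-- The homomorphism `ℕⁿ → σ^∨ ∩ M`. -/
def IsSmoothCone.toDual (h : IsSmoothCone N σ l) : (Fin n →₀ ℕ) →+ dualMonoid N σ :=
  Finsupp.liftAddHom fun i => (multiplesHom _) ⟨l i, h.mem i⟩

theorem IsSmoothCone.coe_toDual (h : IsSmoothCone N σ l) (c : Fin n →₀ ℕ) :
    (h.toDual c : Module.Dual ℝ E) = ∑ i, (c i : ℝ) • l i := by
  rw [toDual, Finsupp.liftAddHom_apply, Finsupp.sum_fintype _ _ (fun i => map_zero _), AddSubmonoid.coe_finsetSum]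
  refine Finset.sum_congr rfl fun i _ => ?_
  ext x
  simp

theorem IsSmoothCone.toDual_bijective (h : IsSmoothCone N σ l) : Function.Bijective h.toDual := by
  constructor
  · intro c d hcd
    have h1 := congrArg Subtype.val hcd
    rw [h.coe_toDual, h.coe_toDual] at h1
    have h2 : ∑ i, ((c i : ℝ) - d i) • l i = 0 := by
      ext x
      have h3 := congr($h1 x)
      simp only [LinearMap.sum_apply, LinearMap.smul_apply, smul_eq_mul] at h3
      simp [sub_mul, h3]
    ext i
    have := Fintype.linearIndependent_iff.mp h.linearIndependent _ h2 i
    exact_mod_cast sub_eq_zero.mp this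
  · rintro ⟨m, hm⟩
    have hm' := hm
    rw [h.closure_eq] at hm'
    induction hm' using AddSubmonoid.closure_induction with
    | mem x hx =>
      obtain ⟨i, rfl⟩ := hx
      refine ⟨Finsupp.single i 1, ?_⟩
      simp [toDual]
    | zero => exact ⟨0, map_zero _⟩
    | add x y hx hy hx' hy' =>
      obtain ⟨c, hc⟩ := hx' (h.closure_eq ▸ hx)
      obtain ⟨d, hd⟩ := hy' (h.closure_eq ▸ hy)
      exact ⟨c + d, by rw [map_add, hc, hd]; rfl⟩

/-- The coordinate ring of a smooth affine toric variety is a polynomial ring. -/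
def IsSmoothCone.algEquiv (h : IsSmoothCone N σ l) : MvPolynomial (Fin n) ℂ ≃ₐ[ℂ] toricRing N σ :=
  AddMonoidAlgebra.domCongr ℂ ℂ (AddEquiv.ofBijective h.toDual h.toDual_bijective)

theorem IsSmoothCone.algEquiv_X (h : IsSmoothCone N σ l) (i : Fin n) :
    h.algEquiv (MvPolynomial.X i) = chr ⟨l i, h.mem i⟩ := by
  have : h.toDual (Finsupp.single i 1) = ⟨l i, h.mem i⟩ := by simp [toDual]
  rw [← this]
  exact AddMonoidAlgebra.domCongr_single _ _ _

/-- The differentials of the variables form a basis of the Kähler differentials; this yields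
standard smoothness and the dimension at once. -/
theorem isStandardSmoothOfRelativeDimension_mvPolynomial (n : ℕ) :
    Algebra.IsStandardSmoothOfRelativeDimension n ℂ (MvPolynomial (Fin n) ℂ) := by
  have : Algebra.IsStandardSmooth ℂ (MvPolynomial (Fin n) ℂ) :=
    Algebra.IsStandardSmooth.of_basis_kaehlerDifferential
      (KaehlerDifferential.mvPolynomialBasis ℂ (Fin n)) (by
        rintro _ ⟨i, rfl⟩
        exact ⟨MvPolynomial.X i, by simp⟩)
  rw [Algebra.IsStandardSmoothOfRelativeDimension.iff_of_isStandardSmooth,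
    rank_eq_card_basis (KaehlerDifferential.mvPolynomialBasis ℂ (Fin n)), Fintype.card_fin]

theorem IsSmoothCone.smooth_affineToricStr (h : IsSmoothCone N σ l) :
    SmoothOfRelativeDimension n (affineToricStr N σ) := by
  have h1 : Algebra.IsStandardSmoothOfRelativeDimension n ℂ (toricRing N σ) :=
    have := isStandardSmoothOfRelativeDimension_mvPolynomial n
    Algebra.IsStandardSmoothOfRelativeDimension.of_algEquiv n h.algEquiv
  refine (HasRingHomProperty.Spec_iff (P := @SmoothOfRelativeDimension n)).mpr ?_
  refine RingHom.locally_of RingHom.isStandardSmoothOfRelativeDimension_respectsIso _ ?_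
  rw [CommRingCat.hom_ofHom, RingHom.isStandardSmoothOfRelativeDimension_algebraMap]
  exact h1

theorem ToricVariety.smooth (A : ToricVariety N F) (hF : IsGluable N F)
    (h : ∀ σ ∈ F, ∃ σ' ∈ F, σ ≤ σ' ∧ ∃ l : Fin n → Module.Dual ℝ E, IsSmoothCone N σ' l) :
    SmoothOfRelativeDimension n A.str := by
  have := HasRingHomProperty.instIsZariskiLocalAtSource (P := @SmoothOfRelativeDimension n)
    (Q := RingHom.Locally (RingHom.IsStandardSmoothOfRelativeDimension n))
  refine (IsZariskiLocalAtSource.iff_of_openCover (P := @SmoothOfRelativeDimension n)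
    A.openCover).mpr fun σ => ?_
  obtain ⟨σ', hσ', hle, l, hl⟩ := h σ.1 σ.2
  have h1 := hl.smooth_affineToricStr
  have h2 := hF.isOpenImmersion hσ' σ.2 hle
  have h3 : A.openCover.f σ ≫ A.str = affineToricMap N hle ≫ affineToricStr N σ' :=
    (A.chart_str σ).trans (affineToricMap_str hle).symm
  have h4 : SmoothOfRelativeDimension n (affineToricMap N hle ≫ affineToricStr N σ') :=
    IsZariskiLocalAtSource.comp (P := @SmoothOfRelativeDimension n) h1 _
  exact h3 ▸ h4

end Smooth


/-! ### Local rings in the function field -/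

section LocalRings

variable {X Y : Scheme.{0}} [IsIntegral X]

theorem genericPoint_specializes' (x : X) : genericPoint X ⤳ x :=
  (genericPoint_spec X).specializes trivial

/-- The inclusion of the local ring at a point of an open chart into the function field. -/
def stalkToFunctionField {U : Scheme.{0}} (c : U ⟶ X) [IsOpenImmersion c] (y : U) :
    U.presheaf.stalk y ⟶ X.functionField :=
  inv (c.stalkMap y) ≫ X.presheaf.stalkSpecializes (genericPoint_specializes' (c y))

theorem localRingIn_chart {U : Scheme.{0}} (c : U ⟶ X) [IsOpenImmersion c] (y : U) :
    localRingIn (𝟙 X) (c y) = (stalkToFunctionField c y).hom.range := by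
  ext a
  constructor
  · rintro ⟨b, rfl⟩
    refine ⟨(c.stalkMap y).hom b, ?_⟩
    rw [stalkToFunctionField, Scheme.Hom.stalkMap_id]
    change ((c.stalkMap y) ≫ inv (c.stalkMap y) ≫ _).hom b = _
    rw [IsIso.hom_inv_id_assoc]
    rfl
  · rintro ⟨b, rfl⟩
    refine ⟨(inv (c.stalkMap y)).hom b, ?_⟩
    rw [stalkToFunctionField, Scheme.Hom.stalkMap_id]
    rfl

theorem localRingIn_eq_of_isIso_stalkMap (π : X ⟶ Y) [IsDominant π] (x : X)
    [IsIso (π.stalkMap x)] : localRingIn π (π x) = localRingIn (𝟙 X) x := by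
  have h := Scheme.Hom.stalkSpecializes_stalkMap π _ _ (genericPoint_specializes' x)
  ext a
  constructor
  · rintro ⟨b, rfl⟩
    refine ⟨(π.stalkMap x).hom b, ?_⟩
    rw [Scheme.Hom.stalkMap_id]
    exact congr($(h.symm).hom b)
  · rintro ⟨b, rfl⟩
    refine ⟨(inv (π.stalkMap x)).hom b, ?_⟩
    rw [Scheme.Hom.stalkMap_id]
    refine (congr($(h).hom _)).trans ?_
    change (inv (π.stalkMap x) ≫ π.stalkMap x ≫ _).hom b = _
    rw [IsIso.inv_hom_id_assoc]
    rfl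

variable {R S : Type} [CommRing R] [CommRing S]

/-- The homomorphism from a ring to a local ring of its spectrum. -/
def toLocalRing (y : Spec (CommRingCat.of R)) :
    CommRingCat.of R ⟶ (Spec (CommRingCat.of R)).presheaf.stalk y :=
  (Scheme.ΓSpecIso (CommRingCat.of R)).inv ≫ (Spec (CommRingCat.of R)).presheaf.germ ⊤ y trivial

theorem isLocalization_toLocalRing (p : PrimeSpectrum R) :
    letI := (toLocalRing (R := R) p).hom.toAlgebra
    IsLocalization.AtPrime ((Spec (CommRingCat.of R)).presheaf.stalk p) p.asIdeal :=
  StructureSheaf.IsLocalization.to_stalk R p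

theorem toLocalRing_stalkMap (g : S →+* R) (y : Spec (CommRingCat.of R)) :
    toLocalRing (Spec.map (CommRingCat.ofHom g) y) ≫ (Spec.map (CommRingCat.ofHom g)).stalkMap y =
      CommRingCat.ofHom g ≫ toLocalRing y :=
  stalkMap_toStalk (CommRingCat.ofHom g) y

/-- The inclusion of the coordinate ring of an affine open chart into the function field. -/
def toFunctionField [IsDomain R] (c : Spec (CommRingCat.of R) ⟶ X) [IsOpenImmersion c] :
    R →+* X.functionField :=
  (toLocalRing (genericPoint (Spec (CommRingCat.of R))) ≫
    stalkToFunctionField c (genericPoint (Spec (CommRingCat.of R)))).hom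

theorem toLocalRing_comp [IsDomain R] (c : Spec (CommRingCat.of R) ⟶ X) [IsOpenImmersion c]
    (y : Spec (CommRingCat.of R)) :
    toLocalRing y ≫ stalkToFunctionField c y = CommRingCat.ofHom (toFunctionField c) := by
  have hy := genericPoint_specializes' y
  have h1 : toLocalRing y ≫ (Spec (CommRingCat.of R)).presheaf.stalkSpecializes hy =
      toLocalRing (genericPoint (Spec (CommRingCat.of R))) :=
    StructureSheaf.toStalk_stalkSpecializes hy
  have h2 := Scheme.Hom.stalkSpecializes_stalkMap c _ _ hy
  have h3 : stalkToFunctionField c y = (Spec (CommRingCat.of R)).presheaf.stalkSpecializes hy ≫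
      stalkToFunctionField c (genericPoint (Spec (CommRingCat.of R))) := by
    rw [stalkToFunctionField, stalkToFunctionField, ← cancel_epi (c.stalkMap y),
      IsIso.hom_inv_id_assoc, ← reassoc_of% h2, IsIso.hom_inv_id_assoc,
      TopCat.Presheaf.stalkSpecializes_comp]
  rw [h3, reassoc_of% h1]
  rfl

theorem toFunctionField_comp [IsDomain R] [IsDomain S] (g : S →+* R)
    (d : Spec (CommRingCat.of S) ⟶ X) [IsOpenImmersion d] (c : Spec (CommRingCat.of R) ⟶ X)
    [IsOpenImmersion c] (h : Spec.map (CommRingCat.ofHom g) ≫ d = c) :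
    (toFunctionField c).comp g = toFunctionField d := by
  subst h
  let y : Spec (CommRingCat.of R) := genericPoint _
  have h1 := toLocalRing_comp d (Spec.map (CommRingCat.ofHom g) y)
  have h2 := toLocalRing_comp (Spec.map (CommRingCat.ofHom g) ≫ d) y
  have h3 : (Spec.map (CommRingCat.ofHom g)).stalkMap y ≫
      stalkToFunctionField (Spec.map (CommRingCat.ofHom g) ≫ d) y =
      stalkToFunctionField d (Spec.map (CommRingCat.ofHom g) y) := by
    rw [stalkToFunctionField, stalkToFunctionField,
      ← cancel_epi (d.stalkMap (Spec.map (CommRingCat.ofHom g) y)), IsIso.hom_inv_id_assoc,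
      ← Category.assoc, ← Scheme.Hom.stalkMap_comp]
    have hi : IsIso ((Spec.map (CommRingCat.ofHom g) ≫ d).stalkMap y) := inferInstance
    exact @IsIso.hom_inv_id_assoc _ _ _ _ _ hi _ _
  have h4 : CommRingCat.ofHom g ≫ CommRingCat.ofHom
      (toFunctionField (Spec.map (CommRingCat.ofHom g) ≫ d)) =
      CommRingCat.ofHom (toFunctionField d) := by
    rw [← h2, ← h1, ← Category.assoc, ← toLocalRing_stalkMap, Category.assoc, h3]
  exact congr(($h4).hom)

theorem toFunctionField_algebraMap [IsDomain R] [Algebra ℂ R]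
    (s : X ⟶ Spec (CommRingCat.of ℂ)) (c : Spec (CommRingCat.of R) ⟶ X) [IsOpenImmersion c]
    (h : c ≫ s = Spec.map (CommRingCat.ofHom (algebraMap ℂ R))) :
    (toFunctionField c).comp (algebraMap ℂ R) = scalars s := by
  let y : Spec (CommRingCat.of R) := genericPoint _
  have h1 : CommRingCat.ofHom (algebraMap ℂ R) ≫ (Scheme.ΓSpecIso (CommRingCat.of R)).inv =
      (Scheme.ΓSpecIso (CommRingCat.of ℂ)).inv ≫ s.appTop ≫ c.appTop := by
    rw [← Scheme.Hom.comp_appTop, h, Scheme.ΓSpecIso_inv_naturality]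
  have h2 : c.appTop ≫ (Spec (CommRingCat.of R)).presheaf.germ ⊤ y trivial =
      X.presheaf.germ ⊤ (c y) (TopologicalSpace.Opens.mem_top _) ≫ c.stalkMap y :=
    (Scheme.Hom.germ_stalkMap c ⊤ y trivial).symm
  have h4 : CommRingCat.ofHom (algebraMap ℂ R) ≫ CommRingCat.ofHom (toFunctionField c) =
      CommRingCat.ofHom (scalars s) := by
    rw [← toLocalRing_comp c y, toLocalRing, Category.assoc, reassoc_of% h1, reassoc_of% h2,
      stalkToFunctionField, IsIso.hom_inv_id_assoc, TopCat.Presheaf.germ_stalkSpecializes]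
    rfl
  exact congr(($h4).hom)

theorem toFunctionField_mem_localRingIn [IsDomain R] (c : Spec (CommRingCat.of R) ⟶ X)
    [IsOpenImmersion c] (y : Spec (CommRingCat.of R)) (r : R) :
    toFunctionField c r ∈ localRingIn (𝟙 X) (c y) := by
  rw [localRingIn_chart]
  exact ⟨(toLocalRing y).hom r, congr($(toLocalRing_comp c y).hom r)⟩

/-- The local ring is the localization of the coordinate ring at the prime of the point, so its
elements are fractions with denominators invertible there. -/
theorem exists_of_mem_localRingIn [IsDomain R] (c : Spec (CommRingCat.of R) ⟶ X)
    [IsOpenImmersion c] (y : Spec (CommRingCat.of R)) {a : X.functionField}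
    (ha : a ∈ localRingIn (𝟙 X) (c y)) :
    ∃ r s : R, toFunctionField c s ≠ 0 ∧ (toFunctionField c s)⁻¹ ∈ localRingIn (𝟙 X) (c y) ∧
      a = toFunctionField c r * (toFunctionField c s)⁻¹ := by
  rw [localRingIn_chart] at ha ⊢
  obtain ⟨b, rfl⟩ := ha
  have hc : ∀ r, (stalkToFunctionField c y).hom ((toLocalRing y).hom r) = toFunctionField c r :=
    fun r => congr($(toLocalRing_comp c y).hom r)
  let _ := (toLocalRing (R := R) y).hom.toAlgebra
  have := isLocalization_toLocalRing (R := R) y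
  let p : PrimeSpectrum R := y
  obtain ⟨⟨r, s⟩, hrs⟩ := IsLocalization.surj p.asIdeal.primeCompl b
  obtain ⟨u, hu⟩ := IsLocalization.map_units ((Spec (CommRingCat.of R)).presheaf.stalk y) s
  have h1 : (stalkToFunctionField c y).hom (u : (Spec (CommRingCat.of R)).presheaf.stalk y) =
    toFunctionField c s := by
    rw [hu]; exact hc s
  have h2 : toFunctionField c s * (stalkToFunctionField c y).hom
      ((u⁻¹ : Units _) : (Spec (CommRingCat.of R)).presheaf.stalk y) = 1 := by
    rw [← h1, ← map_mul, Units.mul_inv, map_one]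
  have h3 : toFunctionField c s ≠ 0 := left_ne_zero_of_mul_eq_one h2
  refine ⟨r, s, h3, ⟨_, eq_inv_of_mul_eq_one_right h2⟩, ?_⟩
  rw [eq_mul_inv_iff_mul_eq₀ h3, ← hc, ← hc, ← map_mul]
  exact congrArg _ hrs

end LocalRings


/-! ### Lattices of rational forms -/

section Forms

/-- Both sides are alternating in the rows of `c`, so distinct standard basis vectors suffice as
rows. These are a permutation of the basis, and both sides pick up its sign. -/
theorem AlternatingMap.map_sum_smul {K V W : Type*} [CommRing K] [AddCommGroup V] [Module K V]
    [AddCommGroup W] [Module K W] {n : ℕ} (f : V [⋀^Fin n]→ₗ[K] W) (c : Matrix (Fin n) (Fin n) K)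
    (x : Fin n → V) : f (fun i => ∑ j, c i j • x j) = c.det • f x := by
  let L : (Fin n → K) →ₗ[K] V := Fintype.linearCombination K x
  have h : f.compLinearMap L =
      (LinearMap.toSpanSingleton K W (f x)).compAlternatingMap Matrix.detRowAlternating := by
    refine Module.Basis.ext_alternating (Pi.basisFun K (Fin n)) fun i hi => ?_
    let σ : Equiv.Perm (Fin n) := Equiv.ofBijective i (Finite.injective_iff_bijective.1 hi)
    have h1 : ∀ k, L (Pi.basisFun K (Fin n) k) = x k := fun k => by
      simp [L, Fintype.linearCombination_apply_single]
    have h2 := f.map_perm x σ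
    have h3 := (Matrix.detRowAlternating (R := K) (n := Fin n)).map_perm (Pi.basisFun K (Fin n)) σ
    change f (fun k => L (Pi.basisFun K (Fin n) (σ k))) =
      (Matrix.detRowAlternating (R := K) (n := Fin n)) ((Pi.basisFun K (Fin n)) ∘ σ) • f x
    rw [h3]
    simp_rw [h1]
    refine h2.trans ?_
    have h4 : (Matrix.detRowAlternating (R := K) (n := Fin n)) (Pi.basisFun K (Fin n)) = 1 := by
      have : (⇑(Pi.basisFun K (Fin n)) : Matrix (Fin n) (Fin n) K) =
          (1 : Matrix (Fin n) (Fin n) K) := by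
        ext a b
        simp [Matrix.one_apply, Pi.single_apply, eq_comm]
      rw [this]
      exact Matrix.det_one
    rw [h4]
    rcases Int.units_eq_one_or (Equiv.Perm.sign σ) with h | h <;> simp [h]
  exact congr($h c)

theorem span_smul_eq {K V : Type*} [Field K] [AddCommGroup V] [Module K V] (A : Subring K) {c : K} (hc : c ≠ 0)
    (h : c ∈ A) (h' : c⁻¹ ∈ A) (x : V) : Submodule.span A {c • x} = Submodule.span A {x} := by
  apply le_antisymm
  · rw [Submodule.span_singleton_le_iff_mem]
    exact Submodule.smul_mem _ (⟨c, h⟩ : A) (Submodule.mem_span_singleton_self x)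
  · rw [Submodule.span_singleton_le_iff_mem]
    have := Submodule.smul_mem _ (⟨c⁻¹, h'⟩ : A) (Submodule.mem_span_singleton_self (R := A) (c • x))
    have e : (⟨c⁻¹, h'⟩ : A) • (c • x) = x := inv_smul_smul₀ hc x
    rwa [e] at this

variable {K : Type} [Field K] [Algebra ℂ K] {n : ℕ}

open KaehlerDifferential in
theorem D_mem_span_of_mem_adjoin (A : Subring K) (t : Fin n → K)
    (hA : ∀ a ∈ Algebra.adjoin ℂ (Set.range t), a ∈ A) {a : K}
    (ha : a ∈ Algebra.adjoin ℂ (Set.range t)) :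
    D ℂ K a ∈ Submodule.span A (Set.range fun i => D ℂ K (t i)) := by
  induction ha using Algebra.adjoin_induction with
  | mem x hx =>
    obtain ⟨i, rfl⟩ := hx
    exact Submodule.subset_span ⟨i, rfl⟩
  | algebraMap c => simp
  | add x y _ _ hx hy => simpa using add_mem hx hy
  | mul x y hx hy hx' hy' =>
    rw [Derivation.leibniz]
    exact add_mem (Submodule.smul_mem _ (⟨x, hA x hx⟩ : A) hy')
      (Submodule.smul_mem _ (⟨y, hA y hy⟩ : A) hx')

open KaehlerDifferential in
-- By the quotient rule the differential of every element of `A` is an `A`-combination of the dt_i.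
-- A wedge of n such differentials is a determinant with entries in `A` times dt_1 ∧ … ∧ dt_n.
theorem formLattice_eq_span (A : Subring K) (t : Fin n → K)
    (hA : ∀ a ∈ Algebra.adjoin ℂ (Set.range t), a ∈ A)
    (hA' : ∀ a ∈ A, ∃ r ∈ Algebra.adjoin ℂ (Set.range t), ∃ s ∈ Algebra.adjoin ℂ (Set.range t),
      s ≠ 0 ∧ s⁻¹ ∈ A ∧ a = r * s⁻¹) :
    formLattice n A = Submodule.span A {exteriorPower.ιMulti K n fun i => D ℂ K (t i)} := by
  have ht : ∀ i, t i ∈ A := fun i => hA _ (Algebra.subset_adjoin ⟨i, rfl⟩)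
  have h1 : ∀ a ∈ A, D ℂ K a ∈ Submodule.span A (Set.range fun i => D ℂ K (t i)) := by
    intro a ha
    obtain ⟨r, hr, s, hs, hs0, hsA, rfl⟩ := hA' a ha
    rw [Derivation.leibniz, Derivation.leibniz_inv, smul_smul]
    exact add_mem
      (Submodule.smul_mem _ (⟨_, mul_mem (hA r hr) (neg_mem (pow_mem hsA 2))⟩ : A)
        (D_mem_span_of_mem_adjoin A t hA hs))
      (Submodule.smul_mem _ (⟨_, hsA⟩ : A) (D_mem_span_of_mem_adjoin A t hA hr))
  apply le_antisymm
  · refine Submodule.span_le.mpr ?_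
    rintro _ ⟨a, rfl⟩
    have h2 : ∀ i, ∃ c : Fin n → A, ∑ j, c j • D ℂ K (t j) = D ℂ K (a i : K) := fun i =>
      Submodule.mem_span_range_iff_exists_fun A |>.mp (h1 _ (a i).2)
    choose c hc using h2
    have h3 : (fun i => D ℂ K (a i : K)) =
        fun i => ∑ j, ((Matrix.of c).map A.subtype) i j • D ℂ K (t j) := by
      ext1 i
      rw [← hc]
      rfl
    rw [h3, AlternatingMap.map_sum_smul, ← RingHom.mapMatrix_apply, ← RingHom.map_det]
    exact Submodule.smul_mem _ ((Matrix.of c).det) (Submodule.mem_span_singleton_self _)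
  · refine Submodule.span_le.mpr ?_
    rintro _ rfl
    exact Submodule.subset_span ⟨fun i => ⟨t i, ht i⟩, rfl⟩

/-- The logarithmic differential of a character. -/
def dlog {M : Type*} [AddMonoid M] (χ : Multiplicative M →* K) (hχ : ∀ m, χ m ≠ 0) :
    M →+ Ω[K⁄ℂ] where
  toFun m := (χ (.ofAdd m))⁻¹ • KaehlerDifferential.D ℂ K (χ (.ofAdd m))
  map_zero' := by simp
  map_add' m m' := by
    have h := hχ (.ofAdd m)
    have h' := hχ (.ofAdd m')
    rw [ofAdd_add, map_mul, Derivation.leibniz, smul_add, smul_smul, smul_smul, add_comm]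
    congr 2
    · field_simp
    · field_simp

/-- Each dχ is χ times dlog χ, and the scalar factors multiply to the character of the sum. This
exponent is what has to be matched for crepancy. -/
theorem ιMulti_D_character {M : Type*} [AddCommMonoid M] (χ : Multiplicative M →* K)
    (hχ : ∀ m, χ m ≠ 0) (l : Fin n → M) :
    (exteriorPower.ιMulti K n fun i => KaehlerDifferential.D ℂ K (χ (.ofAdd (l i)))) =
      χ (.ofAdd (∑ i, l i)) • exteriorPower.ιMulti K n fun i => dlog χ hχ (l i) := by
  have h : (fun i => KaehlerDifferential.D ℂ K (χ (.ofAdd (l i)))) =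
      fun i => χ (.ofAdd (l i)) • dlog χ hχ (l i) := by
    ext1 i
    exact (smul_inv_smul₀ (hχ _) _).symm
  rw [h, ofAdd_sum, map_prod]
  exact MultilinearMap.map_smul_univ (exteriorPower.ιMulti K n).toMultilinearMap _ _

end Forms


/-! ### Crepancy of toric morphisms -/

section Crepancy

variable {E : Type} [AddCommGroup E] [Module ℝ E] {N : AddSubgroup E} {F G : Set (PointedCone ℝ E)}

/-- An affine chart, as a morphism from a spectrum. -/
def ToricVariety.specChart (A : ToricVariety N F) (σ : F) :
    Spec (CommRingCat.of (toricRing N σ.1)) ⟶ A.X :=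
  A.chart σ

instance (A : ToricVariety N F) (σ : F) : IsOpenImmersion (A.specChart σ) :=
  A.chart_isOpenImmersion σ

/-- The inclusion of the coordinate ring of a chart into the function field. -/
def ToricVariety.coord (A : ToricVariety N F) [IsIntegral A.X] (σ : F) :
    toricRing N σ.1 →+* A.X.functionField :=
  toFunctionField (A.specChart σ)

variable (A : ToricVariety N F) [IsIntegral A.X]

theorem ToricVariety.coord_comp {ρ σ : F} (h : ρ.1 ≤ σ.1) :
    (A.coord ρ).comp (restr N h) = A.coord σ :=
  toFunctionField_comp (restr N h) (A.specChart σ) (A.specChart ρ) (A.chart_comp ρ σ h)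

theorem ToricVariety.coord_algebraMap (σ : F) :
    (A.coord σ).comp (algebraMap ℂ _) = scalars A.str :=
  toFunctionField_algebraMap A.str (A.specChart σ) (A.chart_str σ)

theorem ToricVariety.coord_mem (σ : F) (y : affineToric N σ.1) (r : toricRing N σ.1) :
    A.coord σ r ∈ localRingIn (𝟙 A.X) (A.chart σ y) :=
  toFunctionField_mem_localRingIn (A.specChart σ) y r

theorem ToricVariety.exists_of_mem_localRingIn (σ : F) (y : affineToric N σ.1)
    {a : A.X.functionField} (ha : a ∈ localRingIn (𝟙 A.X) (A.chart σ y)) :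
    ∃ r s : toricRing N σ.1, A.coord σ s ≠ 0 ∧
      (A.coord σ s)⁻¹ ∈ localRingIn (𝟙 A.X) (A.chart σ y) ∧
      a = A.coord σ r * (A.coord σ s)⁻¹ :=
  CubicsMPCP.exists_of_mem_localRingIn (A.specChart σ) y ha

/-- The dual lattice. -/
def dualLattice (N : AddSubgroup E) : AddSubgroup (Module.Dual ℝ E) where
  __ := dualMonoid N ⊥
  neg_mem' := by
    rintro m ⟨h, -⟩
    refine ⟨fun x hx => ?_, fun x hx => ?_⟩
    · obtain ⟨z, hz⟩ := h x hx
      exact ⟨-z, by simp [hz]⟩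
    · rw [Submodule.mem_bot] at hx
      simp [hx]

theorem mem_dualLattice {m : Module.Dual ℝ E} :
    m ∈ dualLattice N ↔ ∀ x ∈ N, ∃ z : ℤ, m x = z :=
  ⟨fun h => h.1, fun h => ⟨h, fun x hx => by
    rw [Submodule.mem_bot] at hx
    simp [hx]⟩⟩

theorem dualMonoid_le_dualLattice (σ : PointedCone ℝ E) {m : Module.Dual ℝ E}
    (h : m ∈ dualMonoid N σ) : m ∈ dualLattice N :=
  mem_dualLattice.mpr h.1

/-- The characters in the function field. -/
def ToricVariety.character (hF : IsGluable N F) :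
    Multiplicative (dualLattice N) →* A.X.functionField where
  toFun m := A.coord ⟨⊥, hF.bot_mem⟩ (chr (⟨m.toAdd.1, m.toAdd.2⟩ : dualMonoid N ⊥))
  map_one' := map_one _
  map_mul' m m' := by
    rw [← map_mul, ← chr_add]
    rfl

variable {A}

theorem ToricVariety.character_ne_zero (hF : IsGluable N F) (m : Multiplicative (dualLattice N)) :
    A.character hF m ≠ 0 := by
  have h : A.character hF m * A.character hF m⁻¹ = 1 := by
    rw [← map_mul, mul_inv_cancel, map_one]
  exact left_ne_zero_of_mul_eq_one h

theorem ToricVariety.coord_chr (hF : IsGluable N F) {σ : F} (m : dualMonoid N σ.1) :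
    A.coord σ (chr m) = A.character hF (.ofAdd ⟨m.1, dualMonoid_le_dualLattice _ m.2⟩) := by
  rw [← A.coord_comp (ρ := ⟨⊥, hF.bot_mem⟩) bot_le, RingHom.comp_apply, restr_chr]
  rfl

/-- Every character is a difference of two characters of the cone: a large multiple of a form that
cuts out the origin makes it nonnegative on the cone. -/
theorem IsSmoothCone.exists_int {n : ℕ} (hF : IsGluable N F) {σ : PointedCone ℝ E} (hσ : σ ∈ F)
    {l : Fin n → Module.Dual ℝ E} (h : IsSmoothCone N σ l) {m : Module.Dual ℝ E}
    (hm : m ∈ dualLattice N) : ∃ c : Fin n → ℤ, m = ∑ i, (c i : ℝ) • l i := by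
  have h1 : ∀ m ∈ dualMonoid N σ, ∃ c : Fin n → ℤ, m = ∑ i, (c i : ℝ) • l i := by
    intro m hm
    obtain ⟨c, hc⟩ := h.toDual_bijective.2 ⟨m, hm⟩
    refine ⟨fun i => c i, ?_⟩
    have := congrArg Subtype.val hc
    rw [h.coe_toDual] at this
    simpa using this.symm
  obtain ⟨m₀, hm₀⟩ := hF.exists_faceForm σ hσ ⊥ hF.bot_mem bot_le
  obtain ⟨s, hs⟩ := hF.fg σ hσ
  obtain ⟨k, hk⟩ := exists_nsmul_add_mem hm₀ hs (m' := m) hm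
  obtain ⟨c, hc⟩ := h1 _ hk
  obtain ⟨d, hd⟩ := h1 _ hm₀.mem
  refine ⟨fun i => c i - k * d i, ?_⟩
  have : m = (m + k • m₀) - k • m₀ := by abel
  rw [this, hc]
  nth_rewrite 1 [hd]
  ext x
  simp [sub_mul, Finset.mul_sum, mul_assoc]

/-- Both families are bases of the dual lattice, so the two transition matrices are integral and
inverse to each other. -/
theorem IsSmoothCone.exists_matrix {n : ℕ} (hF : IsGluable N F) {σ σ' : PointedCone ℝ E}
    (hσ : σ ∈ F) (hσ' : σ' ∈ F) {l l' : Fin n → Module.Dual ℝ E} (h : IsSmoothCone N σ l)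
    (h' : IsSmoothCone N σ' l') :
    ∃ c : Matrix (Fin n) (Fin n) ℤ, (c.det = 1 ∨ c.det = -1) ∧
      ∀ i, l' i = ∑ j, (c i j : ℝ) • l j := by
  have h1 : ∀ i, ∃ c : Fin n → ℤ, l' i = ∑ j, (c j : ℝ) • l j := fun i =>
    h.exists_int hF hσ (dualMonoid_le_dualLattice _ (h'.mem i))
  have h2 : ∀ i, ∃ c : Fin n → ℤ, l i = ∑ j, (c j : ℝ) • l' j := fun i =>
    h'.exists_int hF hσ' (dualMonoid_le_dualLattice _ (h.mem i))
  choose c hc using h1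
  choose d hd using h2
  refine ⟨Matrix.of c, ?_, hc⟩
  have h3 : Matrix.of d * Matrix.of c = 1 := by
    ext i k
    have h4 : ∑ k, (((Matrix.of d * Matrix.of c) i k - (1 : Matrix (Fin n) (Fin n) ℤ) i k : ℤ) : ℝ) •
        l k = 0 := by
      have h5 : l i = ∑ j, (d i j : ℝ) • ∑ k, (c j k : ℝ) • l k := by
        simp_rw [← hc]
        exact hd i
      ext x
      have h6 := congr($h5 x)
      simp only [LinearMap.sum_apply, LinearMap.smul_apply, smul_eq_mul, Finset.mul_sum] at h6
      rw [Finset.sum_comm] at h6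
      simp only [Matrix.mul_apply, Matrix.of_apply, Matrix.one_apply, LinearMap.sum_apply,
        LinearMap.smul_apply, smul_eq_mul, Int.cast_sub, sub_mul, Finset.sum_sub_distrib,
        Int.cast_sum, Int.cast_mul, Finset.sum_mul, mul_assoc, LinearMap.zero_apply]
      rw [← h6]
      simp
    have := Fintype.linearIndependent_iff.mp h.linearIndependent _ h4 k
    exact sub_eq_zero.mp (by exact_mod_cast this)
  have h7 := congrArg Matrix.det h3
  rw [Matrix.det_mul, Matrix.det_one, mul_comm] at h7
  exact Int.isUnit_iff.mp (IsUnit.of_mul_eq_one _ h7)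

/-! ### Points of codimension one -/

/-- The endomorphism of `ℂ[σ^∨ ∩ M]` that annihilates the characters which are positive at `x`. -/
def killPositive {σ : PointedCone ℝ E} {x : E} (hx : x ∈ σ) : toricRing N σ →+* toricRing N σ :=
  open Classical in
  (AddMonoidAlgebra.lift ℂ (toricRing N σ) (dualMonoid N σ)
    { toFun := fun m => if m.toAdd.1 x = 0 then chr m.toAdd else 0
      map_one' := by simp [chr_zero]
      map_mul' := fun m m' => by
        have h := m.toAdd.2.2 x hx
        have h' := m'.toAdd.2.2 x hx
        have e : (m * m').toAdd.1 x = m.toAdd.1 x + m'.toAdd.1 x := rfl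
        have : (m * m').toAdd.1 x = 0 ↔ m.toAdd.1 x = 0 ∧ m'.toAdd.1 x = 0 := by
          rw [e]
          exact add_eq_zero_iff_of_nonneg h h'
        simp only [this]
        by_cases h1 : m.toAdd.1 x = 0 <;> by_cases h2 : m'.toAdd.1 x = 0 <;>
          simp [h1, h2, chr_add] }).toRingHom

open Classical in
theorem killPositive_single {σ : PointedCone ℝ E} {x : E} (hx : x ∈ σ) (m : dualMonoid N σ)
    (c : ℂ) : killPositive hx (AddMonoidAlgebra.single m c) =
      if m.1 x = 0 then AddMonoidAlgebra.single m c else 0 := by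
  change AddMonoidAlgebra.lift ℂ (toricRing N σ) (dualMonoid N σ) _ _ = _
  rw [AddMonoidAlgebra.lift_single]
  change c • (if m.1 x = 0 then chr m else 0) = _
  split_ifs
  · simp [chr]
  · simp

/-- The kernel of `killPositive` is a prime ideal inside `p`, nonzero because some character is
positive at `x`. Height one forces it to be `p`, and it contains no character that vanishes at `x`.
-/
theorem mem_nonvanishing_of_height_eq_one {σ : PointedCone ℝ E} {x : E} (hx : x ∈ σ)
    (p : PrimeSpectrum (toricRing N σ)) (hp : p.asIdeal.height = 1)
    (h : ∀ m : dualMonoid N σ, 0 < m.1 x → chr m ∈ p.asIdeal) (h0 : ∃ m : dualMonoid N σ, 0 < m.1 x)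
    (m : dualMonoid N σ) (hm : m.1 x = 0) : chr m ∉ p.asIdeal := by
  intro hmem
  have hle : RingHom.ker (killPositive (N := N) hx) ≤ p.asIdeal := by
    intro f hf
    have key : ∀ f : toricRing N σ, f - killPositive hx f ∈ p.asIdeal := by
      intro f
      induction f using AddMonoidAlgebra.induction_linear with
      | zero => simp
      | add f g hf hg =>
        rw [map_add, add_sub_add_comm]
        exact add_mem hf hg
      | single m c =>
        rw [killPositive_single]
        split_ifs with h1
        · simp
        · have h2 := h m (lt_of_le_of_ne (m.2.2 x hx) (Ne.symm h1))
          have h3 : (AddMonoidAlgebra.single m c : toricRing N σ) = algebraMap ℂ _ c * chr m := by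
            simp [chr, AddMonoidAlgebra.single_mul_single]
          rw [sub_zero, h3]
          exact Ideal.mul_mem_left _ _ h2
    have := key f
    rwa [(RingHom.mem_ker).mp hf, sub_zero] at this
  have hlt : RingHom.ker (killPositive (N := N) hx) < p.asIdeal := by
    refine lt_of_le_of_ne hle fun he => ?_
    rw [← he, RingHom.mem_ker, chr, killPositive_single, if_pos hm] at hmem
    exact chr_ne_zero m hmem
  have hprime : (RingHom.ker (killPositive (N := N) hx)).IsPrime := RingHom.ker_isPrime _
  have h1 := Ideal.height_add_one_le_of_lt_of_isPrime hlt
  rw [hp] at h1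
  have h2 : (RingHom.ker (killPositive (N := N) hx)).height = 0 := by
    by_contra hne
    have := Order.one_le_iff_ne_zero.mpr hne
    have h3 : (1 : ℕ∞) + 1 ≤ 1 := (add_le_add_left this 1).trans h1
    exact absurd h3 (by decide)
  rw [Ideal.height_eq_zero_iff_eq_bot] at h2
  obtain ⟨m', hm'⟩ := h0
  have h3 : chr m' ∈ RingHom.ker (killPositive (N := N) hx) := by
    rw [RingHom.mem_ker, chr, killPositive_single, if_neg hm'.ne']
  rw [h2] at h3
  exact chr_ne_zero m' h3

/-- Every prime ideal of the monoid `ρ^∨ ∩ M` contains the characters that are positive on a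
generator of some cone, common to `F` and `G`. -/
def HasRays (N : AddSubgroup E) (F G : Set (PointedCone ℝ E)) : Prop :=
  ∀ ρ ∈ G, ∀ T : Set (dualMonoid N ρ), (0 : dualMonoid N ρ) ∉ T →
    (∀ m m', m + m' ∈ T ↔ m ∈ T ∨ m' ∈ T) → T.Nonempty →
    ∃ η ∈ F, η ∈ G ∧ η ≤ ρ ∧ ∃ x ∈ η, (∃ m : dualMonoid N ρ, 0 < m.1 x) ∧
      ∀ m : dualMonoid N ρ, 0 < m.1 x → m ∈ T

/-- A point at which no character vanishes lies in the torus. Otherwise the vanishing characters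
form a prime ideal of the monoid; `HasRays` supplies a common cone, and height one keeps the form
that cuts it out invertible at the point. -/
theorem HasRays.exists_mem_range (h : HasRays N F G) (hF : IsGluable N F) (hG : IsGluable N G)
    {ρ : PointedCone ℝ E} (hρ : ρ ∈ G) (y : affineToric N ρ)
    (hy : (y : PrimeSpectrum (toricRing N ρ)).asIdeal.height = 1) :
    ∃ η, ∃ hle : η ≤ ρ, η ∈ F ∧ η ∈ G ∧ y ∈ Set.range (affineToricMap N hle) := by
  obtain ⟨s, hs⟩ := hG.fg ρ hρ
  let p : PrimeSpectrum (toricRing N ρ) := y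
  by_cases hT : ∃ m : dualMonoid N ρ, chr m ∈ p.asIdeal
  · obtain ⟨η, hηF, hηG, hle, x, hx, h0, h1⟩ := h ρ hρ {m | chr m ∈ p.asIdeal}
      (by
        rw [Set.mem_ofPred_eq, chr_zero]
        exact (Ideal.ne_top_iff_one _).mp p.isPrime.ne_top)
      (fun m m' => by
        rw [Set.mem_ofPred_eq, chr_add]
        exact p.isPrime.mul_mem_iff_mem_or_mem) hT
    obtain ⟨m, hm⟩ := hG.exists_faceForm ρ hρ η hηG hle
    refine ⟨η, hle, hηF, hηG, ?_⟩
    rw [range_affineToricMap hle hm hs]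
    exact mem_nonvanishing_of_height_eq_one (hle hx) p hy h1 h0 hm.elt (hm.eq_zero x hx)
  · push Not at hT
    obtain ⟨m, hm⟩ := hG.exists_faceForm ρ hρ ⊥ hG.bot_mem bot_le
    refine ⟨⊥, bot_le, hF.bot_mem, hG.bot_mem, ?_⟩
    rw [range_affineToricMap bot_le hm hs]
    exact hT hm.elt

end Crepancy


/-! ### The logarithmic volume form and the canonical sheaf. -/

section CanonicalForm

variable {E : Type} [AddCommGroup E] [Module ℝ E] {N : AddSubgroup E} {F G : Set (PointedCone ℝ E)}

/-- The scalars make the function field a `ℂ`-algebra. -/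
@[reducible]
def ToricVariety.functionFieldAlgebra (A : ToricVariety N F) [IsIntegral A.X] :
    Algebra ℂ A.X.functionField := (scalars A.str).toAlgebra

attribute [local instance] ToricVariety.functionFieldAlgebra

variable {A : ToricVariety N F} [IsIntegral A.X]

/-- The forms as elements of the dual lattice. -/
def IsSmoothCone.elt {n : ℕ} {σ : PointedCone ℝ E} {l : Fin n → Module.Dual ℝ E}
    (h : IsSmoothCone N σ l) (i : Fin n) : dualLattice N :=
  ⟨l i, dualMonoid_le_dualLattice _ (h.mem i)⟩

/-- The rational form `dlog t₁ ∧ … ∧ dlog tₙ`, for the coordinates `t` of a smooth cone. -/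
def IsSmoothCone.logForm {n : ℕ} {σ : PointedCone ℝ E} {l : Fin n → Module.Dual ℝ E}
    (h : IsSmoothCone N σ l) (A : ToricVariety N F) [IsIntegral A.X] (hF : IsGluable N F) :
    ⋀[A.X.functionField]^n (Ω[A.X.functionField⁄ℂ]) :=
  exteriorPower.ιMulti A.X.functionField n fun i =>
    dlog (A.character hF) (ToricVariety.character_ne_zero hF) (h.elt i)

/-- `dlog` is additive in the character, so a change of smooth cone multiplies the form by the
determinant of a unimodular integral matrix. -/
theorem IsSmoothCone.logForm_eq_or {n : ℕ} (hF : IsGluable N F) {σ σ' : PointedCone ℝ E}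
    (hσ : σ ∈ F) (hσ' : σ' ∈ F) {l l' : Fin n → Module.Dual ℝ E} (h : IsSmoothCone N σ l)
    (h' : IsSmoothCone N σ' l') : h'.logForm A hF = h.logForm A hF ∨
      h'.logForm A hF = (-1 : A.X.functionField) • h.logForm A hF := by
  obtain ⟨c, hc, hl⟩ := h.exists_matrix hF hσ hσ' h'
  have h1 : ∀ i, h'.elt i = ∑ j, c i j • h.elt j := by
    intro i
    ext1
    rw [AddSubgroup.val_finsetSum]
    refine (hl i).trans (Finset.sum_congr rfl fun j _ => ?_)
    ext x
    simp [IsSmoothCone.elt]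
  have h2 : h'.logForm A hF = ((c.map (Int.castRingHom A.X.functionField)).det) •
      h.logForm A hF := by
    rw [logForm, logForm, ← AlternatingMap.map_sum_smul]
    congr 1
    ext1 i
    rw [h1, map_sum]
    refine Finset.sum_congr rfl fun j _ => ?_
    rw [map_zsmul, Matrix.map_apply, eq_intCast, Int.cast_smul_eq_zsmul]
  rw [h2, ← RingHom.mapMatrix_apply, ← RingHom.map_det]
  rcases hc with hc | hc <;> simp [hc]

theorem IsSmoothCone.coord_algEquiv {n : ℕ} (hF : IsGluable N F) {σ : F}
    {l : Fin n → Module.Dual ℝ E} (h : IsSmoothCone N σ.1 l) (p : MvPolynomial (Fin n) ℂ) :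
    A.coord σ (h.algEquiv p) =
      MvPolynomial.aeval (fun i => A.character hF (.ofAdd (h.elt i))) p := by
  let f : toricRing N σ.1 →ₐ[ℂ] A.X.functionField :=
    { A.coord σ with commutes' := fun c => congr($(A.coord_algebraMap σ) c) }
  have : f.comp h.algEquiv.toAlgHom =
      MvPolynomial.aeval (fun i => A.character hF (.ofAdd (h.elt i))) := by
    refine MvPolynomial.algHom_ext fun i => ?_
    rw [MvPolynomial.aeval_X]
    change A.coord σ (h.algEquiv (MvPolynomial.X i)) = _
    rw [h.algEquiv_X, ToricVariety.coord_chr hF]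
    rfl
  exact congr($this p)

/-- The chart is an affine space with the characters of the l_i as coordinates, so the wedge of
their differentials generates; it is rewritten in terms of the logarithmic form. -/
theorem IsSmoothCone.formLattice_eq {n : ℕ} (hF : IsGluable N F) {σ : F}
    {l : Fin n → Module.Dual ℝ E} (h : IsSmoothCone N σ.1 l) (y : affineToric N σ.1) :
    formLattice n (localRingIn (𝟙 A.X) (A.chart σ y)) =
      Submodule.span (localRingIn (𝟙 A.X) (A.chart σ y))
        {A.character hF (.ofAdd (∑ i, h.elt i)) • h.logForm A hF} := by
  have hadj : ∀ a, a ∈ Algebra.adjoin ℂ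
      (Set.range fun i => A.character hF (.ofAdd (h.elt i))) ↔ ∃ r, A.coord σ r = a := by
    intro a
    rw [Algebra.adjoin_range_eq_range_aeval]
    constructor
    · rintro ⟨p, rfl⟩
      exact ⟨_, h.coord_algEquiv hF p⟩
    · rintro ⟨r, rfl⟩
      refine ⟨h.algEquiv.symm r, ?_⟩
      have := h.coord_algEquiv (A := A) hF (h.algEquiv.symm r)
      rw [h.algEquiv.apply_symm_apply] at this
      exact this.symm
  rw [formLattice_eq_span (localRingIn (𝟙 A.X) (A.chart σ y))
    (fun i => A.character hF (.ofAdd (h.elt i))), ιMulti_D_character (A.character hF)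
      (ToricVariety.character_ne_zero hF)]
  · rfl
  · intro a ha
    obtain ⟨r, rfl⟩ := (hadj a).mp ha
    exact A.coord_mem σ y r
  · intro a ha
    obtain ⟨r, s, h0, h1, h2⟩ := A.exists_of_mem_localRingIn σ y ha
    exact ⟨_, (hadj _).mpr ⟨r, rfl⟩, _, (hadj _).mpr ⟨s, rfl⟩, h0, h1, h2⟩

/-- Choose a smooth cone containing `κ`. On `κ` both the sum of its forms l_i and `m` equal `g`, so
the character of their difference is a unit on the chart of `κ`; the logarithmic forms of the two
smooth cones differ at most by a sign. -/
theorem formLattice_eq_span_character {n : ℕ} (hF : IsGluable N F) {g : E → ℝ}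
    (hsm : ∀ σ ∈ F, ∃ σ' ∈ F, σ ≤ σ' ∧ ∃ l : Fin n → Module.Dual ℝ E, IsSmoothCone N σ' l ∧
      ∀ x ∈ σ', ∑ i, l i x = g x) {σ₀ : PointedCone ℝ E} (hσ₀ : σ₀ ∈ F)
    {l₀ : Fin n → Module.Dual ℝ E} (h₀ : IsSmoothCone N σ₀ l₀) {κ : F} {m : dualLattice N}
    (hm : ∀ x ∈ κ.1, m.1 x = g x) {x : A.X} (hx : x ∈ Set.range (A.chart κ)) :
    formLattice n (localRingIn (𝟙 A.X) x) = Submodule.span (localRingIn (𝟙 A.X) x)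
      {A.character hF (.ofAdd m) • h₀.logForm A hF} := by
  obtain ⟨z, rfl⟩ := hx
  obtain ⟨σ, hσ, hle, l, hl, hlg⟩ := hsm κ.1 κ.2
  have hz : A.chart κ z = A.chart ⟨σ, hσ⟩ (affineToricMap N hle z) :=
    congr($((A.chart_comp κ ⟨σ, hσ⟩ hle).symm) z)
  have h1 := hl.formLattice_eq (A := A) (σ := ⟨σ, hσ⟩) hF (affineToricMap N hle z)
  rw [← hz] at h1
  rw [h1]
  have hmem : ∀ m' : dualLattice N, (∀ x ∈ κ.1, m'.1 x = 0) →
      A.character hF (.ofAdd m') ∈ localRingIn (𝟙 A.X) (A.chart κ z) := by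
    intro m' hm'
    have h2 : m'.1 ∈ dualMonoid N κ.1 := ⟨mem_dualLattice.mp m'.2, fun x hx => (hm' x hx).ge⟩
    have := A.coord_mem κ z (chr ⟨_, h2⟩)
    rwa [ToricVariety.coord_chr hF] at this
  have hsum : ∀ x, (∑ i, hl.elt i : dualLattice N).1 x = ∑ i, l i x := by
    intro x
    rw [AddSubgroup.val_finsetSum, LinearMap.sum_apply]
    rfl
  have hd : ∀ x ∈ κ.1, (∑ i, hl.elt i - m : dualLattice N).1 x = 0 := by
    intro x hx
    rw [AddSubgroup.coe_sub, LinearMap.sub_apply, hsum, hlg x (hle hx), hm x hx, sub_self]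
  have hchar : A.character hF (.ofAdd (∑ i, hl.elt i)) =
      A.character hF (.ofAdd (∑ i, hl.elt i - m)) * A.character hF (.ofAdd m) := by
    rw [← map_mul, ← ofAdd_add, sub_add_cancel]
  have hinv : (A.character hF (.ofAdd (∑ i, hl.elt i - m)))⁻¹ =
      A.character hF (.ofAdd (-(∑ i, hl.elt i - m))) := by
    refine inv_eq_of_mul_eq_one_right ?_
    rw [← map_mul, ← ofAdd_add, add_neg_cancel, ofAdd_zero, map_one]
  rw [hchar, mul_smul, span_smul_eq _ (ToricVariety.character_ne_zero hF _) (hmem _ hd)]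
  · rcases h₀.logForm_eq_or (A := A) hF hσ₀ hσ hl with h | h
    · rw [h]
    · rw [h, smul_comm]
      exact span_smul_eq (K := A.X.functionField) _ (neg_ne_zero.mpr one_ne_zero)
        (neg_mem (one_mem _)) (by rw [inv_neg_one]; exact neg_mem (one_mem _)) _
  · rw [hinv]
    refine hmem _ fun x hx => ?_
    rw [AddSubgroup.coe_neg, LinearMap.neg_apply, hd x hx, neg_zero]

theorem height_of_ringKrullDim_stalk (F : Set (PointedCone ℝ E)) (A : ToricVariety N F) (σ : F)
    (y : affineToric N σ.1) (h : ringKrullDim (A.X.presheaf.stalk (A.chart σ y)) = 1) :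
    (y : PrimeSpectrum (toricRing N σ.1)).asIdeal.height = 1 := by
  let p : PrimeSpectrum (toricRing N σ.1) := y
  let q : Spec (CommRingCat.of (toricRing N σ.1)) := y
  let e := (asIso ((A.specChart σ).stalkMap q)).commRingCatIsoToRingEquiv
  have h1 := (ringKrullDim_eq_of_ringEquiv e).symm.trans h
  let _ := (toLocalRing (R := toricRing N σ.1) p).hom.toAlgebra
  have := isLocalization_toLocalRing (R := toricRing N σ.1) p
  have h2 := IsLocalization.AtPrime.ringKrullDim_eq_height p.asIdeal
    ((Spec (CommRingCat.of (toricRing N σ.1))).presheaf.stalk p)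
  rw [h2] at h1
  exact_mod_cast h1

variable {B : ToricVariety N G} {π : A.X ⟶ B.X}

/-- Near the chart of a cone common to both fans the morphism is a local isomorphism. -/
theorem IsToricMorphism.localRingIn_eq [IsDominant π] (h : IsToricMorphism A B π)
    {η : PointedCone ℝ E} (hF : η ∈ F) (hG : η ∈ G) (y : affineToric N η) :
    localRingIn π (B.chart ⟨η, hG⟩ y) = localRingIn (𝟙 A.X) (A.chart ⟨η, hF⟩ y) := by
  have h1 := h.comp_chart_self hF hG
  have h2 : B.chart ⟨η, hG⟩ y = π (A.chart ⟨η, hF⟩ y) := congr($(h1.symm) y)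
  have hA := A.chart_isOpenImmersion ⟨η, hF⟩
  have hB : IsOpenImmersion (A.chart ⟨η, hF⟩ ≫ π) := h1 ▸ B.chart_isOpenImmersion ⟨η, hG⟩
  have h3 : IsIso (π.stalkMap (A.chart ⟨η, hF⟩ y)) := by
    have h4 : IsIso ((A.chart ⟨η, hF⟩ ≫ π).stalkMap y) := inferInstance
    rw [Scheme.Hom.stalkMap_comp] at h4
    exact @IsIso.of_isIso_comp_right _ _ _ _ _ _ ((A.chart ⟨η, hF⟩).stalkMap y) inferInstance h4
  rw [h2]
  exact localRingIn_eq_of_isIso_stalkMap π _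

/-- If `m` is the integral form equal to `g` on `ρ`, then χ^m times the logarithmic form serves on
the chart of `ρ`. A point of codimension one of that chart lies in the chart of a common cone, where
nothing changes; the preimage is covered by the charts of the cones `σ ⊓ ρ`, on which `m` still
equals `g`. -/
theorem IsToricMorphism.isCrepant {n : ℕ} [IsDominant π] (h : IsToricMorphism A B π)
    (hF : IsGluable N F) (hG : IsGluable N G) (hFG : ∀ σ ∈ F, ∃ ρ ∈ G, σ ≤ ρ)
    (hinf : ∀ σ ∈ F, ∀ ρ ∈ G, σ ⊓ ρ ∈ F) {g : E → ℝ}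
    (hsm : ∀ σ ∈ F, ∃ σ' ∈ F, σ ≤ σ' ∧ ∃ l : Fin n → Module.Dual ℝ E, IsSmoothCone N σ' l ∧
      ∀ x ∈ σ', ∑ i, l i x = g x)
    (hg : ∀ ρ ∈ G, ∃ m ∈ dualLattice N, ∀ x ∈ ρ, m x = g x) (hray : HasRays N F G) :
    IsCrepant n A.str π := by
  obtain ⟨σ₀, hσ₀, -, l₀, h₀, -⟩ := hsm ⊥ hF.bot_mem
  intro y
  have key : ∀ {S T : Subring A.X.functionField}
      {ω : ⋀[A.X.functionField]^n (Ω[A.X.functionField⁄ℂ])}, S = T →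
      formLattice n T = Submodule.span T {ω} → formLattice n S = Submodule.span S {ω} := by
    rintro S _ ω rfl h
    exact h
  obtain ⟨ρ, y, rfl⟩ := B.cover y
  have hB := B.chart_isOpenImmersion ρ
  obtain ⟨m, hm, hmg⟩ := hg ρ.1 ρ.2
  refine ⟨(B.chart ρ).opensRange, ⟨y, rfl⟩,
    A.character hF (.ofAdd ⟨m, hm⟩) • h₀.logForm A hF, ?_, ?_⟩
  · rintro _ ⟨z, rfl⟩ hz
    obtain ⟨η, hle, hηF, hηG, ⟨z', rfl⟩⟩ := hray.exists_mem_range hF hG ρ.2 z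
      (height_of_ringKrullDim_stalk G B ρ z hz)
    have e1 : B.chart ρ (affineToricMap N hle z') = B.chart ⟨η, hηG⟩ z' :=
      congr($(B.chart_comp ⟨η, hηG⟩ ρ hle) z')
    have e2 := h.localRingIn_eq hηF hηG z'
    refine key (congrArg (localRingIn π) e1 |>.trans e2) ?_
    exact formLattice_eq_span_character hF hsm hσ₀ h₀ (κ := ⟨η, hηF⟩) (m := ⟨m, hm⟩)
      (fun x hx => hmg x (hle hx)) ⟨z', rfl⟩
  · intro x hx _
    obtain ⟨σ, hσ⟩ := A.cover x
    have h1 := h.exists_mem_range hF hG hFG hinf hσ hx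
    exact formLattice_eq_span_character hF hsm hσ₀ h₀
      (κ := ⟨σ.1 ⊓ ρ.1, hinf _ σ.2 _ ρ.2⟩) (m := ⟨m, hm⟩)
      (fun x hx => hmg x (inf_le_right (a := σ.1) hx)) h1

end CanonicalForm


/-! ### Linear forms on `N_ℝ` -/

section LinearForms

/-- The coordinates. -/
def X (k : Fin 6) : Module.Dual ℝ NR := (LinearMap.proj k).comp (Submodule.subtype _)

/-- The forms whose maximum is the support function of `-∇₁`. -/
def formA : Fin 4 → Module.Dual ℝ NR := ![0, -X 0, -X 1, -X 2]

/-- The forms whose maximum is the support function of `-∇₂`. -/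
def formB : Fin 4 → Module.Dual ℝ NR := ![0, -X 3, -X 4, -X 5]

theorem X_apply (k : Fin 6) (x : NR) : X k x = x.1 k := rfl

theorem sum_coord (x : NR) : x.1 0 + x.1 1 + x.1 2 + x.1 3 + x.1 4 + x.1 5 = 0 := by
  have := x.2
  rw [LinearMap.mem_ker] at this
  simpa [Fin.sum_univ_six] using this

theorem NR_ext {x y : NR} (h : ∀ k, X k x = X k y) : x = y := Subtype.ext (funext h)

theorem X_u (i k : Fin 6) : X k (u i) = (if k = i then 3 else 0) - if k < 3 then 1 else 0 := by
  rw [X_apply]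
  fin_cases k <;> simp [u, e, Pi.single_apply]

theorem X_v (i k : Fin 6) : X k (v i) = (if k = i then 3 else 0) - if 3 ≤ k then 1 else 0 := by
  rw [X_apply]
  fin_cases k <;> simp [v, e, Pi.single_apply]

theorem X_w (k : Fin 6) : X k w = if k < 3 then 1 else -1 := by
  rw [X_apply]
  fin_cases k <;> simp [w, e]

theorem u_add_w (k : Fin 6) : u k + w = v k := by
  apply NR_ext
  intro l
  rw [map_add, X_u, X_v, X_w]
  fin_cases l <;> simp <;> exact (sub_eq_add_neg _ _).symm

theorem sum_X : ∑ k, X k = 0 := by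
  ext x
  simpa [Fin.sum_univ_six, X_apply] using sum_coord x

/-- The form `3 z_k` of the barycentric type, relative to `A_i` and `B_j`. -/
def formZ (i j : Fin 4) (k : Fin 6) : Module.Dual ℝ NR :=
  X k + if k < 3 then formA i else formB j

/-- `A_i + B_j`. -/
def formT (i j : Fin 4) : Module.Dual ℝ NR := formA i + formB j

/-- The partial sums of the `formZ i j`, and `A_i`. -/
def formY (i j : Fin 4) (m : Fin 8) : Module.Dual ℝ NR :=
  if m = 7 then formA i else ∑ k : Fin 6 with k.val < m.val, formZ i j k

/-- The coordinates sum to zero, and A_i and B_j are added three times each. -/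
theorem sum_formZ (i j : Fin 4) : ∑ k, formZ i j k = 3 • formT i j := by
  have h := sum_X
  simp only [formZ, Finset.sum_add_distrib, h, formT]
  simp [Fin.sum_univ_six]
  abel

/-- The index `k` is the one excluded by `A_i` or by `B_j`. -/
def Excl (i j : Fin 4) (k : Fin 6) : Prop := (k < 3 ∧ i.val = k.val + 1) ∨ (3 ≤ k ∧ j.val + 2 = k.val)

instance (i j : Fin 4) (k : Fin 6) : Decidable (Excl i j k) := by
  unfold Excl
  infer_instance

theorem formZ_eq_zero {i j : Fin 4} {k : Fin 6} (h : Excl i j k) : formZ i j k = 0 := by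
  revert h
  fin_cases k <;> fin_cases i <;> fin_cases j <;> simp [Excl, formZ, formA, formB]

/-- Every coordinate is the negative of some A_i' or B_j', so z_k compares the chosen form with one
competitor. Its nonnegativity on the cell comes from here. -/
theorem formZ_eq (k : Fin 6) : (∃ i', ∀ i j : Fin 4, formZ i j k = formA i - formA i') ∨
    ∃ j', ∀ i j : Fin 4, formZ i j k = formB j - formB j' := by
  fin_cases k
  · exact .inl ⟨1, by simp [formZ, formA, add_comm]⟩
  · exact .inl ⟨2, by simp [formZ, formA, add_comm]⟩
  · exact .inl ⟨3, by simp [formZ, formA, add_comm]⟩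
  · exact .inr ⟨1, by simp [formZ, formB, add_comm]⟩
  · exact .inr ⟨2, by simp [formZ, formB, add_comm]⟩
  · exact .inr ⟨3, by simp [formZ, formB, add_comm]⟩

theorem formA_u (i : Fin 4) (k : Fin 6) :
    formA i (u k) = if i = 0 then 0 else if i.val = k.val + 1 then -2 else 1 := by
  fin_cases i <;> fin_cases k <;> simp [formA, X_u] <;> norm_num

theorem formB_u (j : Fin 4) (k : Fin 6) :
    formB j (u k) = if j = 0 then 0 else if j.val + 2 = k.val then -3 else 0 := by
  fin_cases j <;> fin_cases k <;> simp [formB, X_u]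

theorem formA_v (i : Fin 4) (k : Fin 6) :
    formA i (v k) = if i = 0 then 0 else if i.val = k.val + 1 then -3 else 0 := by
  fin_cases i <;> fin_cases k <;> simp [formA, X_v]

theorem formB_v (j : Fin 4) (k : Fin 6) :
    formB j (v k) = if j = 0 then 0 else if j.val + 2 = k.val then -2 else 1 := by
  fin_cases j <;> fin_cases k <;> simp [formB, X_v] <;> norm_num

theorem sum_formZ_apply (i j : Fin 4) (x : NR) :
    ∑ k, formZ i j k x = 3 * (formA i x + formB j x) := by
  have h := congrArg (fun m : Module.Dual ℝ NR => m x) (sum_formZ i j)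
  simpa [formT, mul_add] using h

/-- The multiples of the u_k reproduce all coordinates up to a multiple of w, which the relation
between the z_k and A_i + B_j determines. Where A_i and B_j are maximal, all coefficients are
nonnegative. -/
theorem eq_sum_u (i j : Fin 4) (x : NR) :
    x = ∑ k, (formZ i j k x / 3) • u k + formB j x • w := by
  have h := sum_formZ_apply i j x
  apply NR_ext
  intro l
  have h1 : ∑ k, formZ i j k x / 3 * X l (u k) =
      formZ i j l x - if l < 3 then formA i x + formB j x else 0 := by
    simp only [X_u, mul_sub, Finset.sum_sub_distrib, mul_ite, mul_zero, Finset.sum_ite_eq,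
      Finset.mem_univ, if_true]
    rw [div_mul_cancel₀ _ three_ne_zero]
    by_cases hl : l < 3 <;> simp [hl, ← Finset.sum_div, h]
  simp only [map_add, map_sum, map_smul, smul_eq_mul, h1, X_w]
  by_cases hl : l < 3
  · simp [hl, formZ]
    abel
  · simp [hl, formZ]

theorem eq_sum_v (i j : Fin 4) (x : NR) :
    x = ∑ k, (formZ i j k x / 3) • v k - formA i x • w := by
  have h := sum_formZ_apply i j x
  nth_rw 1 [eq_sum_u i j x]
  simp only [← u_add_w, smul_add, Finset.sum_add_distrib, ← Finset.sum_smul, ← Finset.sum_div, h]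
  module

theorem X_mem (k : Fin 6) : X k ∈ dualLattice latticeN := by
  rw [mem_dualLattice]
  exact fun x hx => hx k

theorem formA_mem (i : Fin 4) : formA i ∈ dualLattice latticeN := by
  fin_cases i
  · exact zero_mem _
  · exact neg_mem (X_mem 0)
  · exact neg_mem (X_mem 1)
  · exact neg_mem (X_mem 2)

theorem formB_mem (j : Fin 4) : formB j ∈ dualLattice latticeN := by
  fin_cases j
  · exact zero_mem _
  · exact neg_mem (X_mem 3)
  · exact neg_mem (X_mem 4)
  · exact neg_mem (X_mem 5)

theorem formT_mem (i j : Fin 4) : formT i j ∈ dualLattice latticeN :=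
  add_mem (formA_mem i) (formB_mem j)

theorem formZ_mem (i j : Fin 4) (k : Fin 6) : formZ i j k ∈ dualLattice latticeN := by
  refine add_mem (X_mem k) ?_
  split_ifs
  exacts [formA_mem i, formB_mem j]

theorem formY_mem (i j : Fin 4) (m : Fin 8) : formY i j m ∈ dualLattice latticeN := by
  unfold formY
  split_ifs
  exacts [formA_mem i, sum_mem fun k _ => formZ_mem i j k]

theorem u_mem (k : Fin 6) : u k ∈ latticeN := by
  intro l
  change ∃ z : ℤ, X l (u k) = z
  rw [X_u]
  exact ⟨(if l = k then 3 else 0) - if l < 3 then 1 else 0, by split_ifs <;> norm_num⟩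

theorem w_mem : w ∈ latticeN := by
  intro l
  change ∃ z : ℤ, X l w = z
  rw [X_w]
  exact ⟨if l < 3 then 1 else -1, by split_ifs <;> norm_num⟩

theorem v_mem (k : Fin 6) : v k ∈ latticeN := by
  rw [← u_add_w]
  exact add_mem (u_mem k) w_mem

end LinearForms

/-! ### The polytope `P` -/

section Polytope

/-- The support function of `-∇₁`. -/
def supA (x : NR) : ℝ := Finset.univ.sup' Finset.univ_nonempty fun i => formA i x

/-- The support function of `-∇₂`. -/
def supB (x : NR) : ℝ := Finset.univ.sup' Finset.univ_nonempty fun j => formB j x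

theorem formA_le (i : Fin 4) (x : NR) : formA i x ≤ supA x :=
  Finset.le_sup' (fun i => formA i x) (Finset.mem_univ i)

theorem formB_le (j : Fin 4) (x : NR) : formB j x ≤ supB x :=
  Finset.le_sup' (fun j => formB j x) (Finset.mem_univ j)

theorem exists_formA (x : NR) : ∃ i, formA i x = supA x := by
  obtain ⟨i, -, h⟩ := Finset.exists_mem_eq_sup' Finset.univ_nonempty fun i => formA i x
  exact ⟨i, h.symm⟩

theorem exists_formB (x : NR) : ∃ j, formB j x = supB x := by
  obtain ⟨j, -, h⟩ := Finset.exists_mem_eq_sup' Finset.univ_nonempty fun j => formB j x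
  exact ⟨j, h.symm⟩

theorem supA_nonneg (x : NR) : 0 ≤ supA x := by simpa [formA] using formA_le 0 x

theorem supB_nonneg (x : NR) : 0 ≤ supB x := by simpa [formB] using formB_le 0 x

theorem formZ_nonneg {i j : Fin 4} {x : NR} (hi : formA i x = supA x) (hj : formB j x = supB x)
    (k : Fin 6) : 0 ≤ formZ i j k x := by
  obtain ⟨i', h⟩ | ⟨j', h⟩ := formZ_eq k
  · rw [h, LinearMap.sub_apply, hi, sub_nonneg]
    exact formA_le i' x
  · rw [h, LinearMap.sub_apply, hj, sub_nonneg]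
    exact formB_le j' x

/-- The gauge function of `P`. -/
def gaugeP (x : NR) : ℝ := supA x + supB x

theorem gaugeP_nonneg (x : NR) : 0 ≤ gaugeP x := add_nonneg (supA_nonneg x) (supB_nonneg x)

/-- The nonnegative forms z_k sum to three times the gauge, so they all vanish, and `eq_sum_u`
leaves nothing. -/
theorem eq_zero_of_gaugeP {x : NR} (h : gaugeP x = 0) : x = 0 := by
  have ha := supA_nonneg x
  have hb := supB_nonneg x
  obtain ⟨i, hi⟩ := exists_formA x
  obtain ⟨j, hj⟩ := exists_formB x
  unfold gaugeP at h
  have hs : ∑ k, formZ i j k x = 0 := by rw [sum_formZ_apply, hi, hj, h, mul_zero]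
  rw [Finset.sum_eq_zero_iff_of_nonneg fun k _ => formZ_nonneg hi hj k] at hs
  have h1 : ∑ k, (formZ i j k x / 3) • u k = 0 :=
    Finset.sum_eq_zero fun k hk => by rw [hs k hk, zero_div, zero_smul]
  refine (eq_sum_u i j x).trans ?_
  rw [hj, h1, show supB x = 0 by linarith, zero_smul, add_zero]

theorem P_eq : P = convexHull ℝ (Set.range u ∪ Set.range v) := by
  rw [P, Delta₁, Delta₂]
  exact (convexHull ℝ).closure_sup_closure _ _

theorem u_mem_P (k : Fin 6) : u k ∈ P := by
  rw [P_eq]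
  exact subset_convexHull ℝ _ (.inl ⟨k, rfl⟩)

theorem v_mem_P (k : Fin 6) : v k ∈ P := by
  rw [P_eq]
  exact subset_convexHull ℝ _ (.inr ⟨k, rfl⟩)

theorem convex_P : Convex ℝ P := by
  rw [P_eq]
  exact convex_convexHull ℝ _

theorem sum_u_add_v : ∑ k, (u k + v k) = 0 := by
  apply NR_ext
  intro l
  simp only [map_sum, map_add, X_u, X_v, map_zero]
  fin_cases l <;> simp [Fin.sum_univ_six] <;> norm_num

theorem zero_mem_P : (0 : NR) ∈ P := by
  have h : ∀ k, u k + v k = (2 : ℝ) • ((1 / 2 : ℝ) • u k + (1 / 2 : ℝ) • v k) := fun k => by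
    module
  have := convex_P.sum_mem (t := Finset.univ) (w := fun _ : Fin 6 => (1 / 6 : ℝ))
    (z := fun k => (1 / 2 : ℝ) • u k + (1 / 2 : ℝ) • v k) (fun _ _ => by norm_num) (by simp)
    fun k _ => convex_P (u_mem_P k) (v_mem_P k) (by norm_num) (by norm_num) (by norm_num)
  rw [← Finset.smul_sum] at this
  have h2 := sum_u_add_v
  rw [Finset.sum_congr rfl fun k _ => h k, ← Finset.smul_sum] at h2
  rwa [(smul_eq_zero_iff_right (by norm_num : (2 : ℝ) ≠ 0)).1 h2, smul_zero] at this

theorem formT_le_of_mem {x : NR} (hx : x ∈ P) (i j : Fin 4) : formA i x + formB j x ≤ 1 := by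
  rw [P_eq] at hx
  have : convexHull ℝ (Set.range u ∪ Set.range v) ⊆ {x | formT i j x ≤ 1} := by
    refine convexHull_min ?_ (convex_halfSpace_le (formT i j).isLinear 1)
    rintro _ (⟨k, rfl⟩ | ⟨k, rfl⟩)
    · simp only [Set.mem_ofPred_eq, formT, LinearMap.add_apply, formA_u, formB_u]
      split_ifs <;> norm_num
    · simp only [Set.mem_ofPred_eq, formT, LinearMap.add_apply, formA_v, formB_v]
      split_ifs <;> norm_num
  exact this hx

/-- For the converse, x divided by its gauge is a convex combination: the weight of k is z_k over
three times the gauge, and the k-th point lies on the segment from u_k to v_k, with weights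
proportional to max A_i and max B_j. Then x lies between 0 and this point. -/
theorem mem_P_iff {x : NR} : x ∈ P ↔ gaugeP x ≤ 1 := by
  obtain ⟨i, hi⟩ := exists_formA x
  obtain ⟨j, hj⟩ := exists_formB x
  constructor
  · intro hx
    rw [gaugeP, ← hi, ← hj]
    exact formT_le_of_mem hx i j
  · intro hx
    obtain h0 | h0 := (gaugeP_nonneg x).eq_or_lt
    · rw [eq_zero_of_gaugeP h0.symm]
      exact zero_mem_P
    · have ha := supA_nonneg x
      have hb := supB_nonneg x
      have hs := sum_formZ_apply i j x
      rw [hi, hj, ← gaugeP] at hs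
      have hy : ∑ k, (formZ i j k x / (3 * gaugeP x)) •
          ((supA x / gaugeP x) • u k + (supB x / gaugeP x) • v k) ∈ P := by
        refine convex_P.sum_mem (fun k _ => ?_) ?_ fun k _ => ?_
        · exact div_nonneg (formZ_nonneg hi hj k) (by positivity)
        · rw [← Finset.sum_div, hs, div_self (by positivity)]
        · refine convex_P (u_mem_P k) (v_mem_P k) (by positivity) (by positivity) ?_
          rw [← add_div, ← gaugeP, div_self h0.ne']
      have hxy : x = gaugeP x • ∑ k, (formZ i j k x / (3 * gaugeP x)) •
          ((supA x / gaugeP x) • u k + (supB x / gaugeP x) • v k) := by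
        have : ∀ k, gaugeP x • (formZ i j k x / (3 * gaugeP x)) •
            ((supA x / gaugeP x) • u k + (supB x / gaugeP x) • v k) =
            (formZ i j k x / 3) • u k + (formZ i j k x * (supB x / (3 * gaugeP x))) • w := by
          intro k
          rw [← u_add_w, smul_smul, smul_add, smul_smul, smul_smul, smul_add, ← add_assoc, ← add_smul]
          congr 2
          · rw [gaugeP] at h0 ⊢
            field_simp
          · field_simp
        rw [Finset.smul_sum, Finset.sum_congr rfl fun k _ => this k, Finset.sum_add_distrib,
          ← Finset.sum_smul, ← Finset.sum_mul, hs]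
        nth_rw 1 [eq_sum_u i j x, hj]
        congr 2
        field_simp
      rw [hxy]
      exact convex_P.smul_mem_of_zero_mem zero_mem_P hy ⟨h0.le, hx⟩

theorem supA_smul {c : ℝ} (hc : 0 ≤ c) (x : NR) : supA (c • x) = c * supA x := by
  obtain ⟨i, hi⟩ := exists_formA x
  obtain ⟨i', hi'⟩ := exists_formA (c • x)
  apply le_antisymm
  · rw [← hi', map_smul, smul_eq_mul]
    exact mul_le_mul_of_nonneg_left (formA_le i' x) hc
  · rw [← hi, ← smul_eq_mul, ← map_smul]
    exact formA_le i _

theorem supB_smul {c : ℝ} (hc : 0 ≤ c) (x : NR) : supB (c • x) = c * supB x := by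
  obtain ⟨i, hi⟩ := exists_formB x
  obtain ⟨i', hi'⟩ := exists_formB (c • x)
  apply le_antisymm
  · rw [← hi', map_smul, smul_eq_mul]
    exact mul_le_mul_of_nonneg_left (formB_le i' x) hc
  · rw [← hi, ← smul_eq_mul, ← map_smul]
    exact formB_le i _

theorem gaugeP_smul {c : ℝ} (hc : 0 ≤ c) (x : NR) : gaugeP (c • x) = c * gaugeP x := by
  rw [gaugeP, supA_smul hc, supB_smul hc, gaugeP, mul_add]

theorem continuous_gaugeP : Continuous gaugeP := by
  unfold gaugeP supA supB
  refine .add ?_ ?_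
  · exact Continuous.finset_sup'_apply _ fun i _ => (formA i).continuous_of_finiteDimensional
  · exact Continuous.finset_sup'_apply _ fun i _ => (formB i).continuous_of_finiteDimensional

theorem interior_P : interior P = {x | gaugeP x < 1} := by
  apply Set.Subset.antisymm
  · intro x hx
    by_contra h
    have hx1 : gaugeP x = 1 := le_antisymm (mem_P_iff.1 (interior_subset hx)) (not_lt.1 h)
    -- A dilation by a factor slightly above 1 stays in the neighborhood but pushes the gauge beyond
    -- 1.
    have hc : Filter.Tendsto (fun c : ℝ => c • x) (nhdsWithin 1 (Set.Ioi 1)) (nhds x) := by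
      have : Continuous fun c : ℝ => c • x := by fun_prop
      simpa using (this.tendsto 1).mono_left nhdsWithin_le_nhds
    obtain ⟨c, hc1, hc2⟩ := ((hc.eventually (mem_interior_iff_mem_nhds.1 hx)).and
      self_mem_nhdsWithin).exists
    have hc2' : (1 : ℝ) < c := hc2
    have := mem_P_iff.1 hc1
    rw [gaugeP_smul (by linarith), hx1] at this
    linarith
  · exact interior_maximal (fun x hx => mem_P_iff.2 (le_of_lt hx))
      (isOpen_lt continuous_gaugeP continuous_const)

theorem isClosed_P : IsClosed P := by
  have : P = {x | gaugeP x ≤ 1} := Set.ext fun x => mem_P_iff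
  rw [this]
  exact isClosed_le continuous_gaugeP continuous_const

theorem frontier_P : frontier P = {x | gaugeP x = 1} := by
  rw [isClosed_P.frontier_eq, interior_P]
  ext x
  simp only [Set.mem_sdiff, mem_P_iff, Set.mem_ofPred_eq, not_lt]
  exact ⟨fun h => le_antisymm h.1 h.2, fun h => ⟨h.le, h.ge⟩⟩

theorem finrank_NR : Module.finrank ℝ NR = 5 := by
  have h := LinearMap.finrank_range_add_finrank_ker
    (∑ i : Fin 6, LinearMap.proj i : (Fin 6 → ℝ) →ₗ[ℝ] ℝ)
  have hr : LinearMap.range (∑ i : Fin 6, LinearMap.proj i : (Fin 6 → ℝ) →ₗ[ℝ] ℝ) = ⊤ := by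
    refine LinearMap.range_eq_top.2 fun c => ⟨Pi.single 0 c, ?_⟩
    simp
  rw [hr, finrank_top, Module.finrank_self, Module.finrank_fin_fun] at h
  change 1 + Module.finrank ℝ NR = 6 at h
  omega

end Polytope


/-! ### Edgewise subdivisions and preorders of linear forms -/

section Edgewise

theorem mem_iff_lt_card_of_isLowerSet {d : ℕ} {D : Finset (Fin d)} (hD : IsLowerSet (D : Set (Fin d)))
    (m : Fin d) : m ∈ D ↔ m.val < D.card := by
  constructor
  · intro h
    have : Finset.Iic m ⊆ D := fun k hk => hD (Finset.mem_Iic.1 hk) h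
    have := Finset.card_le_card this
    rw [Fin.card_Iic] at this
    omega
  · intro h
    by_contra hm
    have : D ⊆ Finset.Iio m := fun k hk =>
      Finset.mem_Iio.2 (lt_of_not_ge fun hmk => hm (hD hmk hk))
    have := Finset.card_le_card this
    rw [Fin.card_Iio] at this
    omega

theorem eq_of_partial_sums {M : Type*} [AddCommGroup M] {d : ℕ} {Z W : Fin d → M}
    (h : ∀ n ≤ d, ∑ m with m.val < n, Z m = ∑ m with m.val < n, W m) : Z = W := by
  funext m
  have hs : (Finset.univ.filter fun k : Fin d => k.val < m.val + 1) =
      insert m (Finset.univ.filter fun k : Fin d => k.val < m.val) := by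
    ext k
    simp only [Finset.mem_filter, Finset.mem_univ, true_and, Finset.mem_insert, Fin.ext_iff]
    omega
  have h1 := h (m.val + 1) m.2
  rw [hs, Finset.sum_insert (by simp), Finset.sum_insert (by simp), h m.val m.2.le] at h1
  exact add_right_cancel h1

/-- A total preorder on a finite chain can be sorted, with ties broken by the index. -/
theorem exists_sort {d : ℕ} (R : Fin d → Fin d → Prop) (refl : ∀ a, R a a)
    (trans : ∀ a b c, R a b → R b c → R a c) (total : ∀ a b, R a b ∨ R b a) :
    ∃ σ : Equiv.Perm (Fin d), (∀ a b, a ≤ b → R (σ a) (σ b)) ∧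
      ∀ a b, a ≤ b → R a b → σ.symm a ≤ σ.symm b := by
  classical
  let rank : Fin d → ℕ := fun a => (Finset.univ.filter fun b => R b a).card
  have rank_le : ∀ a b, R a b → rank a ≤ rank b := fun a b h =>
    Finset.card_le_card fun c hc => by
      simp only [Finset.mem_filter, Finset.mem_univ, true_and] at hc ⊢
      exact trans _ _ _ hc h
  have of_rank_le : ∀ a b, rank a ≤ rank b → R a b := by
    intro a b h
    obtain hab | hba := total a b
    · exact hab
    have hs : (Finset.univ.filter fun c => R c b) ⊆ Finset.univ.filter fun c => R c a := by
      intro c hc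
      simp only [Finset.mem_filter, Finset.mem_univ, true_and] at hc ⊢
      exact trans _ _ _ hc hba
    have := Finset.eq_of_subset_of_card_le hs h
    have ha : a ∈ Finset.univ.filter fun c => R c b := by simp [this, refl]
    simpa using ha
  let key : Fin d → ℕ ×ₗ Fin d := fun a => toLex (rank a, a)
  have hmono := Tuple.monotone_sort key
  refine ⟨Tuple.sort key, fun a b hab => of_rank_le _ _ ?_, fun a b hab h => ?_⟩
  · have := hmono hab
    simp only [key, Function.comp, Prod.Lex.toLex_le_toLex] at this
    obtain h | h := this
    exacts [h.le, h.1.le]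
  · by_contra hlt
    have := hmono (not_le.1 hlt).le
    simp only [key, Function.comp, Equiv.apply_symm_apply, Prod.Lex.toLex_le_toLex] at this
    have hr := rank_le a b h
    have hba : b ≤ a := by
      obtain h' | h' := this
      exacts [absurd h' (not_lt.2 hr), h'.2]
    exact hlt (le_of_eq (by rw [le_antisymm hab hba]))

variable {M : Type*} [AddCommGroup M]

/-- A family of forms in `S` that sums up to `3 t`, and whose partial sums are comparable modulo
`t`, is obtained from a chain `0 ≤ L 1 ≤ … ≤ L d ≤ t` by a simplex of the edgewise subdivision. -/
theorem exists_edgewise (S : AddSubmonoid M) {d : ℕ} {t : M} (ht : t ∈ S) {Z : Fin (d + 1) → M}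
    (hZ : ∀ m, Z m ∈ S) (hsum : ∑ m, Z m = 3 • t) {Y : Fin d → M}
    (hY : ∀ c, Y c = ∑ m with m.val < c.val + 1, Z m)
    (htot : ∀ c c' (k : ℤ), |k| ≤ 2 → Y c - Y c' - k • t ∈ S ∨ -(Y c - Y c' - k • t) ∈ S)
    (htot' : ∀ c (k : ℤ), |k| ≤ 2 → Y c - k • t ∈ S ∨ -(Y c - k • t) ∈ S) :
    ∃ (r : Fin d → Fin 3) (L : ℕ → M), L 0 = 0 ∧ L (d + 1) = t ∧
      (∀ n ≤ d, L (n + 1) - L n ∈ S) ∧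
      (∀ n, 1 ≤ n → n ≤ d → ∃ c, ∃ k : Fin 3, L n = Y c - (k.val : ℤ) • t) ∧
      ∀ m, Z m = ∑ j : Fin (d + 1),
        (Finset.univ.filter fun i => colorScheme r i j = m).card • (L (j.val + 1) - L j.val) := by
  classical
  have hYS : ∀ c, Y c ∈ S := fun c => by
    rw [hY]
    exact sum_mem fun m _ => hZ m
  have hYt : ∀ c, 3 • t - Y c ∈ S := fun c => by
    rw [← hsum, hY, ← Finset.sum_filter_add_sum_filter_not Finset.univ
      (fun m : Fin (d + 1) => m.val < c.val + 1), add_sub_cancel_left]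
    exact sum_mem fun m _ => hZ m
  have hYmono : ∀ c c', c ≤ c' → Y c' - Y c ∈ S := fun c c' h => by
    rw [hY, hY, ← Finset.sum_sdiff_eq_sub]
    · exact sum_mem fun m _ => hZ m
    · intro m hm
      simp only [Finset.mem_filter, Finset.mem_univ, true_and] at hm ⊢
      have : c.val ≤ c'.val := h
      omega
  -- `ρ c` and `f c` play the roles of the integral and the fractional part of `Y c` in units of
  -- `t`; the value 2 also covers `Y c = 3 t`.
  let ρ : Fin d → Fin 3 := fun c => if Y c - 2 • t ∈ S then 2 else if Y c - t ∈ S then 1 else 0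
  let f : Fin d → M := fun c => Y c - ((ρ c).val : ℤ) • t
  have hρ2 : ∀ c, Y c - 2 • t ∈ S → ρ c = 2 := fun c h => if_pos h
  have hρ1 : ∀ c, Y c - 2 • t ∉ S → Y c - t ∈ S → ρ c = 1 := fun c h h' => by simp [ρ, h, h']
  have hρ0 : ∀ c, Y c - 2 • t ∉ S → Y c - t ∉ S → ρ c = 0 := fun c h h' => by simp [ρ, h, h']
  have hf : ∀ c, f c ∈ S ∧ t - f c ∈ S := by
    intro c
    by_cases h2 : Y c - 2 • t ∈ S
    · have : f c = Y c - 2 • t := by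
        simp only [f, hρ2 c h2]
        congr 1
        exact ofNat_zsmul t 2
      rw [this]
      refine ⟨h2, ?_⟩
      convert hYt c using 1
      abel
    have h2' : 2 • t - Y c ∈ S := by
      have := (htot' c 2 (by norm_num)).resolve_left (by rwa [ofNat_zsmul])
      rwa [neg_sub, ofNat_zsmul] at this
    by_cases h1 : Y c - t ∈ S
    · have : f c = Y c - t := by simp [f, hρ1 c h2 h1]
      rw [this]
      refine ⟨h1, ?_⟩
      convert h2' using 1
      abel
    · have : f c = Y c := by simp [f, hρ0 c h2 h1]
      rw [this]
      refine ⟨hYS c, ?_⟩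
      have := (htot' c 1 (by norm_num)).resolve_left (by rwa [one_zsmul])
      rwa [neg_sub, one_zsmul] at this
  have hρmono : ∀ c c', c ≤ c' → ρ c ≤ ρ c' := by
    intro c c' h
    have h2 : Y c - 2 • t ∈ S → Y c' - 2 • t ∈ S := fun h' => by
      convert add_mem (hYmono c c' h) h' using 1
      abel
    have h1 : Y c - t ∈ S → Y c' - t ∈ S := fun h' => by
      convert add_mem (hYmono c c' h) h' using 1
      abel
    simp only [ρ]
    split_ifs <;> first | exact absurd (h2 ‹_›) ‹_› | exact absurd (h1 ‹_›) ‹_› | decide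
  -- Sorting the fractional parts gives the chain. Breaking ties by the index matters below, where
  -- the dividing lines passed have to form a lower set.
  obtain ⟨σ, hσ, hσ'⟩ := exists_sort (fun a b => f b - f a ∈ S) (fun a => by simp)
    (fun a b c h h' => by
      convert add_mem h h' using 1
      abel) (fun a b => by
      have hk : |((ρ b).val : ℤ) - (ρ a).val| ≤ 2 := by
        have := (ρ a).2
        have := (ρ b).2
        rw [abs_le]
        omega
      have e1 : Y b - Y a - (((ρ b).val : ℤ) - (ρ a).val) • t = f b - f a := by
        simp only [f, sub_smul]
        abel
      have := htot b a _ hk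
      rwa [e1, neg_sub] at this)
  -- The index is shifted by one, since the chain starts with 0 and ends with `t` at the place d +
  -- 1.
  let L : ℕ → M := fun n =>
    if n = 0 then 0 else if h : n - 1 < d then f (σ ⟨n - 1, h⟩) else t
  have hL0 : L 0 = 0 := rfl
  have hLs : ∀ n (h : n < d), L (n + 1) = f (σ ⟨n, h⟩) := fun n h => by simp [L, h]
  have hLd : L (d + 1) = t := by simp [L]
  -- The dividing line after the column c lies in the row given by the integral part of the c-th
  -- form in sorted order.
  refine ⟨fun c => ρ (σ c), L, hL0, hLd, ?_, ?_, ?_⟩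
  · intro n hn
    obtain rfl | hn' := hn.eq_or_lt
    · rw [hLd]
      cases n with
      | zero => simpa [hL0] using ht
      | succ n =>
        rw [hLs n (Nat.lt_succ_self n)]
        exact (hf _).2
    · rw [hLs n hn']
      cases n with
      | zero => simpa [hL0] using (hf _).1
      | succ n =>
        rw [hLs n (by omega)]
        exact hσ _ _ (Nat.le_succ n)
  · intro n h1 hn
    obtain ⟨n, rfl⟩ := Nat.exists_eq_add_of_le' h1
    exact ⟨_, _, hLs n hn⟩
  -- The lines passed before the entry (i, j) belong to a lower set of indices, so their number
  -- exceeds m exactly if the line of m is among them.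
  · have hcolor : ∀ (i : Fin 3) (j : Fin (d + 1)) (m : Fin d),
        (colorScheme (fun c => ρ (σ c)) i j).val < m.val + 1 ↔
          i < ρ m ∨ (i = ρ m ∧ j.val ≤ (σ.symm m).val) := by
      intro i j m
      let D : Finset (Fin d) :=
        Finset.univ.filter fun m => ρ m < i ∨ (ρ m = i ∧ (σ.symm m).castSucc < j)
      have hD : IsLowerSet (D : Set (Fin d)) := by
        intro a b hba ha
        simp only [D, Finset.coe_filter, Finset.mem_univ, true_and, Set.mem_ofPred_eq] at ha ⊢
        have hr := hρmono b a hba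
        obtain ha | ⟨ha, ha'⟩ := ha
        · exact .inl (hr.trans_lt ha)
        · obtain hr | hr := hr.lt_or_eq
          · exact .inl (ha ▸ hr)
          · refine .inr ⟨hr.trans ha, lt_of_le_of_lt ?_ ha'⟩
            refine Fin.castSucc_le_castSucc_iff.2 (hσ' b a hba ?_)
            convert hYmono b a hba using 1
            simp only [f, hr]
            abel
      have hcard : (colorScheme (fun c => ρ (σ c)) i j).val = D.card := by
        unfold colorScheme
        dsimp only
        refine Finset.card_bij (fun c _ => σ c) ?_ (fun _ _ _ _ h => σ.injective h) ?_
        · intro c hc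
          simpa [D] using hc
        · intro m hm
          exact ⟨σ.symm m, by simpa [D] using hm, by simp⟩
      have hm := mem_iff_lt_card_of_isLowerSet hD m
      rw [hcard, Nat.lt_succ_iff, ← not_lt, ← hm]
      simp only [D, Finset.mem_filter, Finset.mem_univ, true_and, not_or, not_and, not_lt,
        Fin.lt_def, Fin.ext_iff, Fin.val_castSucc]
      omega
    -- In each column the entries at most m fill the rows above the line of m, and the row of the
    -- line as well if the column is to the left of it.
    have hcount : ∀ (j : Fin (d + 1)) (m : Fin d),
        (Finset.univ.filter fun i =>
          (colorScheme (fun c => ρ (σ c)) i j).val < m.val + 1).card =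
          (ρ m).val + if j.val < (σ.symm m).val + 1 then 1 else 0 := by
      intro j m
      simp only [hcolor]
      generalize ρ m = q
      by_cases hj : j.val ≤ (σ.symm m).val
      · simp only [hj, and_true, Nat.lt_succ_iff, if_true]
        revert q
        decide
      · simp only [hj, and_false, or_false, Nat.lt_succ_iff, if_false]
        revert q
        decide
    have htel : ∀ n ≤ d + 1, ∑ j : Fin (d + 1) with j.val < n, (L (j.val + 1) - L j.val) = L n := by
      intro n hn
      have : ∑ j : Fin (d + 1) with j.val < n, (L (j.val + 1) - L j.val) =
          ∑ j ∈ Finset.range n, (L (j + 1) - L j) := by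
        refine Finset.sum_bij (fun j _ => j.val) (fun j hj => by simpa using hj)
          (fun _ _ _ _ h => Fin.ext h) (fun j hj => ?_) fun _ _ => rfl
        have hj' := Finset.mem_range.1 hj
        exact ⟨⟨j, by omega⟩, by simpa using hj', rfl⟩
      rw [this, Finset.sum_range_sub, hL0, sub_zero]
    have htel' : ∑ j : Fin (d + 1), (L (j.val + 1) - L j.val) = t := by
      rw [← hLd, ← htel (d + 1) le_rfl, Finset.filter_true_of_mem fun j _ => j.2]
    have hpart : ∀ n : ℕ, ∑ m : Fin (d + 1) with m.val < n, ∑ j : Fin (d + 1),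
        (Finset.univ.filter fun i => colorScheme (fun c => ρ (σ c)) i j = m).card •
          (L (j.val + 1) - L j.val) = ∑ j : Fin (d + 1), (Finset.univ.filter fun i =>
            (colorScheme (fun c => ρ (σ c)) i j).val < n).card • (L (j.val + 1) - L j.val) := by
      intro n
      rw [Finset.sum_comm]
      refine Finset.sum_congr rfl fun j _ => ?_
      rw [← Finset.sum_smul]
      congr 1
      rw [Finset.card_eq_sum_card_fiberwise (t := Finset.univ.filter fun m : Fin (d + 1) => m.val < n)
        (f := fun i => colorScheme (fun c => ρ (σ c)) i j) (fun i hi => by simpa using hi)]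
      refine Finset.sum_congr rfl fun m hm => ?_
      rw [Finset.filter_filter]
      congr 1
      ext i
      simp only [Finset.mem_filter, Finset.mem_univ, true_and] at hm ⊢
      exact ⟨fun h => ⟨by rwa [h], h⟩, fun h => h.2⟩
    -- For the partial sums the counts give integral part times `t` plus a telescoping sum that ends
    -- at the fractional part.
    refine congrFun (eq_of_partial_sums fun n hn => ?_)
    rw [hpart]
    obtain rfl | hn' := hn.eq_or_lt
    · simp only [Fin.is_lt, Finset.filter_true, Finset.card_univ, Fintype.card_fin, hsum]
      rw [← Finset.smul_sum, htel']
    cases n with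
    | zero => simp
    | succ n =>
      have hn'' : n < d := by omega
      have h1 := hY ⟨n, hn''⟩
      simp only at h1
      rw [← h1]
      have h2 := hcount (m := ⟨n, hn''⟩)
      simp only at h2
      simp only [h2, add_smul, Finset.sum_add_distrib, ite_smul, one_smul, zero_smul]
      rw [← Finset.smul_sum, htel', ← Finset.sum_filter, htel _ (by omega), hLs _ (Fin.is_lt _)]
      simp [f]

end Edgewise


/-! ### The simplices of the triangulation as frames -/

section Frames

/-- The edgewise subdivision of a simplex induces that of each facet: the scheme of the facet arises
from a scheme with one more dividing line by dropping a column. Only finitely many cases occur. -/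
theorem exists_colorScheme_succAbove (a b c : Fin 3) (m : Fin 5) :
    ∃ (q : Fin 4) (y : Fin 3) (s : Fin 5), ∀ (i : Fin 3) (j : Fin 4),
      colorScheme (Fin.insertNth q y ![a, b, c] : Fin 4 → Fin 3) i (s.succAbove j) =
        m.succAbove (colorScheme ![a, b, c] i j) := by
  revert a b c m
  decide +kernel

theorem ofFn_succAbove_sublist (c : Fin 5) : (List.ofFn c.succAbove).Sublist (List.finRange 5) := by
  revert c
  decide

/-- The index in `{1, 2, 3}` of the facet that belongs to the form `A_i`. -/
def idxA (i : Fin 4) : Fin 6 := ⟨i.val - 1, by omega⟩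

/-- The index in `{4, 5, 6}` of the facet that belongs to the form `B_j`. -/
def idxB (j : Fin 4) : Fin 6 := ⟨j.val + 2, by omega⟩

/-- The triangulation of the facet on which `A_i + B_j = 1`. -/
def tauAt (i j : Fin 4) : Set (List NR) :=
  if j = 0 then tauU (idxA i) else if i = 0 then tauV (idxB j) else tauC (idxA i) (idxB j)

/-- The forms whose signs distinguish the simplices of the triangulation. -/
def formH (i j : Fin 4) (m l : Fin 8) (k : Fin 5) : Module.Dual ℝ NR :=
  formY i j m - formY i j l - ((k.val : ℤ) - 2) • formT i j

/-- In the preorder with the nonnegative forms `S`, the forms `A_i` and `B_j` are maximal, and the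
forms `formH i j` have a sign. -/
structure Selects (S : AddSubmonoid (Module.Dual ℝ NR)) (i j : Fin 4) : Prop where
  subA : ∀ i', formA i - formA i' ∈ S
  subB : ∀ j', formB j - formB j' ∈ S
  total : ∀ m l k, formH i j m l k ∈ S ∨ -formH i j m l k ∈ S

/-- A lattice simplex of the triangulation of the facet `A_i + B_j = 1`, with the dual basis. -/
structure IsFrame (i j : Fin 4) (p : Fin 5 → NR) (l : Fin 5 → Module.Dual ℝ NR) : Prop where
  mem_lattice : ∀ k, p k ∈ latticeN
  mem_dual : ∀ k, l k ∈ dualLattice latticeN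
  eq_sum : ∀ x, x = ∑ k, l k x • p k
  sum_eq : ∑ k, l k = formT i j
  mem_tauAt : List.ofFn p ∈ tauAt i j
  ne_zero : i ≠ 0 ∨ j ≠ 0

variable {S : AddSubmonoid (Module.Dual ℝ NR)} {i j : Fin 4}

theorem Selects.formA_mem (h : Selects S i j) : formA i ∈ S := by
  simpa [formA] using h.subA 0

theorem Selects.formB_mem (h : Selects S i j) : formB j ∈ S := by
  simpa [formB] using h.subB 0

theorem Selects.formT_mem (h : Selects S i j) : formT i j ∈ S := add_mem h.formA_mem h.formB_mem

theorem Selects.formZ_mem (h : Selects S i j) (k : Fin 6) : formZ i j k ∈ S := by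
  obtain ⟨i', hk⟩ | ⟨j', hk⟩ := formZ_eq k
  · rw [hk]
    exact h.subA i'
  · rw [hk]
    exact h.subB j'

theorem formY_seven (i j : Fin 4) : formY i j 7 = formA i := if_pos rfl

theorem formY_zero (i j : Fin 4) : formY i j 0 = 0 := by simp [formY]

/-- The last index of `formH` encodes the integers from -2 to 2 by a shift. -/
theorem Selects.total' (h : Selects S i j) (m l : Fin 8) {k : ℤ} (hk : |k| ≤ 2) :
    formY i j m - formY i j l - k • formT i j ∈ S ∨
      -(formY i j m - formY i j l - k • formT i j) ∈ S := by
  rw [abs_le] at hk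
  have hk' : (((k + 2).toNat : ℕ) : ℤ) - 2 = k := by omega
  have := h.total m l ⟨(k + 2).toNat, by omega⟩
  simpa only [formH, hk'] using this

/-- Excluded indices contribute zero, so partial sums over the vertices of a facet are partial sums
over all six indices. The walls can therefore be written uniformly for all facets. -/
theorem formY_eq_sum {d : ℕ} {f : Fin d → Fin 6} (hf : StrictMono f)
    (h0 : ∀ k, k ∉ Set.range f → formZ i j k = 0) (c : Fin d) :
    formY i j ⟨(f c).val + 1, by omega⟩ = ∑ m with m.val < c.val + 1, formZ i j (f m) := by
  have h7 : (⟨(f c).val + 1, by omega⟩ : Fin 8) ≠ 7 := by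
    rw [Ne, Fin.ext_iff]
    simp
    omega
  rw [formY, if_neg h7]
  symm
  refine Finset.sum_of_injOn f hf.injective.injOn ?_ ?_ fun _ _ => rfl
  · intro m hm
    simp only [Finset.coe_filter, Finset.mem_univ, true_and, Set.mem_ofPred_eq] at hm ⊢
    have : f m ≤ f c := hf.monotone (Nat.lt_succ_iff.1 hm)
    exact Nat.lt_succ_of_le this
  · intro k hk hk'
    refine h0 k fun ⟨m, hm⟩ => hk' ⟨m, ?_, hm⟩
    simp only [Finset.coe_filter, Finset.mem_filter, Finset.mem_univ, true_and,
      Set.mem_ofPred_eq] at hk ⊢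
    rw [← hm] at hk
    have : f m ≤ f c := Nat.lt_succ_iff.1 hk
    exact Nat.lt_succ_of_le (hf.le_iff_le.1 this)

/-- The factor 1/3 cancels in the terms 3 e_i, and the subtracted e_1 + e_2 + e_3 is the same in all
three summands. -/
theorem thirds_mem_latticeN (c : Fin 3 → Fin 6) : ((3 : ℕ) : ℝ)⁻¹ • ∑ i, u (c i) ∈ latticeN := by
  intro k
  refine ⟨(∑ i, if k = c i then 1 else 0) - if k < 3 then 1 else 0, ?_⟩
  change X k (((3 : ℕ) : ℝ)⁻¹ • ∑ i, u (c i)) = _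
  simp only [map_smul, Fin.sum_univ_three, map_add, X_u, smul_eq_mul]
  push_cast
  split_ifs <;> norm_num

theorem thirds_mem_latticeN' (c : Fin 3 → Fin 6) : ((3 : ℕ) : ℝ)⁻¹ • ∑ i, v (c i) ∈ latticeN := by
  have : ((3 : ℕ) : ℝ)⁻¹ • ∑ i, v (c i) = ((3 : ℕ) : ℝ)⁻¹ • ∑ i, u (c i) + w := by
    simp only [← u_add_w, Fin.sum_univ_three]
    push_cast
    module
  rw [this]
  exact add_mem (thirds_mem_latticeN c) w_mem

/-- The edgewise simplex selected by `S`, in terms of forms. -/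
theorem Selects.exists_edgewise (h : Selects S i j) {d : ℕ} {f : Fin (d + 1) → Fin 6}
    (hf : StrictMono f) (h0 : ∀ k, k ∉ Set.range f → formZ i j k = 0) :
    ∃ (r : Fin d → Fin 3) (L : ℕ → Module.Dual ℝ NR), L 0 = 0 ∧ L (d + 1) = formT i j ∧
      (∀ n ≤ d, L (n + 1) - L n ∈ S) ∧ (∀ n ≤ d + 1, L n ∈ dualLattice latticeN) ∧
      (∀ n, 1 ≤ n → n ≤ d → L n - formA i ∈ S ∨ formA i - L n ∈ S) ∧
      ∀ (y : Fin 6 → NR) (x : NR), ∑ k, (formZ i j k x / 3) • y k = ∑ m : Fin (d + 1),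
        (L (m.val + 1) - L m.val) x • ((3 : ℕ) : ℝ)⁻¹ • ∑ a : Fin 3, y (f (colorScheme r a m)) := by
  classical
  have hsum : ∑ m, formZ i j (f m) = 3 • formT i j := by
    rw [← sum_formZ]
    exact Finset.sum_of_injOn f hf.injective.injOn (by simp) (fun k _ hk => h0 k (by simpa using hk))
      fun _ _ => rfl
  -- The comparisons required are signs of wall forms; those of a single partial sum are the walls
  -- against Y_0 = 0.
  obtain ⟨r, L, hL0, hLd, hLS, hL, hZ⟩ := CubicsMPCP.exists_edgewise S h.formT_mem
    (Z := fun m => formZ i j (f m)) (fun m => h.formZ_mem _) hsum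
    (Y := fun c : Fin d => formY i j ⟨(f c.castSucc).val + 1, by omega⟩)
    (fun c => formY_eq_sum hf h0 c.castSucc) (fun c c' k hk => h.total' _ _ hk)
    (fun c k hk => by simpa [formY_zero] using h.total' ⟨(f c.castSucc).val + 1, by omega⟩ 0 hk)
  refine ⟨r, L, hL0, hLd, hLS, ?_, ?_, ?_⟩
  · intro n hn
    obtain rfl | hn0 := Nat.eq_zero_or_pos n
    · rw [hL0]
      exact zero_mem _
    obtain rfl | hn' := hn.eq_or_lt
    · rw [hLd]
      exact CubicsMPCP.formT_mem i j
    · obtain ⟨c, k, hc⟩ := hL n hn0 (by omega)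
      rw [hc]
      exact sub_mem (formY_mem i j _) (zsmul_mem (CubicsMPCP.formT_mem i j) _)
  · intro n hn0 hn
    obtain ⟨c, k, hc⟩ := hL n hn0 hn
    -- The walls against Y_7 = A_i place A_i in the chain, as the prism subdivision requires.
    have := h.total' ⟨(f c.castSucc).val + 1, by omega⟩ 7 (k := k.val) (by
      rw [abs_le]
      omega)
    rw [formY_seven] at this
    rw [hc]
    convert this using 2 <;> abel
  · intro y x
    have h1 : ∑ k, (formZ i j k x / 3) • y k = ∑ m, (formZ i j (f m) x / 3) • y (f m) := by
      symm
      refine Finset.sum_of_injOn f hf.injective.injOn (by simp) (fun k _ hk => ?_) fun _ _ => rfl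
      rw [h0 k (by simpa using hk)]
      simp
    have h2 : ∀ m, (formZ i j (f m) x / 3) • y (f m) = ∑ n : Fin (d + 1),
        (L (n.val + 1) - L n.val) x • ((3 : ℕ) : ℝ)⁻¹ •
          ∑ a with colorScheme r a n = m, y (f (colorScheme r a n)) := by
      intro m
      have h3 : ∀ n, ∑ a with colorScheme r a n = m, y (f (colorScheme r a n)) =
          ((Finset.univ.filter fun a => colorScheme r a n = m).card : ℝ) • y (f m) := by
        intro n
        rw [Finset.sum_congr rfl fun a ha => by rw [(Finset.mem_filter.1 ha).2],
          Finset.sum_const, Nat.cast_smul_eq_nsmul]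
      simp only [h3, smul_smul, ← Finset.sum_smul]
      congr 1
      rw [hZ m, LinearMap.sum_apply, Finset.sum_div]
      refine Finset.sum_congr rfl fun n _ => ?_
      rw [LinearMap.smul_apply, nsmul_eq_mul]
      push_cast
      ring
    rw [h1, Finset.sum_congr rfl fun m _ => h2 m, Finset.sum_comm]
    refine Finset.sum_congr rfl fun n _ => ?_
    rw [← Finset.smul_sum, ← Finset.smul_sum]
    congr 2
    exact Finset.sum_fiberwise _ _ _

end Frames


/-! ### Existence of a frame for each admissible preorder. -/

section ExistsFrame

variable {S : AddSubmonoid (Module.Dual ℝ NR)} {i j : Fin 4}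

theorem excl_idxA (hi : i ≠ 0) (j : Fin 4) : Excl i j (idxA i) := by
  revert i j
  decide

theorem excl_idxB (i : Fin 4) (hj : j ≠ 0) : Excl i j (idxB j) := by
  revert i j
  decide

theorem formA_zero : formA 0 = 0 := rfl

theorem formB_zero : formB 0 = 0 := rfl

/-- This is the facet P(U_i). As B_0 = 0, the multiple of w in `eq_sum_u` disappears, and the
differences of the edgewise chain are the dual basis. -/
theorem Selects.exists_frame_of_right_eq_zero (h : Selects S i 0) (hi : i ≠ 0) :
    ∃ p l, IsFrame i 0 p l ∧ ∀ k, l k ∈ S := by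
  obtain ⟨r, L, hL0, hLd, hLS, hLN, -, hsum⟩ := h.exists_edgewise
    (Fin.strictMono_succAbove (idxA i)) fun k hk => by
      rw [Fin.range_succAbove, Set.mem_compl_iff, not_not] at hk
      rw [hk]
      exact formZ_eq_zero (excl_idxA hi 0)
  refine ⟨fun m => ((3 : ℕ) : ℝ)⁻¹ • ∑ a : Fin 3, u ((idxA i).succAbove (colorScheme r a m)),
    fun m => L (m.val + 1) - L m.val, ⟨fun k => thirds_mem_latticeN _,
      fun k => sub_mem (hLN _ (by omega)) (hLN _ (by omega)), fun x => ?_, ?_, ?_, .inl hi⟩,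
      fun k => hLS _ (by omega)⟩
  · rw [← hsum u x]
    refine (eq_sum_u i 0 x).trans ?_
    rw [formB_zero, LinearMap.zero_apply, zero_smul, add_zero]
  · rw [Fin.sum_univ_eq_sum_range (fun n => L (n + 1) - L n), Finset.sum_range_sub, hL0, hLd,
      sub_zero]
  · rw [tauAt, if_pos rfl]
    exact ⟨by simp, _, ⟨r, rfl⟩, List.Sublist.refl _⟩

theorem Selects.exists_frame_of_left_eq_zero (h : Selects S 0 j) (hj : j ≠ 0) :
    ∃ p l, IsFrame 0 j p l ∧ ∀ k, l k ∈ S := by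
  obtain ⟨r, L, hL0, hLd, hLS, hLN, -, hsum⟩ := h.exists_edgewise
    (Fin.strictMono_succAbove (idxB j)) fun k hk => by
      rw [Fin.range_succAbove, Set.mem_compl_iff, not_not] at hk
      rw [hk]
      exact formZ_eq_zero (excl_idxB 0 hj)
  refine ⟨fun m => ((3 : ℕ) : ℝ)⁻¹ • ∑ a : Fin 3, v ((idxB j).succAbove (colorScheme r a m)),
    fun m => L (m.val + 1) - L m.val, ⟨fun k => thirds_mem_latticeN' _,
      fun k => sub_mem (hLN _ (by omega)) (hLN _ (by omega)), fun x => ?_, ?_, ?_, .inr hj⟩,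
      fun k => hLS _ (by omega)⟩
  · rw [← hsum v x]
    refine (eq_sum_v 0 j x).trans ?_
    rw [formA_zero, LinearMap.zero_apply, zero_smul, sub_zero]
  · rw [Fin.sum_univ_eq_sum_range (fun n => L (n + 1) - L n), Finset.sum_range_sub, hL0, hLd,
      sub_zero]
  · rw [tauAt, if_neg hj, if_pos rfl]
    exact ⟨by simp, _, ⟨r, rfl⟩, List.Sublist.refl _⟩

/-- An edgewise simplex of a facet of an ordered simplex is a face of an edgewise simplex. -/
theorem edgewise_succAbove {E : Type} [AddCommGroup E] [Module ℝ E] (p : Fin 5 → E) (m : Fin 5)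
    (r : Fin 3 → Fin 3) :
    (List.ofFn fun n : Fin 4 => ((3 : ℕ) : ℝ)⁻¹ •
      ∑ a : Fin 3, p (m.succAbove (colorScheme r a n))) ∈ edgewise 3 p := by
  obtain ⟨q, y, s, hs⟩ := exists_colorScheme_succAbove (r 0) (r 1) (r 2) m
  have hr : ![r 0, r 1, r 2] = r := by
    ext k
    fin_cases k <;> rfl
  rw [hr] at hs
  refine ⟨by simp, _, ⟨(Fin.insertNth q y r : Fin 4 → Fin 3), rfl⟩, ?_⟩
  have := (ofFn_succAbove_sublist s).map fun n => ((3 : ℕ) : ℝ)⁻¹ •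
    ∑ a : Fin 3, p (colorScheme (Fin.insertNth q y r : Fin 4 → Fin 3) a n)
  rw [List.map_ofFn, ← List.ofFn_eq_map] at this
  simpa only [Function.comp_def, hs] using this

theorem thirds_mem_hull (s : Set NR) (y : Fin 3 → NR) (hy : ∀ a, y a ∈ s) :
    ((3 : ℕ) : ℝ)⁻¹ • ∑ a, y a ∈ PointedCone.hull ℝ s :=
  (PointedCone.hull ℝ s).smul_mem (by positivity : (0 : ℝ) ≤ ((3 : ℕ) : ℝ)⁻¹)
    (sum_mem fun a _ => Submodule.subset_span (hy a))

/-- Inserting `A` into a chain of forms of length four. -/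
theorem exists_prism {S : AddSubmonoid (Module.Dual ℝ NR)} {q : Fin 4 → NR}
    {L : ℕ → Module.Dual ℝ NR} {A T : Module.Dual ℝ NR} (hL0 : L 0 = 0) (hL4 : L 4 = T)
    (hLS : ∀ n ≤ 3, L (n + 1) - L n ∈ S)
    (hLA : ∀ n, 1 ≤ n → n ≤ 3 → L n - A ∈ S ∨ A - L n ∈ S) (hA : A ∈ S) (hTA : T - A ∈ S) :
    ∃ (p : Fin 5 → NR) (l : Fin 5 → Module.Dual ℝ NR),
      (∀ k, (∃ n, p k = q n) ∨ ∃ n, p k = q n + w) ∧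
      (∀ k, ∃ m m', l k = m - m' ∧ (m = A ∨ ∃ n ≤ 4, m = L n) ∧ (m' = A ∨ ∃ n ≤ 4, m' = L n)) ∧
      (∀ x, ∑ k, l k x • p k = ∑ n : Fin 4, (L (n.val + 1) - L n.val) x • q n + (T - A) x • w) ∧
      ∑ k, l k = T ∧ (∃ n < (List.ofFn q).length, List.ofFn p =
        (List.ofFn q).take (n + 1) ++ ((List.ofFn q).map (· + w)).drop n) ∧ ∀ k, l k ∈ S := by
  classical
  have hex : ∃ n, L (n + 1) - A ∈ S := ⟨3, by rwa [hL4]⟩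
  -- The place in the chain where `A` is inserted: the first gap whose upper end dominates it.
  obtain ⟨n, hn, hn1, hn2⟩ : ∃ n ≤ 3, L (n + 1) - A ∈ S ∧ A - L n ∈ S := by
    have h3 : Nat.find hex ≤ 3 := Nat.find_min' hex (by rwa [hL4])
    refine ⟨Nat.find hex, h3, Nat.find_spec hex, ?_⟩
    obtain h0 | h0 := Nat.eq_zero_or_pos (Nat.find hex)
    · rwa [h0, hL0, sub_zero]
    · refine (hLA _ h0 h3).resolve_left ?_
      have := Nat.find_min hex (Nat.sub_lt h0 one_pos)
      rwa [show Nat.find hex - 1 + 1 = Nat.find hex by omega] at this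
  obtain ⟨M, hMdef⟩ : ∃ M : ℕ → Module.Dual ℝ NR, ∀ m, M m =
    if m ≤ n then L m else if m = n + 1 then A else L (m - 1) := ⟨_, fun _ => rfl⟩
  have hM : ∀ m ≤ 5, M m = A ∨ ∃ n ≤ 4, M m = L n := by
    intro m hm
    rw [hMdef]
    split_ifs
    · exact .inr ⟨m, by omega, rfl⟩
    · exact .inl rfl
    · exact .inr ⟨m - 1, by omega, rfl⟩
  have hM0 : M 0 = 0 := by simp [hMdef, hL0]
  have hM5 : M 5 = T := by
    rw [hMdef, if_neg (by omega), if_neg (by omega), ← hL4]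
  -- The vertex `q n` occurs twice, at the bottom and shifted by w. The minimum with 3 only keeps
  -- the index in range, since n ≤ 3.
  obtain ⟨p, hpdef⟩ : ∃ p : Fin 5 → NR, ∀ k, p k =
    if k.val ≤ n then q ⟨min k.val 3, by omega⟩ else q ⟨k.val - 1, by omega⟩ + w :=
      ⟨_, fun _ => rfl⟩
  refine ⟨p, fun k => M (k.val + 1) - M k.val, ?_, ?_, ?_, ?_, ⟨n, by simpa using Nat.lt_succ_iff.2 hn, ?_⟩, ?_⟩
  · intro k
    by_cases hk : k.val ≤ n
    · exact .inl ⟨_, (hpdef k).trans (if_pos hk)⟩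
    · exact .inr ⟨_, (hpdef k).trans (if_neg hk)⟩
  · exact fun k => ⟨_, _, rfl, hM _ (by omega), hM _ (by omega)⟩
  · intro x
    rw [← hL4]
    interval_cases n <;> simp [hpdef, hMdef, Fin.sum_univ_five, Fin.sum_univ_four, hL0] <;> module
  · rw [Fin.sum_univ_eq_sum_range (fun n => M (n + 1) - M n), Finset.sum_range_sub, hM0, hM5,
      sub_zero]
  · interval_cases n <;> simp [hpdef, List.ofFn_succ]
  · intro k
    change M (k.val + 1) - M k.val ∈ S
    rw [hMdef, hMdef]
    split_ifs with h1 h2 h3 h4 h5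
    all_goals first | exact (by omega : False).elim | skip
    · exact hLS _ (by omega)
    · rwa [show k.val = n by omega]
    · rwa [Nat.add_sub_cancel, ‹k.val = n + 1›]
    · have := hLS (k.val - 1) (by omega)
      rwa [Nat.sub_add_cancel (by omega)] at this

/-- Two indices are excluded, so the edgewise chain belongs to a facet of the simplex P(U_i).
Inserting A_i into the chain turns it into the dual basis of a simplex of the prism, the multiple of
w being T - A_i = B_j. -/
theorem Selects.exists_frame_of_ne_zero (h : Selects S i j) (hi : i ≠ 0) (hj : j ≠ 0) :
    ∃ p l, IsFrame i j p l ∧ ∀ k, l k ∈ S := by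
  obtain ⟨m, hm⟩ := Fin.exists_succAbove_eq (x := idxB j) (y := idxA i) (by
    clear h
    revert i j
    decide)
  obtain ⟨r, L, hL0, hLd, hLS, hLN, hLA, hsum⟩ := h.exists_edgewise
    ((Fin.strictMono_succAbove (idxA i)).comp (Fin.strictMono_succAbove m)) fun k hk => by
      by_cases hkA : k = idxA i
      · rw [hkA]
        exact formZ_eq_zero (excl_idxA hi j)
      · obtain ⟨n, rfl⟩ := Fin.exists_succAbove_eq hkA
        rw [Set.range_comp, Fin.succAbove_right_injective.mem_set_image] at hk
        rw [Fin.range_succAbove, Set.mem_compl_iff, not_not] at hk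
        rw [hk, hm]
        exact formZ_eq_zero (excl_idxB i hj)
  obtain ⟨q, hqdef⟩ : ∃ q : Fin 4 → NR, ∀ n, q n = ((3 : ℕ) : ℝ)⁻¹ •
    ∑ a : Fin 3, u ((idxA i).succAbove (m.succAbove (colorScheme r a n))) := ⟨_, fun _ => rfl⟩
  have hδ := edgewise_succAbove (fun k => u ((idxA i).succAbove k)) m r
  have hqN : ∀ n, q n ∈ latticeN := fun n => by
    rw [hqdef]
    exact thirds_mem_latticeN _
  have hqC : ∀ n, q n ∈ coneC (idxA i) (idxB j) := by
    intro n
    rw [hqdef]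
    refine thirds_mem_hull _ _ fun a => .inl ⟨_, ⟨Fin.succAbove_ne _ _, ?_⟩, rfl⟩
    rw [← hm]
    exact fun h => Fin.succAbove_ne _ _ (Fin.succAbove_right_injective h)
  simp only [← hqdef] at hδ
  simp only [Function.comp_apply] at hsum
  obtain ⟨p, l, hp, hl, hpl, hlT, hlist, hlS⟩ := exists_prism (q := q) hL0 hLd hLS hLA h.formA_mem (by
    rw [formT, add_sub_cancel_left]
    exact h.formB_mem)
  have hmem : ∀ m, (m = formA i ∨ ∃ n ≤ 4, m = L n) → m ∈ dualLattice latticeN := by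
    rintro _ (rfl | ⟨n, hn, rfl⟩)
    exacts [CubicsMPCP.formA_mem i, hLN n hn]
  refine ⟨p, l, ⟨fun k => ?_, fun k => ?_, fun x => ?_, hlT, ?_, .inl hi⟩, hlS⟩
  · obtain ⟨n, h⟩ | ⟨n, h⟩ := hp k
    · rw [h]
      exact hqN n
    · rw [h]
      exact add_mem (hqN n) w_mem
  · obtain ⟨m, m', h, hm, hm'⟩ := hl k
    rw [h]
    exact sub_mem (hmem m hm) (hmem m' hm')
  · have hsum' := hsum u x
    simp only [← hqdef] at hsum'
    rw [hpl, ← hsum', formT, add_sub_cancel_left]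
    exact eq_sum_u i j x
  · rw [tauAt, if_neg hj, if_neg hi]
    refine ⟨_, hδ, ?_, by simp, ?_⟩
    · intro x hx
      obtain ⟨n, rfl⟩ := (List.mem_ofFn' _ _).1 hx
      exact hqC n
    · obtain ⟨n, hn, h⟩ := hlist
      exact ⟨n, hn, h ▸ List.Sublist.refl _⟩

theorem Selects.exists_frame (h : Selects S i j) (h0 : i ≠ 0 ∨ j ≠ 0) :
    ∃ p l, IsFrame i j p l ∧ ∀ k, l k ∈ S := by
  by_cases hj : j = 0
  · subst hj
    exact h.exists_frame_of_right_eq_zero (by simpa using h0)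
  · by_cases hi : i = 0
    · subst hi
      exact h.exists_frame_of_left_eq_zero hj
    · exact h.exists_frame_of_ne_zero hi hj

end ExistsFrame


/-! ### The forms on the simplices of the triangulation -/

section Signs

variable {i j : Fin 4}

theorem excl_iff {i j : Fin 4} {k : Fin 6} :
    Excl i j k ↔ (i ≠ 0 ∧ k = idxA i) ∨ (j ≠ 0 ∧ k = idxB j) := by
  revert i j k
  decide

/-- So the forms z_l / 3 act as barycentric coordinates on the vertices that are not excluded. -/
theorem formZ_u (hi : i ≠ 0) {k : Fin 6} (hk : ¬ Excl i j k) (l : Fin 6) :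
    formZ i j l (u k) = if l = k then 3 else 0 := by
  simp only [Excl, not_or, not_and] at hk
  rw [formZ, LinearMap.add_apply, X_u]
  by_cases hl : l < 3
  · rw [if_pos hl, if_pos hl, formA_u, if_neg hi, if_neg fun h => hk.1 (by
      have := i.2
      change k.val < 3
      omega) h]
    ring
  · rw [if_neg hl, if_neg hl, formB_u]
    by_cases hj : j = 0
    · simp [hj]
    · rw [if_neg hj, if_neg fun h => hk.2 (by
        change 3 ≤ k.val
        have := Fin.val_ne_zero_iff.2 hj
        omega) h]
      ring

theorem formZ_v (hj : j ≠ 0) {k : Fin 6} (hk : ¬ Excl i j k) (l : Fin 6) :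
    formZ i j l (v k) = if l = k then 3 else 0 := by
  simp only [Excl, not_or, not_and] at hk
  rw [formZ, LinearMap.add_apply, X_v]
  by_cases hl : l < 3
  · rw [if_pos hl, if_neg (not_le.2 hl), formA_v]
    by_cases hi : i = 0
    · simp [hi]
    · rw [if_neg hi, if_neg fun h => hk.1 (by
        have := i.2
        change k.val < 3
        omega) h]
      ring
  · rw [if_neg hl, if_pos (not_lt.1 hl), formB_v, if_neg hj, if_neg fun h => hk.2 (by
      change 3 ≤ k.val
      have := Fin.val_ne_zero_iff.2 hj
      omega) h]
    ring

/-- A lattice point on the part of the boundary of `P` where `A_i` and `B_j` are maximal. -/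
structure OnFacet (i j : Fin 4) (x : NR) : Prop where
  mem_lattice : x ∈ latticeN
  formA_eq : formA i x = supA x
  formB_eq : formB j x = supB x
  formT_eq : formA i x + formB j x = 1

/-- The partial sums of `x` exceed those of `y` by at most one. -/
def Step (i j : Fin 4) (x y : NR) : Prop :=
  ∀ m, formY i j m x = formY i j m y ∨ formY i j m x = formY i j m y + 1

/-- The nonnegative forms on a set. -/
def nonnegOn (s : Set NR) : AddSubmonoid (Module.Dual ℝ NR) where
  carrier := {m | ∀ x ∈ s, 0 ≤ m x}
  add_mem' ha hb x hx := add_nonneg (ha x hx) (hb x hx)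
  zero_mem' _ _ := le_rfl

/-- Between two points of the list all the sums Y_m change in the same direction and by at most one,
so the values of a wall form differ by at most one. Being integers, they cannot be positive at one
point and negative at another. -/
theorem selects_nonnegOn {l : List NR} (h : ∀ x ∈ l, OnFacet i j x) (hl : l.Pairwise (Step i j)) :
    Selects (nonnegOn {x | x ∈ l}) i j where
  subA i' x hx := by
    rw [LinearMap.sub_apply, (h x hx).formA_eq, sub_nonneg]
    exact formA_le i' x
  subB j' x hx := by
    rw [LinearMap.sub_apply, (h x hx).formB_eq, sub_nonneg]
    exact formB_le j' x
  total m n k := by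
    have hH : formH i j m n k ∈ dualLattice latticeN :=
      sub_mem (sub_mem (formY_mem i j m) (formY_mem i j n)) (zsmul_mem (formT_mem i j) _)
    have hval : ∀ x ∈ l, formH i j m n k x =
        formY i j m x - formY i j n x - ((k.val : ℤ) - 2 : ℤ) := by
      intro x hx
      have := (h x hx).formT_eq
      rw [formH, LinearMap.sub_apply, LinearMap.sub_apply, LinearMap.smul_apply, formT,
        LinearMap.add_apply, this, zsmul_eq_mul, mul_one]
    have hst : ∀ ⦃x⦄, x ∈ l → ∀ ⦃y⦄, y ∈ l → Step i j x y ∨ Step i j y x := by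
      have : Std.Symm fun x y => Step i j x y ∨ Step i j y x := ⟨fun _ _ => Or.symm⟩
      exact List.Pairwise.forall_of_forall (R := fun x y => Step i j x y ∨ Step i j y x)
        (fun x _ => .inl fun m => .inl rfl) (hl.imp .inl)
    have hR : ∀ x ∈ l, ∀ y ∈ l, formH i j m n k x ≤ formH i j m n k y + 1 := by
      intro x hx y hy
      rw [hval x hx, hval y hy]
      obtain h | h := hst hx hy
      · obtain h1 | h1 := h m <;> obtain h2 | h2 := h n <;> linarith
      · obtain h1 | h1 := h m <;> obtain h2 | h2 := h n <;> linarith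
    by_cases hneg : ∃ x ∈ l, formH i j m n k x < 0
    · right
      obtain ⟨x, hx, hx0⟩ := hneg
      intro y hy
      rw [LinearMap.neg_apply, neg_nonneg]
      obtain ⟨a, ha⟩ := mem_dualLattice.1 hH x (h x hx).mem_lattice
      have h1 := hR y hy x hx
      rw [ha] at hx0 h1
      have : a ≤ -1 := by
        have : a < 0 := by exact_mod_cast hx0
        omega
      have : (a : ℝ) ≤ -1 := by exact_mod_cast this
      linarith
    · left
      push Not at hneg
      exact hneg

theorem formY_eq {m : Fin 8} (hm : m ≠ 7) (x : NR) :
    formY i j m x = ∑ k : Fin 6 with k.val < m.val, formZ i j k x := by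
  rw [formY, if_neg hm, LinearMap.sum_apply]

/-- At a vertex of the edgewise subdivision, Y_m counts the entries of its column that are below m.
-/
theorem formY_thirds {y : Fin 6 → NR} {c : Fin 3 → Fin 6}
    (hy : ∀ a l, formZ i j l (y (c a)) = if l = c a then 3 else 0) {m : Fin 8} (hm : m ≠ 7) :
    formY i j m (((3 : ℕ) : ℝ)⁻¹ • ∑ a, y (c a)) = ∑ a, if (c a).val < m.val then 1 else 0 := by
  simp only [formY_eq hm, map_smul, map_sum, hy]
  rw [← Finset.smul_sum, Finset.sum_comm, Finset.smul_sum]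
  refine Finset.sum_congr rfl fun a _ => ?_
  rw [Finset.sum_ite_eq']
  simp

/-- The columns `c` and `c'` of a color scheme, in this order. -/
def Interlaced (c c' : Fin 3 → Fin 6) : Prop :=
  c 0 ≤ c' 0 ∧ c' 0 ≤ c 1 ∧ c 1 ≤ c' 1 ∧ c' 1 ≤ c 2 ∧ c 2 ≤ c' 2

/-- The entries of the two columns alternate, so a threshold can cut off at most one more entry of
the first than of the second. -/
theorem Interlaced.sum_eq {c c' : Fin 3 → Fin 6} (h : Interlaced c c') (m : ℕ) :
    (∑ a, if (c a).val < m then (1 : ℝ) else 0) = (∑ a, if (c' a).val < m then 1 else 0) ∨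
      (∑ a, if (c a).val < m then (1 : ℝ) else 0) =
        (∑ a, if (c' a).val < m then 1 else 0) + 1 := by
  obtain ⟨h1, h2, h3, h4, h5⟩ := h
  rw [Fin.le_def] at h1 h2 h3 h4 h5
  have key : (∑ a, if (c a).val < m then 1 else 0) = (∑ a, if (c' a).val < m then 1 else 0) ∨
      (∑ a, if (c a).val < m then 1 else 0) = (∑ a, if (c' a).val < m then 1 else 0) + 1 := by
    simp only [Fin.sum_univ_three]
    split_ifs <;> omega
  exact_mod_cast key

theorem colorScheme_mono {k d : ℕ} (r : Fin d → Fin k) (i : Fin k) {j j' : Fin (d + 1)}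
    (h : j ≤ j') : colorScheme r i j ≤ colorScheme r i j' := by
  rw [Fin.le_def]
  unfold colorScheme
  dsimp only
  refine Finset.card_le_card fun c hc => ?_
  simp only [Finset.mem_filter, Finset.mem_univ, true_and] at hc ⊢
  exact hc.imp_right fun hc => ⟨hc.1, hc.2.trans_le h⟩

theorem colorScheme_le_of_lt {k d : ℕ} (r : Fin d → Fin k) {i i' : Fin k} (h : i < i')
    (j j' : Fin (d + 1)) : colorScheme r i j ≤ colorScheme r i' j' := by
  rw [Fin.le_def]
  unfold colorScheme
  dsimp only
  refine Finset.card_le_card fun c hc => ?_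
  simp only [Finset.mem_filter, Finset.mem_univ, true_and] at hc ⊢
  refine .inl ?_
  obtain hc | hc := hc
  exacts [hc.trans h, hc.1 ▸ h]

/-- In the reading order the number of lines passed never decreases, neither within a row nor from
one row to a later one. -/
theorem interlaced_colorScheme {d : ℕ} (r : Fin d → Fin 3) {f : Fin (d + 1) → Fin 6}
    (hf : Monotone f) {j j' : Fin (d + 1)} (h : j ≤ j') :
    Interlaced (fun a => f (colorScheme r a j)) fun a => f (colorScheme r a j') :=
  ⟨hf (colorScheme_mono r 0 h), hf (colorScheme_le_of_lt r (by decide) _ _),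
    hf (colorScheme_mono r 1 h), hf (colorScheme_le_of_lt r (by decide) _ _),
    hf (colorScheme_mono r 2 h)⟩

theorem supA_eq_of_le {x : NR} (h : ∀ i', formA i' x ≤ formA i x) : formA i x = supA x := by
  obtain ⟨i', hi'⟩ := exists_formA x
  exact le_antisymm (formA_le i x) (hi' ▸ h i')

theorem supB_eq_of_le {x : NR} (h : ∀ j', formB j' x ≤ formB j x) : formB j x = supB x := by
  obtain ⟨j', hj'⟩ := exists_formB x
  exact le_antisymm (formB_le j x) (hj' ▸ h j')

theorem map_thirds {m : Module.Dual ℝ NR} {y : Fin 3 → NR} {t : ℝ} (h : ∀ a, m (y a) = t) :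
    m (((3 : ℕ) : ℝ)⁻¹ • ∑ a, y a) = t := by
  simp only [map_smul, map_sum, h]
  simp

theorem map_thirds_le {m : Module.Dual ℝ NR} {y : Fin 3 → NR} {t : ℝ} (h : ∀ a, m (y a) ≤ t) :
    m (((3 : ℕ) : ℝ)⁻¹ • ∑ a, y a) ≤ t := by
  have h0 := h 0
  have h1 := h 1
  have h2 := h 2
  simp only [map_smul, Fin.sum_univ_three, map_add, smul_eq_mul]
  push_cast
  linarith

theorem formA_u_of_not_excl (hi : i ≠ 0) {k : Fin 6} (hk : ¬ Excl i j k) : formA i (u k) = 1 := by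
  rw [formA_u, if_neg hi, if_neg fun h => hk (.inl ⟨?_, h⟩)]
  have := i.2
  change k.val < 3
  omega

theorem formB_u_of_not_excl {k : Fin 6} (hk : ¬ Excl i j k) : formB j (u k) = 0 := by
  rw [formB_u]
  split_ifs with h1 h2
  · rfl
  · refine absurd (.inr ⟨?_, h2⟩) hk
    change 3 ≤ k.val
    have := Fin.val_ne_zero_iff.2 h1
    omega
  · rfl

theorem formA_v_of_not_excl {k : Fin 6} (hk : ¬ Excl i j k) : formA i (v k) = 0 := by
  rw [formA_v]
  split_ifs with h1 h2
  · rfl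
  · refine absurd (.inl ⟨?_, h2⟩) hk
    have := i.2
    change k.val < 3
    omega
  · rfl

theorem formB_v_of_not_excl (hj : j ≠ 0) {k : Fin 6} (hk : ¬ Excl i j k) : formB j (v k) = 1 := by
  rw [formB_v, if_neg hj, if_neg fun h => hk (.inr ⟨?_, h⟩)]
  change 3 ≤ k.val
  have := Fin.val_ne_zero_iff.2 hj
  omega

theorem formA_u_le (i : Fin 4) (k : Fin 6) : formA i (u k) ≤ 1 := by
  rw [formA_u]
  split_ifs <;> norm_num

theorem formB_u_le (j : Fin 4) (k : Fin 6) : formB j (u k) ≤ 0 := by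
  rw [formB_u]
  split_ifs <;> norm_num

theorem formA_v_le (i : Fin 4) (k : Fin 6) : formA i (v k) ≤ 0 := by
  rw [formA_v]
  split_ifs <;> norm_num

theorem formB_v_le (j : Fin 4) (k : Fin 6) : formB j (v k) ≤ 1 := by
  rw [formB_v]
  split_ifs <;> norm_num

theorem onFacet_thirds_u (hi : i ≠ 0) {c : Fin 3 → Fin 6} (hc : ∀ a, ¬ Excl i j (c a)) :
    OnFacet i j (((3 : ℕ) : ℝ)⁻¹ • ∑ a, u (c a)) := by
  have hA := map_thirds fun a => formA_u_of_not_excl hi (hc a)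
  have hB := map_thirds fun a => formB_u_of_not_excl (hc a)
  refine ⟨thirds_mem_latticeN c, supA_eq_of_le fun i' => ?_, supB_eq_of_le fun j' => ?_, ?_⟩
  · rw [hA]
    exact map_thirds_le fun a => formA_u_le _ _
  · rw [hB]
    exact map_thirds_le fun a => formB_u_le _ _
  · rw [hA, hB, add_zero]

theorem onFacet_thirds_v (hj : j ≠ 0) {c : Fin 3 → Fin 6} (hc : ∀ a, ¬ Excl i j (c a)) :
    OnFacet i j (((3 : ℕ) : ℝ)⁻¹ • ∑ a, v (c a)) := by
  have hA := map_thirds fun a => formA_v_of_not_excl (hc a)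
  have hB := map_thirds fun a => formB_v_of_not_excl hj (hc a)
  refine ⟨thirds_mem_latticeN' c, supA_eq_of_le fun i' => ?_, supB_eq_of_le fun j' => ?_, ?_⟩
  · rw [hA]
    exact map_thirds_le fun a => formA_v_le _ _
  · rw [hB]
    exact map_thirds_le fun a => formB_v_le _ _
  · rw [hA, hB, zero_add]

theorem step_thirds_u (hi : i ≠ 0) {c c' : Fin 3 → Fin 6} (hc : ∀ a, ¬ Excl i j (c a))
    (hc' : ∀ a, ¬ Excl i j (c' a)) (h : Interlaced c c') :
    Step i j (((3 : ℕ) : ℝ)⁻¹ • ∑ a, u (c a)) (((3 : ℕ) : ℝ)⁻¹ • ∑ a, u (c' a)) := by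
  intro m
  by_cases hm : m = 7
  · rw [hm, formY_seven, map_thirds fun a => formA_u_of_not_excl hi (hc a),
      map_thirds fun a => formA_u_of_not_excl hi (hc' a)]
    exact .inl rfl
  · rw [formY_thirds (fun a => formZ_u hi (hc a)) hm, formY_thirds (fun a => formZ_u hi (hc' a)) hm]
    exact h.sum_eq m

theorem step_thirds_v (hj : j ≠ 0) {c c' : Fin 3 → Fin 6} (hc : ∀ a, ¬ Excl i j (c a))
    (hc' : ∀ a, ¬ Excl i j (c' a)) (h : Interlaced c c') :
    Step i j (((3 : ℕ) : ℝ)⁻¹ • ∑ a, v (c a)) (((3 : ℕ) : ℝ)⁻¹ • ∑ a, v (c' a)) := by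
  intro m
  by_cases hm : m = 7
  · rw [hm, formY_seven, map_thirds fun a => formA_v_of_not_excl (hc a),
      map_thirds fun a => formA_v_of_not_excl (hc' a)]
    exact .inl rfl
  · rw [formY_thirds (fun a => formZ_v hj (hc a)) hm, formY_thirds (fun a => formZ_v hj (hc' a)) hm]
    exact h.sum_eq m

/-- Passing from the bottom of a prism to the top lowers Y_7 = A_i from 1 to 0, while the other sums
do not notice the translation by w. -/
theorem step_thirds_u_v (hi : i ≠ 0) (hj : j ≠ 0) {c c' : Fin 3 → Fin 6}
    (hc : ∀ a, ¬ Excl i j (c a)) (hc' : ∀ a, ¬ Excl i j (c' a)) (h : Interlaced c c') :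
    Step i j (((3 : ℕ) : ℝ)⁻¹ • ∑ a, u (c a)) (((3 : ℕ) : ℝ)⁻¹ • ∑ a, v (c' a)) := by
  intro m
  by_cases hm : m = 7
  · rw [hm, formY_seven, map_thirds fun a => formA_u_of_not_excl hi (hc a),
      map_thirds fun a => formA_v_of_not_excl (hc' a)]
    exact .inr (zero_add 1).symm
  · rw [formY_thirds (fun a => formZ_u hi (hc a)) hm, formY_thirds (fun a => formZ_v hj (hc' a)) hm]
    exact h.sum_eq m

theorem thirds_u_add_w (c : Fin 3 → Fin 6) :
    ((3 : ℕ) : ℝ)⁻¹ • ∑ a, u (c a) + w = ((3 : ℕ) : ℝ)⁻¹ • ∑ a, v (c a) := by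
  simp only [← u_add_w, Fin.sum_univ_three]
  push_cast
  module

theorem formB_nonneg_of_mem_coneC (hj : j ≠ 0) {x : NR} (hx : x ∈ coneC (idxA i) (idxB j)) :
    0 ≤ formB j x := by
  induction hx using Submodule.span_induction with
  | mem x hx =>
    obtain ⟨k, hk, rfl⟩ | ⟨k, hk, rfl⟩ := hx
    · rw [formB_u, if_neg hj, if_neg fun h => hk.2 (Fin.ext h.symm)]
    · rw [formB_v, if_neg hj, if_neg fun h => hk.2 (Fin.ext h.symm)]
      exact zero_le_one
  | zero => simp
  | add x y _ _ hx hy =>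
    rw [map_add]
    exact add_nonneg hx hy
  | smul c x _ hx =>
    rw [show c • x = (c : ℝ) • x from rfl, map_smul]
    exact mul_nonneg c.2 hx

/-- Columns of a color scheme interlace, and a prism simplex changes only once from bottom to top.
This is the property of the explicit subdivisions from which the geometric lemmas below are drawn.
-/
theorem chain_of_mem_tauAt (h0 : i ≠ 0 ∨ j ≠ 0) {l : List NR} (hl : l ∈ tauAt i j) :
    (∀ x ∈ l, OnFacet i j x) ∧ l.Pairwise (Step i j) := by
  rw [tauAt] at hl
  split_ifs at hl with hj hi
  · have hi : i ≠ 0 := h0.resolve_right (not_not.2 hj)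
    obtain ⟨-, _, ⟨r, rfl⟩, hl⟩ := hl
    have hex : ∀ k, ¬ Excl i j ((idxA i).succAbove k) := by
      intro k hk
      obtain ⟨-, h⟩ | ⟨h, -⟩ := excl_iff.1 hk
      exacts [Fin.succAbove_ne _ _ h, h hj]
    refine ⟨fun x hx => ?_, .sublist hl (List.pairwise_ofFn.2 fun m m' hm => ?_)⟩
    · obtain ⟨n, rfl⟩ := (List.mem_ofFn' _ _).1 (hl.subset hx)
      exact onFacet_thirds_u hi fun a => hex _
    · exact step_thirds_u hi (fun a => hex _) (fun a => hex _)
        (interlaced_colorScheme r (Fin.strictMono_succAbove _).monotone hm.le)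
  · obtain ⟨-, _, ⟨r, rfl⟩, hl⟩ := hl
    have hex : ∀ k, ¬ Excl i j ((idxB j).succAbove k) := by
      intro k hk
      obtain ⟨h, -⟩ | ⟨-, h⟩ := excl_iff.1 hk
      exacts [h hi, Fin.succAbove_ne _ _ h]
    refine ⟨fun x hx => ?_, .sublist hl (List.pairwise_ofFn.2 fun m m' hm => ?_)⟩
    · obtain ⟨n, rfl⟩ := (List.mem_ofFn' _ _).1 (hl.subset hx)
      exact onFacet_thirds_v hj fun a => hex _
    · exact step_thirds_v hj (fun a => hex _) (fun a => hex _)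
        (interlaced_colorScheme r (Fin.strictMono_succAbove _).monotone hm.le)
  · obtain ⟨δ, ⟨-, _, ⟨r, rfl⟩, hδ⟩, hδC, -, s, -, hl⟩ := hl
    obtain ⟨c, hc⟩ : ∃ c : Fin 5 → Fin 3 → Fin 6, ∀ n a, c n a =
      (idxA i).succAbove (colorScheme r a n) := ⟨_, fun _ _ => rfl⟩
    simp only [← hc] at hδ
    have hcc : ∀ n n', n ≤ n' → Interlaced (c n) (c n') := fun n n' h => by
      simp only [funext (hc _)]
      exact interlaced_colorScheme r (Fin.strictMono_succAbove _).monotone h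
    let Q : NR → NR → Prop := fun x y => ∃ n n', n ≤ n' ∧ x = ((3 : ℕ) : ℝ)⁻¹ • ∑ a, u (c n a) ∧
      y = ((3 : ℕ) : ℝ)⁻¹ • ∑ a, u (c n' a)
    have hQ : δ.Pairwise Q :=
      .sublist hδ (List.pairwise_ofFn.2 fun m m' hm => ⟨m, m', hm.le, rfl, rfl⟩)
    have hQrefl : ∀ x ∈ δ, Q x x := by
      intro x hx
      obtain ⟨n, rfl⟩ := (List.mem_ofFn' _ _).1 (hδ.subset hx)
      exact ⟨n, n, le_rfl, rfl, rfl⟩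
    -- A vertex that lies in C_{i,j} cannot involve the index excluded by B_j: there B_j equals -3,
    -- and no other term is positive.
    have hex : ∀ n, ((3 : ℕ) : ℝ)⁻¹ • ∑ a, u (c n a) ∈ δ → ∀ a, ¬ Excl i j (c n a) := by
      intro n hn a hk
      obtain ⟨-, h⟩ | ⟨-, h⟩ := excl_iff.1 hk
      · rw [hc] at h
        exact Fin.succAbove_ne _ _ h
      · have h1 := formB_nonneg_of_mem_coneC hj (hδC _ hn)
        have h2 : ∀ a, formB j (u (c n a)) ≤ 0 := fun a => formB_u_le _ _
        have h3 : formB j (u (c n a)) = -3 := by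
          rw [h, formB_u, if_neg hj]
          exact if_pos rfl
        simp only [map_smul, map_sum, smul_eq_mul] at h1
        have h4 : ∑ a, formB j (u (c n a)) ≤ formB j (u (c n a)) := by
          rw [← Finset.add_sum_erase _ _ (Finset.mem_univ a)]
          have := Finset.sum_nonpos fun b (_ : b ∈ Finset.univ.erase a) => h2 b
          linarith
        push_cast at h1
        linarith
    have hQ' : ∀ x ∈ δ.take (s + 1), ∀ y ∈ δ.drop s, Q x y := by
      intro x hx y hy
      obtain ⟨a, ha, rfl⟩ := List.mem_take_iff_getElem.1 hx
      obtain ⟨b, hb, rfl⟩ := List.mem_drop_iff_getElem.1 hy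
      obtain hab | hab := (show a ≤ s + b by omega).lt_or_eq
      · exact List.pairwise_iff_getElem.1 hQ a (s + b) (by omega) (by omega) hab
      · simp only [hab]
        exact hQrefl _ (List.getElem_mem _)
    have hu : ∀ x ∈ δ, OnFacet i j x ∧ OnFacet i j (x + w) := by
      intro x hx
      obtain ⟨n, rfl⟩ := (List.mem_ofFn' _ _).1 (hδ.subset hx)
      rw [thirds_u_add_w]
      exact ⟨onFacet_thirds_u hi (hex n hx), onFacet_thirds_v hj (hex n hx)⟩
    have hs : ∀ x ∈ δ, ∀ y ∈ δ, Q x y → Step i j x y ∧ Step i j (x + w) (y + w) ∧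
        Step i j x (y + w) := by
      rintro _ hx _ hy ⟨n, n', hn, rfl, rfl⟩
      rw [thirds_u_add_w, thirds_u_add_w]
      exact ⟨step_thirds_u hi (hex n hx) (hex n' hy) (hcc n n' hn),
        step_thirds_v hj (hex n hx) (hex n' hy) (hcc n n' hn),
        step_thirds_u_v hi hj (hex n hx) (hex n' hy) (hcc n n' hn)⟩
    have hQδ : δ.Pairwise fun x y => x ∈ δ ∧ y ∈ δ ∧ Q x y := by
      rw [List.pairwise_iff_getElem] at hQ ⊢
      exact fun a b ha hb hab => ⟨List.getElem_mem _, List.getElem_mem _, hQ a b ha hb hab⟩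
    constructor
    · intro x hx
      obtain hx | hx := List.mem_append.1 (hl.subset hx)
      · exact (hu x (List.mem_of_mem_take hx)).1
      · obtain ⟨y, hy, rfl⟩ := List.mem_map.1 (List.mem_of_mem_drop hx)
        exact (hu y hy).2
    · refine .sublist hl (List.pairwise_append.2 ⟨?_, ?_, ?_⟩)
      · exact (hQδ.sublist (List.take_sublist _ _)).imp fun h => (hs _ h.1 _ h.2.1 h.2.2).1
      · refine List.Pairwise.sublist (List.drop_sublist _ _) (List.pairwise_map.2 ?_)
        exact hQδ.imp fun h => (hs _ h.1 _ h.2.1 h.2.2).2.1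
      · intro x hx y hy
        rw [← List.map_drop] at hy
        obtain ⟨y, hy', rfl⟩ := List.mem_map.1 hy
        exact (hs x (List.mem_of_mem_take hx) y (List.mem_of_mem_drop hy') (hQ' x hx y hy')).2.2

end Signs


/-! ### The simplices of the triangulation and their cones -/

section FrameGeometry

variable {i j i' j' : Fin 4} {p p' : Fin 5 → NR} {l l' : Fin 5 → Module.Dual ℝ NR} {x : NR}

theorem IsFrame.onFacet (h : IsFrame i j p l) (k : Fin 5) : OnFacet i j (p k) :=
  (chain_of_mem_tauAt h.ne_zero h.mem_tauAt).1 _ ((List.mem_ofFn' _ _).2 ⟨k, rfl⟩)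

theorem IsFrame.selects (h : IsFrame i j p l) : Selects (nonnegOn (Set.range p)) i j := by
  have hc := chain_of_mem_tauAt h.ne_zero h.mem_tauAt
  have hs := selects_nonnegOn hc.1 hc.2
  rwa [show {x | x ∈ List.ofFn p} = Set.range p from Set.ext fun x => List.mem_ofFn' _ _] at hs

theorem IsFrame.sum_apply (h : IsFrame i j p l) (x : NR) :
    ∑ k, l k x = formA i x + formB j x := by
  rw [← LinearMap.sum_apply, h.sum_eq, formT, LinearMap.add_apply]

theorem IsFrame.linearIndependent (h : IsFrame i j p l) : LinearIndependent ℝ p := by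
  refine linearIndependent_of_top_le_span_of_card_eq_finrank (fun x _ => ?_) ?_
  · rw [h.eq_sum x]
    exact sum_mem fun k _ => Submodule.smul_mem _ _ (Submodule.subset_span ⟨k, rfl⟩)
  · rw [finrank_NR, Fintype.card_fin]

theorem IsFrame.apply_sum (h : IsFrame i j p l) (c : Fin 5 → ℝ) (k : Fin 5) :
    l k (∑ m, c m • p m) = c k := by
  have h1 := h.eq_sum (∑ m, c m • p m)
  have h2 : ∑ m, (c m - l m (∑ n, c n • p n)) • p m = 0 := by
    have h3 : ∀ m, (c m - l m (∑ n, c n • p n)) • p m = c m • p m - l m (∑ n, c n • p n) • p m :=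
      fun m => sub_smul (M := NR) _ _ _
    rw [Finset.sum_congr rfl fun m _ => h3 m, Finset.sum_sub_distrib]
    exact sub_eq_zero.2 h1
  exact (sub_eq_zero.1 (Fintype.linearIndependent_iff.1 h.linearIndependent _ h2 k)).symm

theorem IsFrame.apply_self (h : IsFrame i j p l) (k m : Fin 5) :
    l k (p m) = if k = m then 1 else 0 := by
  have := h.apply_sum (fun n => if n = m then 1 else 0) k
  simpa using this

theorem IsFrame.injective (h : IsFrame i j p l) : Function.Injective p :=
  h.linearIndependent.injective

/-- The dual basis is integral, so the coordinates are nonnegative integers with sum 1. -/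
theorem IsFrame.exists_eq_of_mem_lattice (h : IsFrame i j p l) (hx : x ∈ latticeN)
    (hl : ∀ k, 0 ≤ l k x) (h1 : formA i x + formB j x = 1) : ∃ k, x = p k := by
  choose z hz using fun k => mem_dualLattice.1 (h.mem_dual k) x hx
  have hz0 : ∀ k, 0 ≤ z k := fun k => by
    have := hl k
    rw [hz] at this
    exact_mod_cast this
  have hz1 : ∑ k, z k = 1 := by
    have := h.sum_apply x
    simp only [hz, h1] at this
    exact_mod_cast this
  obtain ⟨k, -, hk⟩ : ∃ k ∈ Finset.univ, 0 < z k := by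
    by_contra hne
    push Not at hne
    have := Finset.sum_nonpos hne
    omega
  have hk1 : ∀ m ≠ k, z m = 0 := by
    intro m hm
    have h2 := Finset.add_sum_erase Finset.univ z (Finset.mem_univ k)
    have h3 := Finset.single_le_sum (f := z) (fun n _ => hz0 n)
      (Finset.mem_erase.2 ⟨hm, Finset.mem_univ m⟩)
    have := hz0 m
    omega
  have hk2 : z k = 1 := by
    rwa [Finset.sum_eq_single k (fun m _ hm => hk1 m hm) (by simp)] at hz1
  refine ⟨k, (h.eq_sum x).trans ?_⟩
  rw [Finset.sum_eq_single k (fun m _ hm => by simp [hz, hk1 m hm]) (by simp), hz, hk2]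
  simp

theorem nonneg_sum {ι : Type*} {s : Finset ι} {S : Set NR} {m : Module.Dual ℝ NR} (hm : m ∈ nonnegOn S)
    {c : ι → ℝ} (hc : ∀ k, 0 ≤ c k) {y : ι → NR} (hy : ∀ k ∈ s, y k ∈ S) :
    0 ≤ m (∑ k ∈ s, c k • y k) := by
  rw [map_sum]
  refine Finset.sum_nonneg fun k hk => ?_
  rw [map_smul]
  exact mul_nonneg (hc k) (hm _ (hy k hk))

theorem IsFrame.nonneg_of_mem (h : IsFrame i j p l) (hl : ∀ k, 0 ≤ l k x) {m : Module.Dual ℝ NR}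
    (hm : m ∈ nonnegOn (Set.range p)) : 0 ≤ m x := by
  rw [h.eq_sum x]
  exact nonneg_sum hm hl fun k _ => ⟨k, rfl⟩

/-- If a nonnegative form vanishes at `x`, then it vanishes on the support of `x`. -/
theorem IsFrame.apply_eq_zero (h : IsFrame i j p l) (hl : ∀ k, 0 ≤ l k x) {m : Module.Dual ℝ NR}
    (hm : m ∈ nonnegOn (Set.range p)) (hx : m x ≤ 0) {k : Fin 5} (hk : 0 < l k x) : m (p k) = 0 := by
  have h1 : m x = ∑ k, l k x * m (p k) := by
    conv_lhs => rw [h.eq_sum x]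
    rw [map_sum]
    exact Finset.sum_congr rfl fun k _ => by rw [map_smul, smul_eq_mul]
  have h2 : ∀ k ∈ Finset.univ, 0 ≤ l k x * m (p k) := fun k _ => mul_nonneg (hl k) (hm _ ⟨k, rfl⟩)
  have h3 := (Finset.sum_eq_zero_iff_of_nonneg h2).1 (le_antisymm (h1 ▸ hx) (Finset.sum_nonneg h2)) k
    (Finset.mem_univ k)
  exact (mul_eq_zero.1 h3).resolve_left hk.ne'

theorem IsFrame.onCell (h : IsFrame i j p l) (hl : ∀ k, 0 ≤ l k x) :
    formA i x = supA x ∧ formB j x = supB x := by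
  refine ⟨supA_eq_of_le fun r => ?_, supB_eq_of_le fun r => ?_⟩
  · have := h.nonneg_of_mem hl (h.selects.subA r)
    rwa [LinearMap.sub_apply, sub_nonneg] at this
  · have := h.nonneg_of_mem hl (h.selects.subB r)
    rwa [LinearMap.sub_apply, sub_nonneg] at this

theorem formZ_congr {y : NR} (hA : formA i y = formA i' y) (hB : formB j y = formB j' y) (k : Fin 6) :
    formZ i j k y = formZ i' j' k y := by
  simp only [formZ, LinearMap.add_apply]
  split_ifs <;> simp [hA, hB]

theorem formY_congr {y : NR} (hA : formA i y = formA i' y) (hB : formB j y = formB j' y) (m : Fin 8) :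
    formY i j m y = formY i' j' m y := by
  by_cases hm : m = 7
  · rw [hm, formY_seven, formY_seven, hA]
  · rw [formY_eq hm, formY_eq hm]
    exact Finset.sum_congr rfl fun k _ => formZ_congr hA hB k

theorem formH_congr {y : NR} (hA : formA i y = formA i' y) (hB : formB j y = formB j' y)
    (m n : Fin 8) (k : Fin 5) : formH i j m n k y = formH i' j' m n k y := by
  simp only [formH, LinearMap.sub_apply, LinearMap.smul_apply, formT, LinearMap.add_apply,
    formY_congr hA hB, hA, hB]

/-- Two cones of the triangulation that share a point have a common refinement of signs. -/
theorem IsFrame.selects_union (h : IsFrame i j p l) (h' : IsFrame i' j' p' l')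
    (hl : ∀ k, 0 ≤ l k x) (hl' : ∀ k, 0 ≤ l' k x) :
    Selects (nonnegOn (p '' {k | 0 < l k x} ∪ Set.range p')) i' j' := by
  -- The difference A_i - A_i' is nonnegative on the first simplex and not positive at x, so it
  -- vanishes on the support of x.
  have hA : ∀ k, 0 < l k x → formA i (p k) = formA i' (p k) := by
    intro k hk
    refine sub_eq_zero.1 (h.apply_eq_zero hl (h.selects.subA i') ?_ hk)
    rw [LinearMap.sub_apply, (h'.onCell hl').1, sub_nonpos]
    exact formA_le i x
  have hB : ∀ k, 0 < l k x → formB j (p k) = formB j' (p k) := by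
    intro k hk
    refine sub_eq_zero.1 (h.apply_eq_zero hl (h.selects.subB j') ?_ hk)
    rw [LinearMap.sub_apply, (h'.onCell hl').2, sub_nonpos]
    exact formB_le j x
  have hAx : formA i x = formA i' x := (h.onCell hl).1.trans (h'.onCell hl').1.symm
  have hBx : formB j x = formB j' x := (h.onCell hl).2.trans (h'.onCell hl').2.symm
  refine ⟨fun r => ?_, fun r => ?_, fun m n k => ?_⟩
  · rintro _ (⟨k, hk, rfl⟩ | hy)
    · rw [LinearMap.sub_apply, ← hA k hk]
      exact h.selects.subA r _ ⟨k, rfl⟩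
    · exact h'.selects.subA r _ hy
  · rintro _ (⟨k, hk, rfl⟩ | hy)
    · rw [LinearMap.sub_apply, ← hB k hk]
      exact h.selects.subB r _ ⟨k, rfl⟩
    · exact h'.selects.subB r _ hy
  -- The sign of a wall form on the second simplex prevails: if the form has the opposite sign on
  -- the first one, then x forces it to vanish on the support of x.
  · have key : ∀ f f' : Module.Dual ℝ NR, (f ∈ nonnegOn (Set.range p) ∨ -f ∈ nonnegOn (Set.range p)) →
        f' ∈ nonnegOn (Set.range p') → (∀ k, 0 < l k x → f (p k) = f' (p k)) → f x = f' x →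
        f' ∈ nonnegOn (p '' {k | 0 < l k x} ∪ Set.range p') := by
      rintro f f' hf hf' hff' hx _ (⟨k, hk, rfl⟩ | hy)
      · rw [← hff' k hk]
        obtain hf | hf := hf
        · exact hf _ ⟨k, rfl⟩
        · refine le_of_eq (neg_eq_zero.1 (h.apply_eq_zero hl hf ?_ hk)).symm
          rw [LinearMap.neg_apply, hx, neg_nonpos]
          exact h'.nonneg_of_mem hl' hf'
      · exact hf' _ hy
    obtain hH' | hH' := h'.selects.total m n k
    · exact .inl (key _ _ (h.selects.total m n k) hH'
        (fun k hk => formH_congr (hA k hk) (hB k hk) m n _) (formH_congr hAx hBx m n k))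
    · refine .inr (key (-formH i j m n k) _ ?_ hH' (fun k hk => ?_) ?_)
      · rw [neg_neg]
        exact (h.selects.total m n k).symm
      · rw [LinearMap.neg_apply, LinearMap.neg_apply, formH_congr (hA k hk) (hB k hk) m n]
      · rw [LinearMap.neg_apply, LinearMap.neg_apply, formH_congr hAx hBx m n]

/-- The vertices that support a point do not depend on the simplex. -/
theorem IsFrame.exists_eq_of_pos (h : IsFrame i j p l) (h' : IsFrame i' j' p' l')
    (hl : ∀ k, 0 ≤ l k x) (hl' : ∀ k, 0 ≤ l' k x) {k : Fin 5} (hk : 0 < l k x) :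
    ∃ m, p' m = p k ∧ 0 < l' m x := by
  have hs := h.selects_union h' hl hl'
  -- A third frame, among whose vertices are the support of x in the first simplex and the whole
  -- second simplex. Its dual basis reads off the coefficient of a vertex in both expansions of x.
  obtain ⟨p'', l'', h'', hS⟩ := hs.exists_frame h'.ne_zero
  have hp : ∀ k, 0 < l k x → ∃ n, p k = p'' n := by
    intro k hk
    refine h''.exists_eq_of_mem_lattice (h.mem_lattice k)
      (fun n => hS n _ (.inl ⟨k, hk, rfl⟩)) ?_
    have hA := hs.subA i _ (.inl ⟨k, hk, rfl⟩)
    have hB := hs.subB j _ (.inl ⟨k, hk, rfl⟩)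
    rw [LinearMap.sub_apply, sub_nonneg] at hA hB
    rw [le_antisymm ((formA_le _ _).trans (h.onFacet k).formA_eq.ge) hA,
      le_antisymm ((formB_le _ _).trans (h.onFacet k).formB_eq.ge) hB, (h.onFacet k).formT_eq]
  have hp' : ∀ k, ∃ n, p' k = p'' n := fun k =>
    h''.exists_eq_of_mem_lattice (h'.mem_lattice k) (fun n => hS n _ (.inr ⟨k, rfl⟩))
      (h'.onFacet k).formT_eq
  obtain ⟨n, hn⟩ := hp k hk
  have h1 : 0 < l'' n x := by
    rw [h.eq_sum x, map_sum]
    refine Finset.sum_pos' (fun m _ => ?_) ⟨k, Finset.mem_univ k, ?_⟩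
    · rw [map_smul]
      obtain hm | hm := (hl m).eq_or_lt
      · rw [← hm, zero_smul]
      · exact mul_nonneg hm.le (hS n _ (.inl ⟨m, hm, rfl⟩))
    · rw [map_smul, hn, h''.apply_self, if_pos rfl]
      simpa using hk
  rw [h'.eq_sum x, map_sum] at h1
  obtain ⟨m, -, hm⟩ := Finset.exists_lt_of_sum_lt (f := fun _ => (0 : ℝ)) (by simpa using h1)
  obtain ⟨n', hn'⟩ := hp' m
  simp only [hn', h''.apply_self] at hm
  split_ifs at hm with hnn
  · refine ⟨m, by rw [hn', hn, hnn], by simpa using hm⟩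
  · simp at hm

theorem selects_singleton (hA : formA i x = supA x) (hB : formB j x = supB x) :
    Selects (nonnegOn {x}) i j := by
  refine ⟨fun r => ?_, fun r => ?_, fun m n k => ?_⟩
  · intro y hy
    rw [Set.mem_singleton_iff.1 hy, LinearMap.sub_apply, hA, sub_nonneg]
    exact formA_le r x
  · intro y hy
    rw [Set.mem_singleton_iff.1 hy, LinearMap.sub_apply, hB, sub_nonneg]
    exact formB_le r x
  · refine (le_total 0 (formH i j m n k x)).imp ?_ ?_
    · rintro h _ rfl
      exact h
    · rintro h _ rfl
      exact neg_nonneg.2 h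

theorem exists_frame_of_mem (h0 : i ≠ 0 ∨ j ≠ 0) (hA : formA i x = supA x) (hB : formB j x = supB x) :
    ∃ p l, IsFrame i j p l ∧ ∀ k, 0 ≤ l k x := by
  obtain ⟨p, l, h, hS⟩ := (selects_singleton hA hB).exists_frame h0
  exact ⟨p, l, h, fun k => hS k _ rfl⟩

/-- The pair (0, 0) can only be maximal at the origin, where any other pair is maximal as well. -/
theorem exists_cell (x : NR) : ∃ i j, (i ≠ 0 ∨ j ≠ 0) ∧ formA i x = supA x ∧ formB j x = supB x := by
  obtain ⟨i, hi⟩ := exists_formA x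
  obtain ⟨j, hj⟩ := exists_formB x
  by_cases h0 : i ≠ 0 ∨ j ≠ 0
  · exact ⟨i, j, h0, hi, hj⟩
  · push Not at h0
    obtain ⟨rfl, rfl⟩ := h0
    have : gaugeP x = 0 := by
      rw [gaugeP, ← hi, ← hj, formA_zero, formB_zero]
      simp
    have hx := eq_zero_of_gaugeP this
    refine ⟨1, 0, .inl one_ne_zero, ?_, hj⟩
    rw [← hi, hx, map_zero, map_zero]

theorem exists_frame_mem (x : NR) : ∃ i j p l, IsFrame i j p l ∧ ∀ k, 0 ≤ l k x := by
  obtain ⟨i, j, h0, hA, hB⟩ := exists_cell x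
  exact ⟨i, j, exists_frame_of_mem h0 hA hB⟩

/-- A simplex is a chain, so the forms nonnegative on it select a frame, and unimodularity makes its
points vertices of that frame. Conversely a subset of a frame is listed in the induced order. -/
theorem vertexSets_tauAt (h0 : i ≠ 0 ∨ j ≠ 0) : vertexSets (tauAt i j) =
    {s : Finset NR | s.Nonempty ∧ ∃ p l, IsFrame i j p l ∧ (s : Set NR) ⊆ Set.range p} := by
  classical
  have hsub : ∀ t ∈ tauAt i j, ∀ s : List NR, s ≠ [] → s.Sublist t → s ∈ tauAt i j := by
    intro t ht s hs hst
    rw [tauAt] at ht ⊢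
    split_ifs at ht ⊢
    · exact ⟨hs, ht.2.imp fun _ h => ⟨h.1, hst.trans h.2⟩⟩
    · exact ⟨hs, ht.2.imp fun _ h => ⟨h.1, hst.trans h.2⟩⟩
    · obtain ⟨δ, h1, h2, -, n, hn, h3⟩ := ht
      exact ⟨δ, h1, h2, hs, n, hn, hst.trans h3⟩
  have hne : ∀ t ∈ tauAt i j, t ≠ [] := by
    intro t ht
    rw [tauAt] at ht
    split_ifs at ht
    · exact ht.1
    · exact ht.1
    · obtain ⟨δ, h1, h2, h3, -⟩ := ht
      exact h3
  ext s
  constructor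
  · rintro ⟨t, ht, rfl⟩
    have hc := chain_of_mem_tauAt h0 ht
    obtain ⟨p, l, h, hS⟩ := (selects_nonnegOn hc.1 hc.2).exists_frame h0
    refine ⟨?_, p, l, h, fun x hx => ?_⟩
    · obtain ⟨x, hx⟩ := List.exists_mem_of_ne_nil t (hne t ht)
      exact ⟨x, by simpa using hx⟩
    · have hx : x ∈ t := by simpa using hx
      obtain ⟨k, hk⟩ := h.exists_eq_of_mem_lattice (hc.1 x hx).mem_lattice (fun k => hS k x hx)
        (hc.1 x hx).formT_eq
      exact ⟨k, hk.symm⟩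
  · rintro ⟨⟨x, hx⟩, p, l, h, hs⟩
    have heq : ((List.ofFn p).filter (· ∈ s)).toFinset = s := by
      ext y
      simp only [List.mem_toFinset, List.mem_filter, decide_eq_true_eq, List.mem_ofFn']
      exact ⟨fun h => h.2, fun h => ⟨hs h, h⟩⟩
    refine ⟨(List.ofFn p).filter (· ∈ s), hsub _ h.mem_tauAt _ ?_ List.filter_sublist, by
      convert heq⟩
    intro h0
    rw [h0] at heq
    rw [← heq] at hx
    simp at hx

theorem exists_idxA {k : Fin 6} (hk : k < 3) : ∃ i : Fin 4, i ≠ 0 ∧ idxA i = k := by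
  revert k
  decide

theorem exists_idxB {k : Fin 6} (hk : 3 ≤ k) : ∃ j : Fin 4, j ≠ 0 ∧ idxB j = k := by
  revert k
  decide

theorem idxA_lt {i : Fin 4} : idxA i < 3 := by
  revert i
  decide

theorem le_idxB {j : Fin 4} (hj : j ≠ 0) : 3 ≤ idxB j := by
  revert j
  decide

theorem tauBoundary_eq : tauBoundary =
    {s : Finset NR | s.Nonempty ∧ ∃ i j p l, IsFrame i j p l ∧ (s : Set NR) ⊆ Set.range p} := by
  ext s
  constructor
  · have key : ∀ i j, (i ≠ 0 ∨ j ≠ 0) → s ∈ vertexSets (tauAt i j) →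
        s.Nonempty ∧ ∃ i j p l, IsFrame i j p l ∧ (s : Set NR) ⊆ Set.range p := by
      intro i j h0 hs
      rw [vertexSets_tauAt h0] at hs
      exact ⟨hs.1, i, j, hs.2⟩
    rintro (⟨k, hk, hs⟩ | ⟨k, hk, hs⟩ | ⟨k, hk, n, hn, hs⟩)
    · obtain ⟨i, hi, rfl⟩ := exists_idxA hk
      exact key i 0 (.inl hi) (by rwa [tauAt, if_pos rfl])
    · obtain ⟨j, hj, rfl⟩ := exists_idxB hk
      exact key 0 j (.inr hj) (by rwa [tauAt, if_neg hj, if_pos rfl])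
    · obtain ⟨i, hi, rfl⟩ := exists_idxA hk
      obtain ⟨j, hj, rfl⟩ := exists_idxB hn
      exact key i j (.inl hi) (by rwa [tauAt, if_neg hj, if_neg hi])
  · rintro ⟨hs, i, j, p, l, h, hsp⟩
    have h1 : s ∈ vertexSets (tauAt i j) := by
      rw [vertexSets_tauAt h.ne_zero]
      exact ⟨hs, p, l, h, hsp⟩
    rw [tauAt] at h1
    split_ifs at h1 with hj hi
    · exact .inl ⟨_, idxA_lt, h1⟩
    · exact .inr (.inl ⟨_, le_idxB hj, h1⟩)
    · exact .inr (.inr ⟨_, idxA_lt, _, le_idxB hj, h1⟩)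

/-- The vertex set of a simplex of maximal dimension. -/
def frameSet (p : Fin 5 → NR) : Finset NR :=
  haveI := Classical.decEq NR
  Finset.univ.image p

theorem coe_frameSet (p : Fin 5 → NR) : (frameSet p : Set NR) = Set.range p := by
  simp [frameSet]

theorem mem_frameSet {y : NR} : y ∈ frameSet p ↔ ∃ k, p k = y := by
  simp [frameSet]

theorem IsFrame.card_frameSet (h : IsFrame i j p l) : (frameSet p).card = 5 := by
  rw [← Set.ncard_coe_finset, coe_frameSet, ← Set.image_univ,
    Set.ncard_image_of_injective _ h.injective, Set.ncard_univ, Nat.card_eq_fintype_card,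
    Fintype.card_fin]

theorem maximal_tauBoundary {t : Finset NR} :
    Maximal (· ∈ tauBoundary) t ↔ ∃ i j p l, IsFrame i j p l ∧ t = frameSet p := by
  rw [tauBoundary_eq]
  constructor
  · intro ht
    obtain ⟨hne, i, j, p, l, h, hs⟩ := ht.prop
    refine ⟨i, j, p, l, h, ?_⟩
    refine ht.eq_of_le ⟨⟨p 0, mem_frameSet.2 ⟨0, rfl⟩⟩, i, j, p, l, h, (coe_frameSet p).le⟩ ?_
    rwa [← Finset.coe_subset, coe_frameSet]
  · rintro ⟨i, j, p, l, h, rfl⟩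
    refine ⟨⟨⟨p 0, mem_frameSet.2 ⟨0, rfl⟩⟩, i, j, p, l, h, (coe_frameSet p).le⟩, ?_⟩
    rintro s ⟨-, i', j', p', l', h', hs⟩ hps
    rw [← coe_frameSet, Finset.coe_subset] at hs
    refine hs.trans (Finset.eq_of_subset_of_card_le (hps.trans hs) ?_).ge
    rw [h.card_frameSet, h'.card_frameSet]

end FrameGeometry


/-! ### The triangulation of `P` -/

section Triangulation

variable {i j i' j' : Fin 4} {p p' : Fin 5 → NR} {l l' : Fin 5 → Module.Dual ℝ NR} {x : NR}

theorem IsFrame.gaugeP_eq (h : IsFrame i j p l) (hl : ∀ k, 0 ≤ l k x) :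
    formA i x + formB j x = gaugeP x := by
  rw [gaugeP, (h.onCell hl).1, (h.onCell hl).2]

theorem IsFrame.ne_zero' (h : IsFrame i j p l) (k : Fin 5) : p k ≠ 0 := by
  intro h0
  have := (h.onFacet k).formT_eq
  rw [h0] at this
  simp at this

/-- The points of a simplex, in terms of the dual basis. -/
theorem IsFrame.mem_convexHull_iff (h : IsFrame i j p l) {s : Set NR}
    (hs : s ⊆ insert 0 (Set.range p)) : x ∈ convexHull ℝ s ↔
      (∀ k, 0 ≤ l k x) ∧ (∀ k, 0 < l k x → p k ∈ s) ∧ formA i x + formB j x ≤ 1 ∧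
        (0 ∉ s → formA i x + formB j x = 1) := by
  constructor
  · intro hx
    have hT : ∀ y : NR, formA i y + formB j y = formT i j y := fun y => rfl
    have hc : Convex ℝ {x | (∀ k, 0 ≤ l k x) ∧ (∀ k, p k ∉ s → l k x = 0) ∧ formT i j x ≤ 1 ∧
        (0 ∉ s → formT i j x = 1)} := by
      rintro y ⟨hy1, hy2, hy3, hy4⟩ z ⟨hz1, hz2, hz3, hz4⟩ a b ha hb hab
      refine ⟨fun k => ?_, fun k hk => ?_, ?_, fun hk => ?_⟩
      · simp only [map_add, map_smul, smul_eq_mul]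
        exact add_nonneg (mul_nonneg ha (hy1 k)) (mul_nonneg hb (hz1 k))
      · simp [hy2 k hk, hz2 k hk]
      · simp only [map_add, map_smul, smul_eq_mul]
        nlinarith
      · simp [hy4 hk, hz4 hk, hab]
    have hsub : s ⊆ {x | (∀ k, 0 ≤ l k x) ∧ (∀ k, p k ∉ s → l k x = 0) ∧ formT i j x ≤ 1 ∧
        (0 ∉ s → formT i j x = 1)} := by
      intro y hy
      obtain rfl | ⟨m, rfl⟩ := hs hy
      · exact ⟨by simp, by simp, by simp, fun h0 => absurd hy h0⟩
      · refine ⟨fun k => ?_, fun k hk => ?_, ((h.onFacet m).formT_eq).le,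
          fun _ => (h.onFacet m).formT_eq⟩
        · rw [h.apply_self]
          split_ifs <;> norm_num
        · rw [h.apply_self, if_neg]
          rintro rfl
          exact hk hy
    obtain ⟨h1, h2, h3, h4⟩ := convexHull_min hsub hc hx
    refine ⟨h1, fun k hk => ?_, h3, h4⟩
    by_contra hks
    exact hk.ne' (h2 k hks)
  · rintro ⟨h1, h2, h3, h4⟩
    have hsum := h.sum_apply x
    -- The vertex 0 takes up the missing weight 1 - (A_i + B_j).
    have := (convex_convexHull ℝ s).finsum_mem (ι := Fin 6)
      (w := Fin.cons (1 - (formA i x + formB j x)) fun k => l k x) (z := Fin.cons 0 p) ?_ ?_ ?_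
    · rw [finsum_eq_sum_of_fintype] at this
      convert this
      refine (h.eq_sum x).trans (Eq.symm ((Fin.sum_univ_succ (M := NR) _).trans ?_))
      simp only [Fin.cons_zero, smul_zero, zero_add, Fin.cons_succ]
    · intro k
      refine Fin.cases ?_ (fun k => ?_) k
      · rw [Fin.cons_zero, sub_nonneg]
        exact h3
      · rw [Fin.cons_succ]
        exact h1 k
    · rw [finsum_eq_sum_of_fintype, Fin.sum_univ_succ]
      simp [hsum]
    · intro k
      refine Fin.cases ?_ (fun k => ?_) k
      · rw [Fin.cons_zero, Fin.cons_zero]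
        intro hne
        refine subset_convexHull ℝ s ?_
        by_contra h0
        exact hne (sub_eq_zero.2 (h4 h0).symm)
      · rw [Fin.cons_succ, Fin.cons_succ]
        exact fun hne => subset_convexHull ℝ s (h2 k (lt_of_le_of_ne (h1 k) hne.symm))

theorem IsFrame.affineIndependent (h : IsFrame i j p l) {s : Set NR}
    (hs : s ⊆ insert 0 (Set.range p)) : AffineIndependent ℝ ((↑) : s → NR) := by
  have h1 : LinearIndependent ℝ (fun y => y : Set.range p → NR) :=
    h.linearIndependent.linearIndepOn_id
  rw [linearIndependent_set_iff_affineIndependent_vadd_union_singleton ℝ (fun y hy => by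
    obtain ⟨k, rfl⟩ := hy
    exact h.ne_zero' k) (0 : NR)] at h1
  refine h1.mono (hs.trans ?_)
  rintro y (rfl | hy)
  · exact .inl rfl
  · exact .inr ⟨y, hy, by simp⟩

/-- The simplices with vertices among those of a simplex of maximal dimension, and `0`. -/
def starFaces : Set (Finset NR) :=
  {s | s.Nonempty ∧ ∃ i j p l, IsFrame i j p l ∧ (s : Set NR) ⊆ insert 0 (Set.range p)}

/-- The nonzero vertices that support a common point do not depend on the simplex, and neither does
the weight of 0, which is 1 minus the gauge. -/
theorem inter_subset_convexHull_of_mem_starFaces {s t : Finset NR} (hs : s ∈ starFaces)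
    (ht : t ∈ starFaces) :
    convexHull ℝ (s : Set NR) ∩ convexHull ℝ (t : Set NR) ⊆ convexHull ℝ (s ∩ t : Set NR) := by
  obtain ⟨-, i, j, p, l, h, hs⟩ := hs
  obtain ⟨-, i', j', p', l', h', ht⟩ := ht
  rintro x ⟨hxs, hxt⟩
  rw [h.mem_convexHull_iff hs] at hxs
  rw [h'.mem_convexHull_iff ht] at hxt
  rw [h.mem_convexHull_iff (Set.inter_subset_left.trans hs)]
  refine ⟨hxs.1, fun k hk => ⟨hxs.2.1 k hk, ?_⟩, hxs.2.2.1, fun h0 => ?_⟩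
  · obtain ⟨m, hm, hmx⟩ := h.exists_eq_of_pos h' hxs.1 hxt.1 hk
    rw [← hm]
    exact hxt.2.1 m hmx
  · by_cases h0s : (0 : NR) ∈ (s : Set NR)
    · rw [h.gaugeP_eq hxs.1, ← h'.gaugeP_eq hxt.1]
      exact hxt.2.2.2 fun h0t => h0 ⟨h0s, h0t⟩
    · exact hxs.2.2.2 h0s

/-- The triangulation of `P` as a simplicial complex. -/
def starComplex : Geometry.SimplicialComplex ℝ NR where
  faces := starFaces
  isRelLowerSet_faces := by
    rintro s ⟨hs, i, j, p, l, h, hsp⟩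
    refine ⟨hs, fun t hts ht => ⟨ht, i, j, p, l, h, ?_⟩⟩
    exact (Finset.coe_subset.2 hts).trans hsp
  indep := by
    rintro s ⟨-, i, j, p, l, h, hs⟩
    exact h.affineIndependent hs
  inter_subset_convexHull := inter_subset_convexHull_of_mem_starFaces

theorem tauP_eq : tauP = starFaces := by
  classical
  ext s
  refine and_congr_right fun hs => ⟨?_, ?_⟩
  · rintro ⟨t, ht, hst⟩
    obtain ⟨i, j, p, l, h, rfl⟩ := maximal_tauBoundary.1 ht
    refine ⟨i, j, p, l, h, ?_⟩
    rw [← coe_frameSet]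
    intro y hy
    simpa using hst hy
  · rintro ⟨i, j, p, l, h, hs⟩
    refine ⟨frameSet p, maximal_tauBoundary.2 ⟨i, j, p, l, h, rfl⟩, fun y hy => ?_⟩
    have := hs hy
    rw [← coe_frameSet] at this
    simpa using this

theorem starFaces_mem_lattice {s : Finset NR} (hs : s ∈ starFaces) {x : NR} (hx : x ∈ s) :
    x ∈ latticeN := by
  obtain ⟨-, i, j, p, l, h, hs⟩ := hs
  obtain rfl | ⟨k, rfl⟩ := hs hx
  exacts [zero_mem _, h.mem_lattice k]

/-- Independence and the intersection condition are inherited from `starComplex`; for a subfamily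
only the faces and the union have to be checked. -/
theorem isTriangulation_of_subset {τ : Set (Finset NR)} {Q : Set NR} (hτ : τ ⊆ starFaces)
    (hne : ∀ s ∈ τ, ∀ t ⊆ s, t.Nonempty → t ∈ τ)
    (hQ : ∀ x, x ∈ Q ↔ ∃ s ∈ τ, x ∈ convexHull ℝ (s : Set NR)) : IsTriangulation latticeN τ Q := by
  refine ⟨⟨⟨⟨τ, fun {s} hs => ⟨(hτ hs).1, fun {t} hts ht => hne s hs t hts ht⟩⟩,
    fun hs => starComplex.indep (hτ hs), fun hs ht => starComplex.inter_subset_convexHull (hτ hs)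
      (hτ ht)⟩, rfl, ?_⟩, fun s hs x hx => starFaces_mem_lattice (hτ hs) hx⟩
  ext x
  rw [Geometry.SimplicialComplex.mem_space_iff, hQ]

theorem isTriangulation_tauP : IsTriangulation latticeN tauP P := by
  rw [tauP_eq]
  refine isTriangulation_of_subset le_rfl
    (fun s hs t hts ht => starComplex.down_closed hs hts ht) fun x => ?_
  constructor
  · intro hx
    obtain ⟨i, j, p, l, h, hl⟩ := exists_frame_mem x
    classical
    have hc : ((insert 0 (frameSet p) : Finset NR) : Set NR) = insert 0 (Set.range p) := by
      rw [Finset.coe_insert, coe_frameSet]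
    refine ⟨insert 0 (frameSet p), ⟨⟨0, by simp⟩, i, j, p, l, h, hc.le⟩, ?_⟩
    rw [h.mem_convexHull_iff hc.le, hc]
    exact ⟨hl, fun k _ => .inr ⟨k, rfl⟩, by rwa [h.gaugeP_eq hl, ← mem_P_iff],
      fun h0 => absurd (.inl rfl) h0⟩
  · rintro ⟨s, ⟨-, i, j, p, l, h, hs⟩, hx⟩
    rw [h.mem_convexHull_iff hs] at hx
    rw [mem_P_iff, ← h.gaugeP_eq hx.1]
    exact hx.2.2.1

theorem IsFrame.mem_convexHull_iff' (h : IsFrame i j p l) {s : Set NR} (hs : s ⊆ Set.range p) :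
    x ∈ convexHull ℝ s ↔
      (∀ k, 0 ≤ l k x) ∧ (∀ k, 0 < l k x → p k ∈ s) ∧ gaugeP x = 1 := by
  rw [h.mem_convexHull_iff (hs.trans (Set.subset_insert _ _))]
  have h0 : 0 ∉ s := fun h0 => by
    obtain ⟨k, hk⟩ := hs h0
    exact h.ne_zero' k hk
  refine and_congr_right fun h1 => and_congr_right fun _ => ?_
  rw [h.gaugeP_eq h1]
  exact ⟨fun h => h.2 h0, fun h => ⟨h.le, fun _ => h⟩⟩

theorem isTriangulation_vertexSets (h0 : i ≠ 0 ∨ j ≠ 0) :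
    IsTriangulation latticeN (vertexSets (tauAt i j))
      {x | formA i x = supA x ∧ formB j x = supB x ∧ gaugeP x = 1} := by
  rw [vertexSets_tauAt h0]
  refine isTriangulation_of_subset ?_ ?_ fun x => ⟨?_, ?_⟩
  · rintro s ⟨hs, p, l, h, hsp⟩
    exact ⟨hs, i, j, p, l, h, hsp.trans (Set.subset_insert _ _)⟩
  · rintro s ⟨-, p, l, h, hsp⟩ t hts ht
    exact ⟨ht, p, l, h, (Finset.coe_subset.2 hts).trans hsp⟩
  · rintro ⟨hA, hB, h1⟩
    obtain ⟨p, l, h, hl⟩ := exists_frame_of_mem h0 hA hB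
    refine ⟨frameSet p, ⟨⟨p 0, mem_frameSet.2 ⟨0, rfl⟩⟩, p, l, h, (coe_frameSet p).le⟩, ?_⟩
    rw [h.mem_convexHull_iff' (coe_frameSet p).le]
    exact ⟨hl, fun k _ => mem_frameSet.2 ⟨k, rfl⟩, h1⟩
  · rintro ⟨s, ⟨-, p, l, h, hsp⟩, hx⟩
    rw [h.mem_convexHull_iff' hsp] at hx
    exact ⟨(h.onCell hx.1).1, (h.onCell hx.1).2, hx.2.2⟩

theorem isTriangulation_tauBoundary : IsTriangulation latticeN tauBoundary (frontier P) := by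
  rw [tauBoundary_eq, frontier_P]
  refine isTriangulation_of_subset ?_ ?_ fun x => ⟨?_, ?_⟩
  · rintro s ⟨hs, i, j, p, l, h, hsp⟩
    exact ⟨hs, i, j, p, l, h, hsp.trans (Set.subset_insert _ _)⟩
  · rintro s ⟨-, i, j, p, l, h, hsp⟩ t hts ht
    exact ⟨ht, i, j, p, l, h, (Finset.coe_subset.2 hts).trans hsp⟩
  · intro h1
    obtain ⟨i, j, p, l, h, hl⟩ := exists_frame_mem x
    refine ⟨frameSet p, ⟨⟨p 0, mem_frameSet.2 ⟨0, rfl⟩⟩, i, j, p, l, h, (coe_frameSet p).le⟩, ?_⟩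
    rw [h.mem_convexHull_iff' (coe_frameSet p).le]
    exact ⟨hl, fun k _ => mem_frameSet.2 ⟨k, rfl⟩, h1⟩
  · rintro ⟨s, ⟨-, i, j, p, l, h, hsp⟩, hx⟩
    rw [h.mem_convexHull_iff' hsp] at hx
    exact hx.2.2

theorem gaugeP_of_mem_lattice {x : NR} (hx : x ∈ latticeN) : ∃ z : ℤ, gaugeP x = z := by
  obtain ⟨i, hi⟩ := exists_formA x
  obtain ⟨j, hj⟩ := exists_formB x
  rw [gaugeP, ← hi, ← hj]
  exact mem_dualLattice.1 (formT_mem i j) x hx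

/-- The gauge is integral on the lattice, so a lattice point of P is 0 or lies on the boundary,
where unimodularity makes it a vertex. -/
theorem isMaximalTriangulation_tauP : IsMaximalTriangulation latticeN tauP P := by
  intro x hx hxN
  rw [tauP_eq]
  obtain ⟨i, j, p, l, h, hl⟩ := exists_frame_mem x
  obtain ⟨z, hz⟩ := gaugeP_of_mem_lattice hxN
  have h0 := gaugeP_nonneg x
  have h1 := mem_P_iff.1 hx
  rw [hz] at h0 h1
  have hz0 : 0 ≤ z := by exact_mod_cast h0
  have hz1 : z ≤ 1 := by exact_mod_cast h1
  obtain rfl | rfl : z = 0 ∨ z = 1 := by omega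
  · have := eq_zero_of_gaugeP (hz.trans Int.cast_zero)
    refine ⟨{0}, ⟨⟨0, by simp⟩, i, j, p, l, h, by simp⟩, by simpa using this⟩
  · obtain ⟨k, rfl⟩ := h.exists_eq_of_mem_lattice hxN hl
      ((h.gaugeP_eq hl).trans (hz.trans Int.cast_one))
    refine ⟨{p k}, ⟨⟨p k, by simp⟩, i, j, p, l, h, by simp⟩, by simp⟩

theorem exists_frame_superset {s : Finset NR} (hs : s ∈ starFaces) : ∃ i j p l, IsFrame i j p l ∧
    ∃ t ∈ starFaces, (t : Set NR) = insert 0 (Set.range p) ∧ s ⊆ t := by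
  classical
  obtain ⟨-, i, j, p, l, h, hs⟩ := hs
  have hc : ((insert 0 (frameSet p) : Finset NR) : Set NR) = insert 0 (Set.range p) := by
    rw [Finset.coe_insert, coe_frameSet]
  refine ⟨i, j, p, l, h, _, ⟨⟨0, by simp⟩, i, j, p, l, h, hc.le⟩, hc, ?_⟩
  rw [← Finset.coe_subset, hc]
  exact hs

theorem maximal_tauP {s : Finset NR} : Maximal (· ∈ tauP) s ↔
    ∃ i j p l, IsFrame i j p l ∧ (s : Set NR) = insert 0 (Set.range p) := by
  classical
  rw [tauP_eq]
  constructor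
  · intro hs
    obtain ⟨i, j, p, l, h, t, ht, hc, hst⟩ := exists_frame_superset hs.prop
    exact ⟨i, j, p, l, h, by rw [hs.eq_of_le ht hst, hc]⟩
  · rintro ⟨i, j, p, l, h, hs⟩
    refine ⟨⟨?_, i, j, p, l, h, hs.le⟩, fun t ht hst => ?_⟩
    · rw [← Finset.coe_nonempty, hs]
      exact ⟨0, .inl rfl⟩
    · obtain ⟨i', j', p', l', h', t', -, hc, htt⟩ := exists_frame_superset ht
      have hcard : ∀ {i j p l}, IsFrame i j p l → (insert (0 : NR) (Set.range p)).ncard = 6 := by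
        intro i j p l h
        rw [← coe_frameSet, Set.ncard_insert_of_notMem, Set.ncard_coe_finset, h.card_frameSet]
        rw [Finset.mem_coe, mem_frameSet]
        rintro ⟨k, hk⟩
        exact h.ne_zero' k hk
      have h1 : s.card = 6 := by rw [← Set.ncard_coe_finset, hs, hcard h]
      have h2 : t'.card = 6 := by rw [← Set.ncard_coe_finset, hc, hcard h']
      have hst' : s ⊆ t := hst
      rw [Finset.eq_of_subset_of_card_le (hst'.trans htt) (by omega)]
      exact htt

theorem isStar_tauP : IsStar tauP P := by
  refine ⟨?_, fun s hs => ?_⟩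
  · rw [interior_P, Set.mem_ofPred_eq]
    have := gaugeP_smul (c := 0) le_rfl (0 : NR)
    rw [zero_smul, zero_mul] at this
    rw [this]
    exact one_pos
  · obtain ⟨i, j, p, l, h, hs⟩ := maximal_tauP.1 hs
    rw [← Finset.mem_coe, hs]
    exact .inl rfl

end Triangulation


/-! ### The face fan -/

section FaceFan

variable {i j i' j' : Fin 4} {p p' : Fin 5 → NR} {l l' : Fin 5 → Module.Dual ℝ NR} {x : NR}
  {W W' : Set (Fin 5)}

/-- The cone on which the forms `l k` are nonnegative, and vanish for `k ∉ W`. -/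
def subCone (l : Fin 5 → Module.Dual ℝ NR) (W : Set (Fin 5)) : PointedCone ℝ NR where
  carrier := {x | (∀ k, 0 ≤ l k x) ∧ ∀ k ∉ W, l k x = 0}
  add_mem' {x y} hx hy := by
    refine ⟨fun k => ?_, fun k hk => ?_⟩
    · rw [map_add]
      exact add_nonneg (hx.1 k) (hy.1 k)
    · rw [map_add, hx.2 k hk, hy.2 k hk, add_zero]
  zero_mem' := ⟨fun k => (map_zero (l k)).ge, fun k _ => map_zero (l k)⟩
  smul_mem' c x hx := by
    refine ⟨fun k => ?_, fun k hk => ?_⟩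
    · rw [show c • x = (c : ℝ) • x from rfl, map_smul]
      exact mul_nonneg c.2 (hx.1 k)
    · rw [show c • x = (c : ℝ) • x from rfl, map_smul, hx.2 k hk, smul_zero]

theorem subCone_mono (h : W ⊆ W') : subCone l W ≤ subCone l W' :=
  fun _ hx => ⟨hx.1, fun k hk => hx.2 k fun hkW => hk (h hkW)⟩

theorem IsFrame.mem_subCone (h : IsFrame i j p l) {k : Fin 5} (hk : k ∈ W) : p k ∈ subCone l W := by
  refine ⟨fun m => ?_, fun m hm => ?_⟩
  · rw [h.apply_self]
    split_ifs <;> norm_num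
  · rw [h.apply_self, if_neg]
    rintro rfl
    exact hm hk

theorem IsFrame.hull_eq (h : IsFrame i j p l) {s : Set NR} (hs : s ⊆ insert 0 (Set.range p)) :
    PointedCone.hull ℝ s = subCone l {k | p k ∈ s} := by
  apply le_antisymm
  · refine Submodule.span_le.2 fun y hy => ?_
    obtain rfl | ⟨k, rfl⟩ := hs hy
    · exact zero_mem _
    · exact h.mem_subCone hy
  · rintro x ⟨hx1, hx2⟩
    rw [h.eq_sum x]
    refine sum_mem fun k _ => ?_
    by_cases hk : p k ∈ s
    · exact (PointedCone.hull ℝ s).smul_mem (hx1 k) (Submodule.subset_span hk)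
    · rw [hx2 k hk, zero_smul]
      exact zero_mem _

theorem mem_faceFan {σ : PointedCone ℝ NR} : σ ∈ faceFan tauP ↔
    ∃ i j p l, IsFrame i j p l ∧ ∃ W, σ = subCone l W := by
  classical
  rw [tauP_eq]
  constructor
  · rintro ⟨s, ⟨-, i, j, p, l, h, hs⟩, -, rfl⟩
    exact ⟨i, j, p, l, h, _, h.hull_eq hs⟩
  · rintro ⟨i, j, p, l, h, W, rfl⟩
    have hc : ((insert 0 ((frameSet p).filter fun y => ∃ k ∈ W, p k = y) : Finset NR) : Set NR) ⊆
        insert 0 (Set.range p) := by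
      intro y hy
      simp only [Finset.coe_insert, Finset.coe_filter, Set.mem_insert_iff, Set.mem_ofPred_eq] at hy
      exact hy.imp id fun hy => mem_frameSet.1 hy.1
    refine ⟨_, ⟨⟨0, Finset.mem_insert_self _ _⟩, i, j, p, l, h, hc⟩, Finset.mem_insert_self _ _, ?_⟩
    rw [h.hull_eq hc]
    congr 1
    ext k
    simp only [Finset.coe_insert, Finset.coe_filter, Set.mem_insert_iff, Set.mem_ofPred_eq,
      mem_frameSet]
    refine ⟨fun hk => .inr ⟨⟨k, rfl⟩, k, hk, rfl⟩, ?_⟩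
    rintro (hk | ⟨-, m, hm, hmk⟩)
    · exact absurd hk (h.ne_zero' k)
    · rwa [← h.injective hmk]

theorem IsFrame.subCone_mem (h : IsFrame i j p l) (W : Set (Fin 5)) : subCone l W ∈ faceFan tauP :=
  mem_faceFan.2 ⟨i, j, p, l, h, W, rfl⟩

theorem isFaceOf_subCone (h : W ⊆ W') : (subCone l W).IsFaceOf (subCone l W') := by
  refine ⟨subCone_mono h, ?_⟩
  rintro x y a hx hy ha ⟨-, hxy⟩
  refine ⟨hx.1, fun k hk => ?_⟩
  have h1 := hxy k hk
  rw [map_add, map_smul, smul_eq_mul] at h1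
  have h2 := mul_nonneg ha.le (hx.1 k)
  have h3 := hy.1 k
  exact (mul_eq_zero.1 (by linarith : a * l k x = 0)).resolve_left ha.ne'

/-- A point of both cones has the same supporting vertices in both, so it is supported on the common
ones. -/
theorem IsFrame.subCone_inf (h : IsFrame i j p l) (h' : IsFrame i' j' p' l') :
    subCone l W ⊓ subCone l' W' = subCone l {k ∈ W | ∃ m ∈ W', p' m = p k} := by
  apply le_antisymm
  · rintro x ⟨hx, hx'⟩
    refine ⟨hx.1, fun k hk => ?_⟩
    by_contra hkx
    have hpos := lt_of_le_of_ne (hx.1 k) (Ne.symm hkx)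
    obtain ⟨m, hm, hmx⟩ := h.exists_eq_of_pos h' hx.1 hx'.1 hpos
    refine hk ⟨?_, m, ?_, hm⟩
    · by_contra hkW
      exact hkx (hx.2 k hkW)
    · by_contra hmW
      exact hmx.ne' (hx'.2 m hmW)
  · intro x hx
    refine ⟨subCone_mono (Set.sep_subset _ _) hx, ?_⟩
    rw [h.eq_sum x]
    refine sum_mem fun k _ => ?_
    by_cases hk : k ∈ {k ∈ W | ∃ m ∈ W', p' m = p k}
    · obtain ⟨-, m, hm, hmk⟩ := hk
      rw [← hmk]
      exact (subCone l' W').smul_mem (hx.1 k) (h'.mem_subCone hm)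
    · rw [hx.2 k hk, zero_smul]
      exact zero_mem _

theorem IsFrame.eq_zero (h : IsFrame i j p l) (hx : ∀ k, l k x = 0) : x = 0 := by
  refine (h.eq_sum x).trans (Finset.sum_eq_zero fun k _ => ?_)
  rw [hx k, zero_smul]

/-- The negative of every coordinate is one of the forms A_i + B_j, hence at most 1 on P. As the
coordinates sum to zero, they lie between -1 and 5. -/
theorem finite_lattice_inter_P : {x | x ∈ latticeN ∧ x ∈ P}.Finite := by
  have hX : ∀ x ∈ P, ∀ k, -1 ≤ X k x := by
    intro x hx k
    have h1 : ∀ i j, formA i x + formB j x ≤ 1 := formT_le_of_mem hx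
    have h2 : ∀ m : Module.Dual ℝ NR, (-m) x ≤ 1 → -1 ≤ m x := fun m h => neg_le.1 h
    fin_cases k
    exacts [h2 _ (by simpa [formA, formB] using h1 1 0), h2 _ (by simpa [formA, formB] using h1 2 0),
      h2 _ (by simpa [formA, formB] using h1 3 0), h2 _ (by simpa [formA, formB] using h1 0 1),
      h2 _ (by simpa [formA, formB] using h1 0 2), h2 _ (by simpa [formA, formB] using h1 0 3)]
  refine Set.Finite.of_finite_image (f := fun x k => ⌊X k x⌋)
    ((Set.finite_Icc (fun _ => (-1 : ℤ)) fun _ : Fin 6 => (5 : ℤ)).subset ?_) ?_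
  · rintro _ ⟨x, ⟨-, hx⟩, rfl⟩
    refine ⟨fun k => ?_, fun k => ?_⟩
    · rw [Int.le_floor]
      exact_mod_cast hX x hx k
    · have h1 : ∑ k, X k x = 0 := by
        rw [← LinearMap.sum_apply, sum_X, LinearMap.zero_apply]
      have h2 : X k x ≤ 5 := by
        have h3 := Finset.card_nsmul_le_sum (Finset.univ.erase k) (fun k => X k x) (-1)
          fun k _ => hX x hx k
        have h4 := Finset.add_sum_erase Finset.univ (fun k => X k x) (Finset.mem_univ k)
        rw [Finset.card_erase_of_mem (Finset.mem_univ k), Finset.card_univ, Fintype.card_fin] at h3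
        norm_num [h1] at h3
        linarith
      have := (Int.floor_le (X k x)).trans h2
      exact_mod_cast this
  · rintro x ⟨hx, -⟩ y ⟨hy, -⟩ hxy
    apply NR_ext
    intro k
    obtain ⟨a, ha⟩ := hx k
    obtain ⟨b, hb⟩ := hy k
    have := congrFun hxy k
    simp only [X_apply, ha, hb, Int.floor_intCast] at this ⊢
    rw [this]

theorem finite_faceFan : (faceFan tauP).Finite := by
  classical
  have h1 : tauP.Finite := by
    refine (finite_lattice_inter_P.toFinset.powerset.finite_toSet).subset fun s hs => ?_
    rw [Finset.mem_coe, Finset.mem_powerset]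
    intro x hx
    rw [Set.Finite.mem_toFinset]
    refine ⟨isTriangulation_tauP.2 s hs x hx, ?_⟩
    obtain ⟨⟨K, hf, hK⟩, -⟩ := isTriangulation_tauP
    rw [← hK]
    exact K.subset_space (hf ▸ hs) hx
  refine (h1.image fun s : Finset NR => PointedCone.hull ℝ (s : Set NR)).subset ?_
  rintro σ ⟨s, hs, -, rfl⟩
  exact ⟨s, hs, rfl⟩

theorem exists_frame : ∃ i j p l, IsFrame i j p l := by
  obtain ⟨i, j, p, l, h, -⟩ := exists_frame_mem 0
  exact ⟨i, j, p, l, h⟩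

theorem isFan_faceFan : IsFan latticeN (faceFan tauP) where
  finite := finite_faceFan
  nonempty := by
    obtain ⟨i, j, p, l, h⟩ := exists_frame
    exact ⟨_, h.subCone_mem ∅⟩
  rational := by
    rintro σ ⟨s, hs, -, rfl⟩
    exact ⟨s, isTriangulation_tauP.2 s hs, rfl⟩
  salient := by
    intro σ hσ x hx hx'
    obtain ⟨i, j, p, l, h, W, rfl⟩ := mem_faceFan.1 hσ
    refine h.eq_zero fun k => le_antisymm ?_ (hx.1 k)
    have := hx'.1 k
    rwa [map_neg, neg_nonneg] at this
  face_mem := by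
    intro σ hσ ρ hρ
    obtain ⟨i, j, p, l, h, W, rfl⟩ := mem_faceFan.1 hσ
    -- A face of a simplicial cone is spanned by the generators it contains: a point of the face
    -- with a positive coefficient at `p k` splits off this generator.
    have : ρ = subCone l {k ∈ W | p k ∈ ρ} := by
      apply le_antisymm
      · intro x hx
        have hxσ := hρ.le hx
        refine ⟨hxσ.1, fun k hk => ?_⟩
        by_contra hkx
        have hkW : k ∈ W := by
          by_contra hkW
          exact hkx (hxσ.2 k hkW)
        have hpos := lt_of_le_of_ne (hxσ.1 k) (Ne.symm hkx)
        have hsum := h.eq_sum x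
        rw [← Finset.add_sum_erase _ _ (Finset.mem_univ k)] at hsum
        refine hk ⟨hkW, hρ.mem_of_smul_add_mem (h.mem_subCone hkW) ?_ hpos (hsum ▸ hx)⟩
        refine sum_mem fun m _ => ?_
        by_cases hm : m ∈ W
        · exact (subCone l W).smul_mem (hxσ.1 m) (h.mem_subCone hm)
        · rw [hxσ.2 m hm, zero_smul]
          exact zero_mem _
      · intro x hx
        rw [h.eq_sum x]
        refine sum_mem fun k _ => ?_
        by_cases hk : k ∈ {k ∈ W | p k ∈ ρ}
        · exact ρ.smul_mem (hx.1 k) hk.2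
        · rw [hx.2 k hk, zero_smul]
          exact zero_mem _
    rw [this]
    exact h.subCone_mem _
  inf_isFaceOf := by
    intro σ hσ ρ hρ
    obtain ⟨i, j, p, l, h, W, rfl⟩ := mem_faceFan.1 hσ
    obtain ⟨i', j', p', l', h', W', rfl⟩ := mem_faceFan.1 hρ
    rw [h.subCone_inf h']
    exact isFaceOf_subCone (Set.sep_subset _ _)

theorem IsFrame.mem_dualMonoid (h : IsFrame i j p l) (W : Set (Fin 5)) (k : Fin 5) :
    l k ∈ dualMonoid latticeN (subCone l W) :=
  ⟨mem_dualLattice.1 (h.mem_dual k), fun _ hx => hx.1 k⟩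

theorem isGluable_faceFan : IsGluable latticeN (faceFan tauP) where
  fg := by
    rintro σ ⟨s, -, -, rfl⟩
    exact ⟨s, rfl⟩
  inf_mem := by
    intro σ hσ ρ hρ
    obtain ⟨i, j, p, l, h, W, rfl⟩ := mem_faceFan.1 hσ
    obtain ⟨i', j', p', l', h', W', rfl⟩ := mem_faceFan.1 hρ
    rw [h.subCone_inf h']
    exact h.subCone_mem _
  exists_faceForm := by
    classical
    intro σ hσ κ hκ hle
    obtain ⟨i, j, p, l, h, W, rfl⟩ := mem_faceFan.1 hσ
    obtain ⟨i', j', p', l', h', W', rfl⟩ := mem_faceFan.1 hκ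
    have heq : subCone l' W' = subCone l {k ∈ W | ∃ m ∈ W', p' m = p k} := by
      rw [← h.subCone_inf h', inf_eq_right.2 hle]
    rw [heq]
    set V := {k ∈ W | ∃ m ∈ W', p' m = p k}
    -- The sum of the dual forms of the omitted generators vanishes exactly where each of them does.
    refine ⟨∑ k with k ∉ V, l k, sum_mem fun k _ => h.mem_dualMonoid W k, fun x hx => ?_,
      fun x hx h0 => ⟨hx.1, fun k hk => ?_⟩⟩
    · rw [LinearMap.sum_apply]
      exact Finset.sum_eq_zero fun k hk => hx.2 k (Finset.mem_filter.1 hk).2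
    · rw [LinearMap.sum_apply, Finset.sum_eq_zero_iff_of_nonneg fun k _ => hx.1 k] at h0
      exact h0 k (by simpa using hk)
  bot_mem := by
    obtain ⟨i, j, p, l, h⟩ := exists_frame
    have : (⊥ : PointedCone ℝ NR) = subCone l ∅ := by
      refine le_antisymm bot_le fun x hx => ?_
      rw [h.eq_zero fun k => hx.2 k (Set.notMem_empty k)]
      exact zero_mem _
    rw [this]
    exact h.subCone_mem ∅

theorem IsFrame.eq_sum_form (h : IsFrame i j p l) (m : Module.Dual ℝ NR) :
    m = ∑ k, m (p k) • l k := by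
  ext x
  rw [LinearMap.sum_apply]
  conv_lhs => rw [h.eq_sum x]
  rw [map_sum]
  refine Finset.sum_congr rfl fun k _ => ?_
  rw [map_smul, LinearMap.smul_apply, smul_eq_mul, smul_eq_mul, mul_comm]

/-- The coefficients of a character in the dual basis are its values at the vertices, which are
nonnegative integers. -/
theorem IsFrame.isSmoothCone (h : IsFrame i j p l) :
    IsSmoothCone latticeN (subCone l Set.univ) l where
  closure_eq := by
    apply le_antisymm
    · intro m hm
      rw [h.eq_sum_form m]
      refine sum_mem fun k _ => ?_
      obtain ⟨z, hz⟩ := hm.1 (p k) (h.mem_lattice k)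
      have h0 := hm.2 (p k) (h.mem_subCone (Set.mem_univ k))
      rw [hz] at h0 ⊢
      have hz0 : 0 ≤ z := by exact_mod_cast h0
      lift z to ℕ using hz0
      rw [Int.cast_natCast, Nat.cast_smul_eq_nsmul]
      have hk : l k ∈ AddSubmonoid.closure (Set.range l) := AddSubmonoid.subset_closure ⟨k, rfl⟩
      exact nsmul_mem hk z
    · rw [AddSubmonoid.closure_le]
      rintro _ ⟨k, rfl⟩
      exact h.mem_dualMonoid _ k
  linearIndependent := by
    rw [Fintype.linearIndependent_iff]
    intro c hc k
    have := congrArg (fun m : Module.Dual ℝ NR => m (p k)) hc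
    simpa [LinearMap.sum_apply, h.apply_self] using this

theorem faceFan_smooth : ∀ σ ∈ faceFan tauP, ∃ σ' ∈ faceFan tauP, σ ≤ σ' ∧
    ∃ l : Fin 5 → Module.Dual ℝ NR, IsSmoothCone latticeN σ' l ∧ ∀ x ∈ σ', ∑ i, l i x = gaugeP x := by
  intro σ hσ
  obtain ⟨i, j, p, l, h, W, rfl⟩ := mem_faceFan.1 hσ
  refine ⟨_, h.subCone_mem Set.univ, subCone_mono (Set.subset_univ _), l, h.isSmoothCone,
    fun x hx => ?_⟩
  rw [h.sum_apply, h.gaugeP_eq hx.1]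

end FaceFan


/-! ### The normal fan of `∇` -/

section Cells

variable {i j : Fin 4} {I I' J J' : Set (Fin 4)} {x : NR}

/-- The cone on which the forms `A_i`, `i ∈ I`, and `B_j`, `j ∈ J`, are maximal. -/
def cell (I J : Set (Fin 4)) : PointedCone ℝ NR where
  carrier := {x | (∀ i ∈ I, ∀ r, formA r x ≤ formA i x) ∧ ∀ j ∈ J, ∀ r, formB r x ≤ formB j x}
  add_mem' {x y} hx hy := by
    refine ⟨fun i hi r => ?_, fun j hj r => ?_⟩
    · rw [map_add, map_add]
      exact add_le_add (hx.1 i hi r) (hy.1 i hi r)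
    · rw [map_add, map_add]
      exact add_le_add (hx.2 j hj r) (hy.2 j hj r)
  zero_mem' := ⟨fun i _ r => by rw [map_zero, map_zero], fun j _ r => by rw [map_zero, map_zero]⟩
  smul_mem' c x hx := by
    rw [show c • x = (c : ℝ) • x from rfl]
    refine ⟨fun i hi r => ?_, fun j hj r => ?_⟩
    · rw [map_smul, map_smul]
      exact mul_le_mul_of_nonneg_left (hx.1 i hi r) c.2
    · rw [map_smul, map_smul]
      exact mul_le_mul_of_nonneg_left (hx.2 j hj r) c.2

theorem mem_cell : x ∈ cell I J ↔
    (∀ i ∈ I, formA i x = supA x) ∧ ∀ j ∈ J, formB j x = supB x := by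
  refine and_congr ?_ ?_
  · exact forall₂_congr fun i _ => ⟨supA_eq_of_le, fun h r => h ▸ formA_le r x⟩
  · exact forall₂_congr fun j _ => ⟨supB_eq_of_le, fun h r => h ▸ formB_le r x⟩

theorem cell_anti (hI : I ⊆ I') (hJ : J ⊆ J') : cell I' J' ≤ cell I J :=
  fun _ hx => ⟨fun i hi => hx.1 i (hI hi), fun j hj => hx.2 j (hJ hj)⟩

theorem cell_inf : cell I J ⊓ cell I' J' = cell (I ∪ I') (J ∪ J') := by
  apply le_antisymm
  · rintro x ⟨hx, hx'⟩
    exact ⟨fun i hi => hi.elim (hx.1 i) (hx'.1 i), fun j hj => hj.elim (hx.2 j) (hx'.2 j)⟩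
  · exact le_inf (cell_anti Set.subset_union_left Set.subset_union_left)
      (cell_anti Set.subset_union_right Set.subset_union_right)

/-- A form that is maximal on the cell is at least the competitor at both summands; if the two agree
at the sum, they agree at each summand. -/
theorem isFaceOf_cell (hI : I ⊆ I') (hJ : J ⊆ J') (hIne : I.Nonempty) (hJne : J.Nonempty) :
    (cell I' J').IsFaceOf (cell I J) := by
  obtain ⟨i, hi⟩ := hIne
  obtain ⟨j, hj⟩ := hJne
  refine ⟨cell_anti hI hJ, fun {x y a} hx hy ha hxy => ⟨fun i' hi' r => ?_, fun j' hj' r => ?_⟩⟩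
  · have h1 := hxy.1 i' hi' i
    have h2 := hx.1 i hi i'
    have h3 := hy.1 i hi i'
    have h4 := hx.1 i hi r
    simp only [map_add, map_smul, smul_eq_mul] at h1
    have : a * (formA i x - formA i' x) ≤ 0 := by linarith
    have := nonpos_of_mul_nonpos_right this ha
    linarith
  · have h1 := hxy.2 j' hj' j
    have h2 := hx.2 j hj j'
    have h3 := hy.2 j hj j'
    have h4 := hx.2 j hj r
    simp only [map_add, map_smul, smul_eq_mul] at h1
    have : a * (formB j x - formB j' x) ≤ 0 := by linarith
    have := nonpos_of_mul_nonpos_right this ha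
    linarith

theorem eq_sum_u_add_v (hi : formA i x = supA x) (hj : formB j x = supB x) (h0 : 0 < gaugeP x) :
    x = ∑ k, (formZ i j k x / (3 * gaugeP x)) • (supA x • u k + supB x • v k) := by
  have hs := sum_formZ_apply i j x
  rw [hi, hj, ← gaugeP] at hs
  have : ∀ k, (formZ i j k x / (3 * gaugeP x)) • (supA x • u k + supB x • v k) =
      (formZ i j k x / 3) • u k + (formZ i j k x * (supB x / (3 * gaugeP x))) • w := by
    intro k
    rw [← u_add_w]
    simp only [smul_add, smul_smul]
    rw [← add_assoc, ← add_smul]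
    congr 2
    · rw [gaugeP] at h0 ⊢
      field_simp
    · field_simp
  rw [Finset.sum_congr rfl fun k _ => this k, Finset.sum_add_distrib, ← Finset.sum_smul,
    ← Finset.sum_mul, hs]
  nth_rw 1 [eq_sum_u i j x, hj]
  congr 2
  field_simp

/-- The generators of `cell I J`. -/
def cellGens (I J : Set (Fin 4)) : Set NR :=
  {x | ∃ k, (∀ i ∈ I, ∀ j ∈ J, ¬ Excl i j k) ∧ ((0 ∉ I ∧ x = u k) ∨ (0 ∉ J ∧ x = v k))}

theorem u_mem_cell (hI : 0 ∉ I) (hIne : I.Nonempty) (hJne : J.Nonempty) {k : Fin 6}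
    (hk : ∀ i ∈ I, ∀ j ∈ J, ¬ Excl i j k) : u k ∈ cell I J := by
  obtain ⟨i, hi⟩ := hIne
  obtain ⟨j, hj⟩ := hJne
  refine ⟨fun i' hi' r => ?_, fun j' hj' r => ?_⟩
  · rw [formA_u_of_not_excl (fun h => hI (h ▸ hi')) (hk i' hi' j hj)]
    exact formA_u_le r k
  · rw [formB_u_of_not_excl (hk i hi j' hj')]
    exact formB_u_le r k

theorem v_mem_cell (hJ : 0 ∉ J) (hIne : I.Nonempty) (hJne : J.Nonempty) {k : Fin 6}
    (hk : ∀ i ∈ I, ∀ j ∈ J, ¬ Excl i j k) : v k ∈ cell I J := by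
  obtain ⟨i, hi⟩ := hIne
  obtain ⟨j, hj⟩ := hJne
  refine ⟨fun i' hi' r => ?_, fun j' hj' r => ?_⟩
  · rw [formA_v_of_not_excl (hk i' hi' j hj)]
    exact formA_v_le r k
  · rw [formB_v_of_not_excl (fun h => hJ (h ▸ hj')) (hk i hi j' hj')]
    exact formB_v_le r k

/-- In the nonnegative expansion of a point, excluded indices have coefficient zero, and the u-part
or v-part vanishes if 0 belongs to `I` or to `J`, since then max A_i or max B_j is zero. -/
theorem cell_eq_hull (hIne : I.Nonempty) (hJne : J.Nonempty) :
    cell I J = PointedCone.hull ℝ (cellGens I J) := by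
  apply le_antisymm
  · intro x hx
    have hx' := mem_cell.1 hx
    obtain ⟨i, hi⟩ := hIne
    obtain ⟨j, hj⟩ := hJne
    obtain h0 | h0 := (gaugeP_nonneg x).eq_or_lt
    · rw [eq_zero_of_gaugeP h0.symm]
      exact zero_mem _
    rw [eq_sum_u_add_v (hx'.1 i hi) (hx'.2 j hj) h0]
    refine sum_mem fun k _ => ?_
    by_cases hk : ∀ i ∈ I, ∀ j ∈ J, ¬ Excl i j k
    · refine (PointedCone.hull ℝ _).smul_mem
        (div_nonneg (formZ_nonneg (hx'.1 i hi) (hx'.2 j hj) k) (by positivity)) (add_mem ?_ ?_)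
      · by_cases hI : 0 ∈ I
        · rw [← hx'.1 0 hI, formA_zero, LinearMap.zero_apply, zero_smul]
          exact zero_mem _
        · exact (PointedCone.hull ℝ _).smul_mem (supA_nonneg x)
            (Submodule.subset_span ⟨k, hk, .inl ⟨hI, rfl⟩⟩)
      · by_cases hJ : 0 ∈ J
        · rw [← hx'.2 0 hJ, formB_zero, LinearMap.zero_apply, zero_smul]
          exact zero_mem _
        · exact (PointedCone.hull ℝ _).smul_mem (supB_nonneg x)
            (Submodule.subset_span ⟨k, hk, .inr ⟨hJ, rfl⟩⟩)
    · push Not at hk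
      obtain ⟨i', hi', j', hj', hk⟩ := hk
      rw [formZ_congr (i' := i') (j' := j') ((hx'.1 i hi).trans (hx'.1 i' hi').symm)
        ((hx'.2 j hj).trans (hx'.2 j' hj').symm), formZ_eq_zero hk, LinearMap.zero_apply, zero_div,
        zero_smul]
      exact zero_mem _
  · refine Submodule.span_le.2 ?_
    rintro y ⟨k, hk, ⟨hI, rfl⟩ | ⟨hJ, rfl⟩⟩
    · exact u_mem_cell hI hIne hJne hk
    · exact v_mem_cell hJ hIne hJne hk

/-- A set of forms is the set of minima of convex combinations. -/
theorem forall_le_sum_iff {f : Fin 4 → Module.Dual ℝ NR} {c : Fin 4 → ℝ} (hc : ∀ i, 0 ≤ c i)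
    (hc1 : ∑ i, c i = 1) (x : NR) :
    (∀ r, f r x ≤ (∑ i, c i • f i) x) ↔ ∀ i ∈ {i | 0 < c i}, ∀ r, f r x ≤ f i x := by
  simp only [LinearMap.sum_apply, LinearMap.smul_apply, smul_eq_mul]
  constructor
  · intro h i hi
    obtain ⟨r, -, hr⟩ := Finset.exists_max_image Finset.univ (fun r => f r x) Finset.univ_nonempty
    have h1 : ∑ n, c n * (f r x - f n x) ≤ 0 := by
      simp only [mul_sub, Finset.sum_sub_distrib, ← Finset.sum_mul, hc1]
      linarith [h r]
    have h2 : ∀ n ∈ Finset.univ, 0 ≤ c n * (f r x - f n x) := fun n hn =>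
      mul_nonneg (hc n) (sub_nonneg.2 (hr n hn))
    have h3 := (Finset.sum_eq_zero_iff_of_nonneg h2).1 (le_antisymm h1 (Finset.sum_nonneg h2)) i
      (Finset.mem_univ i)
    have h4 := (mul_eq_zero.1 h3).resolve_left (ne_of_gt hi)
    intro s
    have := hr s (Finset.mem_univ s)
    linarith
  · intro h r
    have : f r x = ∑ n, c n * f r x := by rw [← Finset.sum_mul, hc1, one_mul]
    rw [this]
    refine Finset.sum_le_sum fun n _ => ?_
    obtain hn | hn := (hc n).eq_or_lt
    · rw [← hn, zero_mul, zero_mul]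
    · exact mul_le_mul_of_nonneg_left (h n hn r) hn.le

theorem forall_mem_Delta₁ {m : Module.Dual ℝ NR} {t : ℝ} :
    (∀ x ∈ Delta₁, 0 ≤ m x + t) ↔ ∀ k, 0 ≤ m (u k) + t := by
  refine ⟨fun h k => h _ (subset_convexHull ℝ _ ⟨k, rfl⟩), fun h x hx => ?_⟩
  have : Delta₁ ⊆ {x | -t ≤ m x} := by
    refine convexHull_min ?_ (convex_halfSpace_ge m.isLinear (-t))
    rintro _ ⟨k, rfl⟩
    have := h k
    change -t ≤ m (u k)
    linarith
  have h1 : -t ≤ m x := this hx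
  linarith

theorem forall_mem_Delta₂ {m : Module.Dual ℝ NR} {t : ℝ} :
    (∀ x ∈ Delta₂, 0 ≤ m x + t) ↔ ∀ k, 0 ≤ m (v k) + t := by
  refine ⟨fun h k => h _ (subset_convexHull ℝ _ ⟨k, rfl⟩), fun h x hx => ?_⟩
  have : Delta₂ ⊆ {x | -t ≤ m x} := by
    refine convexHull_min ?_ (convex_halfSpace_ge m.isLinear (-t))
    rintro _ ⟨k, rfl⟩
    have := h k
    change -t ≤ m (v k)
    linarith
  have h1 : -t ≤ m x := this hx
  linarith

theorem eq_sum_X_u (m : Module.Dual ℝ NR) : m = ∑ k, (m (u k) / 3) • X k := by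
  ext x
  conv_lhs => rw [eq_sum_u 0 0 x, formB_zero, LinearMap.zero_apply, zero_smul, add_zero, map_sum]
  rw [LinearMap.sum_apply]
  refine Finset.sum_congr rfl fun k _ => ?_
  simp [formZ, formA_zero, formB_zero]
  ring

theorem eq_sum_X_v (m : Module.Dual ℝ NR) : m = ∑ k, (m (v k) / 3) • X k := by
  ext x
  conv_lhs => rw [eq_sum_v 0 0 x, formA_zero, LinearMap.zero_apply, zero_smul, sub_zero, map_sum]
  rw [LinearMap.sum_apply]
  refine Finset.sum_congr rfl fun k _ => ?_
  simp [formZ, formA_zero, formB_zero]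
  ring

/-- As v_4 + v_5 + v_6 = 0, a form nonnegative on Δ₂ vanishes at these three vertices, so it is a
combination of the first three coordinates with nonnegative coefficients. The condition at u_4
bounds their sum by 1, and the rest is the weight of A_0 = 0. -/
theorem mem_nabla₁ {m : Module.Dual ℝ NR} :
    m ∈ nabla₁ ↔ ∃ c : Fin 4 → ℝ, (∀ i, 0 ≤ c i) ∧ ∑ i, c i = 1 ∧ m = -∑ i, c i • formA i := by
  have h0 : m ∈ nabla₁ ↔ (∀ k, 0 ≤ m (u k) + 1) ∧ ∀ k, 0 ≤ m (v k) := by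
    have h2 := forall_mem_Delta₂ (m := m) (t := 0)
    simp only [add_zero] at h2
    exact and_congr forall_mem_Delta₁ h2
  rw [h0]
  constructor
  · rintro ⟨hu, hv⟩
    have hsum : v 3 + v 4 + v 5 = 0 := by
      apply NR_ext
      intro k
      simp only [map_add, X_v, map_zero]
      fin_cases k <;> simp <;> norm_num
    have hm := congrArg m hsum
    simp only [map_add, map_zero] at hm
    have h3 : m (v 3) = 0 := by linarith [hv 3, hv 4, hv 5]
    have h4 : m (v 4) = 0 := by linarith [hv 3, hv 4, hv 5]
    have h5 : m (v 5) = 0 := by linarith [hv 3, hv 4, hv 5]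
    have hmX := (eq_sum_X_v m).trans (Fin.sum_univ_six _)
    rw [h3, h4, h5] at hmX
    have hu3 := hu 3
    rw [hmX] at hu3
    simp only [LinearMap.add_apply, LinearMap.smul_apply, X_u] at hu3
    simp at hu3
    refine ⟨![1 - (m (v 0) / 3 + m (v 1) / 3 + m (v 2) / 3), m (v 0) / 3, m (v 1) / 3, m (v 2) / 3],
      fun i => ?_, ?_, ?_⟩
    · have h0 := hv 0
      have h1 := hv 1
      have h2 := hv 2
      fin_cases i
      · simp
        linarith
      all_goals
        simp
        positivity
    · simp [Fin.sum_univ_four]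
      ring
    · nth_rw 1 [hmX]
      simp [Fin.sum_univ_four, formA]
      abel
  · rintro ⟨c, hc, hc1, rfl⟩
    simp only [LinearMap.neg_apply, LinearMap.sum_apply, LinearMap.smul_apply, smul_eq_mul]
    refine ⟨fun k => ?_, fun k => ?_⟩
    · have : ∑ i, c i * formA i (u k) ≤ ∑ i, c i * 1 :=
        Finset.sum_le_sum fun i _ => mul_le_mul_of_nonneg_left (formA_u_le i k) (hc i)
      simp only [mul_one, hc1] at this
      linarith
    · rw [neg_nonneg]
      exact Finset.sum_nonpos fun i _ => mul_nonpos_of_nonneg_of_nonpos (hc i) (formA_v_le i k)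

theorem mem_nabla₂ {m : Module.Dual ℝ NR} :
    m ∈ nabla₂ ↔ ∃ c : Fin 4 → ℝ, (∀ i, 0 ≤ c i) ∧ ∑ i, c i = 1 ∧ m = -∑ i, c i • formB i := by
  have h0 : m ∈ nabla₂ ↔ (∀ k, 0 ≤ m (u k)) ∧ ∀ k, 0 ≤ m (v k) + 1 := by
    have h2 := forall_mem_Delta₁ (m := m) (t := 0)
    simp only [add_zero] at h2
    exact and_congr h2 forall_mem_Delta₂
  rw [h0]
  constructor
  · rintro ⟨hu, hv⟩
    have hsum : u 0 + u 1 + u 2 = 0 := by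
      apply NR_ext
      intro k
      simp only [map_add, X_u, map_zero]
      fin_cases k <;> simp <;> norm_num
    have hm := congrArg m hsum
    simp only [map_add, map_zero] at hm
    have h3 : m (u 0) = 0 := by linarith [hu 0, hu 1, hu 2]
    have h4 : m (u 1) = 0 := by linarith [hu 0, hu 1, hu 2]
    have h5 : m (u 2) = 0 := by linarith [hu 0, hu 1, hu 2]
    have hmX := (eq_sum_X_u m).trans (Fin.sum_univ_six _)
    rw [h3, h4, h5] at hmX
    have hv0 := hv 0
    rw [hmX] at hv0
    simp only [LinearMap.add_apply, LinearMap.smul_apply, X_v] at hv0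
    simp at hv0
    refine ⟨![1 - (m (u 3) / 3 + m (u 4) / 3 + m (u 5) / 3), m (u 3) / 3, m (u 4) / 3, m (u 5) / 3],
      fun i => ?_, ?_, ?_⟩
    · have h0 := hu 3
      have h1 := hu 4
      have h2 := hu 5
      fin_cases i
      · simp
        linarith
      all_goals
        simp
        positivity
    · simp [Fin.sum_univ_four]
      ring
    · nth_rw 1 [hmX]
      simp [Fin.sum_univ_four, formB]
      abel
  · rintro ⟨c, hc, hc1, rfl⟩
    simp only [LinearMap.neg_apply, LinearMap.sum_apply, LinearMap.smul_apply, smul_eq_mul]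
    refine ⟨fun k => ?_, fun k => ?_⟩
    · rw [neg_nonneg]
      exact Finset.sum_nonpos fun i _ => mul_nonpos_of_nonneg_of_nonpos (hc i) (formB_u_le i k)
    · have : ∑ i, c i * formB i (v k) ≤ ∑ i, c i * 1 :=
        Finset.sum_le_sum fun i _ => mul_le_mul_of_nonneg_left (formB_v_le i k) (hc i)
      simp only [mul_one, hc1] at this
      linarith

/-- Minimizing over a Minkowski sum splits into the two summands, and a convex combination attains
the maximum exactly if all forms with positive weight do. -/
theorem normalCone_eq_cell {c d : Fin 4 → ℝ} (hc : ∀ i, 0 ≤ c i) (hc1 : ∑ i, c i = 1)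
    (hd : ∀ i, 0 ≤ d i) (hd1 : ∑ i, d i = 1) :
    normalCone (nabla₁ + nabla₂) (-∑ i, c i • formA i + -∑ i, d i • formB i) =
      cell {i | 0 < c i} {i | 0 < d i} := by
  have hvert : ∀ (f : Fin 4 → Module.Dual ℝ NR) (r : Fin 4), ∃ a : Fin 4 → ℝ, (∀ i, 0 ≤ a i) ∧
      ∑ i, a i = 1 ∧ -f r = -∑ i, a i • f i := by
    intro f r
    refine ⟨Pi.single r 1, fun i => ?_, by simp, ?_⟩
    · by_cases h : i = r
      · subst h
        simp
      · simp [h]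
    · simp [Pi.single_apply, ite_smul]
  ext x
  constructor
  · intro hx
    refine ⟨(forall_le_sum_iff hc hc1 x).1 fun r => ?_, (forall_le_sum_iff hd hd1 x).1 fun r => ?_⟩
    · have := hx (-formA r + -∑ i, d i • formB i) (Set.add_mem_add (mem_nabla₁.2 (hvert formA r))
        (mem_nabla₂.2 ⟨d, hd, hd1, rfl⟩))
      simp only [LinearMap.add_apply, LinearMap.neg_apply] at this
      linarith
    · have := hx (-∑ i, c i • formA i + -formB r) (Set.add_mem_add (mem_nabla₁.2 ⟨c, hc, hc1, rfl⟩)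
        (mem_nabla₂.2 (hvert formB r)))
      simp only [LinearMap.add_apply, LinearMap.neg_apply] at this
      linarith
  · rintro ⟨hA, hB⟩
    have hA' := (forall_le_sum_iff hc hc1 x).2 hA
    have hB' := (forall_le_sum_iff hd hd1 x).2 hB
    rintro _ ⟨m₁, hm₁, m₂, hm₂, rfl⟩
    obtain ⟨a, ha, ha1, rfl⟩ := mem_nabla₁.1 hm₁
    obtain ⟨b, hb, hb1, rfl⟩ := mem_nabla₂.1 hm₂
    have key : ∀ {f : Fin 4 → Module.Dual ℝ NR} {a : Fin 4 → ℝ} {t : ℝ}, (∀ i, 0 ≤ a i) →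
        ∑ i, a i = 1 → (∀ r, f r x ≤ t) → (∑ i, a i • f i) x ≤ t := by
      intro f a t ha ha1 ht
      rw [LinearMap.sum_apply]
      calc ∑ i, (a i • f i) x ≤ ∑ i, a i * t :=
            Finset.sum_le_sum fun i _ => mul_le_mul_of_nonneg_left (ht i) (ha i)
        _ = t := by rw [← Finset.sum_mul, ha1, one_mul]
    have h1 := key ha ha1 hA'
    have h2 := key hb hb1 hB'
    simp only [LinearMap.add_apply, LinearMap.neg_apply]
    linarith

theorem exists_weights {I : Set (Fin 4)} (hI : I.Nonempty) :
    ∃ c : Fin 4 → ℝ, (∀ i, 0 ≤ c i) ∧ ∑ i, c i = 1 ∧ {i | 0 < c i} = I := by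
  classical
  have hcard : 0 < ((Finset.univ.filter (· ∈ I)).card : ℝ) := by
    rw [Nat.cast_pos, Finset.card_pos]
    obtain ⟨i, hi⟩ := hI
    exact ⟨i, by simpa using hi⟩
  refine ⟨fun i => if i ∈ I then ((Finset.univ.filter (· ∈ I)).card : ℝ)⁻¹ else 0, fun i => ?_, ?_, ?_⟩
  · dsimp only
    split_ifs <;> positivity
  · rw [← Finset.sum_filter, Finset.sum_const, nsmul_eq_mul, mul_inv_cancel₀ hcard.ne']
  · ext i
    by_cases hi : i ∈ I
    · refine iff_of_true ?_ hi
      exact (inv_pos.2 hcard).trans_eq (if_pos hi).symm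
    · simp [hi]

theorem mem_SigmaNabla {σ : PointedCone ℝ NR} : σ ∈ SigmaNabla ↔
    ∃ I J : Set (Fin 4), I.Nonempty ∧ J.Nonempty ∧ σ = cell I J := by
  have hpos : ∀ {c : Fin 4 → ℝ}, (∀ i, 0 ≤ c i) → ∑ i, c i = 1 → {i | 0 < c i}.Nonempty := by
    intro c hc hc1
    by_contra hne
    rw [Set.not_nonempty_iff_eq_empty, Set.eq_empty_iff_forall_notMem] at hne
    have := Finset.sum_nonpos fun i (_ : i ∈ Finset.univ) => not_lt.1 (show ¬ 0 < c i from hne i)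
    linarith
  constructor
  · rintro ⟨_, ⟨m₁, hm₁, m₂, hm₂, rfl⟩, rfl⟩
    obtain ⟨c, hc, hc1, rfl⟩ := mem_nabla₁.1 hm₁
    obtain ⟨d, hd, hd1, rfl⟩ := mem_nabla₂.1 hm₂
    exact ⟨_, _, hpos hc hc1, hpos hd hd1, normalCone_eq_cell hc hc1 hd hd1⟩
  · rintro ⟨I, J, hI, hJ, rfl⟩
    obtain ⟨c, hc, hc1, rfl⟩ := exists_weights hI
    obtain ⟨d, hd, hd1, rfl⟩ := exists_weights hJ
    exact ⟨_, Set.add_mem_add (mem_nabla₁.2 ⟨c, hc, hc1, rfl⟩) (mem_nabla₂.2 ⟨d, hd, hd1, rfl⟩),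
      (normalCone_eq_cell hc hc1 hd hd1).symm⟩

end Cells


/-! ### The normal fan of ∇ is a fan that is subdivided by the face fan. -/

section NormalFan

variable {i j i' j' : Fin 4} {I I' J J' : Set (Fin 4)} {x : NR} {p : Fin 5 → NR}
  {l : Fin 5 → Module.Dual ℝ NR} {W : Set (Fin 5)}

theorem cell_mem (hI : I.Nonempty) (hJ : J.Nonempty) : cell I J ∈ SigmaNabla :=
  mem_SigmaNabla.2 ⟨I, J, hI, hJ, rfl⟩

theorem cellGens_finite (I J : Set (Fin 4)) : (cellGens I J).Finite := by
  refine ((Set.finite_range u).union (Set.finite_range v)).subset ?_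
  rintro _ ⟨k, -, ⟨-, rfl⟩ | ⟨-, rfl⟩⟩
  exacts [.inl ⟨k, rfl⟩, .inr ⟨k, rfl⟩]

theorem exists_finset_hull_cell (hI : I.Nonempty) (hJ : J.Nonempty) :
    ∃ s : Finset NR, (∀ x ∈ s, x ∈ latticeN) ∧ PointedCone.hull ℝ (s : Set NR) = cell I J := by
  refine ⟨(cellGens_finite I J).toFinset, fun x hx => ?_, ?_⟩
  · rw [Set.Finite.mem_toFinset] at hx
    obtain ⟨k, -, ⟨-, rfl⟩ | ⟨-, rfl⟩⟩ := hx
    exacts [u_mem k, v_mem k]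
  · rw [Set.Finite.coe_toFinset, cell_eq_hull hI hJ]

theorem supA_eq_zero_of_neg (hi : formA i x = supA x) (hi' : formA i (-x) = supA (-x)) : supA x = 0 := by
  have h1 := supA_nonneg x
  have h2 := supA_nonneg (-x)
  rw [map_neg] at hi'
  linarith

theorem supB_eq_zero_of_neg (hj : formB j x = supB x) (hj' : formB j (-x) = supB (-x)) : supB x = 0 := by
  have h1 := supB_nonneg x
  have h2 := supB_nonneg (-x)
  rw [map_neg] at hj'
  linarith

/-- A face of a cell is a cell. -/
theorem eq_cell_of_isFaceOf {ρ : PointedCone ℝ NR} (h : ρ.IsFaceOf (cell I J)) :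
    ρ = cell {i | ∀ x ∈ ρ, ∀ r, formA r x ≤ formA i x} {j | ∀ x ∈ ρ, ∀ r, formB r x ≤ formB j x} := by
  classical
  set I' := {i | ∀ x ∈ ρ, ∀ r, formA r x ≤ formA i x} with hI'
  set J' := {j | ∀ x ∈ ρ, ∀ r, formB r x ≤ formB j x} with hJ'
  have hII' : I ⊆ I' := fun i hi x hx => (h.le hx).1 i hi
  have hJJ' : J ⊆ J' := fun j hj x hx => (h.le hx).2 j hj
  apply le_antisymm
  · exact fun x hx => ⟨fun i hi => hi x hx, fun j hj => hj x hx⟩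
  intro y hy
  have hA : ∀ i, ∃ z ∈ ρ, i ∉ I' → formA i z < supA z := by
    intro i
    by_cases hi : i ∈ I'
    · exact ⟨0, zero_mem _, fun h => absurd hi h⟩
    · simp only [hI', Set.mem_ofPred_eq, not_forall, not_le] at hi
      obtain ⟨z, hz, r, hr⟩ := hi
      exact ⟨z, hz, fun _ => hr.trans_le (formA_le r z)⟩
  have hB : ∀ j, ∃ z ∈ ρ, j ∉ J' → formB j z < supB z := by
    intro j
    by_cases hj : j ∈ J'
    · exact ⟨0, zero_mem _, fun h => absurd hj h⟩
    · simp only [hJ', Set.mem_ofPred_eq, not_forall, not_le] at hj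
      obtain ⟨z, hz, r, hr⟩ := hj
      exact ⟨z, hz, fun _ => hr.trans_le (formB_le r z)⟩
  choose zA hzA hzA' using hA
  choose zB hzB hzB' using hB
  -- A point in the relative interior of the face: only the forms that are maximal on the whole face
  -- are maximal at it.
  set x₀ := ∑ i, zA i + ∑ j, zB j
  have hx₀ : x₀ ∈ ρ := add_mem (sum_mem fun i _ => hzA i) (sum_mem fun j _ => hzB j)
  have hA₀ : ∀ i ∈ I, ∀ r ∉ I', formA r x₀ < formA i x₀ := by
    intro i hi r hr
    simp only [x₀, map_add, map_sum]
    refine add_lt_add_of_lt_of_le (Finset.sum_lt_sum (fun s _ => (h.le (hzA s)).1 i hi r)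
      ⟨r, Finset.mem_univ r, ?_⟩) (Finset.sum_le_sum fun s _ => (h.le (hzB s)).1 i hi r)
    exact (hzA' r hr).trans_eq ((mem_cell.1 (h.le (hzA r))).1 i hi).symm
  have hB₀ : ∀ j ∈ J, ∀ r ∉ J', formB r x₀ < formB j x₀ := by
    intro j hj r hr
    simp only [x₀, map_add, map_sum]
    refine add_lt_add_of_le_of_lt (Finset.sum_le_sum fun s _ => (h.le (hzA s)).2 j hj r)
      (Finset.sum_lt_sum (fun s _ => (h.le (hzB s)).2 j hj r) ⟨r, Finset.mem_univ r, ?_⟩)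
    exact (hzB' r hr).trans_eq ((mem_cell.1 (h.le (hzB r))).2 j hj).symm
  have hev : ∀ a b : ℝ, 0 < a → ∀ᶠ n : ℝ in Filter.atTop, b ≤ n * a := fun a b ha =>
    (Filter.tendsto_id.atTop_mul_const ha).eventually_ge_atTop b
  have hevA : ∀ᶠ n : ℝ in Filter.atTop, ∀ i ∈ I, ∀ r ∉ I',
      formA i y - formA r y ≤ n * (formA i x₀ - formA r x₀) := by
    refine Filter.eventually_all.2 fun i => Filter.eventually_imp_distrib_left.2 fun hi =>
      Filter.eventually_all.2 fun r => Filter.eventually_imp_distrib_left.2 fun hr => ?_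
    exact hev _ _ (sub_pos.2 (hA₀ i hi r hr))
  have hevB : ∀ᶠ n : ℝ in Filter.atTop, ∀ j ∈ J, ∀ r ∉ J',
      formB j y - formB r y ≤ n * (formB j x₀ - formB r x₀) := by
    refine Filter.eventually_all.2 fun i => Filter.eventually_imp_distrib_left.2 fun hi =>
      Filter.eventually_all.2 fun r => Filter.eventually_imp_distrib_left.2 fun hr => ?_
    exact hev _ _ (sub_pos.2 (hB₀ i hi r hr))
  obtain ⟨n, hnA, hnB, hn⟩ := (hevA.and (hevB.and (Filter.eventually_ge_atTop 0))).exists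
  -- For large n the strict inequalities at `x₀` outweigh y, so y is a summand of `n • x₀` within
  -- the cell and belongs to the face.
  have hmem : n • x₀ - y ∈ cell I J := by
    refine ⟨fun i hi r => ?_, fun j hj r => ?_⟩
    · simp only [map_sub, map_smul, smul_eq_mul]
      by_cases hr : r ∈ I'
      · have h1 := hy.1 r hr i
        have h2 := hy.1 i (hII' hi) r
        have h3 := hr x₀ hx₀ i
        have h4 := hII' hi x₀ hx₀ r
        rw [le_antisymm h1 h2, le_antisymm h3 h4]
      · have := hnA i hi r hr
        linarith
    · simp only [map_sub, map_smul, smul_eq_mul]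
      by_cases hr : r ∈ J'
      · have h1 := hy.2 r hr j
        have h2 := hy.2 j (hJJ' hj) r
        have h3 := hr x₀ hx₀ j
        have h4 := hJJ' hj x₀ hx₀ r
        rw [le_antisymm h1 h2, le_antisymm h3 h4]
      · have := hnB j hj r hr
        linarith
  refine h.mem_of_smul_add_mem (cell_anti hII' hJJ' hy) hmem one_pos ?_
  rw [one_smul, add_sub_cancel]
  exact ρ.smul_mem hn hx₀

theorem isFan_SigmaNabla : IsFan latticeN SigmaNabla where
  finite := by
    refine (Set.finite_range fun p : Set (Fin 4) × Set (Fin 4) => cell p.1 p.2).subset fun σ hσ => ?_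
    obtain ⟨I, J, -, -, rfl⟩ := mem_SigmaNabla.1 hσ
    exact ⟨(I, J), rfl⟩
  nonempty := ⟨_, cell_mem Set.univ_nonempty Set.univ_nonempty⟩
  rational := by
    intro σ hσ
    obtain ⟨I, J, hI, hJ, rfl⟩ := mem_SigmaNabla.1 hσ
    exact exists_finset_hull_cell hI hJ
  salient := by
    intro σ hσ x hx hx'
    obtain ⟨I, J, ⟨i, hi⟩, ⟨j, hj⟩, rfl⟩ := mem_SigmaNabla.1 hσ
    rw [mem_cell] at hx hx'
    apply eq_zero_of_gaugeP
    rw [gaugeP, supA_eq_zero_of_neg (hx.1 i hi) (hx'.1 i hi), supB_eq_zero_of_neg (hx.2 j hj) (hx'.2 j hj),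
      add_zero]
  face_mem := by
    intro σ hσ ρ hρ
    obtain ⟨I, J, ⟨i, hi⟩, ⟨j, hj⟩, rfl⟩ := mem_SigmaNabla.1 hσ
    rw [eq_cell_of_isFaceOf hρ]
    exact cell_mem ⟨i, fun x hx => (hρ.le hx).1 i hi⟩ ⟨j, fun x hx => (hρ.le hx).2 j hj⟩
  inf_isFaceOf := by
    intro σ hσ ρ hρ
    obtain ⟨I, J, hI, hJ, rfl⟩ := mem_SigmaNabla.1 hσ
    obtain ⟨I', J', -, -, rfl⟩ := mem_SigmaNabla.1 hρ
    rw [cell_inf]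
    exact isFaceOf_cell Set.subset_union_left Set.subset_union_left hI hJ

/-- The form that cuts out the face `cell I J` of a cone on which `A_i` and `B_j` are maximal. -/
def cellForm (I J : Set (Fin 4)) (i j : Fin 4) : Module.Dual ℝ NR :=
  haveI := Classical.decPred (· ∈ I)
  haveI := Classical.decPred (· ∈ J)
  ∑ r with r ∈ I, (formA i - formA r) + ∑ r with r ∈ J, (formB j - formB r)

theorem cellForm_mem_dualLattice (I J : Set (Fin 4)) (i j : Fin 4) :
    cellForm I J i j ∈ dualLattice latticeN :=
  add_mem (sum_mem fun r _ => sub_mem (formA_mem i) (formA_mem r))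
    (sum_mem fun r _ => sub_mem (formB_mem j) (formB_mem r))

theorem cellForm_apply_nonneg (hi : formA i x = supA x) (hj : formB j x = supB x) :
    0 ≤ cellForm I J i j x := by
  simp only [cellForm, LinearMap.add_apply, LinearMap.sum_apply, LinearMap.sub_apply, hi, hj]
  exact add_nonneg (Finset.sum_nonneg fun r _ => sub_nonneg.2 (formA_le r x))
    (Finset.sum_nonneg fun r _ => sub_nonneg.2 (formB_le r x))

theorem cellForm_apply_eq_zero (hi : formA i x = supA x) (hj : formB j x = supB x) :
    cellForm I J i j x = 0 ↔ x ∈ cell I J := by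
  have hA : ∀ r, 0 ≤ supA x - formA r x := fun r => sub_nonneg.2 (formA_le r x)
  have hB : ∀ r, 0 ≤ supB x - formB r x := fun r => sub_nonneg.2 (formB_le r x)
  simp only [cellForm, LinearMap.add_apply, LinearMap.sum_apply, LinearMap.sub_apply, hi, hj]
  rw [add_eq_zero_iff_of_nonneg (Finset.sum_nonneg fun r _ => hA r)
    (Finset.sum_nonneg fun r _ => hB r), Finset.sum_eq_zero_iff_of_nonneg fun r _ => hA r,
    Finset.sum_eq_zero_iff_of_nonneg fun r _ => hB r, mem_cell]
  simp only [Finset.mem_filter, Finset.mem_univ, true_and, sub_eq_zero]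
  exact and_congr (forall₂_congr fun r _ => eq_comm) (forall₂_congr fun r _ => eq_comm)

theorem isGluable_SigmaNabla : IsGluable latticeN SigmaNabla where
  fg := by
    intro σ hσ
    obtain ⟨I, J, hI, hJ, rfl⟩ := mem_SigmaNabla.1 hσ
    obtain ⟨s, -, hs⟩ := exists_finset_hull_cell hI hJ
    exact ⟨s, hs⟩
  inf_mem := by
    intro σ hσ ρ hρ
    obtain ⟨I, J, hI, hJ, rfl⟩ := mem_SigmaNabla.1 hσ
    obtain ⟨I', J', -, -, rfl⟩ := mem_SigmaNabla.1 hρ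
    rw [cell_inf]
    exact cell_mem (hI.mono Set.subset_union_left) (hJ.mono Set.subset_union_left)
  exists_faceForm := by
    intro σ hσ κ hκ hle
    obtain ⟨I, J, ⟨i, hi⟩, ⟨j, hj⟩, rfl⟩ := mem_SigmaNabla.1 hσ
    obtain ⟨I', J', -, -, rfl⟩ := mem_SigmaNabla.1 hκ
    refine ⟨cellForm I' J' i j, ⟨mem_dualLattice.1 (cellForm_mem_dualLattice I' J' i j),
      fun x hx => ?_⟩, fun x hx => ?_, fun x hx h0 => ?_⟩
    · rw [mem_cell] at hx
      exact cellForm_apply_nonneg (hx.1 i hi) (hx.2 j hj)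
    · have hx' := mem_cell.1 (hle hx)
      exact (cellForm_apply_eq_zero (hx'.1 i hi) (hx'.2 j hj)).2 hx
    · have hx' := mem_cell.1 hx
      exact (cellForm_apply_eq_zero (hx'.1 i hi) (hx'.2 j hj)).1 h0
  bot_mem := by
    have : (⊥ : PointedCone ℝ NR) = cell Set.univ Set.univ := by
      refine le_antisymm bot_le fun x hx => ?_
      rw [mem_cell] at hx
      have h0 := hx.1 0 trivial
      have h1 := hx.2 0 trivial
      rw [formA_zero, LinearMap.zero_apply] at h0
      rw [formB_zero, LinearMap.zero_apply] at h1
      exact eq_zero_of_gaugeP (by rw [gaugeP, ← h0, ← h1, add_zero])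
    rw [this]
    exact cell_mem Set.univ_nonempty Set.univ_nonempty

theorem IsFrame.subCone_le_cell (h : IsFrame i j p l) : subCone l W ≤ cell {i} {j} := by
  intro x hx
  rw [mem_cell]
  exact ⟨fun r hr => by rw [Set.mem_singleton_iff.1 hr, (h.onCell hx.1).1],
    fun r hr => by rw [Set.mem_singleton_iff.1 hr, (h.onCell hx.1).2]⟩

theorem faceFan_le_SigmaNabla : ∀ σ ∈ faceFan tauP, ∃ ρ ∈ SigmaNabla, σ ≤ ρ := by
  intro σ hσ
  obtain ⟨i, j, p, l, h, W, rfl⟩ := mem_faceFan.1 hσ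
  exact ⟨_, cell_mem (Set.singleton_nonempty i) (Set.singleton_nonempty j), h.subCone_le_cell⟩

theorem subdivides_faceFan : Subdivides (faceFan tauP) SigmaNabla := by
  refine ⟨faceFan_le_SigmaNabla, ?_⟩
  trans Set.univ
  · refine Set.eq_univ_of_forall fun x => ?_
    obtain ⟨i, j, p, l, h, hl⟩ := exists_frame_mem x
    exact Set.mem_biUnion (h.subCone_mem Set.univ) ⟨hl, fun k hk => absurd trivial hk⟩
  · refine (Set.eq_univ_of_forall fun x => ?_).symm
    obtain ⟨i, hi⟩ := exists_formA x
    obtain ⟨j, hj⟩ := exists_formB x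
    refine Set.mem_biUnion (cell_mem (Set.singleton_nonempty i) (Set.singleton_nonempty j)) ?_
    refine mem_cell.2 ⟨fun r hr => ?_, fun r hr => ?_⟩
    · rw [Set.mem_singleton_iff.1 hr, hi]
    · rw [Set.mem_singleton_iff.1 hr, hj]

/-- The form `cellForm` is nonnegative on the frame, so it vanishes at a point only if it vanishes
on its support. The intersection is therefore spanned by the vertices in the cell. -/
theorem inf_mem_faceFan : ∀ σ ∈ faceFan tauP, ∀ ρ ∈ SigmaNabla, σ ⊓ ρ ∈ faceFan tauP := by
  intro σ hσ ρ hρ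
  obtain ⟨i, j, p, l, h, W, rfl⟩ := mem_faceFan.1 hσ
  obtain ⟨I, J, -, -, rfl⟩ := mem_SigmaNabla.1 hρ
  have : subCone l W ⊓ cell I J = subCone l {k ∈ W | p k ∈ cell I J} := by
    apply le_antisymm
    · rintro x ⟨hx, hx'⟩
      refine ⟨hx.1, fun k hk => ?_⟩
      by_contra hkx
      have hpos := lt_of_le_of_ne (hx.1 k) (Ne.symm hkx)
      have hkW : k ∈ W := by
        by_contra hkW
        exact hkx (hx.2 k hkW)
      refine hk ⟨hkW, ?_⟩
      have h1 := h.onCell hx.1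
      rw [← cellForm_apply_eq_zero (h.onFacet k).formA_eq (h.onFacet k).formB_eq]
      refine h.apply_eq_zero hx.1 ?_ ((cellForm_apply_eq_zero h1.1 h1.2).2 hx').le hpos
      rintro _ ⟨m, rfl⟩
      exact cellForm_apply_nonneg (h.onFacet m).formA_eq (h.onFacet m).formB_eq
    · intro x hx
      refine ⟨subCone_mono (Set.sep_subset _ _) hx, ?_⟩
      rw [h.eq_sum x]
      refine sum_mem fun k _ => ?_
      by_cases hk : k ∈ {k ∈ W | p k ∈ cell I J}
      · exact (cell I J).smul_mem (hx.1 k) hk.2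
      · rw [hx.2 k hk, zero_smul]
        exact zero_mem _
  rw [this]
  exact h.subCone_mem _

/-- On a cell the gauge is one of the integral forms A_i + B_j; this is why the canonical divisor of
the target is Cartier. -/
theorem SigmaNabla_cartier : ∀ ρ ∈ SigmaNabla, ∃ m ∈ dualLattice latticeN, ∀ x ∈ ρ, m x = gaugeP x := by
  intro ρ hρ
  obtain ⟨I, J, ⟨i, hi⟩, ⟨j, hj⟩, rfl⟩ := mem_SigmaNabla.1 hρ
  refine ⟨formT i j, formT_mem i j, fun x hx => ?_⟩
  rw [mem_cell] at hx
  rw [formT, LinearMap.add_apply, hx.1 i hi, hx.2 j hj, gaugeP]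

end NormalFan


/-! ### The characters of the normal fan of `∇` -/

section Characters

variable {i j : Fin 4} {I J : Set (Fin 4)} {m : Module.Dual ℝ NR}

/-- An integral form in terms of the forms `z_k`, `A_i` and `B_j`. -/
theorem exists_eq_sum_formZ (hm : m ∈ dualLattice latticeN) (i j : Fin 4) (k₀ : Fin 6) :
    ∃ (n : Fin 6 → ℤ) (a b : ℤ), (∀ k, m (u k) = m (u k₀) + 3 * n k) ∧
      (∀ k, m (v k) = m (v k₀) + 3 * n k) ∧ m (u k₀) = a ∧ m (v k₀) = b ∧
      m = ∑ k, n k • formZ i j k + (a • formA i + b • formB j) := by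
  rw [mem_dualLattice] at hm
  -- The vector is e_k - e_{k₀}; so the values of an integral form at the u_k agree modulo 3.
  have hd : ∀ k, ((3 : ℝ)⁻¹ • (u k - u k₀)) ∈ latticeN := by
    intro k l
    change ∃ z : ℤ, X l ((3 : ℝ)⁻¹ • (u k - u k₀)) = z
    refine ⟨(if l = k then 1 else 0) - (if l = k₀ then 1 else 0), ?_⟩
    simp only [map_smul, map_sub, X_u, smul_eq_mul]
    push_cast
    ring_nf
    split_ifs <;> norm_num
  choose n hn using fun k => hm _ (hd k)
  obtain ⟨a, ha⟩ := hm _ (u_mem k₀)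
  obtain ⟨b, hb⟩ := hm _ (v_mem k₀)
  have hu : ∀ k, m (u k) = m (u k₀) + 3 * n k := by
    intro k
    have := hn k
    rw [map_smul, map_sub, smul_eq_mul] at this
    linarith
  refine ⟨n, a, b, hu, fun k => ?_, ha, hb, ?_⟩
  · rw [← u_add_w, ← u_add_w, map_add, map_add, hu k]
    ring
  · ext x
    have hw : m w = b - a := by
      rw [← ha, ← hb, ← u_add_w, map_add]
      ring
    have hs := sum_formZ_apply i j x
    have h1 : m x = ∑ k, formZ i j k x / 3 * m (u k) + formB j x * m w := by
      conv_lhs => rw [eq_sum_u i j x]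
      simp only [map_add, map_sum, map_smul, smul_eq_mul]
    have h2 : ∀ k, formZ i j k x / 3 * m (u k) = n k * formZ i j k x + a / 3 * formZ i j k x := by
      intro k
      rw [hu, ha]
      ring
    rw [h1, Finset.sum_congr rfl fun k _ => h2 k, Finset.sum_add_distrib, ← Finset.mul_sum, hs, hw]
    simp only [LinearMap.add_apply, LinearMap.sum_apply, LinearMap.smul_apply, zsmul_eq_mul]
    ring

theorem exists_not_excl (i j : Fin 4) : ∃ k, ¬ Excl i j k := by
  revert i j
  decide

theorem zsmul_mem_of_nonneg {S : AddSubmonoid (Module.Dual ℝ NR)} {z : ℤ} {m : Module.Dual ℝ NR}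
    (hz : 0 ≤ z) (hm : m ∈ S) : z • m ∈ S := by
  lift z to ℕ using hz
  rw [natCast_zsmul]
  exact nsmul_mem hm z

/-- The characters of a maximal cone of the normal fan are generated by the differences of the
forms `A_i + B_j`. -/
theorem dualMonoid_cell (i j : Fin 4) : dualMonoid latticeN (cell {i} {j}) =
    AddSubmonoid.closure {m | ∃ i' j', m = formT i j - formT i' j'} := by
  set S := AddSubmonoid.closure {m | ∃ i' j', m = formT i j - formT i' j'}
  have hS : ∀ i' j', formT i j - formT i' j' ∈ S := fun i' j' =>
    AddSubmonoid.subset_closure ⟨i', j', rfl⟩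
  have hA : ∀ i', formA i - formA i' ∈ S := by
    intro i'
    have := hS i' j
    rwa [formT, formT, add_sub_add_right_eq_sub] at this
  have hB : ∀ j', formB j - formB j' ∈ S := by
    intro j'
    have := hS i j'
    rwa [formT, formT, add_sub_add_left_eq_sub] at this
  apply le_antisymm
  · intro m hm
    -- Subtracting the smallest value among the vertices that are not excluded makes the
    -- coefficients of the nonzero z_k nonnegative.
    obtain ⟨k₀, hk₀, hmin⟩ := Finset.exists_min_image (Finset.univ.filter fun k => ¬ Excl i j k)
      (fun k => m (u k)) ((exists_not_excl i j).imp fun k hk => by simpa using hk)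
    have hk₀' : ∀ i' ∈ ({i} : Set (Fin 4)), ∀ j' ∈ ({j} : Set (Fin 4)), ¬ Excl i' j' k₀ := by
      rintro _ rfl _ rfl
      simpa using hk₀
    obtain ⟨n, a, b, hu, -, ha, hb, hsum⟩ := exists_eq_sum_formZ (mem_dualLattice.2 hm.1) i j k₀
    rw [hsum]
    refine add_mem (sum_mem fun k _ => ?_) (add_mem ?_ ?_)
    · by_cases hk : Excl i j k
      · rw [formZ_eq_zero hk, smul_zero]
        exact zero_mem _
      · have := hmin k (by simpa using hk)
        rw [hu k] at this
        refine zsmul_mem_of_nonneg ?_ ?_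
        · have h3 : (0 : ℝ) ≤ n k := by linarith
          exact_mod_cast h3
        · obtain ⟨i', h⟩ | ⟨j', h⟩ := formZ_eq k
          · rw [h]
            exact hA i'
          · rw [h]
            exact hB j'
    · by_cases hi : i = 0
      · rw [hi, formA_zero, smul_zero]
        exact zero_mem _
      · have := hm.2 _ (u_mem_cell (I := {i}) (J := {j}) (by simpa using Ne.symm hi) ⟨i, rfl⟩ ⟨j, rfl⟩ hk₀')
        rw [ha] at this
        refine zsmul_mem_of_nonneg (by exact_mod_cast this) ?_
        have := hA 0
        rwa [formA_zero, sub_zero] at this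
    · by_cases hj : j = 0
      · rw [hj, formB_zero, smul_zero]
        exact zero_mem _
      · have := hm.2 _ (v_mem_cell (I := {i}) (J := {j}) (by simpa using Ne.symm hj) ⟨i, rfl⟩ ⟨j, rfl⟩ hk₀')
        rw [hb] at this
        refine zsmul_mem_of_nonneg (by exact_mod_cast this) ?_
        have := hB 0
        rwa [formB_zero, sub_zero] at this
  · rw [AddSubmonoid.closure_le]
    rintro _ ⟨i', j', rfl⟩
    refine ⟨mem_dualLattice.1 (sub_mem (formT_mem i j) (formT_mem i' j')), fun x hx => ?_⟩
    have h1 := hx.1 i rfl i'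
    have h2 := hx.2 j rfl j'
    simp only [formT, LinearMap.sub_apply, LinearMap.add_apply]
    linarith

/-- The numbering of the pairs of indices. -/
def pairEquiv : Fin 4 × Fin 4 ≃ Fin (15 + 1) := finProdFinEquiv

/-- The maximal cones of the normal fan. -/
def maxCell (k : Fin (15 + 1)) : SigmaNabla :=
  ⟨cell {(pairEquiv.symm k).1} {(pairEquiv.symm k).2},
    cell_mem (Set.singleton_nonempty _) (Set.singleton_nonempty _)⟩

/-- All sixteen forms A_i + B_j are used; the cell of the pair (0, 0) is the origin, which does no
harm. -/
theorem isVeryAmple_SigmaNabla : IsVeryAmple latticeN SigmaNabla (n := 15)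
    (fun k => formT (pairEquiv.symm k).1 (pairEquiv.symm k).2) maxCell where
  mem_of_forall_le k x h := by
    set q := pairEquiv.symm k with hq
    have h' : ∀ i j, formT i j x ≤ formT q.1 q.2 x := fun i j => by
      simpa using h (pairEquiv (i, j))
    change x ∈ cell {q.1} {q.2}
    refine ⟨?_, ?_⟩
    · rintro _ rfl r
      simpa [formT] using h' r q.2
    · rintro _ rfl r
      simpa [formT] using h' q.1 r
  closure_eq k := by
    refine (dualMonoid_cell _ _).trans ?_
    congr 1
    ext m
    constructor
    · rintro ⟨i', j', rfl⟩
      exact ⟨pairEquiv (i', j'), by simp⟩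
    · rintro ⟨l, rfl⟩
      exact ⟨_, _, rfl⟩
  exists_le σ := by
    obtain ⟨I, J, ⟨i, hi⟩, ⟨j, hj⟩, hσ⟩ := mem_SigmaNabla.1 σ.2
    refine ⟨pairEquiv (i, j), ?_⟩
    rw [hσ, maxCell]
    simp only [Equiv.symm_apply_apply]
    exact cell_anti (Set.singleton_subset_iff.2 hi) (Set.singleton_subset_iff.2 hj)

/-- The ray is a cell: the forms A_i with i ≠ 0 and all B_j, without those that exclude k, together
exclude every other index, and B_0 removes the v's. -/
theorem hull_u_mem_SigmaNabla (k : Fin 6) : PointedCone.hull ℝ {u k} ∈ SigmaNabla := by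
  have hI : ∃ i : Fin 4, i ≠ 0 ∧ i.val ≠ k.val + 1 := by
    revert k
    decide
  have hE : ∀ m : Fin 6, (∀ i : Fin 4, i ≠ 0 ∧ i.val ≠ k.val + 1 → ∀ j : Fin 4,
      j = 0 ∨ j.val + 2 ≠ k.val → ¬ Excl i j m) ↔ m = k := by
    revert k
    decide
  have hJ : ({j | j = 0 ∨ j.val + 2 ≠ k.val} : Set (Fin 4)).Nonempty := ⟨0, .inl rfl⟩
  have hI : ({i | i ≠ 0 ∧ i.val ≠ k.val + 1} : Set (Fin 4)).Nonempty := hI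
  convert cell_mem hI hJ
  rw [cell_eq_hull hI hJ]
  congr 1
  ext x
  constructor
  · rintro rfl
    exact ⟨k, (hE k).2 rfl, .inl ⟨fun h => h.1 rfl, rfl⟩⟩
  · rintro ⟨m, hm, ⟨-, rfl⟩ | ⟨h0, -⟩⟩
    · rw [(hE m).1 hm]
      rfl
    · exact absurd (.inl rfl) h0

theorem hull_v_mem_SigmaNabla (k : Fin 6) : PointedCone.hull ℝ {v k} ∈ SigmaNabla := by
  have hJ : ∃ j : Fin 4, j ≠ 0 ∧ j.val + 2 ≠ k.val := by
    revert k
    decide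
  have hE : ∀ m : Fin 6, (∀ i : Fin 4, i = 0 ∨ i.val ≠ k.val + 1 → ∀ j : Fin 4,
      j ≠ 0 ∧ j.val + 2 ≠ k.val → ¬ Excl i j m) ↔ m = k := by
    revert k
    decide
  have hI : ({i | i = 0 ∨ i.val ≠ k.val + 1} : Set (Fin 4)).Nonempty := ⟨0, .inl rfl⟩
  have hJ : ({j | j ≠ 0 ∧ j.val + 2 ≠ k.val} : Set (Fin 4)).Nonempty := hJ
  convert cell_mem hI hJ
  rw [cell_eq_hull hI hJ]
  congr 1
  ext x
  constructor
  · rintro rfl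
    exact ⟨k, (hE k).2 rfl, .inr ⟨fun h => h.1 rfl, rfl⟩⟩
  · rintro ⟨m, hm, ⟨h0, -⟩ | ⟨-, rfl⟩⟩
    · exact absurd (.inl rfl) h0
    · rw [(hE m).1 hm]
      rfl

theorem hull_mem_faceFan {x : NR} (hx : x ∈ latticeN) (h1 : gaugeP x = 1) :
    PointedCone.hull ℝ {x} ∈ faceFan tauP := by
  obtain ⟨i, j, p, l, h, hl⟩ := exists_frame_mem x
  obtain ⟨k, rfl⟩ := h.exists_eq_of_mem_lattice hx hl (by
    rw [(h.onCell hl).1, (h.onCell hl).2, ← gaugeP, h1])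
  rw [h.hull_eq (Set.singleton_subset_iff.2 (.inr ⟨k, rfl⟩))]
  exact h.subCone_mem _

theorem gaugeP_u (k : Fin 6) : gaugeP (u k) = 1 := by
  have hA : formA (if k = 0 then 2 else 1) (u k) = 1 := by
    rw [formA_u]
    fin_cases k <;> simp
  rw [gaugeP, ← supA_eq_of_le (i := if k = 0 then 2 else 1) fun r => by
    rw [hA]
    exact formA_u_le r k, ← supB_eq_of_le (j := 0) fun r => by
    rw [formB_zero]
    exact formB_u_le r k, hA, formB_zero, LinearMap.zero_apply, add_zero]

theorem gaugeP_v (k : Fin 6) : gaugeP (v k) = 1 := by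
  have hB : formB (if k = 3 then 2 else 1) (v k) = 1 := by
    rw [formB_v]
    fin_cases k <;> simp
  rw [gaugeP, ← supA_eq_of_le (i := 0) fun r => by
    rw [formA_zero]
    exact formA_v_le r k, ← supB_eq_of_le (j := if k = 3 then 2 else 1) fun r => by
    rw [hB]
    exact formB_v_le r k, formA_zero, LinearMap.zero_apply, hB, zero_add]

end Characters


/-! ### Prime ideals of characters and the rays of Σ_∇. -/

section PrimeIdeals

variable {i j : Fin 4} {I J : Set (Fin 4)} {m m' : Module.Dual ℝ NR} {D : AddSubmonoid (Module.Dual ℝ NR)}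

/-- A prime ideal of a monoid of forms. -/
structure IsPrimeIdeal (D : AddSubmonoid (Module.Dual ℝ NR)) (T : Module.Dual ℝ NR → Prop) : Prop where
  not_zero : ¬ T 0
  add_iff : ∀ m ∈ D, ∀ m' ∈ D, T (m + m') ↔ T m ∨ T m'

variable {T : Module.Dual ℝ NR → Prop}

theorem IsPrimeIdeal.sum_iff (h : IsPrimeIdeal D T) {ι : Type*} {s : Finset ι}
    {f : ι → Module.Dual ℝ NR} (hf : ∀ k ∈ s, f k ∈ D) : T (∑ k ∈ s, f k) ↔ ∃ k ∈ s, T (f k) := by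
  classical
  induction s using Finset.induction_on with
  | empty => simpa using h.not_zero
  | insert a s ha ih =>
    rw [Finset.sum_insert ha, h.add_iff _ (hf a (Finset.mem_insert_self a s)) _
      (sum_mem fun k hk => hf k (Finset.mem_insert_of_mem hk)),
      ih fun k hk => hf k (Finset.mem_insert_of_mem hk), Finset.exists_mem_insert]

theorem IsPrimeIdeal.smul_iff (h : IsPrimeIdeal D T) (hm : m ∈ D) {z : ℤ} (hz : 0 ≤ z) :
    T (z • m) ↔ z ≠ 0 ∧ T m := by
  lift z to ℕ using hz
  rw [natCast_zsmul, ← Fin.sum_const, h.sum_iff fun _ _ => hm]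
  constructor
  · rintro ⟨k, -, hk⟩
    refine ⟨?_, hk⟩
    have := k.2
    omega
  · rintro ⟨hz, hT⟩
    exact ⟨⟨0, by omega⟩, Finset.mem_univ _, hT⟩

theorem IsPrimeIdeal.not_of_neg_mem (h : IsPrimeIdeal D T) (hm : m ∈ D) (hm' : -m ∈ D) : ¬ T m := by
  intro hT
  apply h.not_zero
  rw [← add_neg_cancel m, h.add_iff _ hm _ hm']
  exact .inl hT

theorem smul_mem_of_neg_mem (hm : m ∈ D) (hm' : -m ∈ D) (z : ℤ) : z • m ∈ D := by
  obtain hz | hz := le_total 0 z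
  · exact zsmul_mem_of_nonneg hz hm
  · rw [← neg_neg z, neg_smul, ← smul_neg]
    exact zsmul_mem_of_nonneg (neg_nonneg.2 hz) hm'

theorem IsPrimeIdeal.not_smul_of_neg_mem (h : IsPrimeIdeal D T) (hm : m ∈ D) (hm' : -m ∈ D) (z : ℤ) :
    ¬ T (z • m) := by
  refine h.not_of_neg_mem (smul_mem_of_neg_mem hm hm' z) ?_
  rw [← neg_smul]
  exact smul_mem_of_neg_mem hm hm' _

/-- The index `k` is excluded by none of the forms `A_i`, `i ∈ I`, and `B_j`, `j ∈ J`. -/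
def Free (I J : Set (Fin 4)) (k : Fin 6) : Prop := ∀ i ∈ I, ∀ j ∈ J, ¬ Excl i j k

theorem mem_dualMonoid_cell_of_eq_zero (hm : m ∈ dualLattice latticeN)
    (h : ∀ x ∈ cell I J, m x = 0) : m ∈ dualMonoid latticeN (cell I J) :=
  ⟨mem_dualLattice.1 hm, fun x hx => (h x hx).ge⟩

theorem formZ_mem_dualMonoid (hi : i ∈ I) (hj : j ∈ J) (k : Fin 6) :
    formZ i j k ∈ dualMonoid latticeN (cell I J) :=
  ⟨mem_dualLattice.1 (formZ_mem i j k), fun _ hx =>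
    formZ_nonneg ((mem_cell.1 hx).1 i hi) ((mem_cell.1 hx).2 j hj) k⟩

theorem formA_mem_dualMonoid (hi : i ∈ I) : formA i ∈ dualMonoid latticeN (cell I J) :=
  ⟨mem_dualLattice.1 (formA_mem i), fun x hx => ((mem_cell.1 hx).1 i hi).symm ▸ supA_nonneg x⟩

theorem formB_mem_dualMonoid (hj : j ∈ J) : formB j ∈ dualMonoid latticeN (cell I J) :=
  ⟨mem_dualLattice.1 (formB_mem j), fun x hx => ((mem_cell.1 hx).2 j hj).symm ▸ supB_nonneg x⟩

theorem formZ_apply_eq_zero (hi : i ∈ I) (hj : j ∈ J) {k : Fin 6} (hk : ¬ Free I J k) {x : NR}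
    (hx : x ∈ cell I J) : formZ i j k x = 0 := by
  simp only [Free, not_forall, not_not] at hk
  obtain ⟨i', hi', j', hj', hk⟩ := hk
  rw [mem_cell] at hx
  rw [formZ_congr ((hx.1 i hi).trans (hx.1 i' hi').symm) ((hx.2 j hj).trans (hx.2 j' hj').symm),
    formZ_eq_zero hk, LinearMap.zero_apply]

theorem neg_formZ_mem (hi : i ∈ I) (hj : j ∈ J) {k : Fin 6} (hk : ¬ Free I J k) :
    -formZ i j k ∈ dualMonoid latticeN (cell I J) :=
  mem_dualMonoid_cell_of_eq_zero (neg_mem (formZ_mem i j k)) fun x hx => by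
    rw [LinearMap.neg_apply, formZ_apply_eq_zero hi hj hk hx, neg_zero]

/-- The decomposition of a character of a cell. -/
theorem exists_eq_sum_of_mem (hm : m ∈ dualMonoid latticeN (cell I J)) (hi : i ∈ I) (hj : j ∈ J)
    (hi0 : 0 ∈ I → i = 0) (hj0 : 0 ∈ J → j = 0) (hfree : ∃ k, Free I J k) :
    ∃ (n : Fin 6 → ℤ) (a b : ℤ), (∀ k, Free I J k → 0 ≤ n k) ∧ (0 ∉ I → 0 ≤ a) ∧ (0 ∉ J → 0 ≤ b) ∧
      (∀ k, m (u k) = a + 3 * n k) ∧ (∀ k, m (v k) = b + 3 * n k) ∧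
      (∀ T, IsPrimeIdeal (dualMonoid latticeN (cell I J)) T →
        (T m ↔ (∃ k, Free I J k ∧ n k ≠ 0 ∧ T (formZ i j k)) ∨ (a ≠ 0 ∧ T (formA i)) ∨
          (b ≠ 0 ∧ T (formB j)))) := by
  classical
  obtain ⟨k₀, hk₀, hmin⟩ := Finset.exists_min_image (Finset.univ.filter fun k => Free I J k)
    (fun k => m (u k)) (hfree.imp fun k hk => by simpa using hk)
  replace hk₀ : Free I J k₀ := by simpa using hk₀
  obtain ⟨n, a, b, hu, hv, ha, hb, hsum⟩ := exists_eq_sum_formZ (mem_dualLattice.2 hm.1) i j k₀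
  have hn : ∀ k, Free I J k → 0 ≤ n k := by
    intro k hk
    have := hmin k (by simpa using hk)
    rw [hu k] at this
    have h3 : (0 : ℝ) ≤ n k := by linarith
    exact_mod_cast h3
  have ha0 : 0 ∉ I → 0 ≤ a := by
    intro h0
    have := hm.2 _ (u_mem_cell h0 ⟨i, hi⟩ ⟨j, hj⟩ hk₀)
    rw [ha] at this
    exact_mod_cast this
  have hb0 : 0 ∉ J → 0 ≤ b := by
    intro h0
    have := hm.2 _ (v_mem_cell h0 ⟨i, hi⟩ ⟨j, hj⟩ hk₀)
    rw [hb] at this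
    exact_mod_cast this
  refine ⟨n, a, b, hn, ha0, hb0, fun k => ha ▸ hu k, fun k => hb ▸ hv k, fun T hT => ?_⟩
  have hZ := formZ_mem_dualMonoid hi hj
  have hA := formA_mem_dualMonoid (J := J) hi
  have hB := formB_mem_dualMonoid (I := I) hj
  have hZ' : ∀ k, n k • formZ i j k ∈ dualMonoid latticeN (cell I J) := by
    intro k
    by_cases hk : Free I J k
    · exact zsmul_mem_of_nonneg (hn k hk) (hZ k)
    · exact smul_mem_of_neg_mem (hZ k) (neg_formZ_mem hi hj hk) _
  have hA' : a • formA i ∈ dualMonoid latticeN (cell I J) ∧ (T (a • formA i) ↔ a ≠ 0 ∧ T (formA i)) := by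
    by_cases h0 : 0 ∈ I
    · rw [hi0 h0, formA_zero, smul_zero]
      simp [zero_mem, hT.not_zero]
    · exact ⟨zsmul_mem_of_nonneg (ha0 h0) hA, hT.smul_iff hA (ha0 h0)⟩
  have hB' : b • formB j ∈ dualMonoid latticeN (cell I J) ∧ (T (b • formB j) ↔ b ≠ 0 ∧ T (formB j)) := by
    by_cases h0 : 0 ∈ J
    · rw [hj0 h0, formB_zero, smul_zero]
      simp [zero_mem, hT.not_zero]
    · exact ⟨zsmul_mem_of_nonneg (hb0 h0) hB, hT.smul_iff hB (hb0 h0)⟩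
  conv_lhs => rw [hsum]
  rw [hT.add_iff _ (sum_mem fun k _ => hZ' k) _ (add_mem hA'.1 hB'.1),
    hT.add_iff _ hA'.1 _ hB'.1, hA'.2, hB'.2, hT.sum_iff fun k _ => hZ' k]
  refine or_congr (exists_congr fun k => ?_) Iff.rfl
  by_cases hk : Free I J k
  · simp [hk, hT.smul_iff (hZ k) (hn k hk)]
  · simp [hk, hT.not_smul_of_neg_mem (hZ k) (neg_formZ_mem hi hj hk)]

/-- The z_k sum to 3(A_i + B_j), so a prime ideal contains A_i or B_j exactly if it contains some
z_k. Every character of the cell is built from these forms, so a nonempty prime ideal contains z_k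
for some free k, together with A_i or B_j. In the first case the ray of u_k works: the value of a
character at u_k is a + 3 n_k, and if this is positive, then A_i or z_k occurs in the character. In
the second case v_k works. -/
theorem hasRays : HasRays latticeN (faceFan tauP) SigmaNabla := by
  intro ρ hρ U h0 hadd hne
  obtain ⟨I, J, hI, hJ, rfl⟩ := mem_SigmaNabla.1 hρ
  -- Preferring A_0 = 0 makes the term of A_i vanish in the case where the sign of its coefficient
  -- is not controlled.
  obtain ⟨i, hi, hi0⟩ : ∃ i ∈ I, 0 ∈ I → i = 0 := by
    by_cases h : 0 ∈ I
    · exact ⟨0, h, fun _ => rfl⟩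
    · exact ⟨hI.some, hI.some_mem, fun h' => absurd h' h⟩
  obtain ⟨j, hj, hj0⟩ : ∃ j ∈ J, 0 ∈ J → j = 0 := by
    by_cases h : 0 ∈ J
    · exact ⟨0, h, fun _ => rfl⟩
    · exact ⟨hJ.some, hJ.some_mem, fun h' => absurd h' h⟩
  let T' : Module.Dual ℝ NR → Prop := fun m => 
    ∃ h : m ∈ dualMonoid latticeN (cell I J), (⟨m, h⟩ : dualMonoid latticeN (cell I J)) ∈ U
  have hT : IsPrimeIdeal (dualMonoid latticeN (cell I J)) T' := by
    refine ⟨fun ⟨_, h⟩ => h0 h, fun m hm m' hm' => ?_⟩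
    have := hadd ⟨m, hm⟩ ⟨m', hm'⟩
    simp only [T', hm, hm', add_mem hm hm', exists_true_left]
    exact this
  have hZ := formZ_mem_dualMonoid hi hj
  have hA := formA_mem_dualMonoid (J := J) hi
  have hB := formB_mem_dualMonoid (I := I) hj
  have hAB : T' (formA i) ∨ T' (formB j) ↔ ∃ k, T' (formZ i j k) := by
    have h1 := hT.smul_iff (add_mem hA hB) (z := 3) (by norm_num)
    have h2 := sum_formZ i j
    rw [formT, ← natCast_zsmul, Nat.cast_ofNat] at h2
    rw [← h2, hT.sum_iff fun k _ => hZ k, hT.add_iff _ hA _ hB] at h1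
    simpa using h1.symm
  obtain ⟨m, hm⟩ := hne
  have hmT : T' m := ⟨m.2, hm⟩
  -- Without a free index all z_k vanish on the cell, so the cell is the origin and every character
  -- is invertible.
  obtain ⟨k, hk⟩ : ∃ k, Free I J k := by
    by_contra hk
    push Not at hk
    refine hT.not_of_neg_mem m.2 (mem_dualMonoid_cell_of_eq_zero (neg_mem (mem_dualLattice.2 m.2.1))
      fun x hx => ?_) hmT
    have hx' := mem_cell.1 hx
    have := sum_formZ_apply i j x
    rw [Finset.sum_eq_zero fun k _ => formZ_apply_eq_zero hi hj (hk k) hx, hx'.1 i hi, hx'.2 j hj,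
      ← gaugeP] at this
    rw [eq_zero_of_gaugeP (by linarith : gaugeP x = 0), map_zero]
  obtain ⟨k, hk, hkT⟩ : ∃ k, Free I J k ∧ T' (formZ i j k) := by
    obtain ⟨n, a, b, -, -, -, -, -, hiff⟩ := exists_eq_sum_of_mem m.2 hi hj hi0 hj0 ⟨k, hk⟩
    have hex : ∃ k, T' (formZ i j k) := by
      obtain ⟨k, -, -, h⟩ | ⟨-, h⟩ | ⟨-, h⟩ := (hiff T' hT).1 hmT
      exacts [⟨k, h⟩, hAB.1 (.inl h), hAB.1 (.inr h)]
    obtain ⟨k, h⟩ := hex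
    refine ⟨k, ?_, h⟩
    by_contra hk
    exact hT.not_of_neg_mem (hZ k) (neg_formZ_mem hi hj hk) h
  obtain hAT | hBT := hAB.2 ⟨k, hkT⟩
  · have hI0 : 0 ∉ I := by
      intro h
      rw [hi0 h, formA_zero] at hAT
      exact hT.not_zero hAT
    have hi' : i ≠ 0 := fun h => hI0 (h ▸ hi)
    refine ⟨_, hull_mem_faceFan (u_mem k) (gaugeP_u k), hull_u_mem_SigmaNabla k,
      Submodule.span_le.2 (Set.singleton_subset_iff.2 (u_mem_cell hI0 hI hJ hk)), u k,
      Submodule.subset_span rfl, ⟨⟨formA i, hA⟩, ?_⟩, ?_⟩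
    · change 0 < formA i (u k)
      rw [formA_u_of_not_excl hi' (hk i hi j hj)]
      norm_num
    · intro m hm
      obtain ⟨n, a, b, hn, ha, -, hu, -, hiff⟩ := exists_eq_sum_of_mem m.2 hi hj hi0 hj0 ⟨k, hk⟩
      refine ((hiff T' hT).2 ?_).2
      by_cases ha0 : a = 0
      · refine .inl ⟨k, hk, fun hn0 => ?_, hkT⟩
        rw [hu, ha0, hn0] at hm
        simp at hm
      · exact .inr (.inl ⟨ha0, hAT⟩)
  · have hJ0 : 0 ∉ J := by
      intro h
      rw [hj0 h, formB_zero] at hBT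
      exact hT.not_zero hBT
    have hj' : j ≠ 0 := fun h => hJ0 (h ▸ hj)
    refine ⟨_, hull_mem_faceFan (v_mem k) (gaugeP_v k), hull_v_mem_SigmaNabla k,
      Submodule.span_le.2 (Set.singleton_subset_iff.2 (v_mem_cell hJ0 hI hJ hk)), v k,
      Submodule.subset_span rfl, ⟨⟨formB j, hB⟩, ?_⟩, ?_⟩
    · change 0 < formB j (v k)
      rw [formB_v_of_not_excl hj' (hk i hi j hj)]
      norm_num
    · intro m hm
      obtain ⟨n, a, b, hn, -, hb, -, hv, hiff⟩ := exists_eq_sum_of_mem m.2 hi hj hi0 hj0 ⟨k, hk⟩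
      refine ((hiff T' hT).2 ?_).2
      by_cases hb0 : b = 0
      · refine .inl ⟨k, hk, fun hn0 => ?_, hkT⟩
        rw [hv, hb0, hn0] at hm
        simp at hm
      · exact .inr (.inr ⟨hb0, hBT⟩)

end PrimeIdeals


/-! ### The convex function of the triangulation -/

section Pieces

/-- A family of forms that depends on `A_i` and `B_j` in an affine way. -/
def IsSplit (f : Fin 4 → Fin 4 → Module.Dual ℝ NR) : Prop :=
  ∃ (L : Module.Dual ℝ NR) (α β : ℤ), ∀ i j, f i j = L + (α • formA i + β • formB j)

variable {f g : Fin 4 → Fin 4 → Module.Dual ℝ NR}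

theorem IsSplit.sub (hf : IsSplit f) (hg : IsSplit g) : IsSplit fun i j => f i j - g i j := by
  obtain ⟨L, α, β, hf⟩ := hf
  obtain ⟨L', α', β', hg⟩ := hg
  refine ⟨L - L', α - α', β - β', fun i j => ?_⟩
  change f i j - g i j = _
  rw [hf, hg]
  module

theorem IsSplit.zsmul (hf : IsSplit f) (z : ℤ) : IsSplit fun i j => z • f i j := by
  obtain ⟨L, α, β, hf⟩ := hf
  refine ⟨z • L, z * α, z * β, fun i j => ?_⟩
  change z • f i j = _
  rw [hf]
  module

theorem isSplit_sum {ι : Type*} (s : Finset ι) {F : ι → Fin 4 → Fin 4 → Module.Dual ℝ NR}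
    (h : ∀ k, IsSplit (F k)) : IsSplit fun i j => ∑ k ∈ s, F k i j := by
  choose L α β hF using h
  refine ⟨∑ k ∈ s, L k, ∑ k ∈ s, α k, ∑ k ∈ s, β k, fun i j => ?_⟩
  simp only [hF, Finset.sum_add_distrib, Finset.sum_smul]

theorem isSplit_formA : IsSplit fun i _ => formA i := ⟨0, 1, 0, fun i j => by module⟩

theorem isSplit_formT : IsSplit formT := ⟨0, 1, 1, fun i j => by
  rw [formT]
  module⟩

theorem isSplit_formZ (k : Fin 6) : IsSplit fun i j => formZ i j k := by
  by_cases hk : k < 3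
  · exact ⟨X k, 1, 0, fun i j => by
      change X k + _ = _
      rw [if_pos hk]
      module⟩
  · exact ⟨X k, 0, 1, fun i j => by
      change X k + _ = _
      rw [if_neg hk]
      module⟩

theorem isSplit_formY (m : Fin 8) : IsSplit fun i j => formY i j m := by
  unfold formY
  split_ifs
  exacts [isSplit_formA, isSplit_sum _ isSplit_formZ]

theorem isSplit_formH (h : Fin 8 × Fin 8 × Fin 5) : IsSplit fun i j => formH i j h.1 h.2.1 h.2.2 :=
  ((isSplit_formY h.1).sub (isSplit_formY h.2.1)).sub (isSplit_formT.zsmul _)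

/-- The coefficient of `A_i` in `formH i j`. -/
def coeffA (h : Fin 8 × Fin 8 × Fin 5) : ℤ := (isSplit_formH h).choose_spec.choose

/-- The coefficient of `B_j` in `formH i j`. -/
def coeffB (h : Fin 8 × Fin 8 × Fin 5) : ℤ := (isSplit_formH h).choose_spec.choose_spec.choose

theorem formH_eq (i j : Fin 4) (h : Fin 8 × Fin 8 × Fin 5) : formH i j h.1 h.2.1 h.2.2 =
    formH 0 0 h.1 h.2.1 h.2.2 + (coeffA h • formA i + coeffB h • formB j) := by
  have : ∀ i j, formH i j h.1 h.2.1 h.2.2 = (isSplit_formH h).choose +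
      (coeffA h • formA i + coeffB h • formB j) :=
    (isSplit_formH h).choose_spec.choose_spec.choose_spec
  rw [this i j, this 0 0, formA_zero, formB_zero, smul_zero, smul_zero, add_zero, add_zero]

/-- The summands of the forms whose maximum is the convex function of the triangulation: the maximum
of the forms `piece (some h)` is the positive part of `formH` up to a multiple of the support
functions. -/
def piece : Option (Fin 8 × Fin 8 × Fin 5) → Bool × Fin 4 × Fin 4 → Module.Dual ℝ NR
  | none, t => formT t.2.1 t.2.2
  | some h, (false, i, j) => (coeffA h)⁻ • formA i + (coeffB h)⁻ • formB j
  | some h, (true, i, j) => formH 0 0 h.1 h.2.1 h.2.2 + ((coeffA h)⁺ • formA i + (coeffB h)⁺ • formB j)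

/-- The choices of summands. -/
abbrev Choice : Type := Option (Fin 8 × Fin 8 × Fin 5) → Bool × Fin 4 × Fin 4

/-- The forms whose maximum is the convex function of the triangulation. -/
def totalForm (κ : Choice) : Module.Dual ℝ NR := ∑ h, piece h (κ h)

theorem piece_mem (h : Option (Fin 8 × Fin 8 × Fin 5)) (t : Bool × Fin 4 × Fin 4) :
    piece h t ∈ dualLattice latticeN := by
  have hAB : ∀ (a b : ℤ) i j, a • formA i + b • formB j ∈ dualLattice latticeN := fun a b i j =>
    add_mem (zsmul_mem (formA_mem i) a) (zsmul_mem (formB_mem j) b)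
  match h, t with
  | none, t => exact formT_mem _ _
  | some h, (false, i, j) => exact hAB _ _ i j
  | some h, (true, i, j) => exact add_mem (sub_mem (sub_mem (formY_mem _ _ _) (formY_mem _ _ _))
      (zsmul_mem (formT_mem _ _) _)) (hAB _ _ i j)

/-- The summands chosen by `κ` are maximal in the preorder with the nonnegative forms `S`. -/
def Dominates (S : AddSubmonoid (Module.Dual ℝ NR)) (κ : Choice) : Prop :=
  ∀ h t, piece h (κ h) - piece h t ∈ S

variable {S : AddSubmonoid (Module.Dual ℝ NR)} {κ : Choice} {i j : Fin 4}

/-- Changing the choice at one index only isolates a single difference. -/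
theorem sub_mem_of_forall_sum_sub_mem {H T : Type*} [Fintype H]
    {f : H → T → Module.Dual ℝ NR} {κ : H → T}
    (h : ∀ κ' : H → T, ∑ k, f k (κ k) - ∑ k, f k (κ' k) ∈ S) (k : H) (t : T) :
    f k (κ k) - f k t ∈ S := by
  classical
  have := h (Function.update κ k t)
  rw [← Finset.sum_sub_distrib, Finset.sum_eq_single k] at this
  · rwa [Function.update_self] at this
  · intro l _ hl
    rw [Function.update_of_ne hl, sub_self]
  · exact fun h => absurd (Finset.mem_univ k) h

theorem dominates_iff : Dominates S κ ↔ ∀ κ', totalForm κ - totalForm κ' ∈ S := by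
  constructor
  · intro h κ'
    rw [totalForm, totalForm, ← Finset.sum_sub_distrib]
    exact sum_mem fun k _ => h k _
  · intro h k t
    unfold totalForm at h
    exact sub_mem_of_forall_sum_sub_mem (f := piece) (κ := κ) h k t

theorem smul_sub_add_smul_sub_mem (hA : ∀ i', formA i - formA i' ∈ S) (hB : ∀ j', formB j - formB j' ∈ S)
    {a b : ℤ} (ha : 0 ≤ a) (hb : 0 ≤ b) (i' j' : Fin 4) :
    a • (formA i - formA i') + b • (formB j - formB j') ∈ S :=
  add_mem (zsmul_mem_of_nonneg ha (hA i')) (zsmul_mem_of_nonneg hb (hB j'))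

theorem posPart_smul_sub (z : ℤ) (m : Module.Dual ℝ NR) : z⁺ • m - z⁻ • m = z • m := by
  rw [← sub_smul, posPart_sub_negPart]

/-- The choice takes A_i and B_j everywhere, and the summand with the wall form exactly if this form
lies in `S`. The positive and negative parts of the coefficients keep all multiples of A_i - A_i'
and B_j - B_j' nonnegative. -/
theorem Selects.dominates (h : Selects S i j) : ∃ κ, Dominates S κ := by
  classical
  refine ⟨fun k => (decide (∃ q, k = some q ∧ formH i j q.1 q.2.1 q.2.2 ∈ S), i, j), ?_⟩
  intro k t
  have hpos := fun {a b : ℤ} => smul_sub_add_smul_sub_mem h.subA h.subB (a := a) (b := b)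
  match k, t with
  | none, (s, i', j') =>
    have := add_mem (h.subA i') (h.subB j')
    simp only [piece, formT]
    convert this using 1
    abel
  | some q, (s, i', j') =>
    simp only [Option.some.injEq, exists_eq_left']
    have hp := hpos (posPart_nonneg (coeffA q)) (posPart_nonneg (coeffB q)) i' j'
    have hn := hpos (negPart_nonneg (coeffA q)) (negPart_nonneg (coeffB q)) i' j'
    have hH := formH_eq i j q
    have h1 := posPart_smul_sub (coeffA q) (formA i)
    have h2 := posPart_smul_sub (coeffB q) (formB j)
    have h3 := posPart_smul_sub (coeffA q) (formA i')
    have h4 := posPart_smul_sub (coeffB q) (formB j')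
    by_cases hq : formH i j q.1 q.2.1 q.2.2 ∈ S
    · rw [decide_eq_true hq]
      cases s
      · convert add_mem hq hn using 1
        rw [hH, ← h1, ← h2]
        simp only [piece]
        module
      · convert hp using 1
        simp only [piece]
        module
    · rw [decide_eq_false hq]
      replace hq := (h.total q.1 q.2.1 q.2.2).resolve_left hq
      cases s
      · convert hn using 1
        simp only [piece]
        module
      · convert add_mem hq hp using 1
        rw [hH, ← h1, ← h2]
        simp only [piece]
        module

/-- The two alternatives of a piece at (i, j) differ by the wall form, so preferring one of them
fixes its sign. -/
theorem Dominates.total (hκ : Dominates S κ) (hA : ∀ i', formA i - formA i' ∈ S)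
    (hB : ∀ j', formB j - formB j' ∈ S) (q : Fin 8 × Fin 8 × Fin 5) :
    formH i j q.1 q.2.1 q.2.2 ∈ S ∨ -formH i j q.1 q.2.1 q.2.2 ∈ S := by
  have hpos := fun {a b : ℤ} => smul_sub_add_smul_sub_mem hA hB (a := a) (b := b)
  have hH := formH_eq i j q
  have h1 := posPart_smul_sub (coeffA q) (formA i)
  have h2 := posPart_smul_sub (coeffB q) (formB j)
  rcases hs : κ (some q) with ⟨s, i', j'⟩
  have hp := hpos (posPart_nonneg (coeffA q)) (posPart_nonneg (coeffB q)) i' j'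
  have hn := hpos (negPart_nonneg (coeffA q)) (negPart_nonneg (coeffB q)) i' j'
  cases s
  · right
    have := hκ (some q) (true, i, j)
    rw [hs] at this
    convert add_mem this hn using 1
    rw [hH, ← h1, ← h2]
    simp only [piece]
    module
  · left
    have := hκ (some q) (false, i, j)
    rw [hs] at this
    convert add_mem this hp using 1
    rw [hH, ← h1, ← h2]
    simp only [piece]
    module

theorem Dominates.exists_selects (hκ : Dominates S κ) : ∃ i j, (i ≠ 0 ∨ j ≠ 0) ∧ Selects S i j := by
  obtain ⟨i, j, hAB⟩ : ∃ i j, ∀ i' j', formT i j - formT i' j' ∈ S :=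
    ⟨_, _, fun i' j' => hκ none (true, i', j')⟩
  have hA : ∀ i', formA i - formA i' ∈ S := by
    intro i'
    have := hAB i' j
    rwa [formT, formT, add_sub_add_right_eq_sub] at this
  have hB : ∀ j', formB j - formB j' ∈ S := by
    intro j'
    have := hAB i j'
    rwa [formT, formT, add_sub_add_left_eq_sub] at this
  by_cases h0 : i ≠ 0 ∨ j ≠ 0
  · exact ⟨i, j, h0, hA, hB, fun m l k => hκ.total hA hB (m, l, k)⟩
  · push Not at h0
    obtain ⟨rfl, rfl⟩ := h0
    have hX : ∀ k, X k ∈ S := by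
      intro k
      have h1 := hA 1
      have h2 := hA 2
      have h3 := hA 3
      have h4 := hB 1
      have h5 := hB 2
      have h6 := hB 3
      simp only [formA, formB, Matrix.cons_val, sub_neg_eq_add, zero_add] at h1 h2 h3 h4 h5 h6
      fin_cases k <;> assumption
    -- A_1 is the sum of the remaining coordinates, all of which lie in `S`. So (1, 0) can replace
    -- the pair (0, 0), which has no frames.
    have hA1 : formA 1 ∈ S := by
      have : formA 1 = ∑ k with k ≠ 0, X k := by
        have h := (Finset.add_sum_erase _ X (Finset.mem_univ 0)).trans sum_X
        have h' : Finset.univ.erase (0 : Fin 6) = Finset.univ.filter (· ≠ 0) := by decide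
        exact (neg_eq_of_add_eq_zero_right h).trans (by rw [h'])
      rw [this]
      exact sum_mem fun k _ => hX k
    refine ⟨1, 0, .inl one_ne_zero, ?_, hB, fun m l k => hκ.total ?_ hB (m, l, k)⟩ <;>
    · intro i'
      have := add_mem hA1 (hA i')
      rwa [formA_zero, zero_sub, ← sub_eq_add_neg] at this

end Pieces


/-! ### Domains of linearity and the projective embedding of the face fan. -/

section Projectivity

variable {S : AddSubmonoid (Module.Dual ℝ NR)} {κ κ' : Choice} {i j : Fin 4} {p : Fin 5 → NR}
  {l : Fin 5 → Module.Dual ℝ NR} {x : NR}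

/-- The monoid generated by the differences `totalForm κ - totalForm κ'`. -/
def diffMonoid (κ : Choice) : AddSubmonoid (Module.Dual ℝ NR) :=
  AddSubmonoid.closure (Set.range fun κ' => totalForm κ - totalForm κ')

theorem dominates_diffMonoid (κ : Choice) : Dominates (diffMonoid κ) κ :=
  dominates_iff.2 fun κ' => AddSubmonoid.subset_closure ⟨κ', rfl⟩

theorem exists_frame_diffMonoid (κ : Choice) :
    ∃ i j p l, IsFrame i j p l ∧ ∀ k, l k ∈ diffMonoid κ := by
  obtain ⟨i, j, h0, hS⟩ := (dominates_diffMonoid κ).exists_selects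
  obtain ⟨p, l, h⟩ := hS.exists_frame h0
  exact ⟨i, j, p, l, h⟩

theorem apply_nonneg_of_mem_diffMonoid (h : ∀ κ', totalForm κ' x ≤ totalForm κ x)
    {m : Module.Dual ℝ NR} (hm : m ∈ diffMonoid κ) : 0 ≤ m x := by
  have : diffMonoid κ ≤ nonnegOn {x} := by
    refine (AddSubmonoid.closure_le).2 ?_
    rintro _ ⟨κ', rfl⟩ y hy
    rw [Set.mem_singleton_iff.1 hy, LinearMap.sub_apply, sub_nonneg]
    exact h κ'
  exact this hm x rfl

theorem IsFrame.exists_int (h : IsFrame i j p l) {m : Module.Dual ℝ NR}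
    (hm : m ∈ dualLattice latticeN) : ∃ z : Fin 5 → ℤ, (∀ k, m (p k) = z k) ∧ m = ∑ k, z k • l k := by
  choose z hz using fun k => mem_dualLattice.1 hm (p k) (h.mem_lattice k)
  refine ⟨z, hz, (h.eq_sum_form m).trans (Finset.sum_congr rfl fun k _ => ?_)⟩
  rw [hz]
  exact Int.cast_smul_eq_zsmul ℝ (z k) (l k)

theorem IsFrame.exists_dominates (h : IsFrame i j p l) : ∃ κ, Dominates (nonnegOn (Set.range p)) κ :=
  h.selects.dominates

/-- The form is a nonnegative integral combination of the dual basis in which `l k` occurs; moving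
everything but one copy of `l k` to the other side expresses `-l k` by elements of the monoid. -/
theorem neg_mem_diffMonoid (h : IsFrame i j p l) (hl : ∀ k, l k ∈ diffMonoid κ)
    {m : Module.Dual ℝ NR} (hm : m ∈ dualLattice latticeN) (hp : m ∈ nonnegOn (Set.range p))
    (hneg : -m ∈ diffMonoid κ) {k : Fin 5} (hk : m (p k) ≠ 0) : -l k ∈ diffMonoid κ := by
  obtain ⟨z, hz, hsum⟩ := h.exists_int hm
  have hz0 : ∀ k, 0 ≤ z k := fun k => by
    have := hp _ ⟨k, rfl⟩
    rw [hz] at this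
    exact_mod_cast this
  have hzk : z k ≠ 0 := fun h0 => hk (by rw [hz, h0, Int.cast_zero])
  have h1 : 0 ≤ z k - 1 := by
    have := hz0 k
    omega
  have h2 : m = z k • l k + ∑ n ∈ Finset.univ.erase k, z n • l n :=
    hsum.trans (Finset.add_sum_erase _ _ (Finset.mem_univ k)).symm
  have h3 : -l k = -m + ((z k - 1) • l k + ∑ n ∈ Finset.univ.erase k, z n • l n) := by
    rw [h2]
    module
  rw [h3]
  exact add_mem hneg (add_mem (zsmul_mem_of_nonneg h1 (hl k)) (sum_mem fun n _ => zsmul_mem_of_nonneg (hz0 n) (hl n)))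

/-- The monoid of differences is the monoid of characters of a cone of the face fan. -/
theorem diffMonoid_eq (h : IsFrame i j p l) (hl : ∀ k, l k ∈ diffMonoid κ) :
    diffMonoid κ = dualMonoid latticeN (subCone l {k | -l k ∉ diffMonoid κ}) := by
  have hκ := dominates_diffMonoid κ
  apply le_antisymm
  · obtain ⟨κ', hκ'⟩ := h.exists_dominates
    -- The choice `κ'` is optimal on the frame. Where a piece of it exceeds that of `κ` at a vertex,
    -- the dual form of this vertex is invertible in the monoid and hence vanishes on the subcone;
    -- so `κ` is optimal there too.
    have hzero : ∀ a, ∀ x ∈ subCone l {k | -l k ∉ diffMonoid κ},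
        (piece a (κ' a) - piece a (κ a)) x = 0 := by
      intro a x hx
      have hm : piece a (κ' a) - piece a (κ a) ∈ dualLattice latticeN :=
        sub_mem (piece_mem _ _) (piece_mem _ _)
      rw [h.eq_sum_form (piece a (κ' a) - piece a (κ a)), LinearMap.sum_apply]
      refine Finset.sum_eq_zero fun k _ => ?_
      by_cases hk : (piece a (κ' a) - piece a (κ a)) (p k) = 0
      · rw [hk, zero_smul, LinearMap.zero_apply]
      · have hn := neg_mem_diffMonoid h hl hm (hκ' a (κ a)) (by
          rw [neg_sub]
          exact hκ a (κ' a)) hk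
        rw [LinearMap.smul_apply, hx.2 k (not_not.2 hn), smul_zero]
    refine (AddSubmonoid.closure_le).2 ?_
    rintro _ ⟨π, rfl⟩
    refine (dominates_iff (S := dualMonoid latticeN _)).1 (fun a t => ?_) π
    refine ⟨mem_dualLattice.1 (sub_mem (piece_mem _ _) (piece_mem _ _)), fun x hx => ?_⟩
    have h1 := hzero a x hx
    have h2 := h.nonneg_of_mem hx.1 (hκ' a t)
    rw [LinearMap.sub_apply] at h1 h2 ⊢
    linarith
  · intro m hm
    obtain ⟨z, hz, hsum⟩ := h.exists_int (mem_dualLattice.2 hm.1)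
    rw [hsum]
    refine sum_mem fun k _ => ?_
    by_cases hk : -l k ∈ diffMonoid κ
    · exact smul_mem_of_neg_mem (hl k) hk _
    · refine zsmul_mem_of_nonneg ?_ (hl k)
      have := hm.2 _ (h.mem_subCone (W := {k | -l k ∉ diffMonoid κ}) hk)
      rw [hz] at this
      exact_mod_cast this

/-- Every choice is used, even if it is optimal only on a smaller cone: its differences always
generate the characters of a cone of the fan, by `diffMonoid_eq`. -/
theorem exists_isVeryAmple_faceFan : ∃ (n : ℕ) (m : Fin (n + 1) → Module.Dual ℝ NR)
    (τ : Fin (n + 1) → faceFan tauP), IsVeryAmple latticeN (faceFan tauP) m τ := by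
  obtain ⟨n, ⟨e⟩⟩ : ∃ n, Nonempty (Choice ≃ Fin (n + 1)) := by
    obtain ⟨n, ⟨e⟩⟩ := Finite.exists_equiv_fin Choice
    cases n with
    | zero => exact (e fun _ => (true, 0, 0)).elim0
    | succ n => exact ⟨n, ⟨e⟩⟩
  choose i j p l h hl using exists_frame_diffMonoid
  have hmem : ∀ κ x, (∀ κ', totalForm κ' x ≤ totalForm κ x) →
      x ∈ subCone (l κ) {k | -l κ k ∉ diffMonoid κ} := by
    intro κ x hx
    refine ⟨fun k => apply_nonneg_of_mem_diffMonoid hx (hl κ k), fun k hk => ?_⟩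
    have h1 := apply_nonneg_of_mem_diffMonoid hx (hl κ k)
    have h2 := apply_nonneg_of_mem_diffMonoid hx (not_not.1 hk)
    rw [LinearMap.neg_apply] at h2
    linarith
  refine ⟨n, fun k => totalForm (e.symm k), fun k => ⟨_, (h (e.symm k)).subCone_mem
    {a | -l (e.symm k) a ∉ diffMonoid (e.symm k)}⟩, ⟨fun k x hx => ?_, fun k => ?_, fun σ => ?_⟩⟩
  · refine hmem _ _ fun κ' => ?_
    simpa using hx (e κ')
  · rw [← diffMonoid_eq (h (e.symm k)) (hl (e.symm k)), diffMonoid]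
    congr 1
    exact (e.symm.surjective.range_comp fun κ' => totalForm (e.symm k) - totalForm κ').symm
  · obtain ⟨i', j', p', l', h', W, hσ⟩ := mem_faceFan.1 σ.2
    obtain ⟨κ, hκ⟩ := h'.exists_dominates
    refine ⟨e κ, ?_⟩
    simp only [Equiv.symm_apply_apply]
    rw [hσ]
    intro x hx
    refine hmem κ x fun κ' => ?_
    have := h'.nonneg_of_mem hx.1 (dominates_iff.1 hκ κ')
    rwa [LinearMap.sub_apply, sub_nonneg] at this

/-- If the maximum of finitely many linear forms is affine on a convex set, then it is attained by
one of the forms on the whole set. -/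
theorem exists_forall_eq_of_affine {ι : Type*} [Finite ι] [Nonempty ι] (m : ι → Module.Dual ℝ NR)
    {f : NR → ℝ} (hle : ∀ k x, m k x ≤ f x) (hf : ∀ x, ∃ k, m k x = f x) {D : Set NR}
    (hD : Convex ℝ D) {g : NR →ᵃ[ℝ] ℝ} (hg : Set.EqOn f g D) : ∃ k, ∀ x ∈ D, m k x = f x := by
  have := Fintype.ofFinite ι
  by_contra! hno
  -- If each form fell short of f somewhere on D, then at the barycenter of such points every form
  -- would be strictly below g, although one of them equals f there.
  choose y hyD hy using hno
  have hN : (Fintype.card ι : ℝ) ≠ 0 := Nat.cast_ne_zero.2 Fintype.card_ne_zero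
  have hw : ∑ _k : ι, (Fintype.card ι : ℝ)⁻¹ = 1 := by simp [hN]
  have hmem := hD.sum_mem (t := Finset.univ) (w := fun _ : ι => (Fintype.card ι : ℝ)⁻¹) (z := y)
    (fun _ _ => by positivity) hw fun k _ => hyD k
  set x := ∑ k, (Fintype.card ι : ℝ)⁻¹ • y k with hx
  obtain ⟨k, hk⟩ := hf x
  have h1 : m k x = ∑ a, (Fintype.card ι : ℝ)⁻¹ * m k (y a) := by
    rw [hx, map_sum]
    exact Finset.sum_congr rfl fun a _ => by rw [map_smul, smul_eq_mul]
  have h2 : g x = ∑ a, (Fintype.card ι : ℝ)⁻¹ * g (y a) := by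
    have hlin : ∀ z, g z = g.linear z + g 0 := fun z => congrFun g.decomp z
    have h0 : ∑ _a : ι, (Fintype.card ι : ℝ)⁻¹ * g 0 = g 0 := by rw [← Finset.sum_mul, hw, one_mul]
    have h3 : g.linear x = ∑ a, (Fintype.card ι : ℝ)⁻¹ * g.linear (y a) := by
      rw [hx, map_sum]
      exact Finset.sum_congr rfl fun a _ => by rw [map_smul, smul_eq_mul]
    rw [hlin x, h3]
    nth_rw 1 [← h0]
    rw [← Finset.sum_add_distrib]
    exact Finset.sum_congr rfl fun a _ => by rw [hlin (y a), mul_add]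
  have h3 : m k x < g x := by
    rw [h1, h2]
    refine Finset.sum_lt_sum (fun a _ => ?_) ⟨k, Finset.mem_univ k, ?_⟩
    · rw [← hg (hyD a)]
      exact mul_le_mul_of_nonneg_left (hle k (y a)) (by positivity)
    · rw [← hg (hyD k)]
      exact mul_lt_mul_of_pos_left (lt_of_le_of_ne (hle k (y k)) (hy k)) (by positivity)
  rw [hk, hg hmem] at h3
  exact h3.false

theorem exists_max (x : NR) : ∃ κ, ∀ κ', totalForm κ' x ≤ totalForm κ x :=
  Finite.exists_max fun κ => totalForm κ x

/-- The convex function of the triangulation. -/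
def convexFun (x : NR) : ℝ := totalForm (exists_max x).choose x

theorem totalForm_le (κ : Choice) (x : NR) : totalForm κ x ≤ convexFun x :=
  (exists_max x).choose_spec κ

theorem convexOn_convexFun : ConvexOn ℝ P convexFun := by
  refine ⟨convex_P, fun x _ y _ a b ha hb _ => ?_⟩
  rw [convexFun, map_add, map_smul, map_smul]
  exact add_le_add (mul_le_mul_of_nonneg_left (totalForm_le _ x) ha)
    (mul_le_mul_of_nonneg_left (totalForm_le _ y) hb)

theorem IsFrame.mem_hull_iff (h : IsFrame i j p l) :
    x ∈ convexHull ℝ (insert 0 (Set.range p)) ↔ x ∈ P ∧ ∀ k, 0 ≤ l k x := by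
  rw [h.mem_convexHull_iff le_rfl, mem_P_iff]
  constructor
  · rintro ⟨h1, -, h2, -⟩
    rw [h.gaugeP_eq h1] at h2
    exact ⟨h2, h1⟩
  · rintro ⟨h2, h1⟩
    rw [← h.gaugeP_eq h1] at h2
    exact ⟨h1, fun k _ => .inr ⟨k, rfl⟩, h2, fun h0 => absurd (Set.mem_insert _ _) h0⟩

/-- On a frame a single choice is optimal, so the function is linear there. Conversely, on a convex
set where the function is affine one choice is optimal throughout, and the frame contained in its
monoid of differences confines the set to one simplex. -/
theorem isProjectiveTriangulation_tauP : IsProjectiveTriangulation tauP P := by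
  refine ⟨convexFun, convexOn_convexFun, ?_⟩
  set Adm : Set NR → Prop := fun D => D ⊆ P ∧ Convex ℝ D ∧ ∃ g : NR →ᵃ[ℝ] ℝ, Set.EqOn convexFun g D
  have hadm : ∀ i j p l, IsFrame i j p l → Adm (convexHull ℝ (insert 0 (Set.range p))) := by
    intro i j p l h
    obtain ⟨κ, hκ⟩ := h.exists_dominates
    refine ⟨fun x hx => (h.mem_hull_iff.1 hx).1, convex_convexHull ℝ _,
      (totalForm κ).toAffineMap, fun x hx => ?_⟩
    refine le_antisymm ?_ (totalForm_le κ x)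
    have := h.nonneg_of_mem (h.mem_hull_iff.1 hx).2 (dominates_iff.1 hκ (exists_max x).choose)
    rwa [LinearMap.sub_apply, sub_nonneg] at this
  have hsub : ∀ D, Adm D → ∃ i j p l, IsFrame i j p l ∧ D ⊆ convexHull ℝ (insert 0 (Set.range p)) := by
    rintro D ⟨hDP, hD, g, hg⟩
    obtain ⟨κ, hκ⟩ := exists_forall_eq_of_affine totalForm totalForm_le
      (fun x => ⟨_, rfl⟩) hD hg
    obtain ⟨i, j, p, l, h, hl⟩ := exists_frame_diffMonoid κ
    refine ⟨i, j, p, l, h, fun x hx => h.mem_hull_iff.2 ⟨hDP hx, fun k => ?_⟩⟩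
    exact apply_nonneg_of_mem_diffMonoid (fun κ' => (hκ x hx).symm ▸ totalForm_le κ' x) (hl k)
  have heq : ∀ i j p l i' j' p' l', IsFrame i j p l → IsFrame i' j' p' l' →
      convexHull ℝ (insert 0 (Set.range p)) ⊆ convexHull ℝ (insert 0 (Set.range p')) →
      convexHull ℝ (insert 0 (Set.range p)) = convexHull ℝ (insert 0 (Set.range p')) := by
    intro i j p l i' j' p' l' h h' hle
    -- The barycenter of the five nonzero vertices is supported on all of them, so a simplex that
    -- contains it has these vertices.
    have hl : ∀ k, l k ((5 : ℝ)⁻¹ • ∑ k, p k) = (5 : ℝ)⁻¹ := by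
      intro k
      have := h.apply_sum (fun _ => (5 : ℝ)⁻¹) k
      rwa [← Finset.smul_sum] at this
    have hmem : (5 : ℝ)⁻¹ • ∑ k, p k ∈ convexHull ℝ (insert 0 (Set.range p)) := by
      rw [Finset.smul_sum]
      refine (convex_convexHull ℝ _).sum_mem (fun k _ => by norm_num) (by norm_num) fun k _ =>
        subset_convexHull ℝ _ (.inr ⟨k, rfl⟩)
    have hpos : ∀ k, ∃ m, p' m = p k := fun k => by
      obtain ⟨m, hm, -⟩ := h.exists_eq_of_pos h' (x := (5 : ℝ)⁻¹ • ∑ k, p k)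
        (fun k => by rw [hl]; norm_num) (h'.mem_hull_iff.1 (hle hmem)).2 (k := k) (by
          rw [hl]
          norm_num)
      exact ⟨m, hm⟩
    have : Set.range p = Set.range p' := by
      refine Set.eq_of_subset_of_ncard_le (by rintro _ ⟨k, rfl⟩; exact hpos k) ?_
      rw [← Set.image_univ, ← Set.image_univ, Set.ncard_image_of_injective _ h.injective,
        Set.ncard_image_of_injective _ h'.injective]
    rw [this]
  have hmax : ∀ D, Maximal Adm D ↔ ∃ i j p l, IsFrame i j p l ∧
      D = convexHull ℝ (insert 0 (Set.range p)) := by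
    intro D
    constructor
    · intro hD
      obtain ⟨i, j, p, l, h, hDp⟩ := hsub D hD.prop
      exact ⟨i, j, p, l, h, hD.eq_of_le (hadm i j p l h) hDp⟩
    · rintro ⟨i, j, p, l, h, rfl⟩
      refine ⟨hadm i j p l h, fun D' hD' hle => ?_⟩
      obtain ⟨i', j', p', l', h', hDp⟩ := hsub D' hD'
      rw [heq i j p l i' j' p' l' h h' (hle.trans hDp)]
      exact hDp
  ext D
  refine (hmax D).trans ?_
  constructor
  · rintro ⟨i, j, p, l, h, rfl⟩
    classical
    have hc : ((insert 0 (frameSet p) : Finset NR) : Set NR) = insert 0 (Set.range p) := by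
      rw [Finset.coe_insert, coe_frameSet]
    exact ⟨_, maximal_tauP.2 ⟨i, j, p, l, h, hc⟩, by rw [hc]⟩
  · rintro ⟨s, hs, rfl⟩
    obtain ⟨i, j, p, l, h, hs⟩ := maximal_tauP.1 hs
    exact ⟨i, j, p, l, h, by rw [hs]⟩

end Projectivity


/-! ### The facets of `P` -/

section Facets

variable {i j i' j' : Fin 4} {x : NR} {G : Set NR}

theorem mem_face_cell : x ∈ face (cell {i} {j}) ↔
    formA i x = supA x ∧ formB j x = supB x ∧ gaugeP x = 1 := by
  rw [face, frontier_P]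
  change gaugeP x = 1 ∧ x ∈ cell {i} {j} ↔ _
  rw [mem_cell]
  simp only [Set.mem_singleton_iff, forall_eq]
  tauto

theorem face_cell : face (cell {i} {j}) =
    {x | formA i x = supA x ∧ formB j x = supB x ∧ gaugeP x = 1} :=
  Set.ext fun _ => mem_face_cell

theorem cell_eq_coneU (hi : i ≠ 0) : cell {i} {0} = coneU (idxA i) := by
  rw [cell_eq_hull (Set.singleton_nonempty _) (Set.singleton_nonempty _), coneU]
  congr 1
  ext x
  simp only [cellGens, Set.mem_singleton_iff, forall_eq, excl_iff, hi, Ne.symm hi, Set.mem_image,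
    Set.mem_ofPred_eq, ne_eq, not_false_eq_true, true_and, not_true_eq_false, false_and, or_false]
  exact exists_congr fun k => and_congr_right fun _ => eq_comm

theorem cell_eq_coneV (hj : j ≠ 0) : cell {0} {j} = coneV (idxB j) := by
  rw [cell_eq_hull (Set.singleton_nonempty _) (Set.singleton_nonempty _), coneV]
  congr 1
  ext x
  simp only [cellGens, Set.mem_singleton_iff, forall_eq, excl_iff, hj, Ne.symm hj, Set.mem_image,
    Set.mem_ofPred_eq, ne_eq, not_false_eq_true, true_and, not_true_eq_false, false_and, false_or]
  exact exists_congr fun k => and_congr_right fun _ => eq_comm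

theorem cell_eq_coneC (hi : i ≠ 0) (hj : j ≠ 0) :
    cell {i} {j} = coneC (idxA i) (idxB j) := by
  rw [cell_eq_hull (Set.singleton_nonempty _) (Set.singleton_nonempty _), coneC]
  congr 1
  ext x
  simp only [cellGens, Set.mem_singleton_iff, forall_eq, excl_iff, hi, hj, Ne.symm hi, Ne.symm hj,
    Set.mem_image, Set.mem_union, Set.mem_ofPred_eq, ne_eq, not_false_eq_true, true_and, not_or]
  constructor
  · rintro ⟨k, hk, rfl | rfl⟩
    exacts [.inl ⟨k, hk, rfl⟩, .inr ⟨k, hk, rfl⟩]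
  · rintro (⟨k, hk, rfl⟩ | ⟨k, hk, rfl⟩)
    exacts [⟨k, hk, .inl rfl⟩, ⟨k, hk, .inr rfl⟩]

theorem u_mem_face (hi : i ≠ 0) {k : Fin 6} (hk : ¬ Excl i j k) : u k ∈ face (cell {i} {j}) := by
  have : u k ∈ cell {i} {j} := u_mem_cell (by simpa using Ne.symm hi) (Set.singleton_nonempty i)
    (Set.singleton_nonempty j) (by simpa using hk)
  rw [mem_cell] at this
  exact mem_face_cell.2 ⟨this.1 i rfl, this.2 j rfl, gaugeP_u k⟩

theorem v_mem_face (hj : j ≠ 0) {k : Fin 6} (hk : ¬ Excl i j k) : v k ∈ face (cell {i} {j}) := by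
  have : v k ∈ cell {i} {j} := v_mem_cell (by simpa using Ne.symm hj) (Set.singleton_nonempty i)
    (Set.singleton_nonempty j) (by simpa using hk)
  rw [mem_cell] at this
  exact mem_face_cell.2 ⟨this.1 i rfl, this.2 j rfl, gaugeP_v k⟩

theorem face_cell_nonempty (h0 : i ≠ 0 ∨ j ≠ 0) : (face (cell {i} {j})).Nonempty := by
  obtain ⟨k, hk⟩ := exists_not_excl i j
  exact h0.elim (fun hi => ⟨_, u_mem_face hi hk⟩) fun hj => ⟨_, v_mem_face hj hk⟩

theorem isExposed_face (h0 : i ≠ 0 ∨ j ≠ 0) : IsExposed ℝ P (face (cell {i} {j})) := by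
  intro _
  refine ⟨(formT i j).toContinuousLinearMap, ?_⟩
  ext x
  have hx1 : ∀ y ∈ P, formT i j y ≤ 1 := fun y hy => formT_le_of_mem hy i j
  have hx2 : ∀ y ∈ face (cell {i} {j}), formT i j y = 1 := by
    intro y hy
    obtain ⟨h1, h2, h3⟩ := mem_face_cell.1 hy
    rw [formT, LinearMap.add_apply, h1, h2, ← gaugeP, h3]
  constructor
  · intro hx
    refine ⟨mem_P_iff.2 (mem_face_cell.1 hx).2.2.le, fun y hy => ?_⟩
    change formT i j y ≤ formT i j x
    rw [hx2 x hx]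
    exact hx1 y hy
  · rintro ⟨hx, hmax⟩
    obtain ⟨y, hy⟩ := face_cell_nonempty h0
    have h1 : formT i j y ≤ formT i j x := hmax y (mem_P_iff.2 (mem_face_cell.1 hy).2.2.le)
    rw [hx2 y hy, formT, LinearMap.add_apply] at h1
    have h2 := mem_P_iff.1 hx
    have h3 := formA_le i x
    have h4 := formB_le j x
    rw [mem_face_cell]
    unfold gaugeP at h2 ⊢
    exact ⟨by linarith, by linarith, by linarith⟩

theorem face_ne_P : face (cell {i} {j}) ≠ P := by
  intro h
  have h0 := zero_mem_P
  rw [← h, mem_face_cell] at h0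
  have h1 := gaugeP_smul le_rfl (0 : NR)
  rw [zero_smul, zero_mul, h0.2.2] at h1
  exact one_ne_zero h1

theorem smul_mem_P (x : NR) : (gaugeP x + 1)⁻¹ • x ∈ P := by
  have h := gaugeP_nonneg x
  rw [mem_P_iff, gaugeP_smul (by positivity), inv_mul_le_iff₀ (by positivity)]
  linarith

/-- A proper exposed face lies in the boundary. -/
theorem gaugeP_eq_one_of_isExposed (hG : IsExposed ℝ P G) (hne : G ≠ P) (hx : x ∈ G) :
    gaugeP x = 1 := by
  obtain ⟨f, hf⟩ := hG ⟨x, hx⟩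
  rw [hf] at hx
  refine (mem_P_iff.1 hx.1).antisymm (not_lt.1 fun hlt => ?_)
  have hf0 := hx.2 0 zero_mem_P
  rw [map_zero] at hf0
  -- If the maximum of f on P is 0, then f vanishes, since P absorbs every point, and the face is
  -- all of P. If it is positive, moving x outward to the boundary would increase f.
  obtain h0 | h0 := hf0.eq_or_lt
  · have hnonpos : ∀ y, f y ≤ 0 := by
      intro y
      have h1 := hx.2 _ (smul_mem_P y)
      rw [← h0, map_smul, smul_eq_mul] at h1
      have h2 := gaugeP_nonneg y
      exact nonpos_of_mul_nonpos_right h1 (by positivity)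
    have hzero : ∀ y, f y = 0 := by
      intro y
      have h1 := hnonpos (-y)
      rw [map_neg] at h1
      exact le_antisymm (hnonpos y) (by linarith)
    refine hne (hf.trans (Set.Subset.antisymm (fun y hy => hy.1) fun y hy => ⟨hy, fun z _ => ?_⟩))
    rw [hzero, hzero]
  · have hg : 0 < gaugeP x := (gaugeP_nonneg x).lt_of_ne' fun hg => by
      rw [eq_zero_of_gaugeP hg, map_zero] at h0
      exact h0.false
    have h1 := hx.2 ((gaugeP x)⁻¹ • x) (by
      rw [mem_P_iff, gaugeP_smul (by positivity), inv_mul_cancel₀ hg.ne'])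
    rw [map_smul, smul_eq_mul] at h1
    have h2 : 1 < (gaugeP x)⁻¹ := (one_lt_inv₀ hg).2 hlt
    nlinarith

/-- The gauge, a maximum of the forms A_i + B_j, is constantly 1 on a proper face. Being affine
there, it equals one of these forms on the whole face. -/
theorem exists_subset_face (hG : IsExposed ℝ P G) (hne : G ≠ P) :
    ∃ i j, (i ≠ 0 ∨ j ≠ 0) ∧ G ⊆ face (cell {i} {j}) := by
  obtain rfl | ⟨y, hy⟩ := G.eq_empty_or_nonempty
  · exact ⟨1, 0, .inl one_ne_zero, Set.empty_subset _⟩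
  have h1 : ∀ x ∈ G, gaugeP x = 1 := fun x hx => gaugeP_eq_one_of_isExposed hG hne hx
  obtain ⟨⟨i, j⟩, hij⟩ := exists_forall_eq_of_affine (fun q : Fin 4 × Fin 4 => formT q.1 q.2)
    (f := gaugeP) (fun q x => add_le_add (formA_le _ x) (formB_le _ x))
    (fun x => by
      obtain ⟨i, hi⟩ := exists_formA x
      obtain ⟨j, hj⟩ := exists_formB x
      exact ⟨(i, j), by rw [formT, LinearMap.add_apply, hi, hj, gaugeP]⟩)
    (hG.convex convex_P) (g := AffineMap.const ℝ NR 1) h1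
  refine ⟨i, j, ?_, fun x hx => ?_⟩
  · by_contra! h0
    have := hij y hy
    rw [h1 y hy, h0.1, h0.2, formT, formA_zero, formB_zero, add_zero, LinearMap.zero_apply] at this
    exact zero_ne_one this
  · have h2 := hij x hx
    have h3 := formA_le i x
    have h4 := formB_le j x
    rw [formT, LinearMap.add_apply, gaugeP] at h2
    exact mem_face_cell.2 ⟨by linarith, by linarith, h1 x hx⟩

/-- Vertices detect the pair: a nonzero form that differs from the chosen one is negative at the
vertex with the index it excludes, while A_0 or B_0 misses the value 1 of a nonzero chosen form. -/
theorem eq_of_face_subset (h0 : i ≠ 0 ∨ j ≠ 0) (h : face (cell {i} {j}) ⊆ face (cell {i'} {j'})) :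
    i = i' ∧ j = j' := by
  have hu : ∀ k, ¬ Excl i j k → i ≠ 0 →
      formA i' (u k) = formA i (u k) ∧ formB j' (u k) = formB j (u k) := by
    intro k hk hi
    have h1 := mem_face_cell.1 (u_mem_face hi hk)
    have h2 := mem_face_cell.1 (h (u_mem_face hi hk))
    exact ⟨h2.1.trans h1.1.symm, h2.2.1.trans h1.2.1.symm⟩
  have hv : ∀ k, ¬ Excl i j k → j ≠ 0 →
      formA i' (v k) = formA i (v k) ∧ formB j' (v k) = formB j (v k) := by
    intro k hk hj
    have h1 := mem_face_cell.1 (v_mem_face hj hk)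
    have h2 := mem_face_cell.1 (h (v_mem_face hj hk))
    exact ⟨h2.1.trans h1.1.symm, h2.2.1.trans h1.2.1.symm⟩
  have hidxA : ∀ i' : Fin 4, i' ≠ 0 → i'.val = (idxA i').val + 1 := by decide
  have hidxB : ∀ j' : Fin 4, j'.val + 2 = (idxB j').val := by decide
  have hneA : ∀ i i' j : Fin 4, i' ≠ 0 → i ≠ i' → ¬ Excl i j (idxA i') := by decide
  have hneB : ∀ i j j' : Fin 4, j' ≠ 0 → j ≠ j' → ¬ Excl i j (idxB j') := by decide
  constructor
  · by_contra hii
    by_cases hi' : i' = 0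
    · have hi : i ≠ 0 := fun h => hii (h.trans hi'.symm)
      obtain ⟨k, hk⟩ := exists_not_excl i j
      have := (hu k hk hi).1
      rw [hi', formA_zero, LinearMap.zero_apply, formA_u_of_not_excl hi hk] at this
      exact zero_ne_one this
    · have hk := hneA i i' j hi' hii
      obtain hi | hj := h0
      · have := (hu _ hk hi).1
        rw [formA_u_of_not_excl hi hk, formA_u, if_neg hi', if_pos (hidxA i' hi')] at this
        norm_num at this
      · have := (hv _ hk hj).1
        rw [formA_v_of_not_excl hk, formA_v, if_neg hi', if_pos (hidxA i' hi')] at this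
        norm_num at this
  · by_contra hjj
    by_cases hj' : j' = 0
    · have hj : j ≠ 0 := fun h => hjj (h.trans hj'.symm)
      obtain ⟨k, hk⟩ := exists_not_excl i j
      have := (hv k hk hj).2
      rw [hj', formB_zero, LinearMap.zero_apply, formB_v_of_not_excl hj hk] at this
      exact zero_ne_one this
    · have hk := hneB i j j' hj' hjj
      obtain hi | hj := h0
      · have := (hu _ hk hi).2
        rw [formB_u_of_not_excl hk, formB_u, if_neg hj', if_pos (hidxB j')] at this
        norm_num at this
      · have := (hv _ hk hj).2
        rw [formB_v_of_not_excl hj hk, formB_v, if_neg hj', if_pos (hidxB j')] at this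
        norm_num at this

theorem isFacet_P : IsFacet P G ↔ ∃ i j, (i ≠ 0 ∨ j ≠ 0) ∧ G = face (cell {i} {j}) := by
  constructor
  · intro hG
    obtain ⟨i, j, h0, hsub⟩ := exists_subset_face hG.prop.1 hG.prop.2
    exact ⟨i, j, h0, hG.eq_of_le ⟨isExposed_face h0, face_ne_P⟩ hsub⟩
  · rintro ⟨i, j, h0, rfl⟩
    refine ⟨⟨isExposed_face h0, face_ne_P⟩, fun G' hG' hle => ?_⟩
    obtain ⟨i', j', -, hsub⟩ := exists_subset_face hG'.1 hG'.2
    obtain ⟨rfl, rfl⟩ := eq_of_face_subset h0 (hle.trans hsub)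
    exact hsub

theorem setOf_isFacet_P : {F | IsFacet P F} =
    {F | (∃ i < 3, F = face (coneU i)) ∨ (∃ j ≥ 3, F = face (coneV j)) ∨
      ∃ i < 3, ∃ j ≥ 3, F = face (coneC i j)} := by
  ext F
  refine isFacet_P.trans ⟨?_, ?_⟩
  · rintro ⟨i, j, h0, rfl⟩
    by_cases hj : j = 0
    · subst hj
      have hi : i ≠ 0 := h0.resolve_right (not_not.2 rfl)
      exact .inl ⟨_, idxA_lt, by rw [cell_eq_coneU hi]⟩
    by_cases hi : i = 0
    · subst hi
      exact .inr (.inl ⟨_, le_idxB hj, by rw [cell_eq_coneV hj]⟩)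
    · exact .inr (.inr ⟨_, idxA_lt, _, le_idxB hj, by rw [cell_eq_coneC hi hj]⟩)
  · rintro (⟨k, hk, rfl⟩ | ⟨k, hk, rfl⟩ | ⟨k, hk, m, hm, rfl⟩)
    · obtain ⟨i, hi, rfl⟩ := exists_idxA hk
      exact ⟨i, 0, .inl hi, by rw [cell_eq_coneU hi]⟩
    · obtain ⟨j, hj, rfl⟩ := exists_idxB hk
      exact ⟨0, j, .inr hj, by rw [cell_eq_coneV hj]⟩
    · obtain ⟨i, hi, rfl⟩ := exists_idxA hk
      obtain ⟨j, hj, rfl⟩ := exists_idxB hm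
      exact ⟨i, j, .inl hi, by rw [cell_eq_coneC hi hj]⟩

theorem isTriangulation_tauU {i : Fin 6} (hi : i < 3) :
    IsTriangulation latticeN (vertexSets (tauU i)) (face (coneU i)) := by
  obtain ⟨i, h, rfl⟩ := exists_idxA hi
  have := isTriangulation_vertexSets (i := i) (j := 0) (.inl h)
  rwa [← face_cell, cell_eq_coneU h, tauAt, if_pos rfl] at this

theorem isTriangulation_tauV {j : Fin 6} (hj : 3 ≤ j) :
    IsTriangulation latticeN (vertexSets (tauV j)) (face (coneV j)) := by
  obtain ⟨j, h, rfl⟩ := exists_idxB hj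
  have := isTriangulation_vertexSets (i := 0) (j := j) (.inr h)
  rwa [← face_cell, cell_eq_coneV h, tauAt, if_neg h, if_pos rfl] at this

theorem isTriangulation_tauC {i j : Fin 6} (hi : i < 3) (hj : 3 ≤ j) :
    IsTriangulation latticeN (vertexSets (tauC i j)) (face (coneC i j)) := by
  obtain ⟨i, h, rfl⟩ := exists_idxA hi
  obtain ⟨j, h', rfl⟩ := exists_idxB hj
  have := isTriangulation_vertexSets (i := i) (j := j) (.inl h)
  rwa [← face_cell, cell_eq_coneC h h', tauAt, if_neg h', if_neg h] at this

end Facets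


/-! ### Assembly of the crepant desingularization. -/

section Desingularization

theorem exists_isCrepantDesingularization :
    ∃ (A : ToricVariety latticeN (faceFan tauP)) (B : ToricVariety latticeN SigmaNabla)
      (π : A.X ⟶ B.X),
      IsToricMorphism A B π ∧ IsCrepantDesingularization 5 A.str B.str π := by
  have hF := isGluable_faceFan
  have hG := isGluable_SigmaNabla
  obtain ⟨A, hA⟩ := hF.exists_toricVariety
  obtain ⟨B, hB⟩ := hG.exists_toricVariety
  obtain ⟨π, hπ⟩ := exists_isToricMorphism hA B hG.inf_mem faceFan_le_SigmaNabla
  obtain ⟨n, m, τ, hm⟩ := exists_isVeryAmple_faceFan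
  have hIA := A.isIntegral hF
  have hdom := hπ.isDominant hF hG
  refine ⟨A, B, π, hπ, hπ.comp_str faceFan_le_SigmaNabla, A.smooth hF fun σ hσ => ?_,
    hπ.isProjective hF hG faceFan_le_SigmaNabla hA hB hm isVeryAmple_SigmaNabla,
    hπ.isBirational hF hG faceFan_le_SigmaNabla inf_mem_faceFan, B.isIntegral hG, hIA, hdom,
    hπ.isCrepant hF hG faceFan_le_SigmaNabla inf_mem_faceFan faceFan_smooth SigmaNabla_cartier
      hasRays⟩
  obtain ⟨σ', hσ', hle, l, hl, -⟩ := faceFan_smooth σ hσ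
  exact ⟨σ', hσ', hle, l, hl⟩

end Desingularization

end CubicsMPCP

end

open CubicsMPCP in
theorem mainTheorem1 :
    -- the facets of `P`
    ({F | IsFacet P F} =
      {F | (∃ i < 3, F = face (coneU i)) ∨ (∃ j ≥ 3, F = face (coneV j)) ∨
        ∃ i < 3, ∃ j ≥ 3, F = face (coneC i j)}) ∧
    -- their explicit triangulations
    (∀ i < 3, IsTriangulation latticeN (vertexSets (tauU i)) (face (coneU i))) ∧
    (∀ j ≥ 3, IsTriangulation latticeN (vertexSets (tauV j)) (face (coneV j))) ∧
    (∀ i < 3, ∀ j ≥ 3, IsTriangulation latticeN (vertexSets (tauC i j)) (face (coneC i j))) ∧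
    -- they glue into a triangulation of the boundary, and `τ(P)` is a maximal star triangulation
    IsTriangulation latticeN tauBoundary (frontier P) ∧
    IsTriangulation latticeN tauP P ∧
    IsMaximalTriangulation latticeN tauP P ∧
    IsStar tauP P ∧
    -- `τ(P)` is projective
    IsProjectiveTriangulation tauP P ∧
    -- the face fan `Π` of `τ(P)` subdivides `Σ_∇` and gives a crepant desingularization
    IsFan latticeN (faceFan tauP) ∧
    IsFan latticeN SigmaNabla ∧
    Subdivides (faceFan tauP) SigmaNabla ∧
    ∃ (A : ToricVariety latticeN (faceFan tauP)) (B : ToricVariety latticeN SigmaNabla)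
      (π : A.X ⟶ B.X),
      IsToricMorphism A B π ∧ IsCrepantDesingularization 5 A.str B.str π := by
  obtain ⟨A, B, π, hπ⟩ := exists_isCrepantDesingularization
  exact ⟨setOf_isFacet_P, fun i hi => isTriangulation_tauU hi, fun j hj => isTriangulation_tauV hj,
    fun i hi j hj => isTriangulation_tauC hi hj, isTriangulation_tauBoundary, isTriangulation_tauP,
    isMaximalTriangulation_tauP, isStar_tauP, isProjectiveTriangulation_tauP, isFan_faceFan,
    isFan_SigmaNabla, subdivides_faceFan, A, B, π, hπ⟩
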